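/- **Setting.** Let $\mathfrak g\subset\mathfrak{gl}_d(\mathbb C)$ be a complex semisimple Lie algebra, the Lie algebra of a connected linear group $G$ (every connected simply connected complex semisimple group is of this kind), with a nondegenerate invariant symmetric bilinear form $(\cdot,\cdot)$. Fix a Cartan subalgebra $\mathfrak h$ and simple roots $\alpha_1,\dots,\alpha_l$, with nilradicals $\mathfrak n$ (positive roots) and $\overline{\mathfrak n}$ (negative roots), and put $N=\exp\mathfrak n$, $\overline N=\exp\overline{\mathfrak n}$. Let $s=s_1s_2\cdots s_l$ be a Coxeter element of the Weyl group, and let $f=\exp(y_l)\cdots\exp(y_1)\in\overline N$ with $0\neq y_i\in\mathfrak g_{-\alpha_i}$. Loops are holomorphic maps on $\mathbb C^\times$; boldface denotes loops, $\mathbf g=L\mathfrak g$, $\mathbf h=L\mathfrak h$, with pairing $\langle X,Y\rangle=\mathrm{Res}_{z=0}(X(z),Y(z))\,dz/z$, and $\mathcal N,\overline{\mathcal N}$ are the groups of loops in $N,\overline N$. Fix $p\in\mathbb C$ with $0<|p|<1$ and let $(D_pg)(z)=g(pz)$, $g^{D_p}=D_pg$. Let $P_+^0,P_0,P_-^0$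 be the projections of $\mathbf h$ onto its Laurent modes of positive, zero, negative degree. For a skew operator $r^0\in\mathrm{End}\,\mathbf h$ commuting with $D_p$ put $r=P_{\overline{\mathbf n}}-P_{\mathbf n}+r^0P_{\mathbf h}$, $r_\pm=\frac12(r\pm1)$, $r^0_\pm=\frac12(r^0\pm1)$. Consider the manifold of factorized loops: triples $(X,n_+,n_-)\in\mathbf h\times\overline{\mathcal N}\times\mathcal N$, representing $L=L_+^{D_p}L_-^{-1}$ with $L_\pm=h_\pm n_\pm$, $h_\pm=e^{r^0_\pm X}$. For functions $\varphi,\psi$ on this manifold (holomorphic, with left and right gradients $\nabla,\nabla'$ with respect to $L$ that lie in $\mathbf g$ and depend holomorphically on the point; these are the smooth functions) the bracket is $$\{\varphi,\psi\}=\langle r\nabla\varphi,\nabla\psi\rangle+\langle r\nabla'\varphi,\nabla'\psi\rangle-2\langle D_pr_+\nabla'\varphi,\nabla\psi\rangle-2\langle r_-D_p^{-1}\nabla\varphi,\nabla'\psi\rangle .$$ Denote the resulting Poisson manifold by $\mathcal G'_{p,D}$ when $r^0=P_+^0-P_-^0$ (the r-matrix of Drinfeld's new realization), and by $\mathcal G'_p$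 when $r^0=\frac{1+sD_p}{1-sD_p}$ (the elliptic r-matrix of Drinfeld–Sokolov reduction). The matrix coefficients of a map $\mu$ to $\overline{\mathcal N}$ are the functions $v\mapsto$ (Laurent coefficient of $u(\mu(v)(z))$), $u$ a regular function on $\overline N$. Given an algebra $F$ of functions and a homomorphism $\chi:F\to\mathbb C$, the reduced space of a Poisson manifold by $(F,\chi)$ is the space of leaves of the constraint surface $C=\{\varphi=\chi(\varphi)\ \forall\varphi\in F\}$ under the Hamiltonian vector fields of functions vanishing on $C$; its smooth functions are those that lift locally to first class functions (functions whose brackets with all functions vanishing on $C$ vanish on $C$), and its bracket is the bracket of lifts. **Theorem.** Let $K\in\mathrm{End}\,\mathbf h$ be an endomorphism that has an adjoint $K^*$ with respect to $\langle\cdot,\cdot\rangle$, commutes with $s$ and $D_p$, and satisfies $$(1-D_p)KK^*+D_pK-K^*=-\frac{D_ps}{1-s}P_+^0-\frac1{1-s}P_-^0-\frac12\,\frac{1+s}{1-s}P_0 .$$ Define $\mu^{D,K}:\mathcal G'_{p,D}\to\overline{\mathcal N}$ by $\mu^{D,K}(X,n_+,n_-)=e^{KX}n_+e^{-KX}$.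 Then: (i) The algebra $F^{D,K}$ generated by the matrix coefficients of $\mu^{D,K}$ is a Poisson subalgebra of the algebra of smooth functions on $\mathcal G'_{p,D}$. (ii) There is an algebra homomorphism $\chi_f^{D,K}:F^{D,K}\to\mathbb C$ taking the value $f$ (a constant loop) on $\mu^{D,K}$, and it is a character of the Poisson algebra $F^{D,K}$, i.e. it vanishes on all brackets. So $(F^{D,K},\chi_f^{D,K})$ is a system of first class constraints. (iii) Let $F$ be the algebra generated by the matrix coefficients of $(X,n_+,n_-)\mapsto n_+$ on $\mathcal G_p'$ and $\chi_f:F\to\mathbb C$ the homomorphism with value $f$. The reduced Poisson manifolds $\mathcal G'_{p,D}/(F^{D,K},\chi_f^{D,K})$ and $\mathcal G'_p/(F,\chi_f)$ are isomorphic: there is a homeomorphism between them under which smooth functions correspond to smooth functions and the Poisson brackets agree. -/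

import Mathlib

attribute [local instance 100] LieRing.ofAssociativeRing LieAlgebra.ofAssociativeAlgebra

noncomputable section

namespace LoopReduction

/-! ### Poisson spaces and reduction by first class constraints -/

/-- The data needed to speak about functions and Poisson brackets on a (possibly infinite
dimensional) complex manifold: its points, the smooth functions on each open set, the holomorphic
curves, and the value of the Poisson bracket of two functions at a point. -/
structure PoissonSpace where
  pt : Type
  top : TopologicalSpace pt
  smooth : Set pt → Set (pt → ℂ)
  curve : Set ℂ → Set (ℂ → pt)
  bracket : (pt → ℂ) → (pt → ℂ) → pt → ℂ

namespace PoissonSpace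

instance (P : PoissonSpace) : TopologicalSpace P.pt := P.top

/-- `F` consists of smooth functions and is closed under the Poisson bracket. -/
def IsPoissonSubalgebra (P : PoissonSpace) (F : Subalgebra ℂ (P.pt → ℂ)) : Prop :=
  (∀ φ ∈ F, φ ∈ P.smooth Set.univ) ∧ ∀ φ ∈ F, ∀ ψ ∈ F, P.bracket φ ψ ∈ F

/-- An algebra homomorphism `χ : F → ℂ` is a character of the Poisson algebra `F` if it vanishes
on all Poisson brackets. -/
def IsPoissonCharacter (P : PoissonSpace) {F : Subalgebra ℂ (P.pt → ℂ)} (χ : F →ₐ[ℂ] ℂ) : Prop :=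
  ∀ φ ψ θ : F, (θ : P.pt → ℂ) = P.bracket φ ψ → χ θ = 0

/-- The constraint surface `{φ = χ φ for all φ ∈ F}`. -/
def surface (P : PoissonSpace) {F : Subalgebra ℂ (P.pt → ℂ)} (χ : F →ₐ[ℂ] ℂ) : Set P.pt :=
  {v | ∀ φ : F, (φ : P.pt → ℂ) v = χ φ}

/-- Smooth functions on `U` that vanish on the constraint surface. -/
def vanishing (P : PoissonSpace) (C U : Set P.pt) : Set (P.pt → ℂ) :=
  {ι | ι ∈ P.smooth U ∧ ∀ v ∈ C ∩ U, ι v = 0}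

/-- First class functions on `U`: those whose brackets with all functions vanishing on the
constraint surface vanish on the constraint surface. -/
def firstClass (P : PoissonSpace) (C U : Set P.pt) : Set (P.pt → ℂ) :=
  {φ | φ ∈ P.smooth U ∧ ∀ U' ⊆ U, IsOpen U' → ∀ ι ∈ P.vanishing C U',
    ∀ v ∈ C ∩ U', P.bracket φ ι v = 0}

/-- A holomorphic curve in the constraint surface whose velocity at each time is the value of the
Hamiltonian vector field of some function vanishing on the constraint surface. -/
def IsGaugeCurve (P : PoissonSpace) (C : Set P.pt) (Ω : Set ℂ) (c : ℂ → P.pt) : Prop :=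
  c ∈ P.curve Ω ∧ ∀ t ∈ Ω, c t ∈ C ∧ ∃ U, IsOpen U ∧ c t ∈ U ∧ ∃ ι ∈ P.vanishing C U,
    ∀ U' ⊆ U, IsOpen U' → c t ∈ U' → ∀ ψ ∈ P.smooth U',
      HasDerivAt (fun t' => ψ (c t')) (P.bracket ψ ι (c t)) t

/-- Gauge equivalence: points joined by a chain of gauge curves, i.e. points on the same leaf of
the characteristic foliation of the constraint surface. -/
def gauge (P : PoissonSpace) (C : Set P.pt) : Setoid C :=
  Relation.EqvGen.setoid fun v w : C => ∃ (Ω : Set ℂ) (c : ℂ → P.pt), IsOpen Ω ∧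
    IsPreconnected Ω ∧ P.IsGaugeCurve C Ω c ∧ (v : P.pt) ∈ c '' Ω ∧ (w : P.pt) ∈ c '' Ω

/-- The reduced space: the space of leaves of the constraint surface, with quotient topology. -/
abbrev Reduced (P : PoissonSpace) (C : Set P.pt) : Type := Quotient (P.gauge C)

/-- The class of a point of the constraint surface. -/
def cls (P : PoissonSpace) (C : Set P.pt) (v : C) : P.Reduced C := Quotient.mk (P.gauge C) v

/-- `φ` is a first class function on the open set `U` that restricts to (the pullback of) `g` on
the constraint surface. -/
def IsLift (P : PoissonSpace) (C : Set P.pt) (g : P.Reduced C → ℂ) (U : Set P.pt)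
    (φ : P.pt → ℂ) : Prop :=
  IsOpen U ∧ φ ∈ P.firstClass C U ∧ ∀ v : C, (v : P.pt) ∈ U → φ v = g (P.cls C v)

/-- Smooth functions on an open set of the reduced space: functions which locally lift to first
class functions. -/
def redSmooth (P : PoissonSpace) (C : Set P.pt) (O : Set (P.Reduced C)) :
    Set (P.Reduced C → ℂ) :=
  {g | ∀ v : C, P.cls C v ∈ O → ∃ U φ, (v : P.pt) ∈ U ∧ P.IsLift C g U φ}

/-- An isomorphism of the reduced Poisson manifolds with constraint surfaces `C` and `C'`: a
homeomorphism under which smooth functions correspond to smooth functions and the Poisson brackets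
agree.  The reduced bracket of two functions is computed from arbitrary local lifts; it does not
depend on the lifts nor on the representative of a class, so it suffices to compare
it at one representative of each pair of corresponding classes. -/
def ReducedIso (P P' : PoissonSpace) (C : Set P.pt) (C' : Set P'.pt) : Prop :=
  ∃ Φ : P.Reduced C ≃ₜ P'.Reduced C',
    (∀ O : Set (P'.Reduced C'), IsOpen O → ∀ g : P'.Reduced C' → ℂ,
      g ∈ P'.redSmooth C' O ↔ g ∘ Φ ∈ P.redSmooth C (Φ ⁻¹' O)) ∧
    ∀ v : C, ∃ v' : C', Φ (P.cls C v) = P'.cls C' v' ∧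
      ∀ (g₁ g₂ : P'.Reduced C' → ℂ) (U : Set P.pt) (U' : Set P'.pt)
        (φ₁ φ₂ : P.pt → ℂ) (φ₁' φ₂' : P'.pt → ℂ),
        (v : P.pt) ∈ U → (v' : P'.pt) ∈ U' →
        P.IsLift C (g₁ ∘ Φ) U φ₁ → P.IsLift C (g₂ ∘ Φ) U φ₂ →
        P'.IsLift C' g₁ U' φ₁' → P'.IsLift C' g₂ U' φ₂' →
        P.bracket φ₁ φ₂ v = P'.bracket φ₁' φ₂' v'

end PoissonSpace

/-! ### Holomorphic loops -/

instance {L : Type*} [LieRing L] [LieAlgebra ℂ L] [TopologicalSpace L] [IsTopologicalAddGroup L]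
    (K : LieSubalgebra ℂ L) : IsTopologicalAddGroup K :=
  inferInstanceAs (IsTopologicalAddGroup K.toSubmodule)

section Loops

variable (E : Type*) [AddCommGroup E] [Module ℂ E] [TopologicalSpace E] [IsTopologicalAddGroup E]
  [ContinuousSMul ℂ E]

/-- The space of holomorphic maps `ℂˣ → E` to a finite dimensional space `E`. -/
def loopSubmodule : Submodule ℂ C(ℂˣ, E) where
  carrier := {f | ∀ ℓ : Module.Dual ℂ E, ∃ F : ℂ → ℂ,
    DifferentiableOn ℂ F {0}ᶜ ∧ ∀ z : ℂˣ, F z = ℓ (f z)}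
  zero_mem' := fun ℓ => ⟨0, differentiableOn_const 0, fun z => by simp⟩
  add_mem' := by
    intro f g hf hg ℓ
    obtain ⟨F, hF, hF'⟩ := hf ℓ
    obtain ⟨G, hG, hG'⟩ := hg ℓ
    exact ⟨F + G, hF.add hG, fun z => by simp [hF', hG']⟩
  smul_mem' := by
    intro a f hf ℓ
    obtain ⟨F, hF, hF'⟩ := hf ℓ
    exact ⟨a • F, hF.const_smul a, fun z => by simp [hF']⟩

/-- Holomorphic loops `ℂˣ → E`, with the topology of uniform convergence on compact sets. -/
def Loop : Type _ := loopSubmodule E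

instance : AddCommGroup (Loop E) := inferInstanceAs (AddCommGroup (loopSubmodule E))

instance : Module ℂ (Loop E) := inferInstanceAs (Module ℂ (loopSubmodule E))

instance : TopologicalSpace (Loop E) := inferInstanceAs (TopologicalSpace (loopSubmodule E))

variable {E}
variable {E' : Type*} [AddCommGroup E'] [Module ℂ E'] [TopologicalSpace E']
  [IsTopologicalAddGroup E'] [ContinuousSMul ℂ E']

/-- The value of a loop at a point. -/
def ev (X : Loop E) (z : ℂˣ) : E := (Subtype.val X : C(ℂˣ, E)) z

theorem continuous_ev (X : Loop E) : Continuous (ev X) := (Subtype.val X : C(ℂˣ, E)).continuous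

theorem ev_spec (X : Loop E) (ℓ : Module.Dual ℂ E) :
    ∃ F : ℂ → ℂ, DifferentiableOn ℂ F {0}ᶜ ∧ ∀ z : ℂˣ, F z = ℓ (ev X z) := X.2 ℓ

/-- A loop from a continuous function which is holomorphic. -/
def Loop.mk (g : ℂˣ → E) (hc : Continuous g) (h : ∀ ℓ : Module.Dual ℂ E, ∃ F : ℂ → ℂ,
    DifferentiableOn ℂ F {0}ᶜ ∧ ∀ z : ℂˣ, F z = ℓ (g z)) : Loop E := ⟨⟨g, hc⟩, h⟩

theorem loop_ext {X Y : Loop E} (h : ∀ z, ev X z = ev Y z) : X = Y :=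
  Subtype.ext (ContinuousMap.ext h)

@[simp] theorem ev_add (X Y : Loop E) (z : ℂˣ) : ev (X + Y) z = ev X z + ev Y z := rfl

@[simp] theorem ev_smul (a : ℂ) (X : Loop E) (z : ℂˣ) : ev (a • X) z = a • ev X z := rfl

@[simp] theorem ev_mk (g : ℂˣ → E) (hc) (h) (z : ℂˣ) : ev (Loop.mk g hc h) z = g z := rfl

/-- A linear map applied pointwise to loops. -/
def Loop.map [FiniteDimensional ℂ E] [T2Space E] (T : E →ₗ[ℂ] E') : Loop E →ₗ[ℂ] Loop E' where
  toFun X := Loop.mk (fun z => T (ev X z))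
    (T.continuous_of_finiteDimensional.comp (continuous_ev X)) fun ℓ => ev_spec X (ℓ ∘ₗ T)
  map_add' X Y := loop_ext fun z => by simp
  map_smul' a X := loop_ext fun z => by simp

/-- The automorphism `(D_p X)(z) = X (p z)`. -/
def shift (p : ℂˣ) : Module.End ℂ (Loop E) where
  toFun X := Loop.mk (fun z => ev X (p * z)) ((continuous_ev X).comp (continuous_const_mul p)) <| by
    intro ℓ
    obtain ⟨F, hF, hF'⟩ := ev_spec X ℓ
    refine ⟨fun z => F (p * z), ?_, fun z => by simpa using hF' (p * z)⟩
    exact hF.comp (by fun_prop) (fun z hz => by simpa using hz)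
  map_add' X Y := loop_ext fun z => by simp
  map_smul' a X := loop_ext fun z => by simp

/-- The coefficient of `z ^ n` in the Laurent expansion of a holomorphic function on `ℂˣ`, i.e.
`(2πi)⁻¹ ∮ g(z) z ^ (-n) dz / z` over the unit circle. -/
def coeff (n : ℤ) (g : ℂˣ → ℂ) : ℂ :=
  (2 * (Real.pi : ℂ))⁻¹ * ∫ t in (0 : ℝ)..(2 * Real.pi),
    Complex.exp (-(n * t * Complex.I)) * g (Circle.toUnits (Circle.exp t))

/-- `P` keeps the Laurent coefficients with index in `S` and kills the others. -/
def IsModeProj (S : Set ℤ) (P : Module.End ℂ (Loop E)) : Prop :=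
  ∀ (X : Loop E) (ℓ : Module.Dual ℂ E) (n : ℤ),
    (n ∈ S → coeff n (fun z => ℓ (ev (P X) z)) = coeff n (fun z => ℓ (ev X z))) ∧
    (n ∉ S → coeff n (fun z => ℓ (ev (P X) z)) = 0)

variable (E) in
open Classical in
/-- The projection of loops onto the Laurent modes with index in `S` (a unique operator). -/
def modeProj (S : Set ℤ) : Module.End ℂ (Loop E) :=
  if h : ∃ P, IsModeProj (E := E) S P then h.choose else 0

/-- The pairing `Res (X(z), Y(z)) dz / z` of loops. -/
def pair (B : LinearMap.BilinForm ℂ E) (X Y : Loop E) : ℂ :=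
  coeff 0 fun z => B (ev X z) (ev Y z)

/-- A family of loops, parametrized by a subset `Ω` of a complex vector space, which is jointly
holomorphic in the parameter and the loop variable. -/
def IsHolFamily {Q : Type*} [NormedAddCommGroup Q] [NormedSpace ℂ Q] (Ω : Set Q)
    (c : Q → Loop E) : Prop :=
  ∀ ℓ : Module.Dual ℂ E, ∃ F : Q × ℂ → ℂ, DifferentiableOn ℂ F (Ω ×ˢ {0}ᶜ) ∧
    ∀ x ∈ Ω, ∀ z : ℂˣ, F (x, z) = ℓ (ev (c x) z)

end Loops

/-! ### Root decomposition of a semisimple Lie algebra of matrices -/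

section Structure

variable {d : ℕ} {𝔤 : LieSubalgebra ℂ (Matrix (Fin d) (Fin d) ℂ)} [LieAlgebra.IsSemisimple ℂ 𝔤]
  {H : LieSubalgebra ℂ 𝔤} [H.IsCartanSubalgebra]

variable (H) in
/-- The sum of the root spaces with root in a given set (the root `0` gives `H`). -/
def rootSum (S : Set (H → ℂ)) : Submodule ℂ 𝔤 :=
  ⨆ χ ∈ S, (LieAlgebra.rootSpace H χ).toSubmodule

variable (H) in
theorem isCompl_rootSum (S : Set (H → ℂ)) : IsCompl (rootSum H S) (rootSum H Sᶜ) := by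
  constructor
  · exact (LieSubmodule.iSupIndep_toSubmodule.mpr
      (LieModule.iSupIndep_genWeightSpace ℂ H 𝔤)).disjoint_biSup_biSup disjoint_compl_right
  · rw [codisjoint_iff, rootSum, rootSum, ← iSup_union, Set.union_compl_self, iSup_univ]
    exact LieSubmodule.iSup_toSubmodule_eq_top.mpr (LieModule.iSup_genWeightSpace_eq_top ℂ H 𝔤)

variable (H) in
/-- The projection onto `rootSum H S` along the remaining root spaces. -/
def rootProj (S : Set (H → ℂ)) : 𝔤 →ₗ[ℂ] 𝔤 := (rootSum H S).projection _ (isCompl_rootSum H S)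

variable (H) in
/-- The projection onto the Cartan subalgebra along the nonzero root spaces. -/
def cartanProj : 𝔤 →ₗ[ℂ] H :=
  LinearMap.codRestrict H.toSubmodule (rootProj H {0}) fun x => by
    have h : rootSum H {0} ≤ H.toSubmodule := by
      simp [rootSum, LieAlgebra.rootSpace_zero_eq]
    exact h (Submodule.projection_apply_mem _ x)

/-- The set of positive roots. -/
def posRoots (b : (LieAlgebra.IsKilling.rootSystem H).Base) : Set (H → ℂ) :=
  {χ | ∃ i, b.IsPos i ∧ χ = (LieAlgebra.IsKilling.rootSystem H).root i}

/-- The set of negative roots. -/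
def negRoots (b : (LieAlgebra.IsKilling.rootSystem H).Base) : Set (H → ℂ) :=
  {χ | -χ ∈ posRoots b}

/-- The nilradical `𝔫` of the positive Borel subalgebra. -/
abbrev nil (b : (LieAlgebra.IsKilling.rootSystem H).Base) : Submodule ℂ 𝔤 :=
  rootSum H (posRoots b)

/-- The nilradical of the opposite Borel subalgebra. -/
abbrev nilOpp (b : (LieAlgebra.IsKilling.rootSystem H).Base) : Submodule ℂ 𝔤 :=
  rootSum H (negRoots b)

/-- The Coxeter element `s = s₁ s₂ ⋯ s_l` for the ordering `e` of the simple roots, acting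
pointwise on loops in the Cartan subalgebra. -/
def coxeter (b : (LieAlgebra.IsKilling.rootSystem H).Base) {l : ℕ} (e : Fin l ≃ b.support) :
    Module.End ℂ (Loop H) :=
  Loop.map (List.ofFn fun i =>
    ((LieAlgebra.IsKilling.rootSystem H).coreflection (e i) : Module.End ℂ H)).prod

/-- The restriction of the invariant form to the Cartan subalgebra. -/
def cartanForm (H : LieSubalgebra ℂ 𝔤) (B : LinearMap.BilinForm ℂ 𝔤) : LinearMap.BilinForm ℂ H :=
  B.compl₁₂ H.toSubmodule.subtype H.toSubmodule.subtype

/-- The matrix exponential of an element of the Lie algebra. -/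
def expm (x : 𝔤) : Matrix (Fin d) (Fin d) ℂ := NormedSpace.exp (x : Matrix (Fin d) (Fin d) ℂ)

/-! ### The twisted Poisson manifold of factorized loops -/

/-- Points of the manifold of factorized loops: triples `(X, Y₊, Y₋)` of loops in the
Cartan subalgebra, the opposite nilradical and the nilradical.  Such a triple stands for
`X`, `n₊ = exp Y₊`, `n₋ = exp Y₋` (the exponential maps of the nilpotent Lie algebras
are bijective). -/
abbrev Pts (b : (LieAlgebra.IsKilling.rootSystem H).Base) : Type :=
  Loop H × Loop (nilOpp b) × Loop (nil b)

variable (b : (LieAlgebra.IsKilling.rootSystem H).Base) (B : LinearMap.BilinForm ℂ 𝔤) (p : ℂˣ)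
  (r₀ : Module.End ℂ (Loop H))

/-- `r = P_{𝔫̄} - P_𝔫 + r₀ P_𝔥` on loops in `𝔤`. -/
def rOp : Module.End ℂ (Loop 𝔤) :=
  Loop.map (rootProj H (negRoots b)) - Loop.map (rootProj H (posRoots b)) +
    Loop.map (H.toSubmodule.subtype : H →ₗ[ℂ] 𝔤) ∘ₗ r₀ ∘ₗ Loop.map (cartanProj H)

/-- The component `n₊`. -/
def nPlus (v : Pts b) (z : ℂˣ) : Matrix (Fin d) (Fin d) ℂ := expm ((ev v.2.1 z : nilOpp b) : 𝔤)

/-- The component `n₋`. -/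
def nMinus (v : Pts b) (z : ℂˣ) : Matrix (Fin d) (Fin d) ℂ := expm ((ev v.2.2 z : nil b) : 𝔤)

/-- `L₊ = h₊ n₊`, `h₊ = exp (r₀₊ X)`, `r₀₊ = (r₀ + 1) / 2`. -/
def LPlus (v : Pts b) (z : ℂˣ) : Matrix (Fin d) (Fin d) ℂ :=
  expm ((ev (((1 / 2 : ℂ) • (r₀ + 1)) v.1) z : H) : 𝔤) * nPlus b v z

/-- `L₋ = h₋ n₋`, `h₋ = exp (r₀₋ X)`, `r₀₋ = (r₀ - 1) / 2`. -/
def LMinus (v : Pts b) (z : ℂˣ) : Matrix (Fin d) (Fin d) ℂ :=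
  expm ((ev (((1 / 2 : ℂ) • (r₀ - 1)) v.1) z : H) : 𝔤) * nMinus b v z

/-- The loop `L = L₊^{D_p} L₋⁻¹` in the group. -/
def L (v : Pts b) (z : ℂˣ) : Matrix (Fin d) (Fin d) ℂ :=
  LPlus b r₀ v (p * z) * (LMinus b r₀ v z)⁻¹

/-- `η = ∇φ` at `v`: along every tangent direction `w` in which `L` varies by `δL = ξ L`,
the derivative of `φ` is `⟨ξ, η⟩`. -/
def IsLeftGrad (φ : Pts b → ℂ) (v : Pts b) (η : Loop 𝔤) : Prop :=
  ∀ (w : Pts b) (ξ : Loop 𝔤),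
    (∀ (z : ℂˣ) (i j : Fin d), HasDerivAt (fun t : ℂ => L b p r₀ (v + t • w) z i j)
      ((((ev ξ z : 𝔤) : Matrix (Fin d) (Fin d) ℂ) * L b p r₀ v z) i j) 0) →
    HasDerivAt (fun t : ℂ => φ (v + t • w)) (pair B ξ η) 0

/-- `η = ∇'φ` at `v`: along every tangent direction `w` in which `L` varies by `δL = L ξ`,
the derivative of `φ` is `⟨ξ, η⟩`. -/
def IsRightGrad (φ : Pts b → ℂ) (v : Pts b) (η : Loop 𝔤) : Prop :=
  ∀ (w : Pts b) (ξ : Loop 𝔤),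
    (∀ (z : ℂˣ) (i j : Fin d), HasDerivAt (fun t : ℂ => L b p r₀ (v + t • w) z i j)
      ((L b p r₀ v z * ((ev ξ z : 𝔤) : Matrix (Fin d) (Fin d) ℂ)) i j) 0) →
    HasDerivAt (fun t : ℂ => φ (v + t • w)) (pair B ξ η) 0

/-- The left gradient (unique when it exists). -/
def leftGrad (φ : Pts b → ℂ) (v : Pts b) : Loop 𝔤 := Classical.epsilon (IsLeftGrad b B p r₀ φ v)

/-- The right gradient (unique when it exists). -/
def rightGrad (φ : Pts b → ℂ) (v : Pts b) : Loop 𝔤 :=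
  Classical.epsilon (IsRightGrad b B p r₀ φ v)

/-- The twisted Poisson bracket
`⟨r∇φ, ∇ψ⟩ + ⟨r∇'φ, ∇'ψ⟩ - 2⟨D_p r₊ ∇'φ, ∇ψ⟩ - 2⟨r₋ D_p⁻¹ ∇φ, ∇'ψ⟩`, `r_± = (r ± 1) / 2`. -/
def bracket (φ ψ : Pts b → ℂ) (v : Pts b) : ℂ :=
  let r := rOp b r₀
  let rp : Module.End ℂ (Loop 𝔤) := (1 / 2 : ℂ) • (r + 1)
  let rm : Module.End ℂ (Loop 𝔤) := (1 / 2 : ℂ) • (r - 1)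
  let dφ := leftGrad b B p r₀ φ v
  let dφ' := rightGrad b B p r₀ φ v
  let dψ := leftGrad b B p r₀ ψ v
  let dψ' := rightGrad b B p r₀ ψ v
  pair B (r dφ) dψ + pair B (r dφ') dψ' - 2 * pair B (shift p (rp dφ')) dψ -
    2 * pair B (rm (shift p⁻¹ dφ)) dψ'

/-- Holomorphic families of points. -/
def IsHolFamilyPts {Q : Type*} [NormedAddCommGroup Q] [NormedSpace ℂ Q] (Ω : Set Q)
    (c : Q → Pts b) : Prop :=
  IsHolFamily Ω (fun x => (c x).1) ∧ IsHolFamily Ω (fun x => (c x).2.1) ∧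
    IsHolFamily Ω (fun x => (c x).2.2)

/-- Smooth functions on `U`: functions which are holomorphic along all finite dimensional
holomorphic families, and which have left and right gradients in the loop algebra that depend
holomorphically on the point. -/
def IsSmooth (U : Set (Pts b)) (φ : Pts b → ℂ) : Prop :=
  (∀ (k : ℕ) (Ω : Set (Fin k → ℂ)) (c : (Fin k → ℂ) → Pts b), IsOpen Ω → IsHolFamilyPts b Ω c →
    Set.MapsTo c Ω U → DifferentiableOn ℂ (φ ∘ c) Ω) ∧
  ∃ η η' : Pts b → Loop 𝔤,
    (∀ v ∈ U, IsLeftGrad b B p r₀ φ v (η v) ∧ IsRightGrad b B p r₀ φ v (η' v)) ∧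
    ∀ (k : ℕ) (Ω : Set (Fin k → ℂ)) (c : (Fin k → ℂ) → Pts b), IsOpen Ω → IsHolFamilyPts b Ω c →
      Set.MapsTo c Ω U → IsHolFamily Ω (η ∘ c) ∧ IsHolFamily Ω (η' ∘ c)

/-- The twisted Poisson manifold of factorized loops for the r-matrix with Cartan part `r₀`. -/
def space : PoissonSpace where
  pt := Pts b
  top := inferInstance
  smooth U := {φ | IsSmooth b B p r₀ U φ}
  curve Ω := {c | IsHolFamilyPts b Ω c}
  bracket := bracket b B p r₀

/-- Cartan part of the r-matrix of the new realization: `P₊⁰ - P₋⁰`. -/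
def rNew (H : LieSubalgebra ℂ 𝔤) : Module.End ℂ (Loop H) :=
  modeProj H {n | 0 < n} - modeProj H {n | n < 0}

/-- Cartan part of the elliptic r-matrix: `(1 + s D_p) / (1 - s D_p)`. -/
def rEll {l : ℕ} (e : Fin l ≃ b.support) : Module.End ℂ (Loop H) :=
  (1 + coxeter b e * shift p) * Ring.inverse (1 - coxeter b e * shift p)

/-- The map `μ^K (X, n₊, n₋) = exp(K X) n₊ exp(- K X)`; for `K = 0` it is `n₊`. -/
def mu (K : Module.End ℂ (Loop H)) (v : Pts b) (z : ℂˣ) : Matrix (Fin d) (Fin d) ℂ :=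
  expm ((ev (K v.1) z : H) : 𝔤) * nPlus b v z * expm (-((ev (K v.1) z : H) : 𝔤))

/-- The `n`-th Laurent coefficient of the regular function `q` (a polynomial in matrix entries)
of a matrix valued loop. -/
def matCoeff (q : MvPolynomial (Fin d × Fin d) ℂ) (n : ℤ)
    (g : ℂˣ → Matrix (Fin d) (Fin d) ℂ) : ℂ :=
  coeff n fun z => MvPolynomial.eval (fun ij => g z ij.1 ij.2) q

/-- The algebra of functions generated by the matrix coefficients of `mu K`. -/
def constraints (K : Module.End ℂ (Loop H)) : Subalgebra ℂ (Pts b → ℂ) :=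
  Algebra.adjoin ℂ {φ | ∃ q n, φ = fun v => matCoeff q n (mu b K v)}

/-- The homomorphism `χ` takes the value `f` (a constant loop) on the matrix of functions `mu K`. -/
def TakesValue (K : Module.End ℂ (Loop H)) (f : Matrix (Fin d) (Fin d) ℂ)
    (χ : constraints b K →ₐ[ℂ] ℂ) : Prop :=
  ∀ (q : MvPolynomial (Fin d × Fin d) ℂ) (n : ℤ) (φ : constraints b K),
    (φ : Pts b → ℂ) = (fun v => matCoeff q n (mu b K v)) → χ φ = matCoeff q n fun _ => f

end Structure

end LoopReduction

end

noncomputable section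

open Set Filter Topology Metric

set_option linter.unusedSectionVars false
set_option autoImplicit false

/-! ### Instance shortcuts for Lie subalgebras of matrix algebras -/

theorem LoopReduction.isKilling_of_isSemisimple {d : ℕ}
    (𝔤 : LieSubalgebra ℂ (Matrix (Fin d) (Fin d) ℂ)) [LieAlgebra.IsSemisimple ℂ 𝔤] :
    LieAlgebra.IsKilling ℂ 𝔤 := inferInstance

theorem LoopReduction.finiteDimensional_lieSubalgebra {d : ℕ}
    (𝔤 : LieSubalgebra ℂ (Matrix (Fin d) (Fin d) ℂ)) : FiniteDimensional ℂ 𝔤 := inferInstance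

theorem LoopReduction.finiteDimensional_subalgebra {d : ℕ}
    {𝔤 : LieSubalgebra ℂ (Matrix (Fin d) (Fin d) ℂ)} (H : LieSubalgebra ℂ 𝔤) :
    FiniteDimensional ℂ H := inferInstance

theorem LoopReduction.finiteDimensional_submodule {d : ℕ}
    {𝔤 : LieSubalgebra ℂ (Matrix (Fin d) (Fin d) ℂ)} (S : Submodule ℂ 𝔤) :
    FiniteDimensional ℂ S := inferInstance

@[reducible] def LoopReduction.addCommMonoidLie {d : ℕ}
    (𝔤 : LieSubalgebra ℂ (Matrix (Fin d) (Fin d) ℂ)) : AddCommMonoid 𝔤 := inferInstance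

@[reducible] def LoopReduction.addCommMonoidSub {d : ℕ}
    {𝔤 : LieSubalgebra ℂ (Matrix (Fin d) (Fin d) ℂ)} (H : LieSubalgebra ℂ 𝔤) : AddCommMonoid H :=
  inferInstance

open scoped Matrix.Norms.Operator in
theorem LoopReduction.continuousSMul_lieSubalgebra {d : ℕ}
    (𝔤 : LieSubalgebra ℂ (Matrix (Fin d) (Fin d) ℂ)) : ContinuousSMul ℂ 𝔤 := inferInstance

open scoped Matrix.Norms.Operator in
theorem LoopReduction.continuousSMul_subalgebra {d : ℕ}
    {𝔤 : LieSubalgebra ℂ (Matrix (Fin d) (Fin d) ℂ)} (H : LieSubalgebra ℂ 𝔤) :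
    ContinuousSMul ℂ H := inferInstance

theorem LoopReduction.isTriangularizable_subalgebra {d : ℕ}
    {𝔤 : LieSubalgebra ℂ (Matrix (Fin d) (Fin d) ℂ)} (H : LieSubalgebra ℂ 𝔤)
    [H.IsCartanSubalgebra] : LieModule.IsTriangularizable ℂ H 𝔤 := inferInstance

open scoped Matrix.Norms.Operator in
theorem LoopReduction.isTopologicalAddGroup_lieSubalgebra {d : ℕ}
    (𝔤 : LieSubalgebra ℂ (Matrix (Fin d) (Fin d) ℂ)) : IsTopologicalAddGroup 𝔤 := inferInstance

open scoped Matrix.Norms.Operator in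
theorem LoopReduction.isTopologicalAddGroup_subalgebra {d : ℕ}
    {𝔤 : LieSubalgebra ℂ (Matrix (Fin d) (Fin d) ℂ)} (H : LieSubalgebra ℂ 𝔤) :
    IsTopologicalAddGroup H := inferInstance

@[reducible] def LoopReduction.moduleLie {d : ℕ}
    (𝔤 : LieSubalgebra ℂ (Matrix (Fin d) (Fin d) ℂ)) : Module ℂ 𝔤 := inferInstance

@[reducible] def LoopReduction.moduleSub {d : ℕ}
    {𝔤 : LieSubalgebra ℂ (Matrix (Fin d) (Fin d) ℂ)} (H : LieSubalgebra ℂ 𝔤) : Module ℂ H :=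
  inferInstance

attribute [local instance] LoopReduction.isKilling_of_isSemisimple
  LoopReduction.finiteDimensional_lieSubalgebra
  LoopReduction.finiteDimensional_subalgebra
  LoopReduction.finiteDimensional_submodule
  LoopReduction.addCommMonoidLie
  LoopReduction.addCommMonoidSub
  LoopReduction.continuousSMul_lieSubalgebra
  LoopReduction.continuousSMul_subalgebra
  LoopReduction.isTriangularizable_subalgebra
  LoopReduction.isTopologicalAddGroup_lieSubalgebra
  LoopReduction.isTopologicalAddGroup_subalgebra
  LoopReduction.moduleLie
  LoopReduction.moduleSub

/-! ### Holomorphic functions of several variables -/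

namespace SeveralVariables

variable {E : Type*} [NormedAddCommGroup E] [NormedSpace ℂ E]

theorem norm_fderiv_le_of_norm_le {f : E → ℂ} {c : E} {R C : ℝ} (hR : 0 < R)
    (hd : DifferentiableOn ℂ f (ball c R)) (hC : ∀ x ∈ ball c R, ‖f x‖ ≤ C) :
    ‖fderiv ℂ f c‖ ≤ 2 * C / R := by
  refine Complex.norm_fderiv_le_div_of_mapsTo_ball hd (fun x hx => ?_) hR
  rw [mem_closedBall, dist_eq_norm]
  calc ‖f x - f c‖ ≤ ‖f x‖ + ‖f c‖ := norm_sub_le _ _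
    _ ≤ C + C := add_le_add (hC x hx) (hC c (mem_ball_self hR))
    _ = 2 * C := by ring

theorem differentiableOn_tsum {ι : Type*} {U : Set E} {f : ι → E → ℂ} (hU : IsOpen U)
    (hf : ∀ i, DifferentiableOn ℂ (f i) U)
    (hb : ∀ x ∈ U, ∃ V ∈ 𝓝 x, ∃ u : ι → ℝ, Summable u ∧ ∀ i, ∀ y ∈ V, ‖f i y‖ ≤ u i) :
    DifferentiableOn ℂ (fun x => ∑' i, f i x) U := by
  intro x hx
  obtain ⟨V, hV, u, hu, hb⟩ := hb x hx
  obtain ⟨R, hR, hRV⟩ := Metric.mem_nhds_iff.mp (inter_mem hV (hU.mem_nhds hx))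
  have hsub : ∀ y ∈ ball x (R / 2), ball y (R / 2) ⊆ V ∩ U := fun y hy =>
    (ball_subset_ball' (by have := mem_ball.mp hy; linarith)).trans hRV
  have hd : ∀ i, ∀ y ∈ ball x (R / 2), HasFDerivAt (f i) (fderiv ℂ (f i) y) y := fun i y hy =>
    ((hf i).differentiableAt (hU.mem_nhds
      (hsub y hy (mem_ball_self (by positivity))).2)).hasFDerivAt
  refine ((hasFDerivAt_tsum_of_isPreconnected (u := fun i => 2 * u i / (R / 2)) ?_ isOpen_ball
    (convex_ball x (R / 2)).isPreconnected hd ?_ (mem_ball_self (by positivity)) ?_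
    (mem_ball_self (by positivity))).differentiableAt).differentiableWithinAt
  · exact (hu.mul_left 2).div_const _
  · intro i y hy
    exact norm_fderiv_le_of_norm_le (by positivity)
      ((hf i).mono fun w hw => (hsub y hy hw).2) fun w hw => hb i w (hsub y hy hw).1
  · exact Summable.of_norm_bounded hu fun i => hb i x (mem_of_mem_nhds hV)

variable [FiniteDimensional ℂ E]

theorem differentiableOn_intervalIntegral {U : Set E} (hU : IsOpen U) {F : E → ℝ → ℂ}
    (hc : ContinuousOn (Function.uncurry F) (U ×ˢ univ))
    (hd : ∀ t, DifferentiableOn ℂ (fun x => F x t) U) (a b : ℝ) :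
    DifferentiableOn ℂ (fun x => ∫ t in a..b, F x t) U := by
  have : ProperSpace E := FiniteDimensional.proper ℂ E
  intro x hx
  obtain ⟨R, hR, hRU⟩ := Metric.nhds_basis_closedBall.mem_iff.mp (hU.mem_nhds hx)
  have hslice : ∀ y ∈ U, Continuous (F y) := fun y hy => by
    have : ContinuousOn (fun t => Function.uncurry F (y, t)) univ :=
      hc.comp (by fun_prop) fun t _ => ⟨hy, mem_univ _⟩
    rwa [continuousOn_univ] at this
  obtain ⟨C, hC⟩ : ∃ C, ∀ p ∈ closedBall x R ×ˢ uIcc a b, ‖Function.uncurry F p‖ ≤ C :=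
    ((isCompact_closedBall x R).prod isCompact_uIcc).exists_bound_of_continuousOn
      (hc.mono (prod_mono hRU (subset_univ _)))
  have hsub : ∀ y ∈ ball x (R / 2), ball y (R / 2) ⊆ closedBall x R := fun y hy =>
    (ball_subset_ball' (by have := mem_ball.mp hy; linarith)).trans ball_subset_closedBall
  have hball : ball x (R / 2) ∈ 𝓝 x := ball_mem_nhds x (by positivity)
  have hmem : ∀ y ∈ ball x (R / 2), y ∈ U := fun y hy =>
    hRU (hsub y hy (mem_ball_self (by positivity)))
  have hderiv : Continuous fun t => fderiv ℂ (fun y => F y t) x := by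
    rw [continuous_iff_continuousAt]
    intro t₀
    have hcomp : CompactSpace (closedBall x R) := isCompact_iff_compactSpace.mp
      (isCompact_closedBall x R)
    have hunif : TendstoUniformly (fun t (y : closedBall x R) => F y t)
        (fun y => F y t₀) (𝓝 t₀) := by
      refine ContinuousOn.tendstoUniformly (U := univ) univ_mem ?_
      exact hc.comp (f := fun q : ℝ × closedBall x R => ((q.2 : E), q.1)) (by fun_prop)
        fun q _ => ⟨hRU q.2.2, mem_univ _⟩
    rw [Metric.continuousAt_iff']
    intro ε hε
    filter_upwards [Metric.tendstoUniformly_iff.mp hunif (ε * R / 4) (by positivity)] with t ht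
    have hdt : ∀ t, DifferentiableAt ℂ (fun y => F y t) x := fun t =>
      (hd t).differentiableAt (hU.mem_nhds hx)
    rw [dist_eq_norm, ← fderiv_fun_sub (hdt t) (hdt t₀)]
    refine (norm_fderiv_le_of_norm_le hR (C := ε * R / 4) ?_ ?_).trans_lt ?_
    · exact ((hd t).sub (hd t₀)).mono (ball_subset_closedBall.trans hRU)
    · intro y hy
      have := ht ⟨y, ball_subset_closedBall hy⟩
      rw [dist_comm, dist_eq_norm] at this
      exact this.le
    · have : 2 * (ε * R / 4) / R = ε / 2 := by field_simp; ring
      rw [this]; linarith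
  have key := intervalIntegral.hasFDerivAt_integral_of_dominated_of_fderiv_le
    (μ := MeasureTheory.volume) (a := a) (b := b) (F := F)
    (F' := fun y t => fderiv ℂ (fun y => F y t) y) (bound := fun _ => 2 * C / (R / 2))
    hball
    (by filter_upwards [hball] with y hy
        exact (hslice y (hmem y hy)).aestronglyMeasurable)
    ((hslice x hx).intervalIntegrable a b)
    hderiv.aestronglyMeasurable
    (Eventually.of_forall fun t ht y hy => norm_fderiv_le_of_norm_le (by positivity)
      ((hd t).mono ((hsub y hy).trans hRU)) fun w hw =>
        hC (w, t) ⟨hsub y hy hw, uIoc_subset_uIcc ht⟩)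
    intervalIntegrable_const
    (Eventually.of_forall fun t _ y hy =>
      ((hd t).differentiableAt (hU.mem_nhds (hmem y hy))).hasFDerivAt)
  exact key.differentiableAt.differentiableWithinAt

/-- Cauchy integrals depending on parameters are holomorphic. -/
theorem differentiableOn_cauchyIntegral {U : Set E} (hU : IsOpen U) {ρ r : ℝ} (hr : 0 < r)
    (hrρ : r < ρ) {F : ℂ × E → ℂ} (hF : DifferentiableOn ℂ F (ball 0 ρ ×ˢ U)) :
    DifferentiableOn ℂ (fun q : ℂ × E => ∮ w in C(0, r), (w - q.1)⁻¹ * (w⁻¹ * F (w, q.2)))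
      (ball 0 r ×ˢ U) := by
  have hcircle : ∀ θ : ℝ, circleMap 0 r θ ∈ ball (0 : ℂ) ρ := fun θ =>
    closedBall_subset_ball hrρ (circleMap_mem_closedBall _ hr.le θ)
  have hne : ∀ (θ : ℝ) (t : ℂ), t ∈ ball (0 : ℂ) r → circleMap 0 r θ - t ≠ 0 := by
    intro θ t ht h
    have h1 : circleMap 0 r θ = t := sub_eq_zero.mp h
    have h2 : ‖circleMap (0 : ℂ) r θ‖ = r := by
      rw [norm_circleMap_zero, abs_of_pos hr]
    rw [h1] at h2
    exact absurd h2 (mem_ball_zero_iff.mp ht).ne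
  simp only [circleIntegral]
  refine differentiableOn_intervalIntegral (E := ℂ × E) (U := ball 0 r ×ˢ U)
    (F := fun q θ => deriv (circleMap 0 r) θ •
      ((circleMap 0 r θ - q.1)⁻¹ * ((circleMap 0 r θ)⁻¹ * F (circleMap 0 r θ, q.2))))
    (isOpen_ball.prod hU) ?_ ?_ 0 (2 * Real.pi)
  · have hc1 : ContinuousOn (fun q : (ℂ × E) × ℝ => F (circleMap 0 r q.2, q.1.2))
        ((ball 0 r ×ˢ U) ×ˢ univ) :=
      hF.continuousOn.comp (by fun_prop) fun q hq => ⟨hcircle _, hq.1.2⟩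
    have hc3 : ContinuousOn (fun q : (ℂ × E) × ℝ => (circleMap 0 r q.2 - q.1.1)⁻¹)
        ((ball 0 r ×ˢ U) ×ˢ univ) :=
      ContinuousOn.inv₀ (by fun_prop) fun q hq => hne _ _ hq.1.1
    have hc4 : ContinuousOn (fun q : (ℂ × E) × ℝ => (circleMap 0 r q.2)⁻¹)
        ((ball 0 r ×ˢ U) ×ˢ univ) :=
      ContinuousOn.inv₀ (by fun_prop) fun q hq => by
        simpa using hne q.2 0 (mem_ball_self hr)
    have hc5 : ContinuousOn (fun q : (ℂ × E) × ℝ => deriv (circleMap 0 r) q.2)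
        ((ball 0 r ×ˢ U) ×ˢ univ) := by
      simp only [deriv_circleMap]; fun_prop
    exact hc5.smul (hc3.mul (hc4.mul hc1))
  · intro θ
    have hd1 : DifferentiableOn ℂ (fun q : ℂ × E => F (circleMap 0 r θ, q.2))
        (ball 0 r ×ˢ U) := hF.comp (by fun_prop) fun q hq => ⟨hcircle θ, hq.2⟩
    have hd3 : DifferentiableOn ℂ (fun q : ℂ × E => (circleMap 0 r θ - q.1)⁻¹)
        (ball 0 r ×ˢ U) := DifferentiableOn.fun_inv (by fun_prop) fun q hq => hne _ _ hq.1
    exact (hd3.mul (hd1.const_mul _)).const_mul (deriv (circleMap 0 r) θ)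

/-- The difference quotient of a holomorphic function in the first of its variables is
holomorphic. -/
theorem exists_differentiableOn_slope {U : Set E} (hU : IsOpen U) {ρ : ℝ} (hρ : 0 < ρ)
    {F : ℂ × E → ℂ} (hF : DifferentiableOn ℂ F (ball 0 ρ ×ˢ U)) :
    ∃ G : ℂ × E → ℂ, DifferentiableOn ℂ G (ball 0 (ρ / 2) ×ˢ U) ∧
      (∀ t ∈ ball (0 : ℂ) (ρ / 2), ∀ x ∈ U, F (t, x) = F (0, x) + t * G (t, x)) ∧
      ∀ x ∈ U, HasDerivAt (fun t => F (t, x)) (G (0, x)) 0 := by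
  have hr : 0 < ρ / 2 := by positivity
  have hrρ : closedBall (0 : ℂ) (ρ / 2) ⊆ ball 0 ρ := closedBall_subset_ball (by linarith)
  have h0 : (0 : ℂ) ∈ ball (0 : ℂ) ρ := mem_ball_self hρ
  have hF0 : DifferentiableOn ℂ (fun q : ℂ × E => F (0, q.2)) (ball 0 ρ ×ˢ U) :=
    hF.comp (by fun_prop) fun q hq => ⟨h0, hq.2⟩
  have hF2 : ∀ x ∈ U, DifferentiableOn ℂ (fun w => F (w, x)) (ball 0 ρ) := fun x hx =>
    hF.comp (by fun_prop) fun w hw => ⟨hw, hx⟩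
  have hslope : ∀ x ∈ U, DifferentiableOn ℂ (dslope (fun w => F (w, x)) 0) (ball 0 ρ) :=
    fun x hx => (Complex.differentiableOn_dslope (ball_mem_nhds _ hρ)).mpr (hF2 x hx)
  obtain ⟨G, hG, hGeq⟩ : ∃ G : ℂ × E → ℂ, DifferentiableOn ℂ G (ball 0 (ρ / 2) ×ˢ U) ∧
      ∀ t ∈ ball (0 : ℂ) (ρ / 2), ∀ x ∈ U, G (t, x) = dslope (fun w => F (w, x)) 0 t := by
    refine ⟨_, (differentiableOn_cauchyIntegral hU hr (by linarith : ρ / 2 < ρ)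
      (hF.sub hF0)).const_mul (2 * Real.pi * Complex.I)⁻¹, ?_⟩
    intro t ht x hx
    have hcauchy :=
      Complex.two_pi_I_inv_smul_circleIntegral_sub_inv_smul_of_differentiable_on_off_countable
      (f := dslope (fun w => F (w, x)) 0) (s := ∅) (R := ρ / 2) (c := 0) (w := t) countable_empty ht
      ((hslope x hx).continuousOn.mono hrρ) fun z hz => (hslope x hx).differentiableAt
        (isOpen_ball.mem_nhds (hrρ (ball_subset_closedBall hz.1)))
    rw [← hcauchy, smul_eq_mul]
    congr 1
    refine circleIntegral.integral_congr hr.le fun w hw => ?_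
    have hw0 : w ≠ 0 := by
      rintro rfl
      simp at hw
      linarith
    simp only [smul_eq_mul]
    rw [dslope_of_ne _ hw0, slope_def_module]
    simp
  refine ⟨G, hG, ?_, ?_⟩
  · intro t ht x hx
    rw [hGeq t ht x hx]
    have := sub_smul_dslope (fun w => F (w, x)) 0 t
    simp only [sub_zero, smul_eq_mul] at this
    rw [this]; ring
  · intro x hx
    rw [hGeq 0 (mem_ball_self hr) x hx, dslope_same]
    exact ((hF2 x hx).differentiableAt (isOpen_ball.mem_nhds h0)).hasDerivAt

end SeveralVariables

namespace LoopReduction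

/-! ### Holomorphic functions on `ℂˣ` and their Laurent series -/

/-- `g` is the restriction along `π` of a function which is holomorphic on `S`. -/
def Hol {I Q : Type*} [NormedAddCommGroup Q] [NormedSpace ℂ Q] (π : I → Q) (S : Set Q)
    (g : I → ℂ) : Prop :=
  ∃ F : Q → ℂ, DifferentiableOn ℂ F S ∧ ∀ i, F (π i) = g i

/-- Holomorphic functions on `ℂˣ`. -/
abbrev HolU (g : ℂˣ → ℂ) : Prop := Hol (fun z : ℂˣ => (z : ℂ)) {0}ᶜ g

section Hol

variable {I Q : Type*} [NormedAddCommGroup Q] [NormedSpace ℂ Q] {π : I → Q} {S : Set Q}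
  {g h : I → ℂ}

theorem Hol.const (a : ℂ) : Hol π S fun _ => a := ⟨fun _ => a, differentiableOn_const a, fun _ => rfl⟩

theorem Hol.add (hg : Hol π S g) (hh : Hol π S h) : Hol π S fun i => g i + h i := by
  obtain ⟨F, hF, hF'⟩ := hg
  obtain ⟨G, hG, hG'⟩ := hh
  exact ⟨F + G, hF.add hG, fun i => by simp [hF', hG']⟩

theorem Hol.mul (hg : Hol π S g) (hh : Hol π S h) : Hol π S fun i => g i * h i := by
  obtain ⟨F, hF, hF'⟩ := hg
  obtain ⟨G, hG, hG'⟩ := hh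
  exact ⟨F * G, hF.mul hG, fun i => by simp [hF', hG']⟩

theorem Hol.const_mul (a : ℂ) (hg : Hol π S g) : Hol π S fun i => a * g i := (Hol.const a).mul hg

theorem Hol.sum {κ : Type*} (s : Finset κ) {g : κ → I → ℂ} (hg : ∀ k ∈ s, Hol π S (g k)) :
    Hol π S fun i => ∑ k ∈ s, g k i := by
  classical
  induction s using Finset.induction_on with
  | empty => simpa using Hol.const 0
  | insert a s ha ih =>
    simp only [Finset.sum_insert ha]
    exact (hg a (by simp)).add (ih fun k hk => hg k (by simp [hk]))

theorem Hol.congr (hg : Hol π S g) (h' : ∀ i, g i = h i) : Hol π S h := by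
  rwa [show h = g from funext fun i => (h' i).symm]

/-- Holomorphic functions of finitely many holomorphic functions are holomorphic. -/
theorem Hol.comp {κ : Type*} [Finite κ] {g : κ → I → ℂ} (hg : ∀ k, Hol π S (g k))
    {Φ : (κ → ℂ) → ℂ} (hΦ : Differentiable ℂ Φ) : Hol π S fun i => Φ fun k => g k i := by
  choose F hF hF' using hg
  have := Fintype.ofFinite κ
  exact ⟨fun q => Φ fun k => F k q, hΦ.comp_differentiableOn (differentiableOn_pi.mpr hF),
    fun i => by simp [hF']⟩

end Hol

section Laurent

theorem holU_zpow (n : ℤ) : HolU fun z => (z : ℂ) ^ n :=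
  ⟨fun z => z ^ n, fun _ hz => (differentiableAt_zpow.mpr (Or.inl hz)).differentiableWithinAt,
    fun _ => rfl⟩

theorem HolU.continuous {g : ℂˣ → ℂ} (hg : HolU g) : Continuous g := by
  obtain ⟨F, hF, hF'⟩ := hg
  rw [show g = fun z : ℂˣ => F z from funext fun z => (hF' z).symm]
  exact hF.continuousOn.comp_continuous Units.continuous_val fun z => z.ne_zero

theorem coe_toUnits_exp (t : ℝ) :
    ((Circle.toUnits (Circle.exp t) : ℂˣ) : ℂ) = Complex.exp (t * Complex.I) := by
  simp [Circle.coe_exp]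

theorem continuous_toUnits_exp : Continuous fun t : ℝ => (Circle.toUnits (Circle.exp t) : ℂˣ) := by
  rw [Units.continuous_iff]
  constructor
  · exact (continuous_induced_dom.comp Circle.exp.continuous).congr fun t => rfl
  · have : ∀ t : ℝ, (((Circle.toUnits (Circle.exp t))⁻¹ : ℂˣ) : ℂ) = Circle.exp (-t) := fun t => by
      rw [← map_inv, ← Circle.exp_neg]; rfl
    simp only [this]
    exact continuous_induced_dom.comp (Circle.exp.continuous.comp continuous_neg)

theorem continuous_coeff_integrand {g : ℂˣ → ℂ} (hg : Continuous g) (n : ℤ) :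
    Continuous fun t : ℝ => Complex.exp (-(n * t * Complex.I)) *
      g (Circle.toUnits (Circle.exp t)) :=
  (by fun_prop : Continuous fun t : ℝ => Complex.exp (-(n * t * Complex.I))).mul
    (hg.comp continuous_toUnits_exp)

theorem coeff_add {g h : ℂˣ → ℂ} (hg : HolU g) (hh : HolU h) (n : ℤ) :
    coeff n (fun z => g z + h z) = coeff n g + coeff n h := by
  simp only [coeff, mul_add]
  rw [intervalIntegral.integral_add
    ((continuous_coeff_integrand hg.continuous n).intervalIntegrable _ _)
    ((continuous_coeff_integrand hh.continuous n).intervalIntegrable _ _), mul_add]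

theorem coeff_const_mul (a : ℂ) (g : ℂˣ → ℂ) (n : ℤ) :
    coeff n (fun z => a * g z) = a * coeff n g := by
  simp only [coeff, mul_left_comm _ a, intervalIntegral.integral_const_mul]

theorem coeff_zero_fun (n : ℤ) : coeff n (fun _ => 0) = 0 := by simp [coeff]

theorem coeff_sum {κ : Type*} (s : Finset κ) {g : κ → ℂˣ → ℂ} (hg : ∀ k ∈ s, HolU (g k)) (n : ℤ) :
    coeff n (fun z => ∑ k ∈ s, g k z) = ∑ k ∈ s, coeff n (g k) := by
  classical
  induction s using Finset.induction_on with
  | empty => simpa using coeff_zero_fun n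
  | insert a s ha ih =>
    simp only [Finset.sum_insert ha]
    rw [coeff_add (hg a (by simp)) (Hol.sum s fun k hk => hg k (by simp [hk])),
      ih fun k hk => hg k (by simp [hk])]

theorem coeff_zpow_mul (m n : ℤ) (g : ℂˣ → ℂ) :
    coeff n (fun z => (z : ℂ) ^ m * g z) = coeff (n - m) g := by
  simp only [coeff]
  congr 1
  refine intervalIntegral.integral_congr fun t _ => ?_
  · rw [← mul_assoc, coe_toUnits_exp, ← Complex.exp_int_mul, ← Complex.exp_add]
    congr 2
    push_cast; ring

theorem coeff_one (n : ℤ) : coeff n (fun _ => 1) = if n = 0 then 1 else 0 := by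
  have hpi : (Real.pi : ℂ) ≠ 0 := by exact_mod_cast Real.pi_ne_zero
  simp only [coeff, mul_one]
  split_ifs with h
  · subst h
    simp
    field_simp
  · have hc : (-(n * Complex.I) : ℂ) ≠ 0 := by simp [h]
    have := integral_exp_mul_complex (a := 0) (b := 2 * Real.pi) hc
    have h2 : ∀ t : ℝ, (-(n * t * Complex.I) : ℂ) = -(n * Complex.I) * t := fun t => by ring
    simp only [h2, this]
    have h3 : Complex.exp (-(n * Complex.I) * ((2 * Real.pi : ℝ) : ℂ)) = 1 := by
      rw [Complex.exp_eq_one_iff]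
      exact ⟨-n, by push_cast; ring⟩
    rw [h3]
    simp

theorem coeff_zpow (m n : ℤ) : coeff n (fun z : ℂˣ => (z : ℂ) ^ m) = if n = m then 1 else 0 := by
  have := coeff_zpow_mul m n fun _ => 1
  rw [coeff_one] at this
  simpa [sub_eq_zero] using this

theorem norm_coeff_le {g : ℂˣ → ℂ} {C : ℝ} (n : ℤ) (hC : ∀ z : ℂˣ, ‖(z : ℂ)‖ = 1 → ‖g z‖ ≤ C) :
    ‖coeff n g‖ ≤ C := by
  have h1 : ‖∫ t in (0 : ℝ)..(2 * Real.pi), Complex.exp (-(n * t * Complex.I)) *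
      g (Circle.toUnits (Circle.exp t))‖ ≤ C * |2 * Real.pi - 0| := by
    refine intervalIntegral.norm_integral_le_of_norm_le_const fun t _ => ?_
    have h2 : ‖Complex.exp (-(n * t * Complex.I))‖ = 1 := by
      have : (-(n * t * Complex.I) : ℂ) = ((-(n * t) : ℝ) : ℂ) * Complex.I := by push_cast; ring
      rw [this, Complex.norm_exp_ofReal_mul_I]
    rw [norm_mul, h2, one_mul]
    exact hC _ (by rw [coe_toUnits_exp, Complex.norm_exp_ofReal_mul_I])
  rw [sub_zero, abs_of_pos Real.two_pi_pos] at h1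
  rw [coeff, norm_mul, norm_inv]
  have h3 : ‖(2 * (Real.pi : ℂ))‖ = 2 * Real.pi := by
    rw [norm_mul]; simp [abs_of_pos Real.pi_pos]
  rw [h3, inv_mul_le_iff₀ Real.two_pi_pos]
  linarith

theorem coeff_rotate {g : ℂˣ → ℂ} (θ : ℝ) (n : ℤ) :
    coeff n (fun z => g (Circle.toUnits (Circle.exp θ) * z)) =
      ((Circle.toUnits (Circle.exp θ) : ℂˣ) : ℂ) ^ n * coeff n g := by
  let f : ℝ → ℂ := fun t => Complex.exp (-(n * t * Complex.I)) * g (Circle.toUnits (Circle.exp t))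
  have hper : Function.Periodic f (2 * Real.pi) := by
    intro t
    simp only [f]
    rw [Circle.exp_add, Circle.exp_two_pi, mul_one]
    congr 1
    rw [Complex.exp_eq_exp_iff_exists_int]
    exact ⟨-n, by push_cast; ring⟩
  have h1 : ∀ t : ℝ, Complex.exp (-(n * t * Complex.I)) *
      g (Circle.toUnits (Circle.exp θ) * Circle.toUnits (Circle.exp t)) =
      ((Circle.toUnits (Circle.exp θ) : ℂˣ) : ℂ) ^ n * f (θ + t) := by
    intro t
    simp only [f]
    rw [Circle.exp_add, map_mul, ← mul_assoc, coe_toUnits_exp, ← Complex.exp_int_mul,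
      ← Complex.exp_add]
    congr 2
    push_cast; ring
  have h2 := hper.intervalIntegral_add_eq θ 0
  simp only [coeff, h1, intervalIntegral.integral_const_mul]
  rw [intervalIntegral.integral_comp_add_left, add_zero, h2, zero_add, mul_left_comm]

theorem coeff_dilate {g : ℂˣ → ℂ} (hg : HolU g) (q : ℂˣ) (r : ℝ) (hr : 0 < r)
    (hq : (q : ℂ) = r) (n : ℤ) :
    coeff n (fun z => g (q * z)) = (q : ℂ) ^ n * coeff n g := by
  obtain ⟨F, hF, hF'⟩ := hg
  have hr' : (r : ℂ) ≠ 0 := by exact_mod_cast hr.ne'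
  have key : ∀ ρ : ℝ, 0 < ρ → (∮ w in C(0, ρ), w ^ (-n - 1) * F w) =
      Complex.I * (ρ : ℂ) ^ (-n) * ∫ t in (0 : ℝ)..(2 * Real.pi),
        Complex.exp (-(n * t * Complex.I)) * F (ρ * Complex.exp (t * Complex.I)) := by
    intro ρ hρ
    have hρ' : (ρ : ℂ) ≠ 0 := by exact_mod_cast hρ.ne'
    rw [circleIntegral, ← intervalIntegral.integral_const_mul]
    congr 1; ext t
    have h1 : circleMap 0 ρ t = ρ * Complex.exp (t * Complex.I) := by simp [circleMap]
    have h2 : Complex.exp (-(n * t * Complex.I)) = Complex.exp (t * Complex.I) ^ (-n) := by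
      rw [← Complex.exp_int_mul]; congr 1; push_cast; ring
    rw [deriv_circleMap, h1, h2, smul_eq_mul, mul_zpow, sub_eq_add_neg, zpow_add₀ hρ',
      zpow_add₀ (Complex.exp_ne_zero _)]
    simp only [zpow_neg_one]
    field_simp [Complex.exp_ne_zero]
  have hd : DifferentiableOn ℂ (fun w : ℂ => w ^ (-n - 1) * F w) {0}ᶜ := fun w hw =>
    ((differentiableAt_zpow.mpr (Or.inl hw)).differentiableWithinAt).mul (hF w hw)
  have hann : ∀ a b : ℝ, 0 < a → a ≤ b → (∮ w in C(0, b), w ^ (-n - 1) * F w) =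
      ∮ w in C(0, a), w ^ (-n - 1) * F w := by
    intro a b ha hab
    refine Complex.circleIntegral_eq_of_differentiable_on_annulus_off_countable ha hab
      (s := ∅) countable_empty (hd.continuousOn.mono ?_) fun z hz => hd.differentiableAt
        (isOpen_compl_singleton.mem_nhds ?_)
    · rintro z hz rfl
      exact hz.2 (mem_ball_self ha)
    · rintro rfl
      exact hz.1.2 (mem_closedBall_self ha.le)
  have hcirc : (∮ w in C(0, r), w ^ (-n - 1) * F w) = ∮ w in C(0, 1), w ^ (-n - 1) * F w := by
    rcases le_total r 1 with h | h
    · exact (hann r 1 hr h).symm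
    · exact hann 1 r one_pos h
  rw [key r hr, key 1 one_pos] at hcirc
  have hint : ∀ t : ℝ, g (q * Circle.toUnits (Circle.exp t)) =
      F (r * Complex.exp (t * Complex.I)) := fun t => by
    rw [← hF']; beta_reduce; rw [Units.val_mul, hq, coe_toUnits_exp]
  have hint1 : ∀ t : ℝ, g (Circle.toUnits (Circle.exp t)) =
      F (((1 : ℝ) : ℂ) * Complex.exp (t * Complex.I)) := fun t => by
    rw [← hF']; beta_reduce; rw [coe_toUnits_exp]; simp
  simp only [coeff, hint, hint1, hq]
  rw [Complex.ofReal_one, one_zpow, mul_one, mul_assoc] at hcirc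
  have h5 := mul_left_cancel₀ Complex.I_ne_zero hcirc
  simp only [Complex.ofReal_one]
  rw [← h5, zpow_neg, mul_left_comm ((r : ℂ) ^ n), mul_inv_cancel_left₀ (zpow_ne_zero n hr')]

theorem exists_toUnits_mul (q : ℂˣ) : ∃ (θ : ℝ) (ρ : ℂˣ), (ρ : ℂ) = (‖(q : ℂ)‖ : ℝ) ∧
    q = Circle.toUnits (Circle.exp θ) * ρ := by
  have hq : (‖(q : ℂ)‖ : ℂ) ≠ 0 := by exact_mod_cast norm_ne_zero_iff.mpr q.ne_zero
  refine ⟨Complex.arg q, Units.mk0 _ hq, rfl, Units.ext ?_⟩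
  rw [Units.val_mul, coe_toUnits_exp, Units.val_mk0, mul_comm, Complex.norm_mul_exp_arg_mul_I]

/-- Laurent coefficients of a rescaled function. -/
theorem coeff_comp_mul {g : ℂˣ → ℂ} (hg : HolU g) (q : ℂˣ) (n : ℤ) :
    coeff n (fun z => g (q * z)) = (q : ℂ) ^ n * coeff n g := by
  obtain ⟨θ, ρ, hρ, rfl⟩ := exists_toUnits_mul q
  have h1 := coeff_rotate (g := fun z => g (ρ * z)) θ n
  have h2 := coeff_dilate hg ρ _ (norm_pos_iff.mpr (Units.ne_zero _)) hρ n
  rw [h2] at h1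
  rw [Units.val_mul, mul_zpow, mul_assoc, ← h1]
  congr 1; ext z
  congr 1
  rw [← mul_assoc, mul_comm ρ]

/-- Two-sided sequences which decay faster than every exponential. -/
def Rapid (a : ℤ → ℂ) : Prop := ∀ r : ℝ, 1 ≤ r → ∃ C, ∀ n : ℤ, ‖a n‖ ≤ C * (r⁻¹) ^ n.natAbs

/-- Two-sided sequences which grow at most exponentially. -/
def ExpGrowth (a : ℤ → ℂ) : Prop := ∃ C R : ℝ, 0 ≤ C ∧ 1 ≤ R ∧ ∀ n : ℤ, ‖a n‖ ≤ C * R ^ n.natAbs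

theorem Rapid.mul {a κ : ℤ → ℂ} (ha : Rapid a) (hκ : ExpGrowth κ) : Rapid fun n => κ n * a n := by
  intro r hr
  obtain ⟨C, R, hC, hR, hκ⟩ := hκ
  obtain ⟨C', hC'⟩ := ha (R * r) (one_le_mul_of_one_le_of_one_le hR hr)
  refine ⟨C * C', fun n => ?_⟩
  rw [norm_mul]
  calc ‖κ n‖ * ‖a n‖ ≤ (C * R ^ n.natAbs) * (C' * ((R * r)⁻¹) ^ n.natAbs) := by
        gcongr
        · exact hκ n
        · exact hC' n
    _ = C * C' * (r⁻¹) ^ n.natAbs := by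
        rw [mul_inv, mul_pow, inv_pow R]
        field_simp

theorem summable_pow_natAbs {s : ℝ} (hs0 : 0 ≤ s) (hs : s < 1) :
    Summable fun n : ℤ => s ^ n.natAbs := by
  refine Summable.of_nat_of_neg ?_ ?_ <;> simpa using summable_geometric_of_lt_one hs0 hs

theorem norm_zpow_le {z : ℂ} (hz : z ≠ 0) {r : ℝ} (h1 : ‖z‖ ≤ r) (h2 : ‖z‖⁻¹ ≤ r) (n : ℤ) :
    ‖z ^ n‖ ≤ r ^ n.natAbs := by
  rw [norm_zpow]
  rcases Int.natAbs_eq n with h | h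
  · conv_lhs => rw [h]
    rw [zpow_natCast]
    exact pow_le_pow_left₀ (norm_nonneg _) h1 _
  · conv_lhs => rw [h]
    rw [zpow_neg, zpow_natCast, ← inv_pow]
    exact pow_le_pow_left₀ (by positivity) h2 _

/-- A decay bound for Laurent coefficients in terms of bounds on two circles. -/
theorem norm_coeff_le_of_bound {g : ℂˣ → ℂ} (hg : HolU g) {r C : ℝ} (hr : 1 ≤ r)
    (hC : ∀ z : ℂˣ, ‖(z : ℂ)‖ = r ∨ ‖(z : ℂ)‖ = r⁻¹ → ‖g z‖ ≤ C) (n : ℤ) :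
    ‖coeff n g‖ ≤ C * (r⁻¹) ^ n.natAbs := by
  have hr0 : 0 < r := by linarith
  have key : ∀ ρ : ℝ, 0 < ρ → (ρ = r ∨ ρ = r⁻¹) → ‖coeff n g‖ ≤ C * (ρ ^ n)⁻¹ := by
    intro ρ hρ h
    have hρ' : (ρ : ℂ) ≠ 0 := by exact_mod_cast hρ.ne'
    have h1 := coeff_comp_mul hg (Units.mk0 (ρ : ℂ) hρ') n
    have h2 : ‖coeff n (fun z => g (Units.mk0 (ρ : ℂ) hρ' * z))‖ ≤ C := norm_coeff_le n fun z hz =>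
      hC _ (by simpa [hz, abs_of_pos hρ] using h)
    rw [h1, norm_mul, Units.val_mk0, norm_zpow, Complex.norm_real, Real.norm_of_nonneg hρ.le] at h2
    rw [← div_eq_mul_inv, le_div_iff₀ (zpow_pos hρ n)]
    linarith
  rcases Int.natAbs_eq n with h | h
  · refine (key r hr0 (Or.inl rfl)).trans_eq ?_
    conv_lhs => rw [h]
    rw [zpow_natCast, inv_pow]
  · refine (key r⁻¹ (by positivity) (Or.inr rfl)).trans_eq ?_
    conv_lhs => rw [h]
    rw [zpow_neg, zpow_natCast, inv_inv]

theorem HolU.exists_bound {g : ℂˣ → ℂ} (hg : HolU g) (r : ℝ) (hr : 0 < r) :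
    ∃ C, ∀ z : ℂˣ, ‖(z : ℂ)‖ = r → ‖g z‖ ≤ C := by
  obtain ⟨F, hF, hF'⟩ := hg
  obtain ⟨C, hC⟩ := (isCompact_sphere (0 : ℂ) r).exists_bound_of_continuousOn
    (hF.continuousOn.mono fun z hz => by
      rintro rfl
      simp at hz; linarith)
  exact ⟨C, fun z hz => by rw [← hF']; exact hC z (by simpa using hz)⟩

theorem HolU.rapid {g : ℂˣ → ℂ} (hg : HolU g) : Rapid fun n => coeff n g := by
  intro r hr
  obtain ⟨C₁, h₁⟩ := hg.exists_bound r (by linarith)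
  obtain ⟨C₂, h₂⟩ := hg.exists_bound r⁻¹ (by positivity)
  refine ⟨max C₁ C₂, norm_coeff_le_of_bound hg hr ?_⟩
  rintro z (hz | hz)
  · exact (h₁ z hz).trans (le_max_left _ _)
  · exact (h₂ z hz).trans (le_max_right _ _)

theorem Rapid.exists_bound {a : ℤ → ℂ} (ha : Rapid a) (r : ℝ) (hr : 1 ≤ r) :
    ∃ u : ℤ → ℝ, Summable u ∧ ∀ n : ℤ, ∀ z : ℂ, z ≠ 0 → ‖z‖ ≤ r → ‖z‖⁻¹ ≤ r → ‖a n * z ^ n‖ ≤ u n := by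
  obtain ⟨C, hC⟩ := ha (2 * r) (by linarith)
  refine ⟨fun n => C * (2⁻¹ : ℝ) ^ n.natAbs,
    (summable_pow_natAbs (by norm_num) (by norm_num)).mul_left _, fun n z hz h1 h2 => ?_⟩
  have hC0 : 0 ≤ C := by simpa using (norm_nonneg _).trans (hC 0)
  rw [norm_mul]
  calc ‖a n‖ * ‖z ^ n‖ ≤ (C * ((2 * r)⁻¹) ^ n.natAbs) * r ^ n.natAbs := by
        gcongr
        · exact hC n
        · exact norm_zpow_le hz h1 h2 n
    _ = C * (2⁻¹ : ℝ) ^ n.natAbs := by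
        rw [mul_inv, mul_pow, inv_pow r]
        field_simp

theorem Rapid.summable {a : ℤ → ℂ} (ha : Rapid a) (z : ℂˣ) : Summable fun n => a n * (z : ℂ) ^ n := by
  have hz : 0 < ‖(z : ℂ)‖ := norm_pos_iff.mpr z.ne_zero
  obtain ⟨u, hu, hb⟩ := ha.exists_bound (max 1 (max ‖(z : ℂ)‖ ‖(z : ℂ)‖⁻¹)) (le_max_left _ _)
  exact Summable.of_norm_bounded hu fun n => hb n z z.ne_zero
    ((le_max_left _ _).trans (le_max_right _ _)) ((le_max_right _ _).trans (le_max_right _ _))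

/-- The Laurent expansion. -/
theorem HolU.hasSum {g : ℂˣ → ℂ} (hg : HolU g) (z : ℂˣ) :
    HasSum (fun n => coeff n g * (z : ℂ) ^ n) (g z) := by
  have : Fact (0 < 2 * Real.pi) := ⟨Real.two_pi_pos⟩
  let f : C(AddCircle (2 * Real.pi), ℂ) :=
    ⟨fun t => g (z * Circle.toUnits (AddCircle.toCircle t)), by
      refine hg.continuous.comp (continuous_const.mul ?_)
      rw [Units.continuous_iff]
      refine ⟨(continuous_induced_dom.comp AddCircle.continuous_toCircle).congr fun t => rfl, ?_⟩
      have : ∀ t : AddCircle (2 * Real.pi),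
          (((Circle.toUnits (AddCircle.toCircle t))⁻¹ : ℂˣ) : ℂ) = AddCircle.toCircle (-t) := by
        intro t
        rw [← map_inv, ← AddCircle.toCircle_neg]; rfl
      simp only [this]
      exact continuous_induced_dom.comp (AddCircle.continuous_toCircle.comp continuous_neg)⟩
  have hexp : ∀ t : ℝ, AddCircle.toCircle (t : AddCircle (2 * Real.pi)) = Circle.exp t := by
    intro t
    rw [AddCircle.toCircle_apply_mk]
    congr 1
    field_simp
  have hcoef : ∀ n, fourierCoeff f n = coeff n g * (z : ℂ) ^ n := by
    intro n
    rw [mul_comm (coeff n g), ← coeff_comp_mul hg z n, fourierCoeff_eq_intervalIntegral f n 0, zero_add]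
    unfold coeff
    rw [Complex.real_smul]
    congr 1
    · push_cast; simp
    · congr 1; ext t
      rw [smul_eq_mul]
      congr 1
      · rw [fourier_coe_apply]
        congr 1
        push_cast
        field_simp
      · simp [f, hexp]
  have hsum : Summable (fourierCoeff f) := by
    simp only [funext hcoef]
    exact hg.rapid.summable z
  have := has_pointwise_sum_fourier_series_of_summable hsum 0
  simp only [hcoef] at this
  simpa [f] using this

theorem HolU.ext {g h : ℂˣ → ℂ} (hg : HolU g) (hh : HolU h) (H : ∀ n, coeff n g = coeff n h) :
    g = h := by
  ext z
  have h1 := hg.hasSum z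
  simp only [H] at h1
  exact h1.unique (hh.hasSum z)

theorem Rapid.holU {a : ℤ → ℂ} (ha : Rapid a) : HolU fun z => ∑' n, a n * (z : ℂ) ^ n := by
  refine ⟨fun z => ∑' n, a n * z ^ n, ?_, fun _ => rfl⟩
  refine SeveralVariables.differentiableOn_tsum isOpen_compl_singleton (fun n z hz =>
    ((differentiableAt_zpow.mpr (Or.inl hz)).const_mul _).differentiableWithinAt) fun z hz => ?_
  have hz' : 0 < ‖z‖ := norm_pos_iff.mpr hz
  obtain ⟨u, hu, hb⟩ := ha.exists_bound (max 1 (max (2 * ‖z‖) (‖z‖ / 2)⁻¹)) (le_max_left _ _)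
  refine ⟨{w | ‖z‖ / 2 < ‖w‖ ∧ ‖w‖ < 2 * ‖z‖}, ?_, u, hu, fun n w hw => hb n w ?_ ?_ ?_⟩
  · exact ((isOpen_lt continuous_const continuous_norm).inter
      (isOpen_lt continuous_norm continuous_const)).mem_nhds
      ⟨half_lt_self hz', by
        change ‖z‖ < 2 * ‖z‖
        linarith⟩
  · exact norm_pos_iff.mp ((by positivity : 0 ≤ ‖z‖ / 2).trans_lt hw.1)
  · exact hw.2.le.trans ((le_max_left _ _).trans (le_max_right _ _))
  · refine (inv_anti₀ (by positivity) hw.1.le).trans ((le_max_right _ _).trans (le_max_right _ _))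

/-- Laurent coefficients of a product, as far as the constant term is concerned. -/
theorem hasSum_coeff_zero_mul {g h : ℂˣ → ℂ} (hg : HolU g) (hh : HolU h) :
    HasSum (fun n => coeff n g * coeff (-n) h) (coeff 0 fun z => g z * h z) := by
  obtain ⟨C, hC⟩ := hh.exists_bound 1 one_pos
  obtain ⟨u, hu, hb⟩ := hg.rapid.exists_bound 1 le_rfl
  have hcirc : ∀ t : ℝ, ‖((Circle.toUnits (Circle.exp t) : ℂˣ) : ℂ)‖ = 1 := fun t => by simp
  have hC0 : 0 ≤ C := (norm_nonneg _).trans (hC 1 (by simp))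
  have h1 := intervalIntegral.hasSum_integral_of_dominated_convergence (μ := MeasureTheory.volume)
    (a := 0) (b := 2 * Real.pi) (fun n _ => u n * C)
    (F := fun n t => coeff n g * (Complex.exp (n * t * Complex.I) *
      h (Circle.toUnits (Circle.exp t))))
    (f := fun t => g (Circle.toUnits (Circle.exp t)) * h (Circle.toUnits (Circle.exp t)))
    (fun n => by
      have := continuous_coeff_integrand hh.continuous (-n)
      simp only [Int.cast_neg, neg_mul, neg_neg] at this
      exact (this.const_mul (coeff n g)).aestronglyMeasurable)
    (fun n => Eventually.of_forall fun t _ => by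
      have h2 := hb n (Circle.toUnits (Circle.exp t) : ℂˣ) (Units.ne_zero _) (hcirc t).le
        (by rw [hcirc]; simp)
      have h3 := hC (Circle.toUnits (Circle.exp t)) (hcirc t)
      rw [coe_toUnits_exp, ← Complex.exp_int_mul, ← mul_assoc] at h2
      rw [← mul_assoc, norm_mul]
      exact mul_le_mul h2 h3 (norm_nonneg _) ((norm_nonneg _).trans h2))
    (Eventually.of_forall fun t _ => hu.mul_right C)
    (by simp)
    (Eventually.of_forall fun t _ => by
      have h2 := (hg.hasSum (Circle.toUnits (Circle.exp t))).mul_right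
        (h (Circle.toUnits (Circle.exp t)))
      refine h2.congr_fun fun n => ?_
      rw [coe_toUnits_exp, ← Complex.exp_int_mul]
      ring_nf)
  have h4 := h1.mul_left (2 * (Real.pi : ℂ))⁻¹
  have h5 : (2 * (Real.pi : ℂ))⁻¹ * ∫ t in (0 : ℝ)..(2 * Real.pi),
      g (Circle.toUnits (Circle.exp t)) * h (Circle.toUnits (Circle.exp t)) =
      coeff 0 fun z => g z * h z := by simp [coeff]
  rw [h5] at h4
  refine h4.congr_fun fun n => ?_
  rw [intervalIntegral.integral_const_mul]
  simp only [coeff, Int.cast_neg, neg_mul, neg_neg]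
  ring

theorem Rapid.coeff_tsum {a : ℤ → ℂ} (ha : Rapid a) (n : ℤ) :
    coeff n (fun z => ∑' m, a m * (z : ℂ) ^ m) = a n := by
  obtain ⟨u, hu, hb⟩ := ha.exists_bound 1 le_rfl
  have hcirc : ∀ t : ℝ, ‖((Circle.toUnits (Circle.exp t) : ℂˣ) : ℂ)‖ = 1 := fun t => by simp
  have h1 := intervalIntegral.hasSum_integral_of_dominated_convergence (μ := MeasureTheory.volume)
    (a := 0) (b := 2 * Real.pi) (fun m _ => u m)
    (F := fun m t => a m * (Complex.exp (-(n * t * Complex.I)) *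
      ((Circle.toUnits (Circle.exp t) : ℂˣ) : ℂ) ^ m))
    (f := fun t => Complex.exp (-(n * t * Complex.I)) *
      ∑' m, a m * ((Circle.toUnits (Circle.exp t) : ℂˣ) : ℂ) ^ m)
    (fun m => ((continuous_coeff_integrand (holU_zpow m).continuous n).const_mul
      (a m)).aestronglyMeasurable)
    (fun m => Eventually.of_forall fun t _ => by
      have h2 := hb m (Circle.toUnits (Circle.exp t) : ℂˣ) (Units.ne_zero _) (hcirc t).le
        (by rw [hcirc]; simp)
      have h3 : ‖Complex.exp (-(n * t * Complex.I))‖ = 1 := by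
        have : (-(n * t * Complex.I) : ℂ) = ((-(n * t) : ℝ) : ℂ) * Complex.I := by push_cast; ring
        rw [this, Complex.norm_exp_ofReal_mul_I]
      rw [norm_mul, norm_mul, h3, one_mul, ← norm_mul]
      exact h2)
    (Eventually.of_forall fun t _ => hu)
    (by simp)
    (Eventually.of_forall fun t _ => by
      refine ((ha.summable (Circle.toUnits (Circle.exp t))).hasSum.mul_left
        (Complex.exp (-(n * t * Complex.I)))).congr_fun fun m => ?_
      ring)
  have h4 := h1.mul_left (2 * (Real.pi : ℂ))⁻¹
  have h5 : ∀ m, (2 * (Real.pi : ℂ))⁻¹ * ∫ t in (0 : ℝ)..(2 * Real.pi),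
      a m * (Complex.exp (-(n * t * Complex.I)) * ((Circle.toUnits (Circle.exp t) : ℂˣ) : ℂ) ^ m) =
      if m = n then a n else 0 := by
    intro m
    have := coeff_zpow m n
    rw [coeff] at this
    rw [intervalIntegral.integral_const_mul, mul_left_comm, this]
    by_cases h : m = n
    · rw [if_pos h, if_pos h.symm, h, mul_one]
    · rw [if_neg h, if_neg (Ne.symm h), mul_zero]
  simp only [h5] at h4
  exact h4.unique (by convert hasSum_ite_eq n (a n) using 1)

end Laurent

end LoopReduction

namespace LoopReduction

/-! ### Vector valued loops and multipliers -/

theorem Rapid.zero : Rapid fun _ => 0 := fun _ _ => ⟨0, fun n => by simp⟩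

theorem Rapid.add {a b : ℤ → ℂ} (ha : Rapid a) (hb : Rapid b) : Rapid fun n => a n + b n := by
  intro r hr
  obtain ⟨C, hC⟩ := ha r hr
  obtain ⟨C', hC'⟩ := hb r hr
  refine ⟨C + C', fun n => (norm_add_le _ _).trans ?_⟩
  rw [add_mul]
  exact add_le_add (hC n) (hC' n)

theorem Rapid.sum {κ : Type*} (s : Finset κ) {a : κ → ℤ → ℂ} (ha : ∀ k ∈ s, Rapid (a k)) :
    Rapid fun n => ∑ k ∈ s, a k n := by
  classical
  induction s using Finset.induction_on with
  | empty => simpa using Rapid.zero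
  | insert i s hi ih =>
    simp only [Finset.sum_insert hi]
    exact (ha i (by simp)).add (ih fun k hk => ha k (by simp [hk]))

section Vector

variable {E : Type*} [AddCommGroup E] [Module ℂ E] [TopologicalSpace E] [IsTopologicalAddGroup E]
  [ContinuousSMul ℂ E]

theorem ev_holU (X : Loop E) (ℓ : Module.Dual ℂ E) : HolU fun z => ℓ (ev X z) := ev_spec X ℓ

@[simp] theorem ev_zero (z : ℂˣ) : ev (0 : Loop E) z = 0 := rfl

@[simp] theorem ev_neg (X : Loop E) (z : ℂˣ) : ev (-X) z = -ev X z := rfl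

@[simp] theorem ev_sub (X Y : Loop E) (z : ℂˣ) : ev (X - Y) z = ev X z - ev Y z := rfl

@[simp] theorem ev_shift (p : ℂˣ) (X : Loop E) (z : ℂˣ) : ev (shift p X) z = ev X (p * z) := rfl

variable [FiniteDimensional ℂ E]

theorem sum_coord (x : E) :
    ∑ i, (Module.finBasis ℂ E).coord i x • Module.finBasis ℂ E i = x :=
  (Module.finBasis ℂ E).sum_repr x

theorem continuous_of_holU {g : ℂˣ → E} (h : ∀ ℓ : Module.Dual ℂ E, HolU fun z => ℓ (g z)) :
    Continuous g := by
  rw [show g = fun z => ∑ i, (Module.finBasis ℂ E).coord i (g z) • Module.finBasis ℂ E i from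
    funext fun z => (sum_coord (g z)).symm]
  exact continuous_finsetSum _ fun i _ => (h _).continuous.smul continuous_const

/-- A loop from a holomorphic function. -/
def Loop.ofHol (g : ℂˣ → E) (h : ∀ ℓ : Module.Dual ℂ E, HolU fun z => ℓ (g z)) : Loop E :=
  Loop.mk g (continuous_of_holU h) h

@[simp] theorem ev_ofHol (g : ℂˣ → E) (h) (z : ℂˣ) : ev (Loop.ofHol g h) z = g z := rfl

theorem dual_ext {x y : E} (h : ∀ ℓ : Module.Dual ℂ E, ℓ x = ℓ y) : x = y := by
  rw [← sum_coord x, ← sum_coord y]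
  simp only [h]

theorem loop_ext_coeff {X Y : Loop E}
    (h : ∀ (ℓ : Module.Dual ℂ E) (n : ℤ), coeff n (fun z => ℓ (ev X z)) =
      coeff n fun z => ℓ (ev Y z)) : X = Y :=
  loop_ext fun z => dual_ext fun ℓ =>
    congrFun ((ev_holU X ℓ).ext (ev_holU Y ℓ) (h ℓ)) z

theorem dual_eq_sum (ℓ : Module.Dual ℂ E) (x : E) :
    ℓ x = ∑ i, ℓ (Module.finBasis ℂ E i) * (Module.finBasis ℂ E).coord i x := by
  conv_lhs => rw [← sum_coord x]
  rw [map_sum]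
  exact Finset.sum_congr rfl fun i _ => by rw [map_smul, smul_eq_mul, mul_comm]

/-- The vector valued Laurent coefficients of a loop. -/
def vc (n : ℤ) : Loop E →ₗ[ℂ] E where
  toFun X := ∑ i, coeff n (fun z => (Module.finBasis ℂ E).coord i (ev X z)) • Module.finBasis ℂ E i
  map_add' X Y := by
    simp only [ev_add, map_add, coeff_add (ev_holU X _) (ev_holU Y _), add_smul,
      Finset.sum_add_distrib]
  map_smul' a X := by
    simp only [ev_smul, map_smul, smul_eq_mul, coeff_const_mul, mul_smul, Finset.smul_sum,
      RingHom.id_apply]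

theorem dual_vc (ℓ : Module.Dual ℂ E) (n : ℤ) (X : Loop E) :
    ℓ (vc n X) = coeff n fun z => ℓ (ev X z) := by
  have h : (fun z => ℓ (ev X z)) = fun z => ∑ i, ℓ (Module.finBasis ℂ E i) *
      (Module.finBasis ℂ E).coord i (ev X z) := funext fun z => dual_eq_sum ℓ _
  rw [h, coeff_sum _ fun i _ => (ev_holU X _).const_mul _]
  simp only [vc, LinearMap.coe_mk, AddHom.coe_mk, map_sum, map_smul, smul_eq_mul, coeff_const_mul]
  exact Finset.sum_congr rfl fun i _ => mul_comm _ _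

theorem loop_ext_vc {X Y : Loop E} (h : ∀ n, vc n X = vc n Y) : X = Y :=
  loop_ext_coeff fun ℓ n => by rw [← dual_vc, ← dual_vc, h]

theorem end_ext_vc {T T' : Module.End ℂ (Loop E)} (h : ∀ n X, vc n (T X) = vc n (T' X)) : T = T' :=
  LinearMap.ext fun X => loop_ext_vc fun n => h n X

theorem vc_shift (p : ℂˣ) (n : ℤ) (X : Loop E) : vc n (shift p X) = (p : ℂ) ^ n • vc n X :=
  dual_ext fun ℓ => by
    rw [dual_vc, map_smul, dual_vc]
    exact coeff_comp_mul (ev_holU X ℓ) p n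

theorem vc_map {E' : Type*} [AddCommGroup E'] [Module ℂ E'] [TopologicalSpace E']
    [IsTopologicalAddGroup E'] [ContinuousSMul ℂ E'] [FiniteDimensional ℂ E'] [T2Space E]
    (T : E →ₗ[ℂ] E') (n : ℤ) (X : Loop E) : vc n (Loop.map T X) = T (vc n X) :=
  dual_ext fun ℓ => by
    rw [dual_vc]
    exact (dual_vc (ℓ ∘ₗ T) n X).symm

/-- The loop `z ↦ a(z) e`. -/
def scalarLoop (g : ℂˣ → ℂ) (hg : HolU g) (e : E) : Loop E :=
  Loop.ofHol (fun z => g z • e) fun ℓ => (hg.mul (Hol.const (ℓ e))).congr fun z => by simp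

theorem vc_scalarLoop (g : ℂˣ → ℂ) (hg : HolU g) (e : E) (n : ℤ) :
    vc n (scalarLoop g hg e) = coeff n g • e :=
  dual_ext fun ℓ => by
    rw [dual_vc]
    simp only [scalarLoop, ev_ofHol, map_smul, smul_eq_mul, mul_comm _ (ℓ e), coeff_const_mul]

/-- The loop `z ↦ zⁿ e`. -/
def mono (n : ℤ) (e : E) : Loop E := scalarLoop (fun z => (z : ℂ) ^ n) (holU_zpow n) e

@[simp] theorem ev_mono (n : ℤ) (e : E) (z : ℂˣ) : ev (mono n e) z = (z : ℂ) ^ n • e := rfl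

theorem vc_mono (m n : ℤ) (e : E) : vc m (mono n e) = if m = n then e else 0 := by
  rw [mono, vc_scalarLoop, coeff_zpow]
  split_ifs <;> simp

/-- `T` multiplies the `n`-th Laurent coefficient by `τ n`. -/
def IsMult (T : Module.End ℂ (Loop E)) (τ : ℤ → Module.End ℂ E) : Prop :=
  ∀ n X, vc n (T X) = τ n (vc n X)

namespace IsMult

variable {T T' : Module.End ℂ (Loop E)} {τ τ' : ℤ → Module.End ℂ E}

theorem eq (h : IsMult T τ) (h' : IsMult T' τ') (H : ∀ n, τ n = τ' n) : T = T' :=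
  end_ext_vc fun n X => by rw [h, h', H]

theorem add (h : IsMult T τ) (h' : IsMult T' τ') : IsMult (T + T') fun n => τ n + τ' n :=
  fun n X => by simp [h n X, h' n X]

theorem sub (h : IsMult T τ) (h' : IsMult T' τ') : IsMult (T - T') fun n => τ n - τ' n :=
  fun n X => by simp [h n X, h' n X]

theorem neg (h : IsMult T τ) : IsMult (-T) fun n => -τ n :=
  fun n X => by simp [h n X]

theorem mul (h : IsMult T τ) (h' : IsMult T' τ') : IsMult (T * T') fun n => τ n * τ' n :=
  fun n X => by simp [h n, h' n X]

theorem smul (a : ℂ) (h : IsMult T τ) : IsMult (a • T) fun n => a • τ n :=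
  fun n X => by simp [h n X]

theorem one : IsMult (1 : Module.End ℂ (Loop E)) fun _ => 1 := fun _ _ => rfl

theorem shift (p : ℂˣ) : IsMult (shift p : Module.End ℂ (Loop E)) fun n => (p : ℂ) ^ n • 1 :=
  fun n X => by simp [vc_shift]

theorem map [T2Space E] (S : E →ₗ[ℂ] E) : IsMult (Loop.map S) fun _ => S :=
  fun n X => vc_map S n X

theorem comm_iff (h : IsMult T τ) (h' : IsMult T' τ') :
    Commute T T' ↔ ∀ n, Commute (τ n) (τ' n) := by
  constructor
  · intro H n
    ext e
    have := congrArg (vc n) (LinearMap.congr_fun H.eq (mono n e))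
    simpa [h n, h' n, vc_mono] using this
  · intro H
    exact (h.mul h').eq (h'.mul h) fun n => (H n).eq

theorem isUnit (h : IsMult T τ) (hT : T * T' = 1) (n : ℤ) : IsUnit (τ n) := by
  rw [LinearMap.isUnit_iff_range_eq_top, LinearMap.range_eq_top]
  intro e
  refine ⟨vc n (T' (mono n e)), ?_⟩
  rw [← h, ← Module.End.mul_apply, hT, Module.End.one_apply, vc_mono, if_pos rfl]

theorem inv (h : IsMult T τ) (hT : T * T' = 1) : IsMult T' fun n => Ring.inverse (τ n) := by
  intro n X
  have h1 : τ n (vc n (T' X)) = vc n X := by rw [← h, ← Module.End.mul_apply, hT, Module.End.one_apply]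
  rw [← h1, ← Module.End.mul_apply, Ring.inverse_mul_cancel _ (h.isUnit hT n), Module.End.one_apply]

/-- A multiplier whose symbol consists of invertible operators is injective. -/
theorem mul_left_cancel (h : IsMult T τ) (hτ : ∀ n, IsUnit (τ n)) {A A' : Module.End ℂ (Loop E)}
    (hA : T * A = T * A') : A = A' := by
  refine end_ext_vc fun n X => ?_
  have h1 := congrArg (vc n) (LinearMap.congr_fun hA X)
  rw [Module.End.mul_apply, Module.End.mul_apply, h, h] at h1
  have h2 := congrArg (fun x => Ring.inverse (τ n) x) h1
  beta_reduce at h2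
  rwa [← Module.End.mul_apply, ← Module.End.mul_apply, Ring.inverse_mul_cancel _ (hτ n)] at h2

end IsMult

/-- The operator with a given symbol of at most exponential growth. -/
theorem exists_isMult (τ : ℤ → Module.End ℂ E)
    (hτ : ∀ (ℓ : Module.Dual ℂ E) (e : E), ExpGrowth fun n => ℓ (τ n e)) :
    ∃ T, IsMult (E := E) T τ := by
  have hr : ∀ (X : Loop E) (ℓ : Module.Dual ℂ E), Rapid fun n => ℓ (τ n (vc n X)) := by
    intro X ℓ
    have h1 : ∀ n, ℓ (τ n (vc n X)) = ∑ i, ℓ (τ n (Module.finBasis ℂ E i)) *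
        coeff n (fun z => (Module.finBasis ℂ E).coord i (ev X z)) := by
      intro n
      simp only [← dual_vc]
      exact dual_eq_sum (ℓ ∘ₗ τ n) _
    simp only [h1]
    exact Rapid.sum _ fun i _ => (ev_holU X _).rapid.mul (hτ ℓ _)
  let g : Loop E → ℂˣ → E := fun X z => ∑ i, (∑' n, (Module.finBasis ℂ E).coord i
    (τ n (vc n X)) * (z : ℂ) ^ n) • Module.finBasis ℂ E i
  have hg : ∀ X (ℓ : Module.Dual ℂ E), HolU fun z => ℓ (g X z) := by
    intro X ℓ
    refine (Hol.sum Finset.univ fun i _ => (hr X ((Module.finBasis ℂ E).coord i)).holU.mul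
      (Hol.const (ℓ (Module.finBasis ℂ E i)))).congr fun z => ?_
    simp only [g, map_sum, map_smul, smul_eq_mul]
  have hvc : ∀ n X, vc n (Loop.ofHol (g X) (hg X)) = τ n (vc n X) := by
    intro n X
    refine dual_ext fun ℓ => ?_
    rw [dual_vc, dual_eq_sum ℓ (τ n (vc n X))]
    simp only [ev_ofHol, g, map_sum, map_smul, smul_eq_mul]
    simp only [mul_comm _ (ℓ _)]
    rw [coeff_sum _ fun i _ => (hr X ((Module.finBasis ℂ E).coord i)).holU.const_mul _]
    refine Finset.sum_congr rfl fun i _ => ?_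
    rw [coeff_const_mul, (hr X ((Module.finBasis ℂ E).coord i)).coeff_tsum]
  exact ⟨{ toFun := fun X => Loop.ofHol (g X) (hg X)
           map_add' := fun X Y => loop_ext_vc fun n => by simp only [map_add, hvc]
           map_smul' := fun a X => loop_ext_vc fun n => by simp only [map_smul, hvc, RingHom.id_apply] },
    fun n X => hvc n X⟩

/-- The symbol of an operator on loops grows at most exponentially. -/
theorem IsMult.expGrowth {T : Module.End ℂ (Loop E)} {τ : ℤ → Module.End ℂ E} (h : IsMult T τ)
    (ℓ : Module.Dual ℂ E) (e : E) : ExpGrowth fun n => ℓ (τ n e) := by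
  classical
  by_contra hne
  set κ : ℤ → ℂ := fun n => ℓ (τ n e) with hκ
  have hbig : ∀ k : ℕ, ∃ n : ℤ, k ≤ n.natAbs ∧ ((k : ℝ) + 1) ^ n.natAbs < ‖κ n‖ := by
    intro k
    by_contra! hk
    refine hne ⟨1 + ∑ m ∈ Finset.Icc (-k : ℤ) k, ‖κ m‖, k + 1, by positivity, by simp, fun n => ?_⟩
    have h1 : (1 : ℝ) ≤ ((k : ℝ) + 1) ^ n.natAbs := one_le_pow₀ (by simp)
    have h2 : 0 ≤ ∑ m ∈ Finset.Icc (-k : ℤ) k, ‖κ m‖ := Finset.sum_nonneg fun _ _ => norm_nonneg _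
    rcases le_or_gt k n.natAbs with hn | hn
    · nlinarith [hk n hn]
    · have h3 : ‖κ n‖ ≤ ∑ m ∈ Finset.Icc (-k : ℤ) k, ‖κ m‖ :=
        Finset.single_le_sum (f := fun m => ‖κ m‖) (fun _ _ => norm_nonneg _)
          (Finset.mem_Icc.mpr (by omega))
      nlinarith
  choose N hN hNκ using hbig
  let a : ℤ → ℂ := fun n => if ∃ k, n = N k then (κ n)⁻¹ else 0
  have haN : ∀ k, a (N k) = (κ (N k))⁻¹ := fun k => if_pos ⟨k, rfl⟩
  have hle : ∀ k, ‖a (N k)‖ ≤ (((k : ℝ) + 1)⁻¹) ^ (N k).natAbs := fun k => by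
    rw [haN, norm_inv, inv_pow]
    exact inv_anti₀ (by positivity) (hNκ k).le
  have ha : Rapid a := by
    intro r hr
    obtain ⟨k₀, hk₀⟩ := exists_nat_ge r
    refine ⟨1 + ∑ k ∈ Finset.range k₀, ‖a (N k)‖ * r ^ (N k).natAbs, fun n => ?_⟩
    have h0 : 0 ≤ ∑ k ∈ Finset.range k₀, ‖a (N k)‖ * r ^ (N k).natAbs :=
      Finset.sum_nonneg fun _ _ => by positivity
    by_cases hn : ∃ k, n = N k
    · obtain ⟨k, rfl⟩ := hn
      rcases le_or_gt k₀ k with hk | hk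
      · have h1 : ‖a (N k)‖ ≤ (r⁻¹) ^ (N k).natAbs := by
          refine (hle k).trans (pow_le_pow_left₀ (by positivity) (inv_anti₀ (by linarith) ?_) _)
          have : (k₀ : ℝ) ≤ k := by exact_mod_cast hk
          linarith
        have h2 : 0 ≤ (r⁻¹) ^ (N k).natAbs := by positivity
        nlinarith
      · have h1 := Finset.single_le_sum (f := fun k => ‖a (N k)‖ * r ^ (N k).natAbs)
          (fun _ _ => by positivity) (Finset.mem_range.mpr hk)
        rw [inv_pow, ← div_eq_mul_inv, le_div_iff₀ (by positivity)]
        linarith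
    · have : a n = 0 := if_neg hn
      rw [this, norm_zero]
      positivity
  obtain ⟨C, hC⟩ := (ev_holU (T (scalarLoop _ ha.holU e)) ℓ).rapid 2 (by norm_num)
  have hval : ∀ k, coeff (N k) (fun z => ℓ (ev (T (scalarLoop _ ha.holU e)) z)) = 1 := by
    intro k
    have hne : κ (N k) ≠ 0 := norm_pos_iff.mp ((by positivity : (0:ℝ) ≤ _).trans_lt (hNκ k))
    rw [← dual_vc, h, vc_scalarLoop, ha.coeff_tsum, haN, map_smul, map_smul, smul_eq_mul]
    exact inv_mul_cancel₀ hne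
  obtain ⟨k, hk⟩ := pow_unbounded_of_one_lt C (by norm_num : (1 : ℝ) < 2)
  have h1 := hC (N k)
  beta_reduce at h1
  rw [hval, norm_one, inv_pow, ← div_eq_mul_inv, le_div_iff₀ (by positivity), one_mul] at h1
  have h2 : (2 : ℝ) ^ k ≤ 2 ^ (N k).natAbs := pow_le_pow_right₀ (by norm_num) (hN k)
  linarith

theorem ExpGrowth.exists_uniform {κ : Type*} [Finite κ] {a : κ → ℤ → ℂ} (h : ∀ k, ExpGrowth (a k)) :
    ∃ C R : ℝ, 0 ≤ C ∧ 1 ≤ R ∧ ∀ k n, ‖a k n‖ ≤ C * R ^ n.natAbs := by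
  have := Fintype.ofFinite κ
  choose C R hC hR hb using h
  have hR1 : 1 ≤ 1 + ∑ k, (R k - 1) := by
    have := Finset.sum_nonneg fun k (_ : k ∈ Finset.univ) => sub_nonneg.mpr (hR k)
    linarith
  refine ⟨∑ k, C k, 1 + ∑ k, (R k - 1), Finset.sum_nonneg fun k _ => hC k, hR1, fun k n => ?_⟩
  refine (hb k n).trans ?_
  have h1 : C k ≤ ∑ k, C k := Finset.single_le_sum (fun k _ => hC k) (Finset.mem_univ k)
  have h2 : R k - 1 ≤ ∑ k, (R k - 1) :=
    Finset.single_le_sum (f := fun k => R k - 1) (fun k _ => sub_nonneg.mpr (hR k)) (Finset.mem_univ k)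
  have h6 : 0 ≤ ∑ k, C k := (hC k).trans h1
  have h3 : 0 ≤ C k := hC k
  have h4 : 1 ≤ R k := hR k
  have h5 : R k ≤ 1 + ∑ k, (R k - 1) := by linarith
  gcongr

end Vector

end LoopReduction

namespace LoopReduction

/-! ### Holomorphic families of loops and continuity of multipliers -/

section Families

variable {Q : Type*} [NormedAddCommGroup Q] [NormedSpace ℂ Q]

/-- Holomorphic functions of a parameter in `Ω` and of a loop variable in `ℂˣ`. -/
abbrev HolF (Ω : Set Q) (g : Q → ℂˣ → ℂ) : Prop :=
  Hol (fun i : Ω × ℂˣ => ((i.1 : Q), (i.2 : ℂ))) (Ω ×ˢ {0}ᶜ) fun i => g i.1 i.2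

theorem holF_iff {Ω : Set Q} {g : Q → ℂˣ → ℂ} : HolF Ω g ↔ ∃ F : Q × ℂ → ℂ,
    DifferentiableOn ℂ F (Ω ×ˢ {0}ᶜ) ∧ ∀ x ∈ Ω, ∀ z : ℂˣ, F (x, z) = g x z :=
  ⟨fun ⟨F, hF, h⟩ => ⟨F, hF, fun x hx z => h (⟨x, hx⟩, z)⟩,
    fun ⟨F, hF, h⟩ => ⟨F, hF, fun i => h i.1 i.1.2 i.2⟩⟩

theorem HolF.congr' {Ω : Set Q} {g h : Q → ℂˣ → ℂ} (hg : HolF Ω g)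
    (H : ∀ x ∈ Ω, ∀ z, g x z = h x z) : HolF Ω h := Hol.congr hg fun i => H i.1 i.1.2 i.2

theorem HolF.holU {Ω : Set Q} {g : Q → ℂˣ → ℂ} (hg : HolF Ω g) {x : Q} (hx : x ∈ Ω) :
    HolU (g x) := by
  obtain ⟨F, hF, h⟩ := holF_iff.mp hg
  exact ⟨fun z => F (x, z), hF.comp (by fun_prop) fun z hz => ⟨hx, hz⟩, fun z => h x hx z⟩

theorem HolF.of_holU {Ω : Set Q} {g : ℂˣ → ℂ} (hg : HolU g) : HolF Ω fun _ => g := by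
  obtain ⟨F, hF, h⟩ := hg
  exact holF_iff.mpr ⟨fun q => F q.2, hF.comp (by fun_prop) fun q hq => hq.2, fun x _ z => h z⟩

theorem HolF.of_differentiableOn {Ω : Set Q} {f : Q → ℂ} (hf : DifferentiableOn ℂ f Ω) :
    HolF Ω fun x _ => f x :=
  holF_iff.mpr ⟨fun q => f q.1, hf.comp (by fun_prop) fun q hq => hq.1, fun x _ z => rfl⟩

theorem HolF.comp_mul {Ω : Set Q} {g : Q → ℂˣ → ℂ} (hg : HolF Ω g) (q : ℂˣ) :
    HolF Ω fun x z => g x (q * z) := by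
  obtain ⟨F, hF, h⟩ := holF_iff.mp hg
  exact holF_iff.mpr ⟨fun w => F (w.1, q * w.2), hF.comp (by fun_prop) fun w hw =>
    ⟨hw.1, by simpa using hw.2⟩, fun x hx z => by simpa using h x hx (q * z)⟩

variable [FiniteDimensional ℂ Q]

theorem HolF.differentiableOn_coeff {Ω : Set Q} (hΩ : IsOpen Ω) {g : Q → ℂˣ → ℂ} (hg : HolF Ω g)
    (n : ℤ) : DifferentiableOn ℂ (fun x => coeff n (g x)) Ω := by
  obtain ⟨F, hF, h⟩ := holF_iff.mp hg
  have h1 : DifferentiableOn ℂ (fun x => ∫ t in (0 : ℝ)..(2 * Real.pi),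
      Complex.exp (-(n * t * Complex.I)) * F (x, Complex.exp (t * Complex.I))) Ω := by
    refine SeveralVariables.differentiableOn_intervalIntegral (F := fun x t =>
      Complex.exp (-(n * t * Complex.I)) * F (x, Complex.exp (t * Complex.I))) hΩ ?_ ?_ _ _
    · refine ContinuousOn.mul (by fun_prop) ?_
      exact hF.continuousOn.comp (f := fun q : Q × ℝ => (q.1, Complex.exp (q.2 * Complex.I)))
        (by fun_prop) fun q hq => ⟨hq.1, Complex.exp_ne_zero _⟩
    · intro t
      exact (hF.comp (f := fun x => (x, Complex.exp (t * Complex.I))) (by fun_prop)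
        fun x hx => ⟨hx, Complex.exp_ne_zero _⟩).const_mul _
  refine (h1.const_mul (2 * (Real.pi : ℂ))⁻¹).congr fun x hx => ?_
  simp only [coeff]
  congr 1
  refine intervalIntegral.integral_congr fun t _ => ?_
  rw [← h x hx, coe_toUnits_exp]

theorem HolF.exists_bound {Ω : Set Q} (hΩ : IsOpen Ω) {g : Q → ℂˣ → ℂ} (hg : HolF Ω g) {x : Q}
    (hx : x ∈ Ω) {r : ℝ} (hr : 1 ≤ r) : ∃ V ∈ 𝓝 x, V ⊆ Ω ∧ ∃ C, ∀ y ∈ V, ∀ z : ℂˣ,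
      ‖(z : ℂ)‖ = r ∨ ‖(z : ℂ)‖ = r⁻¹ → ‖g y z‖ ≤ C := by
  have : ProperSpace Q := FiniteDimensional.proper ℂ Q
  obtain ⟨F, hF, h⟩ := holF_iff.mp hg
  obtain ⟨R, hR, hRΩ⟩ := Metric.nhds_basis_closedBall.mem_iff.mp (hΩ.mem_nhds hx)
  have hr0 : 0 < r := by linarith
  obtain ⟨C, hC⟩ := ((isCompact_closedBall x R).prod
    ((isCompact_sphere (0 : ℂ) r).union (isCompact_sphere (0 : ℂ) r⁻¹))).exists_bound_of_continuousOn
    (f := F) (hF.continuousOn.mono (prod_mono hRΩ (by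
      rintro z (hz | hz) rfl
      · simp at hz; linarith
      · simp at hz; linarith)))
  refine ⟨closedBall x R, closedBall_mem_nhds x hR, hRΩ, C, fun y hy z hz => ?_⟩
  rw [← h y (hRΩ hy)]
  exact hC (y, z) ⟨hy, by simpa using hz⟩

/-- Multiplication of Laurent coefficients by a sequence preserves holomorphic families. -/
theorem HolF.multiplier {Ω : Set Q} (hΩ : IsOpen Ω) {g : Q → ℂˣ → ℂ} (hg : HolF Ω g) {κ : ℤ → ℂ}
    (hκ : ExpGrowth κ) : HolF Ω fun x z => ∑' n, κ n * coeff n (g x) * (z : ℂ) ^ n := by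
  obtain ⟨C, R, hC, hR, hκ⟩ := hκ
  refine holF_iff.mpr ⟨fun q => ∑' n, κ n * coeff n (g q.1) * q.2 ^ n, ?_, fun x _ z => rfl⟩
  refine SeveralVariables.differentiableOn_tsum (hΩ.prod isOpen_compl_singleton) (fun n => ?_) ?_
  · have h1 : DifferentiableOn ℂ (fun q : Q × ℂ => coeff n (g q.1)) (Ω ×ˢ {0}ᶜ) :=
      (hg.differentiableOn_coeff hΩ n).comp (by fun_prop) fun q hq => hq.1
    have h2 : DifferentiableOn ℂ (fun q : Q × ℂ => q.2 ^ n) (Ω ×ˢ {0}ᶜ) := fun q hq =>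
      (((differentiableAt_zpow (m := n)).mpr (Or.inl hq.2)).comp q
        differentiableAt_snd).differentiableWithinAt
    exact (h1.const_mul _).mul h2
  · rintro ⟨x, w⟩ ⟨hx, hw⟩
    have hw' : 0 < ‖w‖ := norm_pos_iff.mpr hw
    set s := max 1 (max (2 * ‖w‖) (‖w‖ / 2)⁻¹) with hs
    have hs1 : 1 ≤ s := le_max_left _ _
    have hρ : 1 ≤ 2 * R * s := by nlinarith
    obtain ⟨V, hV, hVΩ, C', hC'⟩ := hg.exists_bound hΩ hx hρ
    have hW : {v : ℂ | ‖w‖ / 2 < ‖v‖ ∧ ‖v‖ < 2 * ‖w‖} ∈ 𝓝 w :=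
      ((isOpen_lt continuous_const continuous_norm).inter
        (isOpen_lt continuous_norm continuous_const)).mem_nhds
        ⟨half_lt_self hw', by change ‖w‖ < 2 * ‖w‖; linarith⟩
    refine ⟨V ×ˢ {v : ℂ | ‖w‖ / 2 < ‖v‖ ∧ ‖v‖ < 2 * ‖w‖}, prod_mem_nhds hV hW,
      fun n => C * C' * (2⁻¹ : ℝ) ^ n.natAbs,
      (summable_pow_natAbs (by norm_num) (by norm_num)).mul_left _, ?_⟩
    rintro n ⟨y, v⟩ ⟨hy, hv1, hv2⟩
    have hv0 : 0 < ‖v‖ := (by positivity : 0 ≤ ‖w‖ / 2).trans_lt hv1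
    have h1 : ‖v ^ n‖ ≤ s ^ n.natAbs := by
      refine norm_zpow_le (norm_pos_iff.mp hv0) ?_ ?_ n
      · exact hv2.le.trans ((le_max_left _ _).trans (le_max_right _ _))
      · exact (inv_anti₀ (by positivity) hv1.le).trans ((le_max_right _ _).trans (le_max_right _ _))
    have h2 := norm_coeff_le_of_bound (hg.holU (hVΩ hy)) hρ (hC' y hy) n
    rw [norm_mul, norm_mul]
    have h3 := hκ n
    have h4 := mul_nonneg ((norm_nonneg _).trans h3) ((norm_nonneg _).trans h2)
    calc ‖κ n‖ * ‖coeff n (g y)‖ * ‖v ^ n‖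
        ≤ (C * R ^ n.natAbs) * (C' * ((2 * R * s)⁻¹) ^ n.natAbs) * s ^ n.natAbs := by gcongr
      _ = C * C' * (2⁻¹ : ℝ) ^ n.natAbs := by
        have hR0 : R ≠ 0 := by linarith
        have hs0 : s ≠ 0 := by linarith
        rw [mul_inv, mul_inv, mul_pow, mul_pow, inv_pow R, inv_pow s]
        field_simp

variable {E : Type*} [AddCommGroup E] [Module ℂ E] [TopologicalSpace E] [IsTopologicalAddGroup E]
  [ContinuousSMul ℂ E]

omit [FiniteDimensional ℂ Q] in
theorem isHolFamily_iff {Ω : Set Q} {c : Q → Loop E} :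
    IsHolFamily Ω c ↔ ∀ ℓ : Module.Dual ℂ E, HolF Ω fun x z => ℓ (ev (c x) z) :=
  forall_congr' fun _ => holF_iff.symm

variable [FiniteDimensional ℂ E]

theorem IsMult.hasSum {T : Module.End ℂ (Loop E)} {τ : ℤ → Module.End ℂ E} (h : IsMult T τ)
    (ℓ : Module.Dual ℂ E) (X : Loop E) (z : ℂˣ) :
    ℓ (ev (T X) z) = ∑ i, ∑' n, ℓ (τ n (Module.finBasis ℂ E i)) *
      coeff n (fun z => (Module.finBasis ℂ E).coord i (ev X z)) * (z : ℂ) ^ n := by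
  have h1 := ((ev_holU (T X) ℓ).hasSum z).tsum_eq
  rw [← h1, ← Summable.tsum_finsetSum fun i _ =>
    ((ev_holU X ((Module.finBasis ℂ E).coord i)).rapid.mul (h.expGrowth ℓ _)).summable z]
  refine tsum_congr fun n => ?_
  rw [← Finset.sum_mul, ← dual_vc, h]
  congr 1
  simp only [← dual_vc]
  exact dual_eq_sum (ℓ ∘ₗ τ n) _

theorem IsMult.isHolFamily {T : Module.End ℂ (Loop E)} {τ : ℤ → Module.End ℂ E} (h : IsMult T τ)
    {Ω : Set Q} (hΩ : IsOpen Ω) {c : Q → Loop E} (hc : IsHolFamily Ω c) :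
    IsHolFamily Ω fun x => T (c x) := by
  rw [isHolFamily_iff] at hc ⊢
  intro ℓ
  have := Hol.sum Finset.univ fun i (_ : i ∈ Finset.univ) =>
    (hc ((Module.finBasis ℂ E).coord i)).multiplier hΩ (h.expGrowth ℓ (Module.finBasis ℂ E i))
  exact this.congr fun i => (h.hasSum ℓ _ _).symm

theorem IsMult.exists_norm_le {T : Module.End ℂ (Loop E)} {τ : ℤ → Module.End ℂ E} (h : IsMult T τ)
    (ℓ : Module.Dual ℂ E) {s : ℝ} (hs : 1 ≤ s) : ∃ ρ C : ℝ, 1 ≤ ρ ∧ 0 ≤ C ∧ ∀ (X : Loop E) (δ : ℝ),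
      (∀ i, ∀ z : ℂˣ, ‖(z : ℂ)‖ = ρ ∨ ‖(z : ℂ)‖ = ρ⁻¹ →
        ‖(Module.finBasis ℂ E).coord i (ev X z)‖ ≤ δ) →
      ∀ z : ℂˣ, ‖(z : ℂ)‖ ≤ s → ‖(z : ℂ)‖⁻¹ ≤ s → ‖ℓ (ev (T X) z)‖ ≤ C * δ := by
  obtain ⟨C, R, hC, hR, hκ⟩ := ExpGrowth.exists_uniform fun i =>
    h.expGrowth ℓ (Module.finBasis ℂ E i)
  have hρ : 1 ≤ 2 * R * s := by nlinarith
  have hsum := summable_pow_natAbs (s := 2⁻¹) (by norm_num) (by norm_num)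
  refine ⟨2 * R * s, ∑ _i : Fin (Module.finrank ℂ E), C * ∑' n : ℤ, (2⁻¹ : ℝ) ^ n.natAbs, hρ,
    Finset.sum_nonneg fun _ _ => mul_nonneg hC (tsum_nonneg fun _ => by positivity), ?_⟩
  intro X δ hX z hz1 hz2
  rw [h.hasSum, Finset.sum_mul]
  refine (norm_sum_le _ _).trans (Finset.sum_le_sum fun i _ => ?_)
  have hb : ∀ n : ℤ, ‖ℓ (τ n (Module.finBasis ℂ E i)) *
      coeff n (fun z => (Module.finBasis ℂ E).coord i (ev X z)) * (z : ℂ) ^ n‖ ≤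
      C * δ * (2⁻¹ : ℝ) ^ n.natAbs := by
    intro n
    rw [norm_mul, norm_mul]
    have h1 := norm_zpow_le z.ne_zero hz1 hz2 n
    have h2 := norm_coeff_le_of_bound (ev_holU X ((Module.finBasis ℂ E).coord i)) hρ (hX i) n
    have h3 := hκ i n
    have h4 := mul_nonneg ((norm_nonneg _).trans h3) ((norm_nonneg _).trans h2)
    calc ‖ℓ (τ n (Module.finBasis ℂ E i))‖ *
          ‖coeff n (fun z => (Module.finBasis ℂ E).coord i (ev X z))‖ * ‖(z : ℂ) ^ n‖
        ≤ (C * R ^ n.natAbs) * (δ * ((2 * R * s)⁻¹) ^ n.natAbs) * s ^ n.natAbs := by gcongr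
      _ = C * δ * (2⁻¹ : ℝ) ^ n.natAbs := by
        have hR0 : R ≠ 0 := by linarith
        have hs0 : s ≠ 0 := by linarith
        rw [mul_inv, mul_inv, mul_pow, mul_pow, inv_pow R, inv_pow s]
        field_simp
  refine (tsum_of_norm_bounded ((hsum.hasSum).mul_left (C * δ)) hb).trans_eq ?_
  ring

end Families

section Topology

variable {E : Type*} [AddCommGroup E] [Module ℂ E] [TopologicalSpace E] [IsTopologicalAddGroup E]
  [ContinuousSMul ℂ E]

/-- The continuous function `z ↦ φ (X z)`. -/
def Loop.compC {E' : Type*} [TopologicalSpace E'] (φ : C(E, E')) (X : Loop E) : C(ℂˣ, E') :=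
  φ.comp (Subtype.val X : C(ℂˣ, E))

theorem Loop.continuous_compC {E' : Type*} [TopologicalSpace E'] (φ : C(E, E')) :
    Continuous (Loop.compC φ) :=
  (ContinuousMap.continuous_postcomp φ).comp continuous_subtype_val

variable [FiniteDimensional ℂ E]

theorem continuous_to_loop {A : Type*} [TopologicalSpace A] {f : A → Loop E}
    (h : ∀ i, Continuous fun a => (⟨fun z => (Module.finBasis ℂ E).coord i (ev (f a) z),
      (ev_holU (f a) _).continuous⟩ : C(ℂˣ, ℂ))) : Continuous f := by
  refine Continuous.subtype_mk (p := fun f => f ∈ loopSubmodule E)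
    (f := fun a => ((f a).1 : C(ℂˣ, E))) ?_ (fun a => (f a).2)
  let S : Fin (Module.finrank ℂ E) → C(ℂ, E) := fun i =>
    ⟨fun a => a • Module.finBasis ℂ E i, by fun_prop⟩
  have h1 : (fun a => ((f a).1 : C(ℂˣ, E))) = fun a => ∑ i, (S i).comp
      ⟨fun z => (Module.finBasis ℂ E).coord i (ev (f a) z), (ev_holU (f a) _).continuous⟩ := by
    ext a z
    rw [ContinuousMap.sum_apply]
    exact (sum_coord (ev (f a) z)).symm
  rw [h1]
  exact continuous_finsetSum _ fun i _ => (ContinuousMap.continuous_postcomp (S i)).comp (h i)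

theorem isCompact_circles (ρ : ℝ) (hρ : 0 < ρ) : IsCompact {z : ℂˣ | ‖(z : ℂ)‖ = ρ} := by
  have hρ' : (ρ : ℂ) ≠ 0 := by exact_mod_cast hρ.ne'
  have hcont : Continuous fun t : ℝ => Units.mk0 (ρ : ℂ) hρ' * Circle.toUnits (Circle.exp t) :=
    continuous_const.mul continuous_toUnits_exp
  have himg : {z : ℂˣ | ‖(z : ℂ)‖ = ρ} = (fun t : ℝ => Units.mk0 (ρ : ℂ) hρ' *
      Circle.toUnits (Circle.exp t)) '' Icc (-Real.pi) Real.pi := by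
    ext z
    constructor
    · intro hz
      refine ⟨Complex.arg z, ⟨(Complex.neg_pi_lt_arg _).le, Complex.arg_le_pi _⟩, Units.ext ?_⟩
      simp only
      rw [Units.val_mul, coe_toUnits_exp, Units.val_mk0, ← show ‖(z : ℂ)‖ = ρ from hz,
        Complex.norm_mul_exp_arg_mul_I]
    · rintro ⟨t, -, rfl⟩
      simp [abs_of_pos hρ]
  rw [himg]
  exact isCompact_Icc.image hcont

variable [T2Space E]

theorem IsMult.continuous {T : Module.End ℂ (Loop E)} {τ : ℤ → Module.End ℂ E} (h : IsMult T τ) :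
    Continuous T := by
  refine continuous_to_loop fun i => continuous_iff_continuousAt.mpr fun X₀ => ?_
  refine ContinuousMap.tendsto_iff_forall_isCompact_tendstoUniformlyOn.mpr fun K hK => ?_
  obtain ⟨a, ha⟩ := hK.exists_bound_of_continuousOn (f := fun z : ℂˣ => (z : ℂ))
    Units.continuous_val.continuousOn
  obtain ⟨b, hb⟩ := hK.exists_bound_of_continuousOn (f := fun z : ℂˣ => ((z⁻¹ : ℂˣ) : ℂ))
    (Units.continuous_val.comp continuous_inv).continuousOn
  obtain ⟨ρ, C, hρ, hC, hle⟩ := h.exists_norm_le ((Module.finBasis ℂ E).coord i)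
    (le_max_left 1 (max a b))
  have hρ0 : 0 < ρ := by linarith
  have hcpt := (isCompact_circles ρ hρ0).union (isCompact_circles ρ⁻¹ (by positivity))
  have hcoord : ∀ j, ∀ δ > 0, ∀ᶠ X in 𝓝 X₀, ∀ z : ℂˣ, ‖(z : ℂ)‖ = ρ ∨ ‖(z : ℂ)‖ = ρ⁻¹ →
      ‖(Module.finBasis ℂ E).coord j (ev X z) - (Module.finBasis ℂ E).coord j (ev X₀ z)‖ < δ := by
    intro j δ hδ
    have h1 := (Loop.continuous_compC (E := E) (⟨(Module.finBasis ℂ E).coord j,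
      LinearMap.continuous_of_finiteDimensional _⟩ : C(E, ℂ))).tendsto X₀
    have h2 := ContinuousMap.tendsto_iff_forall_isCompact_tendstoUniformlyOn.mp h1 _ hcpt
    filter_upwards [Metric.tendstoUniformlyOn_iff.mp h2 δ hδ] with X hX z hz
    have := hX z hz
    rw [dist_comm, dist_eq_norm] at this
    exact this
  rw [Metric.tendstoUniformlyOn_iff]
  intro ε hε
  have hδ : 0 < ε / (2 * (C + 1)) := by positivity
  filter_upwards [eventually_all.mpr fun j => hcoord j _ hδ] with X hX z hz
  have h3 := hle (X - X₀) (ε / (2 * (C + 1))) (fun j z hz => by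
      rw [ev_sub, map_sub]; exact (hX j z hz).le) z
    ((ha z hz).trans ((le_max_left _ _).trans (le_max_right _ _)))
    (by
      have := hb z hz
      simp only [Units.val_inv_eq_inv_val, norm_inv] at this
      exact this.trans ((le_max_right _ _).trans (le_max_right _ _)))
  rw [map_sub, ev_sub, map_sub] at h3
  rw [dist_comm, dist_eq_norm]
  refine h3.trans_lt ?_
  rw [mul_div_assoc', div_lt_iff₀ (by positivity)]
  nlinarith

omit [T2Space E] in
theorem IsHolFamily.continuousOn {Q : Type*} [NormedAddCommGroup Q] [NormedSpace ℂ Q] {Ω : Set Q}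
    {c : Q → Loop E} (hc : IsHolFamily Ω c) : ContinuousOn c Ω := by
  rw [continuousOn_iff_continuous_domRestrict]
  refine continuous_to_loop fun i => ?_
  obtain ⟨F, hF, h⟩ := hc ((Module.finBasis ℂ E).coord i)
  let G : C(Ω × ℂˣ, ℂ) := ⟨fun q => F (q.1, q.2), hF.continuousOn.comp_continuous
    ((continuous_subtype_val.comp continuous_fst).prodMk
      (Units.continuous_val.comp continuous_snd)) fun q => ⟨q.1.2, q.2.ne_zero⟩⟩
  refine G.curry.continuous.congr fun x => ?_
  ext z
  exact h x x.2 z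

end Topology

end LoopReduction

namespace LoopReduction

/-! ### The residue pairing and adjoint operators -/

section Pairing

variable {E : Type*} [AddCommGroup E] [Module ℂ E] [TopologicalSpace E] [IsTopologicalAddGroup E]
  [ContinuousSMul ℂ E] [FiniteDimensional ℂ E] (B : LinearMap.BilinForm ℂ E)

theorem bilin_eq_sum (x y : E) :
    B x y = ∑ i, (Module.finBasis ℂ E).coord i x * B (Module.finBasis ℂ E i) y := by
  conv_lhs => rw [← sum_coord x]
  simp only [map_sum, LinearMap.sum_apply, map_smul, LinearMap.smul_apply, smul_eq_mul]

theorem holU_bilin (X Y : Loop E) : HolU fun z => B (ev X z) (ev Y z) :=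
  (Hol.sum Finset.univ fun i _ => (ev_holU X ((Module.finBasis ℂ E).coord i)).mul
    (ev_holU Y (B (Module.finBasis ℂ E i)))).congr fun _ => (bilin_eq_sum B _ _).symm

/-- The residue pairing as a bilinear form on loops. -/
def pairL : LinearMap.BilinForm ℂ (Loop E) :=
  LinearMap.mk₂ ℂ (pair B)
    (fun X X' Y => by
      simp only [pair, ev_add, map_add, LinearMap.add_apply]
      exact coeff_add (holU_bilin B X Y) (holU_bilin B X' Y) 0)
    (fun a X Y => by
      simp only [pair, ev_smul, map_smul, LinearMap.smul_apply, smul_eq_mul, coeff_const_mul])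
    (fun X Y Y' => by
      simp only [pair, ev_add, map_add]
      exact coeff_add (holU_bilin B X Y) (holU_bilin B X Y') 0)
    (fun a X Y => by simp only [pair, ev_smul, map_smul, smul_eq_mul, coeff_const_mul])

theorem pair_add_left (X X' Y : Loop E) : pair B (X + X') Y = pair B X Y + pair B X' Y :=
  LinearMap.map_add₂ (pairL B) X X' Y

theorem pair_add_right (X Y Y' : Loop E) : pair B X (Y + Y') = pair B X Y + pair B X Y' :=
  map_add (pairL B X) Y Y'

theorem pair_sub_left (X X' Y : Loop E) : pair B (X - X') Y = pair B X Y - pair B X' Y :=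
  LinearMap.map_sub₂ (pairL B) X X' Y

theorem pair_sub_right (X Y Y' : Loop E) : pair B X (Y - Y') = pair B X Y - pair B X Y' :=
  map_sub (pairL B X) Y Y'

theorem pair_smul_left (a : ℂ) (X Y : Loop E) : pair B (a • X) Y = a * pair B X Y :=
  LinearMap.map_smul₂ (pairL B) a X Y

theorem pair_smul_right (a : ℂ) (X Y : Loop E) : pair B X (a • Y) = a * pair B X Y :=
  map_smul (pairL B X) a Y

theorem pair_neg_left (X Y : Loop E) : pair B (-X) Y = -pair B X Y :=
  LinearMap.map_neg₂ (pairL B) X Y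

theorem pair_neg_right (X Y : Loop E) : pair B X (-Y) = -pair B X Y :=
  map_neg (pairL B X) Y

theorem pair_zero_left (Y : Loop E) : pair B 0 Y = 0 := LinearMap.map_zero₂ (pairL B) Y

theorem pair_zero_right (X : Loop E) : pair B X 0 = 0 := map_zero (pairL B X)

theorem pair_congr {E' : Type*} [AddCommGroup E'] [Module ℂ E'] [TopologicalSpace E']
    [IsTopologicalAddGroup E'] [ContinuousSMul ℂ E'] {B' : LinearMap.BilinForm ℂ E'}
    {X Y : Loop E} {X' Y' : Loop E'}
    (h : ∀ z, B (ev X z) (ev Y z) = B' (ev X' z) (ev Y' z)) : pair B X Y = pair B' X' Y' := by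
  simp only [pair, h]

theorem pair_eq_zero {X Y : Loop E} (h : ∀ z, B (ev X z) (ev Y z) = 0) : pair B X Y = 0 := by
  simp only [pair, h, coeff_zero_fun]

theorem pair_symm {B : LinearMap.BilinForm ℂ E} (hB : B.IsSymm) (X Y : Loop E) :
    pair B X Y = pair B Y X :=
  pair_congr _ fun z => hB.eq (ev X z) (ev Y z)

theorem pair_shift (p : ℂˣ) (X Y : Loop E) : pair B (shift p X) (shift p Y) = pair B X Y := by
  have := coeff_comp_mul (holU_bilin B X Y) p 0
  simpa [pair] using this

theorem shift_inv_shift (p : ℂˣ) (X : Loop E) : shift p⁻¹ (shift p X) = X :=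
  loop_ext fun z => by simp

theorem shift_shift_inv (p : ℂˣ) (X : Loop E) : shift p (shift p⁻¹ X) = X :=
  loop_ext fun z => by simp

theorem pair_shift_left (p : ℂˣ) (X Y : Loop E) : pair B (shift p X) Y = pair B X (shift p⁻¹ Y) := by
  rw [← pair_shift B p X, shift_shift_inv]

theorem shift_mul_shift_inv (p : ℂˣ) : (shift p * shift p⁻¹ : Module.End ℂ (Loop E)) = 1 :=
  LinearMap.ext fun X => shift_shift_inv p X

theorem shift_inv_mul_shift (p : ℂˣ) : (shift p⁻¹ * shift p : Module.End ℂ (Loop E)) = 1 :=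
  LinearMap.ext fun X => shift_inv_shift p X

theorem pair_mono_left (n : ℤ) (e : E) (Y : Loop E) : pair B (mono n e) Y = B e (vc (-n) Y) := by
  rw [dual_vc]
  simp only [pair, ev_mono, map_smul, LinearMap.smul_apply, smul_eq_mul]
  rw [coeff_zpow_mul, zero_sub]

theorem pair_mono_right (n : ℤ) (e : E) (X : Loop E) : pair B X (mono n e) = B (vc (-n) X) e := by
  have := dual_vc (B.flip e) (-n) X
  have h2 : B (vc (-n) X) e = coeff (-n) fun z => B (ev X z) e := this
  rw [h2]
  simp only [pair, ev_mono, map_smul, smul_eq_mul]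
  rw [coeff_zpow_mul, zero_sub]

theorem hasSum_pair (X Y : Loop E) : HasSum (fun n => B (vc n X) (vc (-n) Y)) (pair B X Y) := by
  have h1 : pair B X Y = ∑ i, coeff 0 fun z => (Module.finBasis ℂ E).coord i (ev X z) *
      B (Module.finBasis ℂ E i) (ev Y z) := by
    rw [← coeff_sum _ fun i _ => (ev_holU X _).mul (ev_holU Y _), pair]
    congr 1; ext z
    exact bilin_eq_sum B _ _
  have h2 : ∀ n, B (vc n X) (vc (-n) Y) = ∑ i, coeff n (fun z => (Module.finBasis ℂ E).coord i
      (ev X z)) * coeff (-n) fun z => B (Module.finBasis ℂ E i) (ev Y z) := by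
    intro n
    rw [bilin_eq_sum]
    exact Finset.sum_congr rfl fun i _ => by rw [dual_vc, dual_vc]
  simp only [h1, h2]
  exact hasSum_sum fun i _ => hasSum_coeff_zero_mul (ev_holU X _) (ev_holU Y _)

variable {B}

theorem IsMult.pair_adjoint {T T' : Module.End ℂ (Loop E)} {τ τ' : ℤ → Module.End ℂ E}
    (h : IsMult T τ) (h' : IsMult T' τ') (H : ∀ n x y, B (τ n x) y = B x (τ' (-n) y))
    (X Y : Loop E) : pair B (T X) Y = pair B X (T' Y) := by
  have h1 := hasSum_pair B (T X) Y
  have h2 := hasSum_pair B X (T' Y)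
  simp only [h _, h' _, H] at h1 h2
  exact h1.unique h2

theorem eq_of_pair_left (hB : B.Nondegenerate) {Y Y' : Loop E}
    (h : ∀ X, pair B X Y = pair B X Y') : Y = Y' := by
  refine loop_ext_vc fun n => ?_
  rw [← sub_eq_zero]
  refine hB.2 _ fun e => ?_
  have := h (mono (-n) e)
  rw [pair_mono_left, pair_mono_left, neg_neg] at this
  rw [map_sub, this, sub_self]

/-- `T'` is adjoint to `T` with respect to the residue pairing. -/
def IsAdj (B : LinearMap.BilinForm ℂ E) (T T' : Module.End ℂ (Loop E)) : Prop :=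
  ∀ X Y, pair B (T X) Y = pair B X (T' Y)

namespace IsAdj

variable {T T' S S' : Module.End ℂ (Loop E)}

theorem add (h : IsAdj B T T') (h' : IsAdj B S S') : IsAdj B (T + S) (T' + S') := fun X Y => by
  simp [pair_add_left, pair_add_right, h X Y, h' X Y]

theorem sub (h : IsAdj B T T') (h' : IsAdj B S S') : IsAdj B (T - S) (T' - S') := fun X Y => by
  simp [pair_sub_left, pair_sub_right, h X Y, h' X Y]

theorem smul (a : ℂ) (h : IsAdj B T T') : IsAdj B (a • T) (a • T') := fun X Y => by
  simp [pair_smul_left, pair_smul_right, h X Y]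

theorem mul (h : IsAdj B T T') (h' : IsAdj B S S') : IsAdj B (T * S) (S' * T') := fun X Y => by
  rw [Module.End.mul_apply, Module.End.mul_apply, h, h']

theorem one : IsAdj B (1 : Module.End ℂ (Loop E)) 1 := fun _ _ => rfl

theorem shift (p : ℂˣ) : IsAdj B (shift p) (shift p⁻¹) := pair_shift_left B p

theorem symm (hB : B.IsSymm) (h : IsAdj B T T') : IsAdj B T' T := fun X Y => by
  rw [pair_symm hB, ← h, pair_symm hB]

theorem unique (hB : B.Nondegenerate) (h : IsAdj B T T') (h' : IsAdj B T S') : T' = S' :=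
  LinearMap.ext fun Y => eq_of_pair_left hB fun X => by rw [← h, ← h']

theorem commute (hB : B.Nondegenerate) (h : IsAdj B T T') (h' : IsAdj B S S') (hc : Commute T S) :
    Commute T' S' :=
  (h'.mul h).unique hB (by have := h.mul h'; rwa [hc.eq] at this)

/-- Adjoints of mutually inverse operators are mutually inverse. -/
theorem inv (hB : B.Nondegenerate) (h : IsAdj B T T') (h' : IsAdj B S S') (hTS : T * S = 1) :
    S' * T' = 1 :=
  (h.mul h').unique hB (by rw [hTS]; exact one)

end IsAdj

theorem zpow_injective_of_norm_lt_one {p : ℂˣ} (hp : ‖(p : ℂ)‖ < 1) {m n : ℤ}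
    (h : (p : ℂ) ^ m = (p : ℂ) ^ n) : m = n := by
  have h1 := congrArg norm h
  rw [norm_zpow, norm_zpow] at h1
  exact zpow_right_injective₀ (norm_pos_iff.mpr p.ne_zero) hp.ne h1

theorem shift_mono (p : ℂˣ) (n : ℤ) (e : E) : shift p (mono n e) = (p : ℂ) ^ n • mono n e :=
  loop_ext fun z => by simp [mul_zpow, mul_smul]

/-- An operator commuting with `D_p` preserves the Laurent monomials of each degree. -/
theorem apply_mono_of_commute_shift {p : ℂˣ} (hp : ‖(p : ℂ)‖ < 1) {T : Module.End ℂ (Loop E)}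
    (hT : Commute T (shift p)) (n : ℤ) (e : E) : T (mono n e) = mono n (vc n (T (mono n e))) := by
  refine loop_ext_vc fun m => ?_
  rw [vc_mono]
  split_ifs with hmn
  · rw [hmn]
  · have h1 : shift p (T (mono n e)) = (p : ℂ) ^ n • T (mono n e) := by
      rw [← map_smul, ← shift_mono]
      exact (LinearMap.congr_fun hT.eq (mono n e)).symm
    have h2 := congrArg (vc m) h1
    rw [vc_shift, map_smul, ← sub_eq_zero, ← sub_smul, smul_eq_zero] at h2
    rcases h2 with h2 | h2
    · exact absurd (zpow_injective_of_norm_lt_one hp (sub_eq_zero.mp h2)) hmn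
    · exact h2

/-- An operator which commutes with `D_p` and has an adjoint is a multiplier. -/
theorem exists_isMult_of_isAdj (hB : B.Nondegenerate) {p : ℂˣ} (hp : ‖(p : ℂ)‖ < 1)
    {T T' : Module.End ℂ (Loop E)} (h : IsAdj B T T') (hT : Commute T (shift p)) :
    ∃ τ, IsMult T τ := by
  have hT'i : Commute T' (shift p⁻¹) := h.commute hB (IsAdj.shift p) hT
  have hT' : Commute T' (shift p) := by
    have h1 : T' * shift p⁻¹ = shift p⁻¹ * T' := hT'i.eq
    calc T' * shift p = (shift p * shift p⁻¹) * (T' * shift p) := by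
          rw [shift_mul_shift_inv, one_mul]
      _ = shift p * (T' * shift p⁻¹) * shift p := by rw [h1]; simp only [mul_assoc]
      _ = shift p * T' := by
        rw [mul_assoc, mul_assoc, shift_inv_mul_shift, mul_one]
  refine ⟨fun n => { toFun := fun e => vc n (T (mono n e))
                     map_add' := fun e e' => ?_
                     map_smul' := fun a e => ?_ }, fun n X => ?_⟩
  · rw [← map_add, ← map_add]
    congr 2
    exact loop_ext fun z => by simp
  · rw [RingHom.id_apply, ← map_smul, ← map_smul]
    congr 2
    exact loop_ext fun z => smul_comm ((z : ℂ) ^ n) a e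
  · rw [← sub_eq_zero]
    refine hB.1 _ fun e => ?_
    have h1 : B (vc n (T X)) e = pair B X (T' (mono (-n) e)) := by
      rw [← h, pair_mono_right, neg_neg]
    have h2 : B (vc n (T (mono n (vc n X)))) e = pair B (mono n (vc n X)) (T' (mono (-n) e)) := by
      rw [← h, pair_mono_right, neg_neg]
    rw [apply_mono_of_commute_shift hp hT'] at h1 h2
    rw [pair_mono_right, neg_neg] at h1 h2
    rw [vc_mono, if_pos rfl] at h2
    rw [map_sub, LinearMap.sub_apply]
    exact sub_eq_zero.mpr (h1.trans h2.symm)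

variable (E)

theorem isModeProj_modeProj (S : Set ℤ) : IsModeProj S (modeProj E S) := by
  classical
  have h : ∃ P, IsModeProj (E := E) S P := by
    obtain ⟨T, hT⟩ := exists_isMult (E := E) (fun n => if n ∈ S then 1 else 0) fun ℓ e => by
      refine ⟨‖ℓ e‖, 1, norm_nonneg _, le_rfl, fun n => ?_⟩
      beta_reduce
      split_ifs <;> simp
    refine ⟨T, fun X ℓ n => ⟨fun hn => ?_, fun hn => ?_⟩⟩
    · rw [← dual_vc, ← dual_vc, hT]; beta_reduce; rw [if_pos hn, Module.End.one_apply]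
    · rw [← dual_vc, hT]; beta_reduce; rw [if_neg hn, LinearMap.zero_apply, map_zero]
  rw [modeProj, dif_pos h]
  exact h.choose_spec

open Classical in
theorem isMult_modeProj (S : Set ℤ) :
    IsMult (modeProj E S) fun n => if n ∈ S then 1 else 0 := by
  intro n X
  refine dual_ext fun ℓ => ?_
  rw [dual_vc]
  beta_reduce
  split_ifs with hn
  · rw [(isModeProj_modeProj E S X ℓ n).1 hn, ← dual_vc, Module.End.one_apply]
  · rw [(isModeProj_modeProj E S X ℓ n).2 hn, LinearMap.zero_apply, map_zero]

variable {E}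

theorem norm_one_sub_zpow_ge {p : ℂ} (hp0 : p ≠ 0) (hp : ‖p‖ < 1) {n : ℤ} (hn : n ≠ 0) :
    1 - ‖p‖ ≤ ‖1 - p ^ n‖ := by
  have hp' : 0 < ‖p‖ := norm_pos_iff.mpr hp0
  rcases lt_or_gt_of_ne hn with h | h
  · have h1 : ‖p‖⁻¹ ≤ ‖p ^ n‖ := by
      rw [norm_zpow, ← zpow_neg_one]
      exact zpow_right_anti₀ hp' hp.le (by omega)
    have h2 : ‖p ^ n‖ - ‖(1 : ℂ)‖ ≤ ‖1 - p ^ n‖ := by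
      rw [norm_sub_rev]; exact norm_sub_norm_le _ _
    have h3 : 1 ≤ ‖p‖⁻¹ := one_le_inv_iff₀.mpr ⟨hp', hp.le⟩
    have h4 : ‖p‖ * ‖p‖⁻¹ = 1 := mul_inv_cancel₀ hp'.ne'
    rw [norm_one] at h2
    nlinarith
  · have h1 : ‖p ^ n‖ ≤ ‖p‖ := by
      rw [norm_zpow]
      calc ‖p‖ ^ n ≤ ‖p‖ ^ (1 : ℤ) := zpow_right_anti₀ hp' hp.le (by omega)
        _ = ‖p‖ := zpow_one _
    have h2 : ‖(1 : ℂ)‖ - ‖p ^ n‖ ≤ ‖1 - p ^ n‖ := norm_sub_norm_le _ _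
    rw [norm_one] at h2
    linarith

theorem isUnit_one_sub_map_mul_shift [T2Space E] {p : ℂˣ} (hp : ‖(p : ℂ)‖ < 1)
    {s : Module.End ℂ E} {m : ℕ} (hm : 0 < m) (hs : s ^ m = 1) (hs1 : IsUnit (1 - s)) :
    IsUnit (1 - Loop.map s * shift p : Module.End ℂ (Loop E)) := by
  have hp0 : (p : ℂ) ≠ 0 := p.ne_zero
  have hpn : 0 < ‖(p : ℂ)‖ := norm_pos_iff.mpr hp0
  have hmz : (m : ℤ) ≠ 0 := by exact_mod_cast hm.ne'
  have hne : ∀ n : ℤ, n ≠ 0 → 1 - (p : ℂ) ^ (n * m) ≠ 0 := fun n hn =>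
    norm_pos_iff.mp ((sub_pos.mpr hp).trans_le
      (norm_one_sub_zpow_ge hp0 hp (mul_ne_zero hn hmz)))
  have hτ : IsMult (1 - Loop.map s * shift p) fun n => 1 - s * ((p : ℂ) ^ n • 1) :=
    IsMult.one.sub ((IsMult.map s).mul (IsMult.shift p))
  let σ : ℤ → Module.End ℂ E := fun n => if n = 0 then Ring.inverse (1 - s) else
    (1 - (p : ℂ) ^ (n * m))⁻¹ • ∑ j ∈ Finset.range m, ((p : ℂ) ^ n • s) ^ j
  have hgeom : ∀ n : ℤ, n ≠ 0 → (1 - (p : ℂ) ^ n • s) * σ n = 1 ∧ σ n * (1 - (p : ℂ) ^ n • s) = 1 := by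
    intro n hn
    have h1 := mul_neg_geom_sum ((p : ℂ) ^ n • s) m
    have h1' := geom_sum_mul_neg ((p : ℂ) ^ n • s) m
    have h2 : 1 - ((p : ℂ) ^ n • s) ^ m = (1 - (p : ℂ) ^ (n * m)) • (1 : Module.End ℂ E) := by
      rw [smul_pow, hs, sub_smul, one_smul, zpow_mul, zpow_natCast]
    simp only [σ, if_neg hn, mul_smul_comm, smul_mul_assoc]
    rw [h1, h1', h2, smul_smul, inv_mul_cancel₀ (hne n hn), one_smul]
    exact ⟨rfl, rfl⟩
  have hinv : ∀ n, (1 - s * ((p : ℂ) ^ n • 1)) * σ n = 1 ∧ σ n * (1 - s * ((p : ℂ) ^ n • 1)) = 1 := by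
    intro n
    rw [mul_smul_comm, mul_one]
    by_cases hn : n = 0
    · subst hn
      simp only [σ, if_pos, zpow_zero, one_smul]
      exact ⟨Ring.mul_inverse_cancel _ hs1, Ring.inverse_mul_cancel _ hs1⟩
    · exact hgeom n hn
  obtain ⟨T, hT⟩ := exists_isMult σ fun ℓ e => by
    have hR : 1 ≤ ‖(p : ℂ)‖⁻¹ := one_le_inv_iff₀.mpr ⟨hpn, hp.le⟩
    refine ⟨‖ℓ (σ 0 e)‖ + (1 - ‖(p : ℂ)‖)⁻¹ * ∑ j ∈ Finset.range m, ‖ℓ ((s ^ j) e)‖,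
      (‖(p : ℂ)‖⁻¹) ^ m, ?_, one_le_pow₀ hR, fun n => ?_⟩
    · have : 0 ≤ (1 - ‖(p : ℂ)‖)⁻¹ := inv_nonneg.mpr (sub_nonneg.mpr hp.le)
      have := Finset.sum_nonneg fun j (_ : j ∈ Finset.range m) => norm_nonneg (ℓ ((s ^ j) e))
      positivity
    · have h0 : 0 ≤ (1 - ‖(p : ℂ)‖)⁻¹ := inv_nonneg.mpr (sub_nonneg.mpr hp.le)
      have hS : 0 ≤ ∑ j ∈ Finset.range m, ‖ℓ ((s ^ j) e)‖ :=
        Finset.sum_nonneg fun j _ => norm_nonneg _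
      have hRn : 1 ≤ ((‖(p : ℂ)‖⁻¹) ^ m) ^ n.natAbs := one_le_pow₀ (one_le_pow₀ hR)
      by_cases hn : n = 0
      · subst hn
        simp only [Int.natAbs_zero, pow_zero, mul_one]
        have := mul_nonneg h0 hS
        linarith
      · have h1 : ‖ℓ (σ n e)‖ ≤ (1 - ‖(p : ℂ)‖)⁻¹ *
            ((∑ j ∈ Finset.range m, ‖ℓ ((s ^ j) e)‖) * ((‖(p : ℂ)‖⁻¹) ^ m) ^ n.natAbs) := by
          simp only [σ, if_neg hn, LinearMap.smul_apply, map_smul, norm_smul, norm_inv,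
            LinearMap.sum_apply, map_sum, smul_pow]
          refine mul_le_mul ?_ ?_ (norm_nonneg _) h0
          · exact inv_anti₀ (sub_pos.mpr hp) (norm_one_sub_zpow_ge hp0 hp (mul_ne_zero hn hmz))
          · rw [Finset.sum_mul]
            refine (norm_sum_le _ _).trans (Finset.sum_le_sum fun j hj => ?_)
            rw [norm_smul, mul_comm]
            refine mul_le_mul_of_nonneg_left ?_ (norm_nonneg _)
            rw [norm_pow, ← pow_mul, mul_comm m, pow_mul]
            have h2 : ‖(p : ℂ) ^ n‖ ≤ (‖(p : ℂ)‖⁻¹) ^ n.natAbs :=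
              norm_zpow_le hp0 (hp.le.trans hR) le_rfl n
            refine (pow_le_pow_left₀ (norm_nonneg _) h2 j).trans
              (pow_le_pow_right₀ (one_le_pow₀ hR) (Finset.mem_range.mp hj).le)
        refine h1.trans ?_
        have := norm_nonneg (ℓ (σ 0 e))
        rw [← mul_assoc]
        gcongr
        linarith
  refine isUnit_iff_exists.mpr ⟨T, ?_, ?_⟩
  · exact (hτ.mul hT).eq IsMult.one fun n => (hinv n).1
  · exact (hT.mul hτ).eq IsMult.one fun n => (hinv n).2

end Pairing

end LoopReduction

namespace LoopReduction

/-! ### Root decomposition and invariant forms -/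

section RootDecomposition

open LieAlgebra LieAlgebra.IsKilling

variable {d : ℕ} {𝔤 : LieSubalgebra ℂ (Matrix (Fin d) (Fin d) ℂ)} [LieAlgebra.IsSemisimple ℂ 𝔤]
  {H : LieSubalgebra ℂ 𝔤} [H.IsCartanSubalgebra]
  (b : (LieAlgebra.IsKilling.rootSystem H).Base) (B : LinearMap.BilinForm ℂ 𝔤)

theorem lie_cartan_rootSpace {χ : H → ℂ} {x : 𝔤} (hx : x ∈ rootSpace H χ) (h : H) :
    ⁅(h : 𝔤), x⁆ = χ h • x := lie_eq_smul_of_mem_rootSpace hx h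

theorem lie_cartan_cartan (h k : H) : ⁅(h : 𝔤), (k : 𝔤)⁆ = 0 := by
  have : ⁅h, k⁆ = 0 := trivial_lie_zero H H h k
  exact congrArg Subtype.val this

theorem eq_zero_or_root {χ : H → ℂ} (h : rootSpace H χ ≠ ⊥) :
    χ = 0 ∨ ∃ i, χ = (rootSystem H).root i := by
  by_cases h0 : χ = 0
  · exact Or.inl h0
  · refine Or.inr ⟨⟨⟨χ, h⟩, ?_⟩, ?_⟩
    · simpa [LieModule.Weight.IsNonZero, LieModule.Weight.IsZero] using h0
    · rfl

theorem rootSpace_le_rootSum {S : Set (H → ℂ)} {χ : H → ℂ} (hχ : χ ∈ S) :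
    (rootSpace H χ).toSubmodule ≤ rootSum H S :=
  le_iSup₂_of_le (f := fun χ (_ : χ ∈ S) => (rootSpace H χ).toSubmodule) χ hχ le_rfl

theorem rootSum_le {S : Set (H → ℂ)} {N : Submodule ℂ 𝔤}
    (h : ∀ χ ∈ S, ∀ x ∈ rootSpace H χ, x ∈ N) : rootSum H S ≤ N :=
  iSup₂_le fun χ hχ x hx => h χ hχ x hx

theorem rootSum_le_rootSum {S T : Set (H → ℂ)}
    (h : ∀ χ ∈ S, rootSpace H χ ≠ ⊥ → χ ∈ T) : rootSum H S ≤ rootSum H T := by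
  refine rootSum_le fun χ hχ x hx => ?_
  by_cases hb : rootSpace H χ = ⊥
  · rw [hb] at hx
    rw [(LieSubmodule.mem_bot x).1 hx]
    exact zero_mem _
  · exact rootSpace_le_rootSum (h χ hχ hb) hx

theorem rootSum_congr {S T : Set (H → ℂ)}
    (h : ∀ χ, rootSpace H χ ≠ ⊥ → (χ ∈ S ↔ χ ∈ T)) : rootSum H S = rootSum H T :=
  le_antisymm (rootSum_le_rootSum fun χ hχ hb => (h χ hb).1 hχ)
    (rootSum_le_rootSum fun χ hχ hb => (h χ hb).2 hχ)

theorem rootSum_univ : rootSum H (univ : Set (H → ℂ)) = ⊤ := by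
  rw [rootSum, iSup_univ]
  exact LieSubmodule.iSup_toSubmodule_eq_top.mpr (LieModule.iSup_genWeightSpace_eq_top ℂ H 𝔤)

theorem rootSum_singleton_zero : rootSum H {0} = H.toSubmodule := by
  simp [rootSum, LieAlgebra.rootSpace_zero_eq]

theorem bilin_mem_rootSum {S T : Set (H → ℂ)} {F : Type*} [AddCommGroup F] [Module ℂ F]
    {N : Submodule ℂ F} (β : 𝔤 →ₗ[ℂ] 𝔤 →ₗ[ℂ] F)
    (h : ∀ χ ∈ S, ∀ ψ ∈ T, ∀ x ∈ rootSpace H χ, ∀ y ∈ rootSpace H ψ, β x y ∈ N)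
    {x y : 𝔤} (hx : x ∈ rootSum H S) (hy : y ∈ rootSum H T) : β x y ∈ N := by
  have h1 : ∀ χ ∈ S, ∀ x ∈ rootSpace H χ, β x y ∈ N := fun χ hχ x hx =>
    (rootSum_le (N := N.comap (β x)) fun ψ hψ y hy => h χ hχ ψ hψ x hx y hy) hy
  exact (rootSum_le (N := N.comap (β.flip y)) fun χ hχ x hx => h1 χ hχ x hx) hx

theorem lie_mem_rootSum {S T U : Set (H → ℂ)} (h : ∀ χ ∈ S, ∀ ψ ∈ T, χ + ψ ∈ U) {x y : 𝔤}
    (hx : x ∈ rootSum H S) (hy : y ∈ rootSum H T) : ⁅x, y⁆ ∈ rootSum H U :=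
  bilin_mem_rootSum (N := rootSum H U) (LieModule.toEnd ℂ 𝔤 𝔤 : 𝔤 →ₗ[ℂ] Module.End ℂ 𝔤)
    (fun χ hχ ψ hψ _ hx _ hy => rootSpace_le_rootSum (h χ hχ ψ hψ)
      (lie_mem_genWeightSpace_of_mem_genWeightSpace hx hy)) hx hy

variable {B}

theorem form_rootSpace (hinv : ∀ x y z : 𝔤, B ⁅x, y⁆ z = B x ⁅y, z⁆) {χ ψ : H → ℂ}
    (h : χ + ψ ≠ 0) {x y : 𝔤} (hx : x ∈ rootSpace H χ) (hy : y ∈ rootSpace H ψ) : B x y = 0 := by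
  obtain ⟨k, hk⟩ := Function.ne_iff.1 h
  have h1 := hinv x k y
  rw [← lie_skew, lie_cartan_rootSpace hx, lie_cartan_rootSpace hy] at h1
  simp only [map_neg, map_smul, LinearMap.neg_apply, LinearMap.smul_apply, smul_eq_mul] at h1
  have h2 : (χ k + ψ k) * B x y = 0 := by linear_combination -h1
  exact (mul_eq_zero.1 h2).resolve_left hk

theorem form_rootSum (hinv : ∀ x y z : 𝔤, B ⁅x, y⁆ z = B x ⁅y, z⁆) {S T : Set (H → ℂ)}
    (h : ∀ χ ∈ S, ∀ ψ ∈ T, χ + ψ ≠ 0) {x y : 𝔤} (hx : x ∈ rootSum H S) (hy : y ∈ rootSum H T) :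
    B x y = 0 := by
  have := bilin_mem_rootSum (N := (⊥ : Submodule ℂ ℂ)) B
    (fun χ hχ ψ hψ x hx y hy => by
      rw [Submodule.mem_bot]; exact form_rootSpace hinv (h χ hχ ψ hψ) hx hy) hx hy
  simpa using this

/-- The grading element of the Cartan subalgebra attached to a base: every root takes its height
as value. -/
theorem exists_grading : ∃ ρ : H, ∀ i, (rootSystem H).root i ρ = (b.height i : ℂ) := by
  obtain ⟨ρ, hρ⟩ : ∃ ρ : H, ∀ j ∈ b.support, (rootSystem H).root j ρ = 1 := by
    let φ : Module.Dual ℂ (Module.Dual ℂ H) := b.toWeightBasis.constr ℂ fun _ => (1 : ℂ)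
    obtain ⟨ρ, hρ⟩ := (Module.evalEquiv ℂ H).surjective φ
    refine ⟨ρ, fun j hj => ?_⟩
    have h1 : φ ((rootSystem H).root j) = 1 := by
      have := b.toWeightBasis.constr_basis ℂ (fun _ => (1 : ℂ)) ⟨j, hj⟩
      rwa [b.toWeightBasis_apply] at this
    rw [← h1, ← hρ]
    rfl
  refine ⟨ρ, fun i => ?_⟩
  obtain ⟨f, -, -, hf⟩ := b.exists_root_eq_sum_int i
  rw [RootPairing.Base.height_eq_sum hf, hf]
  simp only [LinearMap.sum_apply, LinearMap.smul_apply, Int.cast_sum]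
  exact Finset.sum_congr rfl fun j hj => by rw [hρ j hj, zsmul_one]

/-- The grading element. -/
def grading : H := (exists_grading b).choose

theorem root_grading (i) : (rootSystem H).root i (grading b) = (b.height i : ℂ) :=
  (exists_grading b).choose_spec i

theorem mem_posRoots_iff {χ : H → ℂ} (h : rootSpace H χ ≠ ⊥) :
    χ ∈ posRoots b ↔ 0 < (χ (grading b)).re := by
  constructor
  · rintro ⟨i, hi, rfl⟩
    rw [root_grading]
    simpa using b.isPos_iff.1 hi
  · intro h0
    obtain rfl | ⟨i, rfl⟩ := eq_zero_or_root h
    · simp at h0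
    · refine ⟨i, ?_, rfl⟩
      rw [root_grading] at h0
      exact b.isPos_iff.2 (by simpa using h0)

theorem rootSpace_neg_ne_bot {χ : H → ℂ} (h : rootSpace H χ ≠ ⊥) : rootSpace H (-χ) ≠ ⊥ :=
  (-(⟨χ, h⟩ : LieModule.Weight ℂ H 𝔤)).genWeightSpace_ne_bot

theorem mem_negRoots_iff {χ : H → ℂ} (h : rootSpace H χ ≠ ⊥) :
    χ ∈ negRoots b ↔ (χ (grading b)).re < 0 := by
  rw [negRoots, mem_ofPred_eq, mem_posRoots_iff b (rootSpace_neg_ne_bot h)]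
  simp

theorem eq_zero_iff_grading {χ : H → ℂ} (h : rootSpace H χ ≠ ⊥) :
    χ = 0 ↔ (χ (grading b)).re = 0 := by
  constructor
  · rintro rfl
    simp
  · intro h0
    obtain rfl | ⟨i, rfl⟩ := eq_zero_or_root h
    · rfl
    · rw [root_grading] at h0
      exact absurd (by simpa using h0) (b.height_ne_zero i)

theorem nil_eq : nil b = rootSum H {χ | 0 < (χ (grading b)).re} :=
  rootSum_congr fun _ h => mem_posRoots_iff b h

theorem nilOpp_eq : nilOpp b = rootSum H {χ | (χ (grading b)).re < 0} :=
  rootSum_congr fun _ h => mem_negRoots_iff b h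

theorem cartan_eq : H.toSubmodule = rootSum H {χ | (χ (grading b)).re = 0} := by
  rw [← rootSum_singleton_zero]
  exact rootSum_congr fun _ h => eq_zero_iff_grading b h

theorem lie_nil_nil {x y : 𝔤} (hx : x ∈ nil b) (hy : y ∈ nil b) : ⁅x, y⁆ ∈ nil b := by
  rw [nil_eq] at *
  exact lie_mem_rootSum (fun χ hχ ψ hψ => by
    have h1 : 0 < (χ (grading b)).re := hχ
    have h2 : 0 < (ψ (grading b)).re := hψ
    simp only [mem_ofPred_eq, Pi.add_apply, Complex.add_re]
    linarith) hx hy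

theorem lie_nilOpp_nilOpp {x y : 𝔤} (hx : x ∈ nilOpp b) (hy : y ∈ nilOpp b) :
    ⁅x, y⁆ ∈ nilOpp b := by
  rw [nilOpp_eq] at *
  exact lie_mem_rootSum (fun χ hχ ψ hψ => by
    have h1 : (χ (grading b)).re < 0 := hχ
    have h2 : (ψ (grading b)).re < 0 := hψ
    simp only [mem_ofPred_eq, Pi.add_apply, Complex.add_re]
    linarith) hx hy

theorem lie_cartan_nil (h : H) {y : 𝔤} (hy : y ∈ nil b) : ⁅(h : 𝔤), y⁆ ∈ nil b :=
  lie_mem_rootSum (S := {0}) (fun χ hχ ψ hψ => by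
    rw [mem_singleton_iff.1 hχ, zero_add]; exact hψ) (rootSum_singleton_zero (H := H) ▸ h.2) hy

theorem lie_cartan_nilOpp (h : H) {y : 𝔤} (hy : y ∈ nilOpp b) : ⁅(h : 𝔤), y⁆ ∈ nilOpp b :=
  lie_mem_rootSum (S := {0}) (fun χ hχ ψ hψ => by
    rw [mem_singleton_iff.1 hχ, zero_add]; exact hψ) (rootSum_singleton_zero (H := H) ▸ h.2) hy

theorem form_nil_nil (hinv : ∀ x y z : 𝔤, B ⁅x, y⁆ z = B x ⁅y, z⁆) {x y : 𝔤} (hx : x ∈ nil b)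
    (hy : y ∈ nil b) : B x y = 0 := by
  rw [nil_eq] at *
  exact form_rootSum hinv (fun χ hχ ψ hψ h0 => by
    have h1 : 0 < (χ (grading b)).re := hχ
    have h2 : 0 < (ψ (grading b)).re := hψ
    have h3 := congrArg Complex.re (congrFun h0 (grading b))
    simp only [Pi.add_apply, Complex.add_re, Pi.zero_apply, Complex.zero_re] at h3
    linarith) hx hy

theorem form_nilOpp_nilOpp (hinv : ∀ x y z : 𝔤, B ⁅x, y⁆ z = B x ⁅y, z⁆) {x y : 𝔤}
    (hx : x ∈ nilOpp b) (hy : y ∈ nilOpp b) : B x y = 0 := by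
  rw [nilOpp_eq] at *
  exact form_rootSum hinv (fun χ hχ ψ hψ h0 => by
    have h1 : (χ (grading b)).re < 0 := hχ
    have h2 : (ψ (grading b)).re < 0 := hψ
    have h3 := congrArg Complex.re (congrFun h0 (grading b))
    simp only [Pi.add_apply, Complex.add_re, Pi.zero_apply, Complex.zero_re] at h3
    linarith) hx hy

theorem form_cartan_nil (hinv : ∀ x y z : 𝔤, B ⁅x, y⁆ z = B x ⁅y, z⁆) (h : H) {y : 𝔤}
    (hy : y ∈ nil b) : B h y = 0 := by
  have h1 : (h : 𝔤) ∈ rootSum H {χ | (χ (grading b)).re = 0} := cartan_eq b ▸ h.2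
  rw [nil_eq] at hy
  exact form_rootSum hinv (fun χ hχ ψ hψ h0 => by
    have h1 : (χ (grading b)).re = 0 := hχ
    have h2 : 0 < (ψ (grading b)).re := hψ
    have h3 := congrArg Complex.re (congrFun h0 (grading b))
    simp only [Pi.add_apply, Complex.add_re, Pi.zero_apply, Complex.zero_re] at h3
    linarith) h1 hy

theorem form_cartan_nilOpp (hinv : ∀ x y z : 𝔤, B ⁅x, y⁆ z = B x ⁅y, z⁆) (h : H) {y : 𝔤}
    (hy : y ∈ nilOpp b) : B h y = 0 := by
  have h1 : (h : 𝔤) ∈ rootSum H {χ | (χ (grading b)).re = 0} := cartan_eq b ▸ h.2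
  rw [nilOpp_eq] at hy
  exact form_rootSum hinv (fun χ hχ ψ hψ h0 => by
    have h1 : (χ (grading b)).re = 0 := hχ
    have h2 : (ψ (grading b)).re < 0 := hψ
    have h3 := congrArg Complex.re (congrFun h0 (grading b))
    simp only [Pi.add_apply, Complex.add_re, Pi.zero_apply, Complex.zero_re] at h3
    linarith) h1 hy

/-! #### Projections -/

theorem rootProj_of_mem {S : Set (H → ℂ)} {x : 𝔤} (hx : x ∈ rootSum H S) : rootProj H S x = x :=
  Submodule.projection_apply_left _ ⟨x, hx⟩

theorem rootProj_mem (S : Set (H → ℂ)) (x : 𝔤) : rootProj H S x ∈ rootSum H S :=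
  Submodule.projection_apply_mem _ x

theorem rootProj_of_mem_disjoint {S T : Set (H → ℂ)} (hST : Disjoint S T) {x : 𝔤}
    (hx : x ∈ rootSum H T) : rootProj H S x = 0 := by
  have h1 : rootSum H T ≤ rootSum H Sᶜ :=
    rootSum_le_rootSum fun χ hχ _ => disjoint_right.1 hST hχ
  exact Submodule.projection_apply_right _ ⟨x, h1 hx⟩

theorem disjoint_pos_neg : Disjoint (posRoots b) (negRoots b) := by
  rw [disjoint_left]
  rintro χ ⟨i, hi, rfl⟩ ⟨j, hj, h⟩
  have h1 := congrFun h (grading b)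
  simp only [Pi.neg_apply, root_grading] at h1
  have h2 : -(b.height i) = b.height j := by exact_mod_cast h1
  rw [RootPairing.Base.isPos_iff] at hi hj
  omega

theorem disjoint_zero_pos : Disjoint ({0} : Set (H → ℂ)) (posRoots b) := by
  rw [disjoint_left]
  rintro χ rfl ⟨j, hj, h⟩
  have h1 := congrFun h (grading b)
  simp only [Pi.zero_apply, root_grading] at h1
  have h2 : 0 = b.height j := by exact_mod_cast h1
  rw [RootPairing.Base.isPos_iff] at hj
  omega

theorem disjoint_zero_neg : Disjoint ({0} : Set (H → ℂ)) (negRoots b) := by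
  rw [disjoint_left]
  rintro χ rfl h
  rw [negRoots, mem_ofPred_eq, neg_zero] at h
  exact disjoint_left.1 (disjoint_zero_pos b) (mem_singleton _) h

theorem cartanProj_coe (h : H) : cartanProj H (h : 𝔤) = h :=
  Subtype.ext (rootProj_of_mem (rootSum_singleton_zero (H := H) ▸ h.2))

theorem cartanProj_nil {x : 𝔤} (hx : x ∈ nil b) : cartanProj H x = 0 :=
  Subtype.ext (rootProj_of_mem_disjoint (disjoint_zero_pos b) hx)

theorem cartanProj_nilOpp {x : 𝔤} (hx : x ∈ nilOpp b) : cartanProj H x = 0 :=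
  Subtype.ext (rootProj_of_mem_disjoint (disjoint_zero_neg b) hx)

theorem rootProj_pos_nilOpp {x : 𝔤} (hx : x ∈ nilOpp b) : rootProj H (posRoots b) x = 0 :=
  rootProj_of_mem_disjoint (disjoint_pos_neg b) hx

theorem rootProj_neg_nil {x : 𝔤} (hx : x ∈ nil b) : rootProj H (negRoots b) x = 0 :=
  rootProj_of_mem_disjoint (disjoint_pos_neg b).symm hx

theorem rootProj_pos_cartan (h : H) : rootProj H (posRoots b) (h : 𝔤) = 0 :=
  rootProj_of_mem_disjoint (disjoint_zero_pos b).symm (rootSum_singleton_zero (H := H) ▸ h.2)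

theorem rootProj_neg_cartan (h : H) : rootProj H (negRoots b) (h : 𝔤) = 0 :=
  rootProj_of_mem_disjoint (disjoint_zero_neg b).symm (rootSum_singleton_zero (H := H) ▸ h.2)

theorem proj_add_proj_add_proj (x : 𝔤) :
    rootProj H (negRoots b) x + (cartanProj H x : 𝔤) + rootProj H (posRoots b) x = x := by
  have hx : x ∈ rootSum H (univ : Set (H → ℂ)) := by rw [rootSum_univ]; trivial
  let T : 𝔤 →ₗ[ℂ] 𝔤 := rootProj H (negRoots b) + rootProj H {0} + rootProj H (posRoots b)
  refine (rootSum_le (N := LinearMap.eqLocus T LinearMap.id) fun χ _ y hy => ?_) hx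
  rw [LinearMap.mem_eqLocus, LinearMap.id_apply]
  by_cases hb : rootSpace H χ = ⊥
  · rw [hb] at hy
    rw [(LieSubmodule.mem_bot y).1 hy, map_zero]
  change rootProj H (negRoots b) y + rootProj H {0} y + rootProj H (posRoots b) y = y
  rcases lt_trichotomy (χ (grading b)).re 0 with h | h | h
  · have hy' : y ∈ nilOpp b := rootSpace_le_rootSum ((mem_negRoots_iff b hb).2 h) hy
    rw [rootProj_of_mem hy', rootProj_pos_nilOpp b hy',
      rootProj_of_mem_disjoint (disjoint_zero_neg b) hy', add_zero, add_zero]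
  · have hy' : y ∈ rootSum H {0} :=
      rootSpace_le_rootSum (mem_singleton_iff.2 ((eq_zero_iff_grading b hb).2 h)) hy
    rw [rootProj_of_mem hy', rootProj_of_mem_disjoint (disjoint_zero_pos b).symm hy',
      rootProj_of_mem_disjoint (disjoint_zero_neg b).symm hy', add_zero, zero_add]
  · have hy' : y ∈ nil b := rootSpace_le_rootSum ((mem_posRoots_iff b hb).2 h) hy
    rw [rootProj_of_mem hy', rootProj_neg_nil b hy',
      rootProj_of_mem_disjoint (disjoint_zero_pos b) hy', zero_add, zero_add]

theorem cartanForm_apply (h k : H) : cartanForm H B h k = B h k := rfl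

theorem form_cartan_right (b : (rootSystem H).Base) (hinv : ∀ x y z : 𝔤, B ⁅x, y⁆ z = B x ⁅y, z⁆) (h : H) (x : 𝔤) :
    B h x = cartanForm H B h (cartanProj H x) := by
  conv_lhs => rw [← proj_add_proj_add_proj b x]
  rw [map_add, map_add, form_cartan_nilOpp b hinv h (rootProj_mem _ x),
    form_cartan_nil b hinv h (rootProj_mem _ x), zero_add, add_zero, cartanForm_apply]

theorem form_cartan_left (b : (rootSystem H).Base) (hsymm : B.IsSymm) (hinv : ∀ x y z : 𝔤, B ⁅x, y⁆ z = B x ⁅y, z⁆) (h : H)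
    (x : 𝔤) : B x h = cartanForm H B (cartanProj H x) h := by
  have h1 : B x h = B h x := hsymm.eq x h
  rw [h1, form_cartan_right b hinv h x]
  exact (hsymm.eq _ _).symm

theorem cartanForm_isSymm (hsymm : B.IsSymm) : (cartanForm H B).IsSymm :=
  ⟨fun h k => hsymm.eq h k⟩

theorem cartanForm_nondegenerate (b : (rootSystem H).Base) (hsymm : B.IsSymm) (hnondeg : B.Nondegenerate)
    (hinv : ∀ x y z : 𝔤, B ⁅x, y⁆ z = B x ⁅y, z⁆) : (cartanForm H B).Nondegenerate := by
  have h1 : ∀ h : H, (∀ k, cartanForm H B h k = 0) → h = 0 := fun h hh => by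
    have : (h : 𝔤) = 0 := hnondeg.1 _ fun x => by
      rw [form_cartan_right b hinv, hh]
    exact Subtype.ext this
  exact ⟨h1, fun h hh => h1 h fun k => by
    exact (hsymm.eq _ _).trans (hh k)⟩

end RootDecomposition

end LoopReduction

/-! ### Exponentials in finite dimensional algebras -/

namespace AlgebraExp

open NormedSpace

variable {A : Type*} [NormedRing A] [NormedAlgebra ℂ A] [FiniteDimensional ℂ A]

theorem completeSpace (A : Type*) [NormedRing A] [NormedAlgebra ℂ A] [FiniteDimensional ℂ A] :
    CompleteSpace A := FiniteDimensional.complete ℂ A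

theorem exp_mul_exp_neg (x : A) : exp x * exp (-x) = 1 := by
  let _ := NormedAlgebra.restrictScalars ℚ ℂ A
  have := completeSpace A
  rw [← exp_add_of_commute (Commute.refl x).neg_right, add_neg_cancel, exp_zero]

theorem exp_neg_mul_exp (x : A) : exp (-x) * exp x = 1 := by
  simpa using exp_mul_exp_neg (-x)

theorem hasDerivAt_exp_smul (x : A) (t : ℂ) :
    HasDerivAt (fun t : ℂ => exp (t • x)) (exp (t • x) * x) t :=
  have := completeSpace A
  hasDerivAt_exp_smul_const (𝕂 := ℂ) x t

theorem hasDerivAt_exp_smul' (x : A) (t : ℂ) :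
    HasDerivAt (fun t : ℂ => exp (t • x)) (x * exp (t • x)) t :=
  have := completeSpace A
  hasDerivAt_exp_smul_const' (𝕂 := ℂ) x t

theorem hasDerivAt_exp_neg_smul' (x : A) (t : ℂ) :
    HasDerivAt (fun t : ℂ => exp (-(t • x))) (-(exp (-(t • x)) * x)) t := by
  simpa using hasDerivAt_exp_smul (-x) t

theorem analyticAt_exp (x : A) : AnalyticAt ℂ (exp : A → A) x :=
  have := completeSpace A
  exp_analytic (𝕂 := ℂ) x

theorem differentiable_exp : Differentiable ℂ (exp : A → A) :=
  fun x => (analyticAt_exp x).differentiableAt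

theorem continuous_exp : Continuous (exp : A → A) := differentiable_exp.continuous

theorem isClosed_submodule (S : Submodule ℂ A) : IsClosed (S : Set A) :=
  S.closed_of_finiteDimensional

section Operators

variable {V : Type*} [NormedAddCommGroup V] [NormedSpace ℂ V] [CompleteSpace V] (T : V →L[ℂ] V)
  (y : V)

theorem exp_zero_smul_apply : (exp ((0 : ℂ) • T) : V →L[ℂ] V) y = y := by
  rw [zero_smul, exp_zero]
  rfl

theorem hasSum_exp_apply :
    HasSum (fun n : ℕ => (n.factorial : ℂ)⁻¹ • (T ^ n) y) ((exp T : V →L[ℂ] V) y) := by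
  have h : HasSum (fun n : ℕ => (n.factorial : ℂ)⁻¹ • T ^ n) (exp T) :=
    exp_series_hasSum_exp' (𝕂 := ℂ) T
  exact h.map (ContinuousLinearMap.apply ℂ V y).toLinearMap.toAddMonoidHom
    (ContinuousLinearMap.apply ℂ V y).continuous

theorem hasDerivAt_exp_smul_apply (t : ℂ) :
    HasDerivAt (fun t : ℂ => (exp (t • T) : V →L[ℂ] V) y) (T ((exp (t • T) : V →L[ℂ] V) y)) t :=
  (ContinuousLinearMap.apply ℂ V y).hasFDerivAt.comp_hasDerivAt t
    (hasDerivAt_exp_smul_const' (𝕂 := ℂ) T t)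

end Operators

/-- Conjugation by `exp x` preserves every subspace preserved by `ad x`. -/
theorem exp_conj_mem (S : Submodule ℂ A) {x : A} (hx : ∀ y ∈ S, x * y - y * x ∈ S) {y : A}
    (hy : y ∈ S) : exp x * y * exp (-x) ∈ S := by
  have := completeSpace A
  let T : A →L[ℂ] A :=
    LinearMap.toContinuousLinearMap (LinearMap.mulLeft ℂ x - LinearMap.mulRight ℂ x)
  have hT : ∀ v : A, T v = x * v - v * x := fun v => by simp [T]
  have hTn : ∀ n : ℕ, (T ^ n) y ∈ S := by
    intro n
    induction n with
    | zero => simpa using hy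
    | succ n ih =>
      rw [pow_succ', mul_apply_eq_comp, hT]
      exact hx _ ih
  let v : ℂ → A := fun t => (exp (t • T) : A →L[ℂ] A) y
  have hv : ∀ t, HasDerivAt v (x * v t - v t * x) t := by
    intro t
    rw [← hT]
    exact hasDerivAt_exp_smul_apply T y t
  let u : ℂ → A := fun t => exp (-(t • x)) * v t * exp (t • x)
  have hu : ∀ t, HasDerivAt u 0 t := by
    intro t
    have h := ((hasDerivAt_exp_neg_smul' x t).mul (hv t)).mul (hasDerivAt_exp_smul' x t)
    refine h.congr_deriv ?_
    simp only [Pi.mul_apply]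
    noncomm_ring
  have h01 : u 1 = u 0 := is_const_of_deriv_eq_zero (fun t => (hu t).differentiableAt)
    (fun t => (hu t).deriv) 1 0
  have h0 : u 0 = y := by
    simp only [u, v, exp_zero_smul_apply, zero_smul, neg_zero, exp_zero, one_mul, mul_one]
  have h1 : v 1 = exp x * y * exp (-x) := by
    rw [← h0, ← h01]
    simp only [u, one_smul]
    rw [← mul_assoc, ← mul_assoc, exp_mul_exp_neg, one_mul, mul_assoc, exp_mul_exp_neg, mul_one]
  rw [← h1]
  have hs : HasSum (fun n : ℕ => (n.factorial : ℂ)⁻¹ • (T ^ n) y) (v 1) := by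
    simp only [v, one_smul]
    exact hasSum_exp_apply T y
  exact (isClosed_submodule S).mem_of_tendsto hs
    (Eventually.of_forall fun F => S.sum_mem fun n _ => S.smul_mem _ (hTn n))

theorem hasDerivAt_mem {S : Submodule ℂ A} {f : ℂ → A} {f' : A} {t : ℂ} (h : HasDerivAt f f' t)
    (hf : ∀ s, f s ∈ S) : f' ∈ S := by
  rw [hasDerivAt_iff_tendsto_slope] at h
  refine (isClosed_submodule S).mem_of_tendsto h (Eventually.of_forall fun s => ?_)
  rw [slope_def_module]
  exact S.smul_mem _ (S.sub_mem (hf s) (hf t))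

theorem hasDerivAt_exp_add_smul (Y w : A) :
    HasDerivAt (fun t : ℂ => exp (Y + t • w)) (fderiv ℂ exp Y w) 0 := by
  have h1 : HasDerivAt (fun t : ℂ => Y + t • w) w 0 := by
    simpa using ((hasDerivAt_id (0 : ℂ)).smul_const w).const_add Y
  have h2 : HasFDerivAt (exp : A → A) (fderiv ℂ exp Y) (Y + (0 : ℂ) • w) := by
    simpa using (differentiable_exp Y).hasFDerivAt
  exact h2.comp_hasDerivAt (0 : ℂ) h1

/-- The logarithmic derivative of the exponential map lies in every subspace which contains the
direction and is preserved by the adjoint action of the base point. -/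
theorem exp_neg_mul_fderiv_mem (S : Submodule ℂ A) {Y : A} (hY : ∀ y ∈ S, Y * y - y * Y ∈ S)
    {w : A} (hw : w ∈ S) : exp (-Y) * fderiv ℂ exp Y w ∈ S := by
  have := completeSpace A
  let G : ℂ → ℝ → A := fun t s => exp (-((s : ℂ) • Y)) * w * exp ((s : ℂ) • (Y + t • w))
  have hGc : Continuous (Function.uncurry G) := by
    refine (Continuous.mul (continuous_exp.comp ?_) continuous_const).mul (continuous_exp.comp ?_)
    · fun_prop
    · fun_prop
  let F : ℂ → A := fun t => ∫ s in (0 : ℝ)..1, G t s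
  have hF : Continuous F :=
    intervalIntegral.continuous_parametric_intervalIntegral_of_continuous' hGc 0 1
  have hmain : ∀ t : ℂ, exp (-Y) * exp (Y + t • w) = 1 + t • F t := by
    intro t
    have hd : ∀ s ∈ uIcc (0 : ℝ) 1, HasDerivAt
        (fun s : ℝ => exp (-((s : ℂ) • Y)) * exp ((s : ℂ) • (Y + t • w))) (t • G t s) s := by
      intro s _
      have h1 := ((hasDerivAt_exp_neg_smul' Y (s : ℂ)).mul
        (hasDerivAt_exp_smul' (Y + t • w) (s : ℂ))).scomp s Complex.ofRealCLM.hasDerivAt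
      refine h1.congr_deriv ?_
      simp only [G, Complex.ofRealCLM_apply, Complex.ofReal_one, one_smul, neg_mul, mul_add, add_mul, smul_mul_assoc, mul_smul_comm, mul_assoc]
      abel
    have hi := intervalIntegral.integral_eq_sub_of_hasDerivAt hd
      ((continuous_const.smul (hGc.comp (by fun_prop : Continuous fun s : ℝ => (t, s)))).intervalIntegrable
        _ _)
    rw [intervalIntegral.integral_smul] at hi
    simp only [Complex.ofReal_one, one_smul, Complex.ofReal_zero, zero_smul, neg_zero, exp_zero,
      mul_one] at hi
    rw [← sub_eq_iff_eq_add', ← hi]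
  have h1 : HasDerivAt (fun t : ℂ => exp (-Y) * exp (Y + t • w)) (F 0) 0 := by
    rw [hasDerivAt_iff_tendsto_slope]
    have h2 : Tendsto F (𝓝[≠] 0) (𝓝 (F 0)) := hF.continuousAt.tendsto.mono_left inf_le_left
    refine h2.congr' ?_
    filter_upwards [self_mem_nhdsWithin] with t ht
    have ht' : t ≠ 0 := ht
    rw [slope_def_module, hmain, hmain, zero_smul, add_sub_add_left_eq_sub, sub_zero, sub_zero,
      smul_smul, inv_mul_cancel₀ ht', one_smul]
  have h2 : exp (-Y) * fderiv ℂ exp Y w = F 0 :=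
    ((hasDerivAt_exp_add_smul Y w).const_mul (exp (-Y))).unique h1
  rw [h2, ← Subspace.forall_mem_dualAnnihilator_apply_eq_zero_iff]
  intro ℓ hℓ
  rw [Submodule.mem_dualAnnihilator] at hℓ
  have h3 : Continuous (G 0) := hGc.comp (by fun_prop : Continuous fun s : ℝ => ((0 : ℂ), s))
  have h4 := (LinearMap.toContinuousLinearMap ℓ).intervalIntegral_comp_comm
    (h3.intervalIntegrable 0 1 (μ := MeasureTheory.volume))
  rw [LinearMap.coe_toContinuousLinearMap'] at h4
  rw [← h4]
  refine intervalIntegral.integral_zero_ae (Eventually.of_forall fun s _ => hℓ _ ?_)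
  have h5 := exp_conj_mem S (x := -((s : ℂ) • Y)) (fun y hy => by
    have : -((s : ℂ) • Y) * y - y * -((s : ℂ) • Y) = -((s : ℂ) • (Y * y - y * Y)) := by
      simp only [neg_mul, smul_mul_assoc, mul_neg, mul_smul_comm, smul_sub]
      abel
    rw [this]
    exact S.neg_mem (S.smul_mem _ (hY y hy))) hw
  simpa [G] using h5

/-! #### Multiplicative filtrations -/

section Filtration

variable {F : ℕ → Submodule ℂ A}

theorem pow_add_sub_pow_mem (hF : Antitone F) (hmul : ∀ i j, ∀ x ∈ F i, ∀ y ∈ F j, x * y ∈ F (i + j))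
    (h1 : (1 : A) ∈ F 0) {Y R : A} {m : ℕ} (hm : 1 ≤ m) (hY : Y ∈ F 1) (hR : R ∈ F m) (k : ℕ) :
    Y ^ k ∈ F k ∧ (Y + R) ^ (k + 1) - Y ^ (k + 1) ∈ F (m + k) := by
  have hp : ∀ k, Y ^ k ∈ F k := fun k => by
    induction k with
    | zero => simpa using h1
    | succ k ih => rw [pow_succ]; exact hmul _ _ _ ih _ hY
  refine ⟨hp k, ?_⟩
  induction k with
  | zero => simpa using hR
  | succ k ih =>
    have h2 : (Y + R) ^ (k + 1 + 1) - Y ^ (k + 1 + 1) =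
        ((Y + R) ^ (k + 1) - Y ^ (k + 1)) * (Y + R) + Y ^ (k + 1) * R := by
      rw [pow_succ, pow_succ Y (k + 1)]
      noncomm_ring
    rw [h2]
    refine (F _).add_mem (hmul _ _ _ ih _ ((F 1).add_mem hY (hF hm hR))) ?_
    have := hmul _ _ _ (hp (k + 1)) _ hR
    rwa [add_comm] at this

theorem exp_add_sub_sub_mem (hF : Antitone F)
    (hmul : ∀ i j, ∀ x ∈ F i, ∀ y ∈ F j, x * y ∈ F (i + j)) (h1 : (1 : A) ∈ F 0) {Y R : A} {m : ℕ}
    (hm : 1 ≤ m) (hY : Y ∈ F 1) (hR : R ∈ F m) : exp (Y + R) - exp Y - R ∈ F (m + 1) := by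
  have := completeSpace A
  have hs := ((exp_series_hasSum_exp' (𝕂 := ℂ) (Y + R)).sub
    (exp_series_hasSum_exp' (𝕂 := ℂ) Y)).sub (hasSum_ite_eq 1 R)
  refine (isClosed_submodule (F (m + 1))).mem_of_tendsto hs
    (Eventually.of_forall fun T => (F (m + 1)).sum_mem fun n _ => ?_)
  match n with
  | 0 => simp
  | 1 => simp
  | k + 2 =>
    simp only [Nat.reduceEqDiff, if_false, sub_zero]
    rw [← smul_sub]
    refine Submodule.smul_mem _ _ (hF ?_ (pow_add_sub_pow_mem hF hmul h1 hm hY hR (k + 1)).2)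
    omega

theorem exp_sub_one_mem (hF : Antitone F)
    (hmul : ∀ i j, ∀ x ∈ F i, ∀ y ∈ F j, x * y ∈ F (i + j)) (h1 : (1 : A) ∈ F 0) {Y : A}
    (hY : Y ∈ F 1) : exp Y - 1 ∈ F 1 := by
  have := exp_add_sub_sub_mem hF hmul h1 le_rfl (zero_mem _) hY
  rw [zero_add, exp_zero] at this
  have h2 := (F 1).add_mem (hF (by norm_num : 1 ≤ 1 + 1) this) hY
  simpa using h2

theorem fderiv_exp_sub_mem (hF : Antitone F)
    (hmul : ∀ i j, ∀ x ∈ F i, ∀ y ∈ F j, x * y ∈ F (i + j)) (h1 : (1 : A) ∈ F 0) {Y w : A} {m : ℕ}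
    (hm : 1 ≤ m) (hY : Y ∈ F 1) (hw : w ∈ F m) : fderiv ℂ exp Y w - w ∈ F (m + 1) := by
  have hd : HasDerivAt (fun t : ℂ => exp (Y + t • w) - exp Y - t • w)
      (fderiv ℂ exp Y w - w) 0 := by
    have := ((hasDerivAt_exp_add_smul Y w).sub_const (exp Y)).sub
      ((hasDerivAt_id (0 : ℂ)).smul_const w)
    exact this.congr_deriv (by rw [one_smul])
  exact hasDerivAt_mem hd fun t => exp_add_sub_sub_mem hF hmul h1 hm hY ((F m).smul_mem t hw)

end Filtration

/-! #### The filtration attached to an inner derivation -/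

section Grading

variable (E : A)

/-- The commutator with `E`. -/
def der : Module.End ℂ A := LinearMap.mulLeft ℂ E - LinearMap.mulRight ℂ E

theorem der_apply (x : A) : der E x = E * x - x * E := by simp [der]

/-- The sum of the generalized eigenspaces of `[E, ·]` whose eigenvalues have real part at
least `m`. -/
def filt (m : ℕ) : Submodule ℂ A := ⨆ μ ∈ {μ : ℂ | (m : ℝ) ≤ μ.re}, (der E).maxGenEigenspace μ

variable {E}

theorem mem_filt_of_mem {m : ℕ} {μ : ℂ} (hμ : (m : ℝ) ≤ μ.re) {x : A}
    (hx : x ∈ (der E).maxGenEigenspace μ) : x ∈ filt E m :=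
  Submodule.mem_iSup_of_mem μ (Submodule.mem_iSup_of_mem hμ hx)

theorem mem_filt_of_eigen {m : ℕ} {μ : ℂ} (hμ : (m : ℝ) ≤ μ.re) {x : A}
    (hx : E * x - x * E = μ • x) : x ∈ filt E m := by
  refine mem_filt_of_mem hμ (Module.End.mem_maxGenEigenspace _ _ _ |>.2 ⟨1, ?_⟩)
  simp [der_apply, hx]

theorem filt_antitone : Antitone (filt E) := fun m n h =>
  biSup_mono fun μ hμ => by
    rw [mem_ofPred_eq] at *
    exact le_trans (Nat.cast_le.2 h) hμ

theorem one_mem_filt : (1 : A) ∈ filt E 0 :=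
  mem_filt_of_eigen (μ := 0) (by simp) (by simp)

theorem mul_mem_maxGenEigenspace {μ ν : ℂ} {x y : A} (hx : x ∈ (der E).maxGenEigenspace μ)
    (hy : y ∈ (der E).maxGenEigenspace ν) : x * y ∈ (der E).maxGenEigenspace (μ + ν) := by
  rw [Module.End.mem_maxGenEigenspace] at *
  obtain ⟨m, hm⟩ := hx
  obtain ⟨n, hn⟩ := hy
  have key : ∀ N m n (x y : A), m + n ≤ N → ((der E - μ • 1 : Module.End ℂ A) ^ m) x = 0 →
      ((der E - ν • 1 : Module.End ℂ A) ^ n) y = 0 → ((der E - (μ + ν) • 1 : Module.End ℂ A) ^ N) (x * y) = 0 := by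
    intro N
    induction N with
    | zero =>
      intro m n x y hmn hx hy
      obtain rfl : m = 0 := by omega
      have hx0 : x = 0 := by simpa using hx
      rw [hx0, zero_mul, map_zero]
    | succ N ih =>
      intro m n x y hmn hx hy
      match m, n with
      | 0, _ =>
        have hx0 : x = 0 := by simpa using hx
        rw [hx0, zero_mul, map_zero]
      | _, 0 =>
        have hy0 : y = 0 := by simpa using hy
        rw [hy0, mul_zero, map_zero]
      | m + 1, n + 1 =>
        rw [pow_succ, Module.End.mul_apply]
        have h1 : (der E - (μ + ν) • 1 : Module.End ℂ A) (x * y) =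
            ((der E - μ • 1 : Module.End ℂ A) x) * y + x * ((der E - ν • 1 : Module.End ℂ A) y) := by
          simp only [LinearMap.sub_apply, LinearMap.smul_apply, LinearMap.add_apply,
            Module.End.one_apply, der_apply, add_smul, sub_mul, mul_sub, smul_mul_assoc,
            mul_smul_comm, mul_assoc]
          abel
        rw [h1, map_add, ih m (n + 1) _ _ (by omega) (by rwa [← Module.End.mul_apply, ← pow_succ]) hy,
          ih (m + 1) n _ _ (by omega) hx (by rwa [← Module.End.mul_apply, ← pow_succ]), add_zero]
  exact ⟨m + n, key _ m n x y le_rfl hm hn⟩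

theorem mul_mem_filt (i j : ℕ) (x : A) (hx : x ∈ filt E i) (y : A) (hy : y ∈ filt E j) :
    x * y ∈ filt E (i + j) := by
  have h1 : ∀ μ ∈ {μ : ℂ | (i : ℝ) ≤ μ.re}, ∀ x ∈ (der E).maxGenEigenspace μ,
      x * y ∈ filt E (i + j) := by
    intro μ hμ x hx
    have h2 : filt E j ≤ (filt E (i + j)).comap (LinearMap.mulLeft ℂ x) :=
      iSup₂_le fun ν hν y hy => mem_filt_of_mem (by
        have h3 : (i : ℝ) ≤ μ.re := hμ
        have h4 : (j : ℝ) ≤ ν.re := hν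
        push_cast
        rw [Complex.add_re]
        linarith) (mul_mem_maxGenEigenspace hx hy)
    exact h2 hy
  have h2 : filt E i ≤ (filt E (i + j)).comap (LinearMap.mulRight ℂ y) :=
    iSup₂_le fun μ hμ x hx => h1 μ hμ x hx
  exact h2 hx

theorem der_mem_filt {m : ℕ} {x : A} (hx : x ∈ filt E m) : der E x ∈ filt E m := by
  have h : filt E m ≤ (filt E m).comap (der E) := iSup₂_le fun μ hμ x hx => mem_filt_of_mem hμ
    (Module.End.mapsTo_maxGenEigenspace_of_comm (Commute.refl (der E)) μ hx)
  exact h hx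

theorem eq_zero_of_mem_filt_of_der_eq_zero {x : A} (hx : x ∈ filt E 1) (h0 : der E x = 0) :
    x = 0 := by
  have h1 : x ∈ (der E).maxGenEigenspace 0 :=
    (Module.End.mem_maxGenEigenspace _ _ _).2 ⟨1, by simpa using h0⟩
  have h2 : Disjoint (⨆ μ ∈ ({0} : Set ℂ), (der E).maxGenEigenspace μ) (filt E 1) :=
    (der E).independent_maxGenEigenspace.disjoint_biSup_biSup (by
      rw [disjoint_left]
      rintro _ rfl h
      have h' : ((1 : ℕ) : ℝ) ≤ (0 : ℂ).re := h
      norm_num at h')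
  rw [Submodule.disjoint_def] at h2
  exact h2 x (by simpa using h1) hx

theorem mem_filt_of_der_mem {m : ℕ} (hm : 1 ≤ m) {x : A} (hx : x ∈ filt E 1)
    (h : der E x ∈ filt E m) : x ∈ filt E m := by
  let T : filt E m →ₗ[ℂ] filt E m := (der E).restrict fun y hy => der_mem_filt hy
  have hT : Function.Injective T := by
    rw [← LinearMap.ker_eq_bot, LinearMap.ker_eq_bot']
    intro y hy
    exact Subtype.ext (eq_zero_of_mem_filt_of_der_eq_zero (filt_antitone hm y.2)
      (congrArg Subtype.val hy))
  obtain ⟨y, hy⟩ := (LinearMap.injective_iff_surjective.1 hT) ⟨der E x, h⟩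
  have h1 : der E (y : A) = der E x := congrArg Subtype.val hy
  have h2 : x - y = 0 := eq_zero_of_mem_filt_of_der_eq_zero
    (Submodule.sub_mem _ hx (filt_antitone hm y.2)) (by rw [map_sub, h1, sub_self])
  rw [sub_eq_zero.1 h2]
  exact y.2

variable (E) in
theorem exists_filt_eq_bot : ∃ m, filt E m = ⊥ := by
  have hfin : {μ : ℂ | (der E).maxGenEigenspace μ ≠ ⊥}.Finite :=
    WellFoundedGT.finite_ne_bot_of_iSupIndep (der E).independent_maxGenEigenspace
  obtain ⟨C, hC⟩ := (hfin.image Complex.re).bddAbove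
  obtain ⟨m, hm⟩ := exists_nat_gt C
  refine ⟨m, ?_⟩
  rw [eq_bot_iff]
  refine iSup₂_le fun μ hμ => ?_
  by_contra h
  have h1 : μ.re ≤ C := hC ⟨μ, fun h0 => h (h0 ▸ le_rfl), rfl⟩
  have h2 : (m : ℝ) ≤ μ.re := hμ
  linarith

theorem pow_eq_zero_of_mem_filt {m : ℕ} (hm : filt E m = ⊥) {x : A} (hx : x ∈ filt E 1) :
    x ^ m = 0 := by
  have h : ∀ k, x ^ k ∈ filt E k := fun k => by
    induction k with
    | zero => simpa using one_mem_filt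
    | succ k ih => rw [pow_succ]; exact mul_mem_filt _ _ _ ih _ hx
  simpa [hm] using h m

end Grading

end AlgebraExp

namespace LoopReduction

/-! ### Holomorphic families of matrices -/

open scoped Matrix.Norms.Operator

/-- Square matrices. -/
abbrev Mat (d : ℕ) : Type := Matrix (Fin d) (Fin d) ℂ

section MatrixFamilies

variable {d : ℕ} {Q : Type*} [NormedAddCommGroup Q] [NormedSpace ℂ Q]

/-- Matrix valued functions which are holomorphic in a parameter in `Ω` and a loop variable. -/
def HolM (Ω : Set Q) (g : Q → ℂˣ → Mat d) : Prop :=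
  ∃ F : Q × ℂ → Mat d, DifferentiableOn ℂ F (Ω ×ˢ {0}ᶜ) ∧ ∀ x ∈ Ω, ∀ z : ℂˣ, F (x, z) = g x z

namespace HolM

variable {Ω : Set Q} {g h : Q → ℂˣ → Mat d}

theorem congr (hg : HolM Ω g) (H : ∀ x ∈ Ω, ∀ z, g x z = h x z) : HolM Ω h := by
  obtain ⟨F, hF, hFg⟩ := hg
  exact ⟨F, hF, fun x hx z => (hFg x hx z).trans (H x hx z)⟩

theorem add (hg : HolM Ω g) (hh : HolM Ω h) : HolM Ω fun x z => g x z + h x z := by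
  obtain ⟨F, hF, hFg⟩ := hg
  obtain ⟨G, hG, hGh⟩ := hh
  exact ⟨fun q => F q + G q, hF.add hG, fun x hx z => by simp only [hFg x hx z, hGh x hx z]⟩

theorem neg (hg : HolM Ω g) : HolM Ω fun x z => -g x z := by
  obtain ⟨F, hF, hFg⟩ := hg
  exact ⟨fun q => -F q, hF.neg, fun x hx z => by simp only [hFg x hx z]⟩

theorem mul (hg : HolM Ω g) (hh : HolM Ω h) : HolM Ω fun x z => g x z * h x z := by
  obtain ⟨F, hF, hFg⟩ := hg
  obtain ⟨G, hG, hGh⟩ := hh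
  exact ⟨fun q => F q * G q, hF.mul hG, fun x hx z => by simp only [hFg x hx z, hGh x hx z]⟩

theorem const (m : Mat d) : HolM Ω fun _ _ => m :=
  ⟨fun _ => m, differentiableOn_const m, fun _ _ _ => rfl⟩

theorem exp (hg : HolM Ω g) : HolM Ω fun x z => NormedSpace.exp (g x z) := by
  obtain ⟨F, hF, hFg⟩ := hg
  exact ⟨fun q => NormedSpace.exp (F q), AlgebraExp.differentiable_exp.comp_differentiableOn hF,
    fun x hx z => by simp only [hFg x hx z]⟩

theorem fderiv_exp (hg : HolM Ω g) (hh : HolM Ω h) :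
    HolM Ω fun x z => fderiv ℂ (NormedSpace.exp : Mat d → Mat d) (g x z) (h x z) := by
  obtain ⟨F, hF, hFg⟩ := hg
  obtain ⟨G, hG, hGh⟩ := hh
  have h1 : Differentiable ℂ (fderiv ℂ (NormedSpace.exp : Mat d → Mat d)) := fun x =>
    (AlgebraExp.analyticAt_exp x).fderiv.differentiableAt
  exact ⟨fun q => fderiv ℂ (NormedSpace.exp : Mat d → Mat d) (F q) (G q),
    (h1.comp_differentiableOn hF).clm_apply hG, fun x hx z => by simp only [hFg x hx z, hGh x hx z]⟩

theorem comp_mul (hg : HolM Ω g) (q : ℂˣ) : HolM Ω fun x z => g x (q * z) := by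
  obtain ⟨F, hF, h⟩ := hg
  exact ⟨fun w => F (w.1, q * w.2), hF.comp (by fun_prop) fun w hw =>
    ⟨hw.1, by simpa using hw.2⟩, fun x hx z => by simpa using h x hx (q * z)⟩

theorem holF (hg : HolM Ω g) (ℓ : Mat d →ₗ[ℂ] ℂ) : HolF Ω fun x z => ℓ (g x z) := by
  obtain ⟨F, hF, h⟩ := hg
  exact holF_iff.2 ⟨fun q => ℓ (F q),
    (LinearMap.toContinuousLinearMap ℓ).differentiable.comp_differentiableOn hF,
    fun x hx z => congrArg ℓ (h x hx z)⟩

theorem holF_apply (hg : HolM Ω g) (i j : Fin d) : HolF Ω fun x z => g x z i j :=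
  hg.holF (Matrix.entryLinearMap ℂ ℂ i j)

variable {E : Type*} [AddCommGroup E] [Module ℂ E] [TopologicalSpace E] [IsTopologicalAddGroup E]
  [ContinuousSMul ℂ E] [FiniteDimensional ℂ E]

theorem of_family {c : Q → Loop E} (hc : IsHolFamily Ω c) (T : E →ₗ[ℂ] Mat d) :
    HolM Ω fun x z => T (ev (c x) z) := by
  choose F hF h using fun i => hc ((Module.finBasis ℂ E).coord i)
  refine ⟨fun q => ∑ i, F i q • T (Module.finBasis ℂ E i),
    DifferentiableOn.fun_sum fun i _ => (hF i).smul_const _, fun x hx z => ?_⟩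
  simp only [h _ x hx z]
  rw [← sum_coord (ev (c x) z), map_sum]
  simp only [map_smul, sum_coord]

theorem isHolFamily (hg : HolM Ω g) {c : Q → Loop E} (S : Mat d →ₗ[ℂ] E)
    (h : ∀ x ∈ Ω, ∀ z, ev (c x) z = S (g x z)) : IsHolFamily Ω c :=
  isHolFamily_iff.2 fun ℓ => (hg.holF (ℓ ∘ₗ S)).congr' fun x hx z => by rw [h x hx z]; rfl

end HolM

/-- Holomorphic matrix valued loops. -/
def HolMU (g : ℂˣ → Mat d) : Prop := HolM (univ : Set ℂ) fun _ => g

theorem HolMU.holU {g : ℂˣ → Mat d} (hg : HolMU g) (ℓ : Mat d →ₗ[ℂ] ℂ) : HolU fun z => ℓ (g z) :=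
  (HolM.holF hg ℓ).holU (mem_univ (0 : ℂ))

theorem isHolFamily_const {E : Type*} [AddCommGroup E] [Module ℂ E] [TopologicalSpace E]
    [IsTopologicalAddGroup E] [ContinuousSMul ℂ E] {Ω : Set Q} (X : Loop E) :
    IsHolFamily Ω fun _ => X :=
  isHolFamily_iff.2 fun ℓ => HolF.of_holU (ev_spec X ℓ)

end MatrixFamilies

/-! ### The adjoint action -/

section Adjoint

variable {d : ℕ} (𝔤 : LieSubalgebra ℂ (Mat d))

/-- A linear projection of matrices onto the Lie algebra. -/
def toLie : Mat d →ₗ[ℂ] 𝔤 :=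
  (LinearMap.exists_leftInverse_of_injective (𝔤.toSubmodule.subtype)
    (LinearMap.ker_eq_bot.2 Subtype.val_injective)).choose

variable {𝔤}

@[simp] theorem toLie_coe (x : 𝔤) : toLie 𝔤 (x : Mat d) = x :=
  LinearMap.congr_fun (LinearMap.exists_leftInverse_of_injective (𝔤.toSubmodule.subtype)
    (LinearMap.ker_eq_bot.2 Subtype.val_injective)).choose_spec x

variable (𝔤)

/-- The invertible matrices which normalize the Lie algebra. -/
def adGroup : Subgroup (Mat d)ˣ where
  carrier := {g | (∀ x ∈ 𝔤, (g : Mat d) * x * (g⁻¹ : (Mat d)ˣ) ∈ 𝔤) ∧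
    ∀ x ∈ 𝔤, ((g⁻¹ : (Mat d)ˣ) : Mat d) * x * g ∈ 𝔤}
  one_mem' := by simp
  mul_mem' := by
    rintro g h ⟨hg, hg'⟩ ⟨hh, hh'⟩
    refine ⟨fun x hx => ?_, fun x hx => ?_⟩
    · simpa [mul_assoc] using hg _ (hh x hx)
    · simpa [mul_assoc] using hh' _ (hg' x hx)
  inv_mem' := by
    rintro g ⟨hg, hg'⟩
    exact ⟨by simpa using hg', by simpa using hg⟩

variable {𝔤}

/-- The adjoint action of the normalizer on the Lie algebra. -/
def Ad : adGroup 𝔤 →* Module.End ℂ 𝔤 where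
  toFun g :=
    { toFun := fun x => ⟨(g : (Mat d)ˣ) * x * ((g : (Mat d)ˣ)⁻¹ : (Mat d)ˣ), g.2.1 x x.2⟩
      map_add' := fun x y => Subtype.ext (by simp [mul_add, add_mul])
      map_smul' := fun a x => Subtype.ext (by simp) }
  map_one' := by ext x; simp
  map_mul' g h := by ext x; simp [mul_assoc]

theorem coe_Ad (g : adGroup 𝔤) (x : 𝔤) :
    ((Ad g x : 𝔤) : Mat d) = ((g : (Mat d)ˣ) : Mat d) * x * ((g : (Mat d)ˣ)⁻¹ : (Mat d)ˣ) := rfl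

theorem coe_lie (x y : 𝔤) : ((⁅x, y⁆ : 𝔤) : Mat d) = (x : Mat d) * y - y * x := rfl

/-- The exponential as an invertible matrix. -/
def expU (m : Mat d) : (Mat d)ˣ :=
  ⟨NormedSpace.exp m, NormedSpace.exp (-m), AlgebraExp.exp_mul_exp_neg m,
    AlgebraExp.exp_neg_mul_exp m⟩

theorem conj_exp_mem {m : Mat d} (hm : m ∈ 𝔤) {x : Mat d} (hx : x ∈ 𝔤) :
    NormedSpace.exp m * x * NormedSpace.exp (-m) ∈ 𝔤 :=
  AlgebraExp.exp_conj_mem 𝔤.toSubmodule (fun y hy => 𝔤.lie_mem hm hy) hx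

/-- The exponential of an element of the Lie algebra. -/
def expG (x : 𝔤) : adGroup 𝔤 :=
  ⟨expU x, fun _ hy => conj_exp_mem x.2 hy, fun _ hy => by
    have := conj_exp_mem (𝔤.neg_mem x.2) hy
    rwa [neg_neg] at this⟩

theorem coe_expG (x : 𝔤) : ((expG x : (Mat d)ˣ) : Mat d) = expm x := rfl

theorem coe_expG_inv (x : 𝔤) : (((expG x : (Mat d)ˣ)⁻¹ : (Mat d)ˣ) : Mat d) = expm (-x) := rfl

theorem expG_inv (x : 𝔤) : (expG x)⁻¹ = expG (-x) := Subtype.ext (Units.ext rfl)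

theorem expG_zero : expG (0 : 𝔤) = 1 :=
  Subtype.ext (Units.ext (by rw [coe_expG, expm]; exact NormedSpace.exp_zero))

theorem expG_add {x y : 𝔤} (h : ⁅x, y⁆ = 0) : expG (x + y) = expG x * expG y := by
  refine Subtype.ext (Units.ext ?_)
  have hc : Commute (x : Mat d) (y : Mat d) := by
    have := congrArg Subtype.val h
    rw [coe_lie] at this
    exact sub_eq_zero.1 this
  exact Matrix.exp_add_of_commute _ _ hc

/-- A subspace preserved by `ad x` is preserved by `Ad (exp x)`. -/
theorem Ad_expG_mem (S : Submodule ℂ 𝔤) {x : 𝔤} (hx : ∀ y ∈ S, ⁅x, y⁆ ∈ S) {y : 𝔤} (hy : y ∈ S) :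
    Ad (expG x) y ∈ S := by
  have h : NormedSpace.exp (x : Mat d) * (y : Mat d) * NormedSpace.exp (-(x : Mat d)) ∈
      S.map 𝔤.toSubmodule.subtype := by
    refine AlgebraExp.exp_conj_mem _ ?_ ⟨y, hy, rfl⟩
    rintro _ ⟨u, hu, rfl⟩
    exact ⟨⁅x, u⁆, hx u hu, rfl⟩
  obtain ⟨u, hu, h⟩ := h
  have : u = Ad (expG x) y := Subtype.ext h
  exact this ▸ hu

theorem Ad_expG_of_lie_eq_zero {x y : 𝔤} (h : ⁅x, y⁆ = 0) : Ad (expG x) y = y := by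
  refine Subtype.ext ?_
  have hc : Commute (x : Mat d) (y : Mat d) := by
    have := congrArg Subtype.val h
    rw [coe_lie] at this
    exact sub_eq_zero.1 this
  have h2 : Commute (NormedSpace.exp (x : Mat d)) (y : Mat d) := hc.exp_left
  rw [coe_Ad, coe_expG, coe_expG_inv, expm, h2.eq, mul_assoc, expm]
  exact (congrArg _ (AlgebraExp.exp_mul_exp_neg (x : Mat d))).trans (mul_one _)

/-- The adjoint action of a one parameter group. -/
theorem hasDerivAt_Ad_expG (x y : 𝔤) (t : ℂ) :
    HasDerivAt (fun t : ℂ => ((Ad (expG (t • x)) y : 𝔤) : Mat d))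
      ((⁅x, Ad (expG (t • x)) y⁆ : 𝔤) : Mat d) t := by
  have h := ((AlgebraExp.hasDerivAt_exp_smul' (x : Mat d) t).mul_const (y : Mat d)).mul
    (AlgebraExp.hasDerivAt_exp_neg_smul' (x : Mat d) t)
  have h3 : ∀ s : ℂ, NormedSpace.exp (s • (x : Mat d)) * y * NormedSpace.exp (-(s • (x : Mat d))) =
      ((Ad (expG (s • x)) y : 𝔤) : Mat d) := fun s => rfl
  refine h.congr_deriv ?_
  rw [coe_lie, ← h3]
  noncomm_ring

theorem lie_Ad_expG (x y : 𝔤) (t : ℂ) : ⁅x, Ad (expG (t • x)) y⁆ = Ad (expG (t • x)) ⁅x, y⁆ := by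
  have hc : Commute (x : Mat d) (NormedSpace.exp (t • (x : Mat d))) :=
    ((Commute.refl (x : Mat d)).smul_right t).exp_right
  have hc' : Commute (x : Mat d) (NormedSpace.exp (-(t • (x : Mat d)))) :=
    ((Commute.refl (x : Mat d)).smul_right t).neg_right.exp_right
  refine Subtype.ext ?_
  have h3 : ∀ y : 𝔤, ((Ad (expG (t • x)) y : 𝔤) : Mat d) =
    NormedSpace.exp (t • (x : Mat d)) * y * NormedSpace.exp (-(t • (x : Mat d))) := fun s => rfl
  rw [coe_lie, h3, h3, coe_lie, mul_sub, sub_mul, ← mul_assoc, ← mul_assoc, hc.eq, mul_assoc _ _ (x : Mat d),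
    ← hc'.eq]
  simp only [mul_assoc]

theorem hasDerivAt_dual (ℓ : 𝔤 →ₗ[ℂ] ℂ) {y : ℂ → 𝔤} {y' : 𝔤} {t : ℂ}
    (h : HasDerivAt (fun t => (y t : Mat d)) (y' : Mat d) t) :
    HasDerivAt (fun t => ℓ (y t)) (ℓ y') t := by
  have h1 := (LinearMap.toContinuousLinearMap (ℓ ∘ₗ toLie 𝔤)).hasFDerivAt.comp_hasDerivAt t h
  refine (h1.congr_deriv ?_).congr_of_eventuallyEq (Eventually.of_forall fun s => ?_)
  · exact congrArg ℓ (toLie_coe y')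
  · exact (congrArg ℓ (toLie_coe (y s))).symm

/-- The action of `Ad (exp x)` modulo an `ad x`-stable subspace. -/
theorem Ad_expG_sub_mem (S : Submodule ℂ 𝔤) {x : 𝔤} (hx : ∀ y ∈ S, ⁅x, y⁆ ∈ S) {y : 𝔤}
    (hy : ⁅x, y⁆ ∈ S) : Ad (expG x) y - y ∈ S := by
  rw [← Subspace.forall_mem_dualAnnihilator_apply_eq_zero_iff]
  intro ℓ hℓ
  rw [Submodule.mem_dualAnnihilator] at hℓ
  have hd : ∀ t : ℂ, HasDerivAt (fun t : ℂ => ℓ (Ad (expG (t • x)) y)) 0 t := by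
    intro t
    refine (hasDerivAt_dual ℓ (hasDerivAt_Ad_expG x y t)).congr_deriv ?_
    rw [lie_Ad_expG]
    exact hℓ _ (Ad_expG_mem S (fun u hu => by
      rw [smul_lie]; exact S.smul_mem _ (hx u hu)) hy)
  have := is_const_of_deriv_eq_zero (fun t => (hd t).differentiableAt) (fun t => (hd t).deriv) 1 0
  simp only [one_smul, zero_smul, expG_zero, map_one, Module.End.one_apply] at this
  rw [map_sub, this, sub_self]

theorem form_Ad_expG {B : LinearMap.BilinForm ℂ 𝔤} (hinv : ∀ x y z : 𝔤, B ⁅x, y⁆ z = B x ⁅y, z⁆)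
    (x y z : 𝔤) : B (Ad (expG x) y) (Ad (expG x) z) = B y z := by
  have hd : ∀ t : ℂ, HasDerivAt (fun t : ℂ => B (Ad (expG (t • x)) y) (Ad (expG (t • x)) z)) 0 t := by
    intro t
    have h1 := HasDerivAt.fun_sum (u := Finset.univ) fun i _ =>
      (hasDerivAt_dual ((Module.finBasis ℂ 𝔤).coord i) (hasDerivAt_Ad_expG x y t)).mul
        (hasDerivAt_dual (B (Module.finBasis ℂ 𝔤 i)) (hasDerivAt_Ad_expG x z t))
    refine (h1.congr_deriv ?_).congr_of_eventuallyEq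
      (Eventually.of_forall fun s => bilin_eq_sum B _ _)
    rw [Finset.sum_add_distrib, ← bilin_eq_sum, ← bilin_eq_sum, ← hinv, ← lie_skew x, map_neg,
      LinearMap.neg_apply, neg_add_cancel]
  have := is_const_of_deriv_eq_zero (fun t => (hd t).differentiableAt) (fun t => (hd t).deriv) 1 0
  simpa only [one_smul, zero_smul, expG_zero, map_one, Module.End.one_apply] using this

/-- The logarithmic derivative of the exponential map lies in the Lie algebra. -/
theorem exp_neg_mul_fderiv_exp_mem (Y w : 𝔤) : NormedSpace.exp (-(Y : Mat d)) *
    fderiv ℂ (NormedSpace.exp : Mat d → Mat d) Y w ∈ 𝔤 :=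
  AlgebraExp.exp_neg_mul_fderiv_mem 𝔤.toSubmodule (fun _ hy => 𝔤.lie_mem Y.2 hy) w.2

/-- The logarithmic derivative `exp(-Y) d(exp)_Y w` of the exponential map. -/
def dlog (Y : 𝔤) : 𝔤 →ₗ[ℂ] 𝔤 where
  toFun w := ⟨_, exp_neg_mul_fderiv_exp_mem Y w⟩
  map_add' w w' := Subtype.ext (by simp [mul_add])
  map_smul' a w := Subtype.ext (by simp)

theorem coe_dlog (Y w : 𝔤) : ((dlog Y w : 𝔤) : Mat d) = expm (-Y) *
    fderiv ℂ (NormedSpace.exp : Mat d → Mat d) Y w := rfl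

theorem dlog_mem (S : Submodule ℂ 𝔤) {Y : 𝔤} (hY : ∀ y ∈ S, ⁅Y, y⁆ ∈ S) {w : 𝔤} (hw : w ∈ S) :
    dlog Y w ∈ S := by
  have h := AlgebraExp.exp_neg_mul_fderiv_mem (S.map 𝔤.toSubmodule.subtype) (Y := (Y : Mat d))
    (w := (w : Mat d)) (by
      rintro _ ⟨u, hu, rfl⟩
      exact ⟨⁅Y, u⁆, hY u hu, rfl⟩) ⟨w, hw, rfl⟩
  obtain ⟨u, hu, h⟩ := h
  have : u = dlog Y w := Subtype.ext h
  exact this ▸ hu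

theorem hasDerivAt_expm (Y w : 𝔤) :
    HasDerivAt (fun t : ℂ => expm (Y + t • w)) (expm Y * (dlog Y w : 𝔤)) 0 := by
  rw [coe_dlog, ← mul_assoc]
  have h1 : expm Y * expm (-Y) = 1 := AlgebraExp.exp_mul_exp_neg (Y : Mat d)
  rw [h1, one_mul]
  exact AlgebraExp.hasDerivAt_exp_add_smul (Y : Mat d) (w : Mat d)

/-- The chain rule for the exponential map along a differentiable curve. -/
theorem hasDerivAt_expm_comp {Y : ℂ → 𝔤} {Y' : 𝔤} {t : ℂ}
    (h : HasDerivAt (fun t => (Y t : Mat d)) (Y' : Mat d) t) :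
    HasDerivAt (fun t => expm (Y t)) (expm (Y t) * (dlog (Y t) Y' : 𝔤)) t := by
  rw [coe_dlog, ← mul_assoc]
  have h1 : expm (Y t) * expm (-Y t) = 1 := AlgebraExp.exp_mul_exp_neg (Y t : Mat d)
  rw [h1, one_mul]
  exact ((AlgebraExp.differentiable_exp (Y t : Mat d)).hasFDerivAt).comp_hasDerivAt t h

theorem expm_Ad (g : adGroup 𝔤) (Y : 𝔤) : expm (Ad g Y) =
    ((g : (Mat d)ˣ) : Mat d) * expm Y * ((g : (Mat d)ˣ)⁻¹ : (Mat d)ˣ) :=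
  Matrix.exp_units_conj (g : (Mat d)ˣ) (Y : Mat d)

theorem expG_Ad (g : adGroup 𝔤) (Y : 𝔤) : expG (Ad g Y) = g * expG Y * g⁻¹ :=
  Subtype.ext (Units.ext (expm_Ad g Y))

theorem expm_mul_cancel {Y : 𝔤} {m m' : Mat d} (h : expm Y * m = expm Y * m') : m = m' := by
  have h1 : expm (-Y) * expm Y = 1 := AlgebraExp.exp_neg_mul_exp (Y : Mat d)
  have := congrArg (expm (-Y) * ·) h
  simpa only [← mul_assoc, h1, one_mul] using this

theorem dlog_Ad (g : adGroup 𝔤) (Y w : 𝔤) : dlog (Ad g Y) (Ad g w) = Ad g (dlog Y w) := by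
  have h1 := hasDerivAt_expm (Ad g Y) (Ad g w)
  have h2 : HasDerivAt (fun t : ℂ => expm (Ad g Y + t • Ad g w)) (((g : (Mat d)ˣ) : Mat d) *
      (expm Y * (dlog Y w : 𝔤)) * ((g : (Mat d)ˣ)⁻¹ : (Mat d)ˣ)) 0 := by
    have := ((hasDerivAt_expm Y w).const_mul ((g : (Mat d)ˣ) : Mat d)).mul_const
      (((g : (Mat d)ˣ)⁻¹ : (Mat d)ˣ) : Mat d)
    refine this.congr_of_eventuallyEq (Eventually.of_forall fun t => ?_)
    change expm (Ad g Y + t • Ad g w) = _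
    rw [← map_smul, ← map_add, expm_Ad]
  refine Subtype.ext (expm_mul_cancel (Y := Ad g Y) ?_)
  rw [h1.unique h2, expm_Ad, coe_Ad]
  simp [mul_assoc]

theorem dlog_lie (κ Y : 𝔤) : dlog Y ⁅κ, Y⁆ = Ad (expG Y)⁻¹ κ - κ := by
  have h0 := hasDerivAt_Ad_expG κ Y 0
  simp only [zero_smul, expG_zero, map_one, Module.End.one_apply] at h0
  have h1 := hasDerivAt_expm_comp (Y := fun t : ℂ => Ad (expG (t • κ)) Y) h0
  simp only [zero_smul, expG_zero, map_one, Module.End.one_apply] at h1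
  have h2 : HasDerivAt (fun t : ℂ => expm (Ad (expG (t • κ)) Y))
      ((κ : Mat d) * expm Y - expm Y * κ) 0 := by
    have := ((AlgebraExp.hasDerivAt_exp_smul' (κ : Mat d) 0).mul_const (expm Y)).mul
      (AlgebraExp.hasDerivAt_exp_neg_smul' (κ : Mat d) 0)
    refine (this.congr_deriv ?_).congr_of_eventuallyEq (Eventually.of_forall fun t => ?_)
    · simp [sub_eq_add_neg]
    · exact expm_Ad _ _
  refine Subtype.ext (expm_mul_cancel (Y := Y) ?_)
  rw [h1.unique h2, expG_inv, AddSubgroupClass.coe_sub, coe_Ad, coe_expG, coe_expG_inv, neg_neg]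
  have h3 : expm Y * expm (-Y) = 1 := AlgebraExp.exp_mul_exp_neg (Y : Mat d)
  rw [mul_sub, ← mul_assoc, ← mul_assoc, h3, one_mul]

theorem dlog_of_lie_eq_zero {Y w : 𝔤} (h : ⁅Y, w⁆ = 0) : dlog Y w = w := by
  have h1 := hasDerivAt_expm Y w
  have h2 : HasDerivAt (fun t : ℂ => expm (Y + t • w)) (expm Y * w) 0 := by
    have := (AlgebraExp.hasDerivAt_exp_smul (w : Mat d) 0).const_mul (expm Y)
    refine (this.congr_deriv (by simp)).congr_of_eventuallyEq (Eventually.of_forall fun t => ?_)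
    have h4 : expG (Y + t • w) = expG Y * expG (t • w) := expG_add (by rw [lie_smul, h, smul_zero])
    exact congrArg (fun g : adGroup 𝔤 => ((g : (Mat d)ˣ) : Mat d)) h4
  exact Subtype.ext (expm_mul_cancel (h1.unique h2))

end Adjoint

end LoopReduction

namespace LoopReduction

open scoped Matrix.Norms.Operator

/-! ### Loop groups -/

section LoopGroup

variable {d : ℕ} {𝔤 : LieSubalgebra ℂ (Mat d)}

/-- The matrix of an element of the normalizer. -/
def gm (g : adGroup 𝔤) : Mat d := ((g : (Mat d)ˣ) : Mat d)

theorem gm_mul (g h : adGroup 𝔤) : gm (g * h) = gm g * gm h := rfl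

theorem gm_one : gm (1 : adGroup 𝔤) = 1 := rfl

theorem gm_mul_inv (g : adGroup 𝔤) : gm g * gm g⁻¹ = 1 := (g : (Mat d)ˣ).mul_inv

theorem gm_inv_mul (g : adGroup 𝔤) : gm g⁻¹ * gm g = 1 := (g : (Mat d)ˣ).inv_mul

theorem gm_inv (g : adGroup 𝔤) : gm g⁻¹ = (gm g)⁻¹ := Matrix.coe_units_inv _

theorem gm_expG (x : 𝔤) : gm (expG x) = expm x := rfl

theorem coe_Ad_gm (g : adGroup 𝔤) (x : 𝔤) : ((Ad g x : 𝔤) : Mat d) = gm g * x * gm g⁻¹ := rfl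

theorem ev_mem_linear {E : Type*} [AddCommGroup E] [Module ℂ E] [TopologicalSpace E]
    [IsTopologicalAddGroup E] [ContinuousSMul ℂ E] [FiniteDimensional ℂ E] (X : Loop E)
    (T : E →ₗ[ℂ] Mat d) : HolMU fun z => T (ev X z) :=
  HolM.of_family (isHolFamily_const X) T

theorem holMU_coe (X : Loop 𝔤) : HolMU fun z => ((ev X z : 𝔤) : Mat d) :=
  ev_mem_linear X 𝔤.toSubmodule.subtype

/-- The loop in the Lie algebra given by a holomorphic matrix valued function. -/
def lieLoop (g : ℂˣ → 𝔤) (h : HolMU fun z => (g z : Mat d)) : Loop 𝔤 :=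
  Loop.ofHol g fun ℓ => (h.holU (ℓ ∘ₗ toLie 𝔤)).congr fun z => congrArg ℓ (toLie_coe (g z))

@[simp] theorem ev_lieLoop (g : ℂˣ → 𝔤) (h) (z : ℂˣ) : ev (lieLoop g h) z = g z := rfl

variable (𝔤) in
/-- Holomorphic loops in the normalizer. -/
def LG : Subgroup (ℂˣ → adGroup 𝔤) where
  carrier := {g | HolMU (fun z => gm (g z)) ∧ HolMU fun z => gm (g z)⁻¹}
  one_mem' := ⟨HolM.const _, HolM.const _⟩
  mul_mem' := by
    rintro g h ⟨hg, hg'⟩ ⟨hh, hh'⟩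
    refine ⟨HolM.mul hg hh, (HolM.mul hh' hg').congr fun _ _ z => ?_⟩
    simp [mul_inv_rev, gm_mul]
  inv_mem' := by
    rintro g ⟨hg, hg'⟩
    exact ⟨hg', by simpa using hg⟩

/-- The value of a loop in the normalizer. -/
def atG (g : LG 𝔤) (z : ℂˣ) : adGroup 𝔤 := (g : ℂˣ → adGroup 𝔤) z

theorem atG_mul (g h : LG 𝔤) (z : ℂˣ) : atG (g * h) z = atG g z * atG h z := rfl

theorem atG_inv (g : LG 𝔤) (z : ℂˣ) : atG g⁻¹ z = (atG g z)⁻¹ := rfl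

theorem LG.ext {g h : LG 𝔤} (H : ∀ z, atG g z = atG h z) : g = h := Subtype.ext (funext H)

/-- The pointwise adjoint action of loops. -/
def AdL : LG 𝔤 →* Module.End ℂ (Loop 𝔤) where
  toFun g :=
    { toFun := fun X => lieLoop (fun z => Ad (atG g z) (ev X z))
        (HolM.mul (HolM.mul g.2.1 (holMU_coe X)) g.2.2)
      map_add' := fun X Y => loop_ext fun z => map_add (Ad (atG g z)) _ _
      map_smul' := fun a X => loop_ext fun z => map_smul (Ad (atG g z)) _ _ }
  map_one' := LinearMap.ext fun X => loop_ext fun z => LinearMap.congr_fun (map_one Ad) _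
  map_mul' g h := LinearMap.ext fun X => loop_ext fun z =>
    LinearMap.congr_fun (map_mul Ad (atG g z) (atG h z)) _

theorem ev_AdL (g : LG 𝔤) (X : Loop 𝔤) (z : ℂˣ) : ev (AdL g X) z = Ad (atG g z) (ev X z) := rfl

theorem AdL_mul_apply (g h : LG 𝔤) (X : Loop 𝔤) : AdL (g * h) X = AdL g (AdL h X) := by
  rw [map_mul]
  rfl

theorem AdL_inv_apply_self (g : LG 𝔤) (X : Loop 𝔤) : AdL g⁻¹ (AdL g X) = X := by
  rw [← AdL_mul_apply, inv_mul_cancel, map_one]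
  rfl

theorem AdL_self_apply_inv (g : LG 𝔤) (X : Loop 𝔤) : AdL g (AdL g⁻¹ X) = X := by
  rw [← AdL_mul_apply, mul_inv_cancel, map_one]
  rfl

/-- The exponential of a loop. -/
def expL (X : Loop 𝔤) : LG 𝔤 :=
  ⟨fun z => expG (ev X z), (HolM.exp (holMU_coe X)), HolM.exp (HolM.neg (holMU_coe X))⟩

theorem expL_at (X : Loop 𝔤) (z : ℂˣ) : atG (expL X) z = expG (ev X z) := rfl

theorem expL_add {X Y : Loop 𝔤} (h : ∀ z, ⁅ev X z, ev Y z⁆ = 0) :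
    expL (X + Y) = expL X * expL Y := LG.ext fun z => expG_add (h z)

theorem expL_zero : expL (0 : Loop 𝔤) = 1 := LG.ext fun _ => expG_zero

theorem expL_inv (X : Loop 𝔤) : (expL X)⁻¹ = expL (-X) := LG.ext fun _ => expG_inv _

theorem expL_AdL (g : LG 𝔤) (X : Loop 𝔤) : expL (AdL g X) = g * expL X * g⁻¹ :=
  LG.ext fun z => expG_Ad (atG g z) (ev X z)

/-- The shift automorphism of the loop group. -/
def shiftG (p : ℂˣ) : LG 𝔤 →* LG 𝔤 where
  toFun g := ⟨fun z => atG g (p * z), HolM.comp_mul g.2.1 p, HolM.comp_mul g.2.2 p⟩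
  map_one' := rfl
  map_mul' _ _ := rfl

theorem shiftG_at (p : ℂˣ) (g : LG 𝔤) (z : ℂˣ) : atG (shiftG p g) z = atG g (p * z) := rfl

theorem shift_AdL (p : ℂˣ) (g : LG 𝔤) (X : Loop 𝔤) :
    shift p (AdL g X) = AdL (shiftG p g) (shift p X) := rfl

theorem shiftG_expL (p : ℂˣ) (X : Loop 𝔤) : shiftG p (expL X) = expL (shift p X) := rfl

/-- The logarithmic derivative of the exponential map on loops. -/
def dlogL (Y : Loop 𝔤) : Loop 𝔤 →ₗ[ℂ] Loop 𝔤 where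
  toFun w := lieLoop (fun z => dlog (ev Y z) (ev w z))
    (HolM.mul (HolM.exp (HolM.neg (holMU_coe Y))) (HolM.fderiv_exp (holMU_coe Y) (holMU_coe w)))
  map_add' w w' := loop_ext fun z => map_add (dlog (ev Y z)) _ _
  map_smul' a w := loop_ext fun z => map_smul (dlog (ev Y z)) _ _

theorem dlogL_AdL (g : LG 𝔤) (Y w : Loop 𝔤) : dlogL (AdL g Y) (AdL g w) = AdL g (dlogL Y w) :=
  loop_ext fun z => dlog_Ad (atG g z) _ _

/-- The pointwise commutator of loops. -/
def lieL (X Y : Loop 𝔤) : Loop 𝔤 :=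
  lieLoop (fun z => ⁅ev X z, ev Y z⁆)
    ((HolM.add (HolM.mul (holMU_coe X) (holMU_coe Y))
      (HolM.neg (HolM.mul (holMU_coe Y) (holMU_coe X)))).congr fun _ _ z => by
        rw [coe_lie, sub_eq_add_neg])

theorem dlogL_lieL (κ Y : Loop 𝔤) : dlogL Y (lieL κ Y) = AdL (expL Y)⁻¹ κ - κ :=
  loop_ext fun z => dlog_lie _ _

/-! #### Families -/

section

variable {Q : Type*} [NormedAddCommGroup Q] [NormedSpace ℂ Q] {Ω : Set Q}

theorem HolM.of_lie_family {c : Q → Loop 𝔤} (hc : IsHolFamily Ω c) :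
    HolM Ω fun x z => ((ev (c x) z : 𝔤) : Mat d) := HolM.of_family hc 𝔤.toSubmodule.subtype

theorem isHolFamily_of_coe {c : Q → Loop 𝔤} (h : HolM Ω fun x z => ((ev (c x) z : 𝔤) : Mat d)) :
    IsHolFamily Ω c := h.isHolFamily (toLie 𝔤) fun _ _ _ => (toLie_coe _).symm

/-- Holomorphic families of loops in the normalizer. -/
def HolG (Ω : Set Q) (g : Q → LG 𝔤) : Prop :=
  HolM Ω (fun x z => gm (atG (g x) z)) ∧ HolM Ω fun x z => gm (atG (g x) z)⁻¹

theorem HolG.mul {g h : Q → LG 𝔤} (hg : HolG Ω g) (hh : HolG Ω h) :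
    HolG Ω fun x => g x * h x :=
  ⟨hg.1.mul hh.1, (hh.2.mul hg.2).congr fun _ _ z => by rw [atG_mul, mul_inv_rev, gm_mul]⟩

theorem HolG.inv {g : Q → LG 𝔤} (hg : HolG Ω g) : HolG Ω fun x => (g x)⁻¹ :=
  ⟨hg.2, by simpa [atG_inv] using hg.1⟩

theorem HolG.shiftG {g : Q → LG 𝔤} (hg : HolG Ω g) (p : ℂˣ) : HolG Ω fun x => shiftG p (g x) :=
  ⟨hg.1.comp_mul p, hg.2.comp_mul p⟩

theorem HolG.expL {c : Q → Loop 𝔤} (hc : IsHolFamily Ω c) : HolG Ω fun x => expL (c x) :=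
  ⟨(HolM.of_lie_family hc).exp, (HolM.of_lie_family hc).neg.exp⟩

theorem HolG.isHolFamily_AdL {g : Q → LG 𝔤} (hg : HolG Ω g) {c : Q → Loop 𝔤}
    (hc : IsHolFamily Ω c) : IsHolFamily Ω fun x => AdL (g x) (c x) :=
  isHolFamily_of_coe ((hg.1.mul (HolM.of_lie_family hc)).mul hg.2)

end

section LinearFamilies

variable {Q : Type*} [NormedAddCommGroup Q] [NormedSpace ℂ Q] {Ω : Set Q}
  {E : Type*} [AddCommGroup E] [Module ℂ E] [TopologicalSpace E] [IsTopologicalAddGroup E]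
  [ContinuousSMul ℂ E] {E' : Type*} [AddCommGroup E'] [Module ℂ E'] [TopologicalSpace E']
  [IsTopologicalAddGroup E'] [ContinuousSMul ℂ E']

theorem IsHolFamily.add {c c' : Q → Loop E} (hc : IsHolFamily Ω c) (hc' : IsHolFamily Ω c') :
    IsHolFamily Ω fun x => c x + c' x :=
  isHolFamily_iff.2 fun ℓ => ((isHolFamily_iff.1 hc ℓ).add (isHolFamily_iff.1 hc' ℓ)).congr
    fun i => (map_add ℓ _ _).symm

theorem IsHolFamily.map [FiniteDimensional ℂ E] [T2Space E] {c : Q → Loop E}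
    (hc : IsHolFamily Ω c) (T : E →ₗ[ℂ] E') : IsHolFamily Ω fun x => Loop.map T (c x) :=
  fun ℓ => hc (ℓ ∘ₗ T)

theorem IsHolFamily.shift {c : Q → Loop E} (hc : IsHolFamily Ω c) (p : ℂˣ) :
    IsHolFamily Ω fun x => shift p (c x) :=
  isHolFamily_iff.2 fun ℓ => (isHolFamily_iff.1 hc ℓ).comp_mul p

theorem IsHolFamily.smul {c : Q → Loop E} (hc : IsHolFamily Ω c) {a : Q → ℂ}
    (ha : DifferentiableOn ℂ a Ω) : IsHolFamily Ω fun x => a x • c x :=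
  isHolFamily_iff.2 fun ℓ => ((HolF.of_differentiableOn ha).mul (isHolFamily_iff.1 hc ℓ)).congr
    fun i => (map_smul ℓ _ _).symm

theorem IsHolFamily.comp {Q' : Type*} [NormedAddCommGroup Q'] [NormedSpace ℂ Q'] {Ω' : Set Q'}
    {c : Q → Loop E} (hc : IsHolFamily Ω c) {k : Q' → Q} (hk : DifferentiableOn ℂ k Ω')
    (hm : MapsTo k Ω' Ω) : IsHolFamily Ω' fun x => c (k x) := by
  intro ℓ
  obtain ⟨F, hF, h⟩ := hc ℓ
  exact ⟨fun w => F (k w.1, w.2),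
    hF.comp ((hk.comp differentiableOn_fst fun w hw => hw.1).prodMk differentiableOn_snd)
      fun w hw => ⟨hm hw.1, hw.2⟩, fun x hx z => h (k x) (hm hx) z⟩

end LinearFamilies

/-! #### Invariance of the pairing -/

theorem pair_AdL_expL {B : LinearMap.BilinForm ℂ 𝔤} (hinv : ∀ x y z : 𝔤, B ⁅x, y⁆ z = B x ⁅y, z⁆)
    (U X Y : Loop 𝔤) : pair B (AdL (expL U) X) (AdL (expL U) Y) = pair B X Y := by
  unfold pair
  congr 1
  funext z
  exact form_Ad_expG hinv _ _ _

/-- Loops in the normalizer whose adjoint action preserves the pairing. -/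
def isoG (B : LinearMap.BilinForm ℂ 𝔤) : Subgroup (LG 𝔤) where
  carrier := {g | ∀ X Y, pair B (AdL g X) (AdL g Y) = pair B X Y}
  one_mem' := fun X Y => by rw [map_one]; rfl
  mul_mem' := fun {g h} hg hh X Y => by rw [AdL_mul_apply, AdL_mul_apply, hg, hh]
  inv_mem' := fun {g} hg X Y => by
    rw [← hg (AdL g⁻¹ X), AdL_self_apply_inv, AdL_self_apply_inv]

theorem expL_mem_isoG {B : LinearMap.BilinForm ℂ 𝔤} (hinv : ∀ x y z : 𝔤, B ⁅x, y⁆ z = B x ⁅y, z⁆)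
    (U : Loop 𝔤) : expL U ∈ isoG B := pair_AdL_expL hinv U

theorem pair_AdL_left {B : LinearMap.BilinForm ℂ 𝔤} {g : LG 𝔤} (hg : g ∈ isoG B) (X Y : Loop 𝔤) :
    pair B (AdL g X) Y = pair B X (AdL g⁻¹ Y) := by
  rw [← hg X, AdL_self_apply_inv]

theorem pair_AdL_inv_left {B : LinearMap.BilinForm ℂ 𝔤} {g : LG 𝔤} (hg : g ∈ isoG B)
    (X Y : Loop 𝔤) : pair B (AdL g⁻¹ X) Y = pair B X (AdL g Y) := by
  rw [← hg, AdL_self_apply_inv]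

theorem shiftG_mem_isoG {B : LinearMap.BilinForm ℂ 𝔤} {g : LG 𝔤} (hg : g ∈ isoG B) (p : ℂˣ) :
    shiftG p g ∈ isoG B := fun X Y => by
  have h := hg (shift p⁻¹ X) (shift p⁻¹ Y)
  rw [← pair_shift B p, shift_AdL, shift_AdL, shift_shift_inv, shift_shift_inv, pair_shift] at h
  exact h

end LoopGroup

end LoopReduction

namespace LoopReduction

open scoped Matrix.Norms.Operator

/-! ### Gauge calculus on factorized loops -/

section Calculus

variable {d : ℕ} {𝔤 : LieSubalgebra ℂ (Matrix (Fin d) (Fin d) ℂ)} [LieAlgebra.IsSemisimple ℂ 𝔤]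
  {H : LieSubalgebra ℂ 𝔤} [H.IsCartanSubalgebra]

/-- Loops in a subspace as loops in the Lie algebra. -/
def jS (S : Submodule ℂ 𝔤) : Loop S →ₗ[ℂ] Loop 𝔤 := Loop.map S.subtype

theorem ev_jS (S : Submodule ℂ 𝔤) (X : Loop S) (z : ℂˣ) : ev (jS S X) z = ((ev X z : S) : 𝔤) := rfl

/-- Loops in the Cartan subalgebra as loops in the Lie algebra. -/
def jH : Loop H →ₗ[ℂ] Loop 𝔤 := Loop.map (H.toSubmodule.subtype : H →ₗ[ℂ] 𝔤)

variable (H) in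
/-- The pointwise Cartan component. -/
def PH : Loop 𝔤 →ₗ[ℂ] Loop H := Loop.map (cartanProj H)

theorem PH_jH (X : Loop H) : PH H (jH X) = X := loop_ext fun _ => cartanProj_coe _

theorem shift_jH (p : ℂˣ) (X : Loop H) : shift p (jH X) = jH (shift p X) := rfl

theorem shift_PH (p : ℂˣ) (X : Loop 𝔤) : shift p (PH H X) = PH H (shift p X) := rfl

/-- `r₊ = (r + 1) / 2`. -/
def rpl {V : Type*} [AddCommGroup V] [Module ℂ V] (r : Module.End ℂ V) : Module.End ℂ V :=
  (1 / 2 : ℂ) • (r + 1)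

/-- `r₋ = (r - 1) / 2`. -/
def rmi {V : Type*} [AddCommGroup V] [Module ℂ V] (r : Module.End ℂ V) : Module.End ℂ V :=
  (1 / 2 : ℂ) • (r - 1)

variable (b : (LieAlgebra.IsKilling.rootSystem H).Base) (B : LinearMap.BilinForm ℂ 𝔤) (p : ℂˣ)
  (r₀ : Module.End ℂ (Loop H))

/-- The loop `n₊`. -/
def nP (v : Pts b) : LG 𝔤 := expL (jS (nilOpp b) v.2.1)

/-- The loop `n₋`. -/
def nM (v : Pts b) : LG 𝔤 := expL (jS (nil b) v.2.2)

/-- The loop `L₊`. -/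
def lgP (v : Pts b) : LG 𝔤 := expL (jH (rpl r₀ v.1)) * nP b v

/-- The loop `L₋`. -/
def lgM (v : Pts b) : LG 𝔤 := expL (jH (rmi r₀ v.1)) * nM b v

theorem L_eq (v : Pts b) (z : ℂˣ) : L b p r₀ v z =
    gm (atG (lgP b r₀ v) (p * z)) * gm (atG (lgM b r₀ v) z)⁻¹ := by
  rw [gm_inv]
  rfl

/-- The logarithmic derivative `L₊⁻¹ δL₊` in the direction `w`. -/
def tP (v w : Pts b) : Loop 𝔤 :=
  AdL (nP b v)⁻¹ (jH (rpl r₀ w.1)) + dlogL (jS (nilOpp b) v.2.1) (jS (nilOpp b) w.2.1)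

/-- The logarithmic derivative `L₋⁻¹ δL₋` in the direction `w`. -/
def tM (v w : Pts b) : Loop 𝔤 :=
  AdL (nM b v)⁻¹ (jH (rmi r₀ w.1)) + dlogL (jS (nil b) v.2.2) (jS (nil b) w.2.2)

/-- The variation of `L` in the direction `w`, transported to the identity between the factors. -/
def tL (v w : Pts b) : Loop 𝔤 := shift p (tP b r₀ v w) - tM b r₀ v w

theorem hasDerivAt_factor (h x y ν : 𝔤) (hx : ⁅h, x⁆ = 0) :
    HasDerivAt (fun t : ℂ => expm (h + t • x) * expm (y + t • ν))
      (expm h * expm y * ((Ad (expG y)⁻¹ x + dlog y ν : 𝔤) : Mat d)) 0 := by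
  have h1 := (hasDerivAt_expm h x).mul (hasDerivAt_expm y ν)
  refine h1.congr_deriv ?_
  have h2 : expm y * expm (-y) = 1 := AlgebraExp.exp_mul_exp_neg (y : Mat d)
  rw [dlog_of_lie_eq_zero hx, expG_inv, AddMemClass.coe_add, coe_Ad_gm, gm_expG, ← expG_inv, inv_inv,
    gm_expG, mul_add]
  simp only [zero_smul, add_zero]
  congr 1
  · rw [← mul_assoc, ← mul_assoc, mul_assoc (expm h) (expm y), h2, mul_one]
  · rw [mul_assoc]

theorem hasDerivAt_lgP (v w : Pts b) (z : ℂˣ) :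
    HasDerivAt (fun t : ℂ => gm (atG (lgP b r₀ (v + t • w)) z))
      (gm (atG (lgP b r₀ v) z) * ((ev (tP b r₀ v w) z : 𝔤) : Mat d)) 0 := by
  have h := hasDerivAt_factor (ev (jH (rpl r₀ v.1)) z) (ev (jH (rpl r₀ w.1)) z)
    (ev (jS (nilOpp b) v.2.1) z) (ev (jS (nilOpp b) w.2.1) z) (lie_cartan_cartan _ _)
  refine h.congr_of_eventuallyEq (Eventually.of_forall fun t => ?_)
  simp only [lgP, nP, atG_mul, gm_mul, expL_at, gm_expG, Prod.fst_add, Prod.snd_add, Prod.smul_fst,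
    Prod.smul_snd, map_add, map_smul, ev_add, ev_smul]

theorem hasDerivAt_lgM (v w : Pts b) (z : ℂˣ) :
    HasDerivAt (fun t : ℂ => gm (atG (lgM b r₀ (v + t • w)) z))
      (gm (atG (lgM b r₀ v) z) * ((ev (tM b r₀ v w) z : 𝔤) : Mat d)) 0 := by
  have h := hasDerivAt_factor (ev (jH (rmi r₀ v.1)) z) (ev (jH (rmi r₀ w.1)) z)
    (ev (jS (nil b) v.2.2) z) (ev (jS (nil b) w.2.2) z) (lie_cartan_cartan _ _)
  refine h.congr_of_eventuallyEq (Eventually.of_forall fun t => ?_)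
  simp only [lgM, nM, atG_mul, gm_mul, expL_at, gm_expG, Prod.fst_add, Prod.snd_add, Prod.smul_fst,
    Prod.smul_snd, map_add, map_smul, ev_add, ev_smul]

theorem hasDerivAt_gm_inv {g : ℂ → adGroup 𝔤} {t : ℂ} {x : Mat d}
    (h : HasDerivAt (fun t => gm (g t)) (gm (g t) * x) t) :
    HasDerivAt (fun t => gm (g t)⁻¹) (-(x * gm (g t)⁻¹)) t := by
  have h1 := (hasFDerivAt_ringInverse (𝕜 := ℂ) (g t : (Mat d)ˣ)).comp_hasDerivAt t h
  refine (h1.congr_deriv ?_).congr_of_eventuallyEq (Eventually.of_forall fun s => ?_)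
  · have h2 : gm (g t)⁻¹ * gm (g t) = 1 := gm_inv_mul _
    change -(gm (g t)⁻¹ * (gm (g t) * x) * gm (g t)⁻¹) = _
    rw [← mul_assoc, h2, one_mul]
  · exact (Ring.inverse_unit (g s : (Mat d)ˣ)).symm

theorem hasDerivAt_L (v w : Pts b) (z : ℂˣ) :
    HasDerivAt (fun t : ℂ => L b p r₀ (v + t • w) z)
      (gm (atG (lgP b r₀ v) (p * z)) * ((ev (tL b p r₀ v w) z : 𝔤) : Mat d) *
        gm (atG (lgM b r₀ v) z)⁻¹) 0 := by
  have h0 : v + (0 : ℂ) • w = v := by rw [zero_smul, add_zero]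
  have h1 := hasDerivAt_lgP b r₀ v w (p * z)
  have h2 := hasDerivAt_gm_inv (g := fun t : ℂ => atG (lgM b r₀ (v + t • w)) z) (t := 0)
    (x := ((ev (tM b r₀ v w) z : 𝔤) : Mat d)) (by
      rw [h0]
      exact hasDerivAt_lgM b r₀ v w z)
  have h3 := h1.mul h2
  simp only [L_eq]
  refine h3.congr_deriv ?_
  have h4 : ev (tL b p r₀ v w) z = ev (tP b r₀ v w) (p * z) - ev (tM b r₀ v w) z := rfl
  simp only [h0, h4]
  rw [AddSubgroupClass.coe_sub]
  noncomm_ring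

/-- `Z` is the gradient of `φ` at `v` transported to the identity between the two factors. -/
def IsGrad (φ : Pts b → ℂ) (v : Pts b) (Z : Loop 𝔤) : Prop :=
  ∀ w : Pts b, HasDerivAt (fun t : ℂ => φ (v + t • w)) (pair B (tL b p r₀ v w) Z) 0

theorem hasDerivAt_matrix_iff {f : ℂ → Mat d} {f' : Mat d} {t : ℂ} :
    (∀ i j, HasDerivAt (fun t => f t i j) (f' i j) t) ↔ HasDerivAt f f' t := by
  constructor
  · intro h
    exact hasDerivAt_pi.2 fun i => hasDerivAt_pi.2 fun j => h i j
  · intro h i j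
    exact hasDerivAt_pi.1 (hasDerivAt_pi.1 h i) j

variable {B}

theorem lgP_mem_isoG (hinv : ∀ x y z : 𝔤, B ⁅x, y⁆ z = B x ⁅y, z⁆) (v : Pts b) :
    lgP b r₀ v ∈ isoG B := mul_mem (expL_mem_isoG hinv _) (expL_mem_isoG hinv _)

theorem lgM_mem_isoG (hinv : ∀ x y z : 𝔤, B ⁅x, y⁆ z = B x ⁅y, z⁆) (v : Pts b) :
    lgM b r₀ v ∈ isoG B := mul_mem (expL_mem_isoG hinv _) (expL_mem_isoG hinv _)

variable {b p r₀}

theorem isLeftGrad_iff (hinv : ∀ x y z : 𝔤, B ⁅x, y⁆ z = B x ⁅y, z⁆) {φ : Pts b → ℂ} {v : Pts b}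
    {η : Loop 𝔤} : IsLeftGrad b B p r₀ φ v η ↔
      IsGrad b B p r₀ φ v (AdL (shiftG p (lgP b r₀ v))⁻¹ η) := by
  have hg := shiftG_mem_isoG (lgP_mem_isoG b r₀ hinv v) p
  have hL : ∀ (w : Pts b) (z : ℂˣ), gm (atG (lgP b r₀ v) (p * z)) *
      ((ev (tL b p r₀ v w) z : 𝔤) : Mat d) * gm (atG (lgM b r₀ v) z)⁻¹ =
      ((ev (AdL (shiftG p (lgP b r₀ v)) (tL b p r₀ v w)) z : 𝔤) : Mat d) * L b p r₀ v z := by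
    intro w z
    rw [L_eq, ev_AdL, shiftG_at, coe_Ad_gm, mul_assoc (gm _ * _), ← mul_assoc (gm (_)⁻¹), gm_inv_mul,
      one_mul]
  constructor
  · intro h w
    have := h w (AdL (shiftG p (lgP b r₀ v)) (tL b p r₀ v w)) fun z => hasDerivAt_matrix_iff.2 <| by
      rw [← hL]
      exact hasDerivAt_L b p r₀ v w z
    rwa [pair_AdL_left hg] at this
  · intro h w ξ hξ
    have h1 : ξ = AdL (shiftG p (lgP b r₀ v)) (tL b p r₀ v w) := loop_ext fun z => by
      have h2 := (hasDerivAt_matrix_iff.1 (hξ z)).unique (hasDerivAt_L b p r₀ v w z)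
      rw [hL, L_eq, ← mul_assoc, ← mul_assoc] at h2
      have h3 := congrArg (fun m => m * gm (atG (lgM b r₀ v) z) *
        gm (atG (lgP b r₀ v) (p * z))⁻¹) h2
      simp only [mul_assoc] at h3
      rw [← mul_assoc (gm (atG (lgM b r₀ v) z)⁻¹), gm_inv_mul, one_mul, gm_mul_inv, mul_one,
        mul_one] at h3
      exact Subtype.ext h3
    rw [h1, pair_AdL_left hg]
    exact h w

theorem isRightGrad_iff (hinv : ∀ x y z : 𝔤, B ⁅x, y⁆ z = B x ⁅y, z⁆) {φ : Pts b → ℂ} {v : Pts b}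
    {η : Loop 𝔤} : IsRightGrad b B p r₀ φ v η ↔
      IsGrad b B p r₀ φ v (AdL (lgM b r₀ v)⁻¹ η) := by
  have hg := lgM_mem_isoG b r₀ hinv v
  have hL : ∀ (w : Pts b) (z : ℂˣ), gm (atG (lgP b r₀ v) (p * z)) *
      ((ev (tL b p r₀ v w) z : 𝔤) : Mat d) * gm (atG (lgM b r₀ v) z)⁻¹ =
      L b p r₀ v z * ((ev (AdL (lgM b r₀ v) (tL b p r₀ v w)) z : 𝔤) : Mat d) := by
    intro w z
    rw [L_eq, ev_AdL, coe_Ad_gm]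
    simp only [mul_assoc]
    rw [← mul_assoc (gm (atG (lgM b r₀ v) z)⁻¹), gm_inv_mul, one_mul]
  constructor
  · intro h w
    have := h w (AdL (lgM b r₀ v) (tL b p r₀ v w)) fun z => hasDerivAt_matrix_iff.2 <| by
      rw [← hL]
      exact hasDerivAt_L b p r₀ v w z
    rwa [pair_AdL_left hg] at this
  · intro h w ξ hξ
    have h1 : ξ = AdL (lgM b r₀ v) (tL b p r₀ v w) := loop_ext fun z => by
      have h2 := (hasDerivAt_matrix_iff.1 (hξ z)).unique (hasDerivAt_L b p r₀ v w z)
      rw [hL, L_eq, mul_assoc, mul_assoc] at h2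
      have h3 := congrArg (fun m => gm (atG (lgM b r₀ v) z) *
        (gm (atG (lgP b r₀ v) (p * z))⁻¹ * m)) h2
      simp only [← mul_assoc] at h3
      rw [mul_assoc _ (gm (atG (lgP b r₀ v) (p * z))⁻¹), gm_inv_mul, mul_one, gm_mul_inv, one_mul,
        one_mul] at h3
      exact Subtype.ext h3
    rw [h1, pair_AdL_left hg]
    exact h w

end Calculus

end LoopReduction

namespace LoopReduction

open scoped Matrix.Norms.Operator

section Bracket

variable {d : ℕ} {𝔤 : LieSubalgebra ℂ (Matrix (Fin d) (Fin d) ℂ)} [LieAlgebra.IsSemisimple ℂ 𝔤]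
  {H : LieSubalgebra ℂ 𝔤} [H.IsCartanSubalgebra]
  (b : (LieAlgebra.IsKilling.rootSystem H).Base) {B : LinearMap.BilinForm ℂ 𝔤} {p : ℂˣ}
  {r₀ : Module.End ℂ (Loop H)}

/-! ### Nilpotency -/

open AlgebraExp in
theorem coe_mem_filt_of_mem_nil {x : 𝔤} (hx : x ∈ nil b) :
    (x : Mat d) ∈ filt (((grading b : H) : 𝔤) : Mat d) 1 := by
  refine (rootSum_le (N := (filt (((grading b : H) : 𝔤) : Mat d) 1).comap
    𝔤.toSubmodule.subtype) ?_) hx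
  rintro _ ⟨i, hi, rfl⟩ y hy
  have h1 := lie_cartan_rootSpace hy (grading b)
  rw [root_grading] at h1
  refine mem_filt_of_eigen (μ := (b.height i : ℂ)) ?_ (congrArg Subtype.val h1)
  have h2 := b.isPos_iff.1 hi
  simp only [Nat.cast_one, Complex.intCast_re]
  exact_mod_cast h2

open AlgebraExp in
theorem coe_mem_filt_of_mem_nilOpp {x : 𝔤} (hx : x ∈ nilOpp b) :
    (x : Mat d) ∈ filt (-(((grading b : H) : 𝔤) : Mat d)) 1 := by
  refine (rootSum_le (N := (filt (-(((grading b : H) : 𝔤) : Mat d)) 1).comap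
    𝔤.toSubmodule.subtype) ?_) hx
  rintro χ ⟨i, hi, hχ⟩ y hy
  have h1 := lie_cartan_rootSpace hy (grading b)
  have h3 : χ (grading b) = -(b.height i : ℂ) := by
    rw [← root_grading, ← neg_eq_iff_eq_neg]
    exact congrFun hχ _
  rw [h3] at h1
  have h4 := congrArg Subtype.val h1
  rw [coe_lie] at h4
  refine mem_filt_of_eigen (μ := (b.height i : ℂ)) ?_ ?_
  · have h2 := b.isPos_iff.1 hi
    simp only [Nat.cast_one, Complex.intCast_re]
    exact_mod_cast h2
  · have h5 : (((-(b.height i : ℂ)) • y : 𝔤) : Mat d) = -((b.height i : ℂ) • (y : Mat d)) := by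
      rw [neg_smul]
      rfl
    rw [h5] at h4
    change -_ * (y : Mat d) - (y : Mat d) * -_ = (b.height i : ℂ) • (y : Mat d)
    rw [neg_mul, mul_neg, sub_neg_eq_add, ← neg_eq_iff_eq_neg.2 h4]
    abel

open AlgebraExp in
theorem dlog_surjOn_of_filt (S : Submodule ℂ 𝔤) {E : Mat d} (hS : ∀ x ∈ S, (x : Mat d) ∈ filt E 1)
    (hlie : ∀ x ∈ S, ∀ y ∈ S, ⁅x, y⁆ ∈ S) {Y : 𝔤} (hY : Y ∈ S) {u : 𝔤} (hu : u ∈ S) :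
    ∃ w ∈ S, dlog Y w = u := by
  let T : S →ₗ[ℂ] S := (dlog Y).restrict fun w hw => dlog_mem S (hlie Y hY) hw
  have hT : Function.Injective T := by
    rw [← LinearMap.ker_eq_bot, LinearMap.ker_eq_bot']
    intro w hw
    have h1 : dlog Y (w : 𝔤) = 0 := congrArg Subtype.val hw
    have h2 : fderiv ℂ (NormedSpace.exp : Mat d → Mat d) Y (w : 𝔤) = 0 := by
      have h3 := congrArg (fun x : 𝔤 => expm Y * (x : Mat d)) h1
      have h4 : expm Y * expm (-Y) = 1 := exp_mul_exp_neg (Y : Mat d)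
      simpa only [coe_dlog, ← mul_assoc, h4, one_mul, ZeroMemClass.coe_zero, mul_zero] using h3
    have h3 : ∀ m : ℕ, ((w : 𝔤) : Mat d) ∈ filt E (m + 1) := by
      intro m
      induction m with
      | zero => exact hS _ w.2
      | succ m ih =>
        have := fderiv_exp_sub_mem filt_antitone mul_mem_filt one_mem_filt (by omega) (hS Y hY) ih
        have h5 : -((w : 𝔤) : Mat d) ∈ filt E (m + 1 + 1) := by
          rw [← zero_sub]
          exact h2 ▸ this
        simpa using Submodule.neg_mem _ h5
    obtain ⟨m, hm⟩ := exists_filt_eq_bot E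
    have h4 := filt_antitone (Nat.le_succ m) (h3 m)
    rw [hm, Submodule.mem_bot] at h4
    exact Subtype.ext (Subtype.ext h4)
  obtain ⟨w, hw⟩ := (LinearMap.injective_iff_surjective.1 hT) ⟨u, hu⟩
  exact ⟨w, w.2, congrArg Subtype.val hw⟩

theorem dlog_surjOn_nilOpp {Y : 𝔤} (hY : Y ∈ nilOpp b) {u : 𝔤} (hu : u ∈ nilOpp b) :
    ∃ w ∈ nilOpp b, dlog Y w = u :=
  dlog_surjOn_of_filt (nilOpp b) (fun _ => coe_mem_filt_of_mem_nilOpp b)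
    (fun _ hx _ hy => lie_nilOpp_nilOpp b hx hy) hY hu

theorem dlog_surjOn_nil {Y : 𝔤} (hY : Y ∈ nil b) {u : 𝔤} (hu : u ∈ nil b) :
    ∃ w ∈ nil b, dlog Y w = u :=
  dlog_surjOn_of_filt (nil b) (fun _ => coe_mem_filt_of_mem_nil b)
    (fun _ hx _ hy => lie_nil_nil b hx hy) hY hu

/-! ### Triangularity of the adjoint action -/

theorem lie_nilOpp_cartan {y : 𝔤} (hy : y ∈ nilOpp b) (h : H) : ⁅y, (h : 𝔤)⁆ ∈ nilOpp b := by
  rw [← lie_skew]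
  exact Submodule.neg_mem _ (lie_cartan_nilOpp b h hy)

theorem lie_nil_cartan {y : 𝔤} (hy : y ∈ nil b) (h : H) : ⁅y, (h : 𝔤)⁆ ∈ nil b := by
  rw [← lie_skew]
  exact Submodule.neg_mem _ (lie_cartan_nil b h hy)

theorem Ad_nilOpp_sub_mem {y : 𝔤} (hy : y ∈ nilOpp b) (h : H) {x : 𝔤}
    (hx : x - (h : 𝔤) ∈ nilOpp b) : Ad (expG y) x - x ∈ nilOpp b := by
  refine Ad_expG_sub_mem (nilOpp b) (fun u hu => lie_nilOpp_nilOpp b hy hu) ?_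
  have := Submodule.add_mem _ (lie_nilOpp_nilOpp b hy hx) (lie_nilOpp_cartan b hy h)
  rwa [← lie_add, sub_add_cancel] at this

theorem Ad_nil_sub_mem {y : 𝔤} (hy : y ∈ nil b) (h : H) {x : 𝔤}
    (hx : x - (h : 𝔤) ∈ nil b) : Ad (expG y) x - x ∈ nil b := by
  refine Ad_expG_sub_mem (nil b) (fun u hu => lie_nil_nil b hy hu) ?_
  have := Submodule.add_mem _ (lie_nil_nil b hy hx) (lie_nil_cartan b hy h)
  rwa [← lie_add, sub_add_cancel] at this

theorem Ad_cartan_cartan (h k : H) : Ad (expG (h : 𝔤)) (k : 𝔤) = k :=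
  Ad_expG_of_lie_eq_zero (lie_cartan_cartan h k)

theorem Ad_cartan_nilOpp (h : H) {y : 𝔤} (hy : y ∈ nilOpp b) : Ad (expG (h : 𝔤)) y ∈ nilOpp b :=
  Ad_expG_mem _ (fun _ hu => lie_cartan_nilOpp b h hu) hy

theorem Ad_cartan_nil (h : H) {y : 𝔤} (hy : y ∈ nil b) : Ad (expG (h : 𝔤)) y ∈ nil b :=
  Ad_expG_mem _ (fun _ hu => lie_cartan_nil b h hu) hy

/-- Loops with values in a subspace. -/
def ValuedIn (S : Submodule ℂ 𝔤) : Submodule ℂ (Loop 𝔤) where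
  carrier := {X | ∀ z, ev X z ∈ S}
  zero_mem' := fun _ => S.zero_mem
  add_mem' := fun hX hY z => S.add_mem (hX z) (hY z)
  smul_mem' := fun a _ hX z => S.smul_mem a (hX z)

variable {b}

theorem jS_mem {S : Submodule ℂ 𝔤} (X : Loop S) : jS S X ∈ ValuedIn S := fun z => (ev X z).2

theorem PH_of_nilOpp {X : Loop 𝔤} (hX : X ∈ ValuedIn (nilOpp b)) : PH H X = 0 :=
  loop_ext fun z => cartanProj_nilOpp b (hX z)

theorem PH_of_nil {X : Loop 𝔤} (hX : X ∈ ValuedIn (nil b)) : PH H X = 0 :=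
  loop_ext fun z => cartanProj_nil b (hX z)

theorem AdL_nilOpp_sub_mem {Y X : Loop 𝔤} (hY : Y ∈ ValuedIn (nilOpp b)) (h : Loop H)
    (hX : X - jH h ∈ ValuedIn (nilOpp b)) : AdL (expL Y) X - X ∈ ValuedIn (nilOpp b) :=
  fun z => Ad_nilOpp_sub_mem b (hY z) (ev h z) (hX z)

theorem AdL_nil_sub_mem {Y X : Loop 𝔤} (hY : Y ∈ ValuedIn (nil b)) (h : Loop H)
    (hX : X - jH h ∈ ValuedIn (nil b)) : AdL (expL Y) X - X ∈ ValuedIn (nil b) :=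
  fun z => Ad_nil_sub_mem b (hY z) (ev h z) (hX z)

theorem AdL_cartan_jH (h k : Loop H) : AdL (expL (jH h)) (jH k) = jH k :=
  loop_ext fun _ => Ad_cartan_cartan _ _

theorem AdL_cartan_nilOpp (h : Loop H) {X : Loop 𝔤} (hX : X ∈ ValuedIn (nilOpp b)) :
    AdL (expL (jH h)) X ∈ ValuedIn (nilOpp b) := fun z => Ad_cartan_nilOpp b (ev h z) (hX z)

theorem AdL_cartan_nil (h : Loop H) {X : Loop 𝔤} (hX : X ∈ ValuedIn (nil b)) :
    AdL (expL (jH h)) X ∈ ValuedIn (nil b) := fun z => Ad_cartan_nil b (ev h z) (hX z)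

variable (b) in
/-- The pointwise projection to `𝔫̄`. -/
def Pneg : Loop 𝔤 →ₗ[ℂ] Loop 𝔤 := Loop.map (rootProj H (negRoots b))

variable (b) in
/-- The pointwise projection to `𝔫`. -/
def Ppos : Loop 𝔤 →ₗ[ℂ] Loop 𝔤 := Loop.map (rootProj H (posRoots b))

theorem Pneg_mem (X : Loop 𝔤) : Pneg b X ∈ ValuedIn (nilOpp b) := fun _ => rootProj_mem _ _

theorem Ppos_mem (X : Loop 𝔤) : Ppos b X ∈ ValuedIn (nil b) := fun _ => rootProj_mem _ _

theorem Pneg_add_jH_add_Ppos (X : Loop 𝔤) : Pneg b X + jH (PH H X) + Ppos b X = X :=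
  loop_ext fun _ => proj_add_proj_add_proj b _

theorem Pneg_of_nilOpp {X : Loop 𝔤} (hX : X ∈ ValuedIn (nilOpp b)) : Pneg b X = X :=
  loop_ext fun z => rootProj_of_mem (hX z)

theorem Pneg_of_nil {X : Loop 𝔤} (hX : X ∈ ValuedIn (nil b)) : Pneg b X = 0 :=
  loop_ext fun z => rootProj_neg_nil b (hX z)

theorem Ppos_of_nil {X : Loop 𝔤} (hX : X ∈ ValuedIn (nil b)) : Ppos b X = X :=
  loop_ext fun z => rootProj_of_mem (hX z)

theorem Ppos_of_nilOpp {X : Loop 𝔤} (hX : X ∈ ValuedIn (nilOpp b)) : Ppos b X = 0 :=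
  loop_ext fun z => rootProj_pos_nilOpp b (hX z)

theorem Pneg_jH (X : Loop H) : Pneg b (jH X) = 0 := loop_ext fun _ => rootProj_neg_cartan b _

theorem Ppos_jH (X : Loop H) : Ppos b (jH X) = 0 := loop_ext fun _ => rootProj_pos_cartan b _

theorem rOp_apply (X : Loop 𝔤) : rOp b r₀ X = Pneg b X - Ppos b X + jH (r₀ (PH H X)) := rfl

theorem rpl_rOp (X : Loop 𝔤) :
    rpl (rOp b r₀) X = Pneg b X + jH (rpl r₀ (PH H X)) := by
  have h1 : rpl (rOp b r₀) X = (1 / 2 : ℂ) • (rOp b r₀ X + X) := rfl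
  have h2 : rpl r₀ (PH H X) = (1 / 2 : ℂ) • (r₀ (PH H X) + PH H X) := rfl
  rw [h1, h2, map_smul, map_add, rOp_apply]
  nth_rw 4 [← Pneg_add_jH_add_Ppos (b := b) X]
  module

theorem rmi_rOp (X : Loop 𝔤) :
    rmi (rOp b r₀) X = jH (rmi r₀ (PH H X)) - Ppos b X := by
  have h1 : rmi (rOp b r₀) X = (1 / 2 : ℂ) • (rOp b r₀ X - X) := rfl
  have h2 : rmi r₀ (PH H X) = (1 / 2 : ℂ) • (r₀ (PH H X) - PH H X) := rfl
  rw [h1, h2, map_smul, map_sub, rOp_apply]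
  nth_rw 4 [← Pneg_add_jH_add_Ppos (b := b) X]
  module

theorem shift_rOp (hr : Commute r₀ (shift p)) (X : Loop 𝔤) :
    shift p (rOp b r₀ X) = rOp b r₀ (shift p X) := by
  have h1 : shift p (r₀ (PH H X)) = r₀ (shift p (PH H X)) := LinearMap.congr_fun hr.eq.symm _
  rw [rOp_apply, rOp_apply, map_add, map_sub, shift_jH, h1]
  rfl

theorem pair_jH_left (hinv : ∀ x y z : 𝔤, B ⁅x, y⁆ z = B x ⁅y, z⁆)
    (b : (LieAlgebra.IsKilling.rootSystem H).Base) (X : Loop H) (Y : Loop 𝔤) :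
    pair B (jH X) Y = pair (cartanForm H B) X (PH H Y) := by
  unfold pair
  congr 1
  funext z
  exact form_cartan_right b hinv _ _

theorem pair_jH_right (hsymm : B.IsSymm) (hinv : ∀ x y z : 𝔤, B ⁅x, y⁆ z = B x ⁅y, z⁆)
    (b : (LieAlgebra.IsKilling.rootSystem H).Base) (X : Loop 𝔤) (Y : Loop H) :
    pair B X (jH Y) = pair (cartanForm H B) (PH H X) Y := by
  unfold pair
  congr 1
  funext z
  exact form_cartan_left b hsymm hinv _ _

/-! ### Uniqueness of gradients -/

/-- The operator `D r₀₊ - r₀₋` which governs the variation of the Cartan component. -/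
def qOp (p : ℂˣ) (r₀ : Module.End ℂ (Loop H)) : Module.End ℂ (Loop H) :=
  shift p * rpl r₀ - rmi r₀

theorem ev_eq_zero_of_pair {Z : Loop 𝔤} {S : Submodule ℂ 𝔤}
    (T : Loop 𝔤 → Loop 𝔤) (T' : ℂˣ → 𝔤 →ₗ[ℂ] 𝔤) (hT : ∀ X z, ev (T X) z = T' z (ev X z))
    (h : ∀ X : Loop S, pair B (T (jS S X)) Z = 0) (z : ℂˣ) {u : 𝔤} (hu : u ∈ S) :
    B (T' z u) (ev Z z) = 0 := by
  have h1 : (fun z => B (T' z u) (ev Z z)) = fun _ => 0 := by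
    have h2 : ∀ X : Loop S, (fun z => B (ev (T (jS S X)) z) (ev Z z)) =
      fun z => B (T' z ((ev X z : S) : 𝔤)) (ev Z z) := fun X => by
        funext z
        rw [hT, ev_jS]
    have h3 : HolU fun z => B (T' z u) (ev Z z) := by
      refine (holU_bilin B (T (jS S (mono 0 ⟨u, hu⟩))) Z).congr fun z => ?_
      rw [hT, ev_jS, ev_mono, zpow_zero, one_smul]
    refine h3.ext (Hol.const 0) fun n => ?_
    have h4 := h (mono (-n) ⟨u, hu⟩)
    rw [pair, h2] at h4
    simp only [ev_mono, Submodule.coe_smul, map_smul, LinearMap.smul_apply, smul_eq_mul] at h4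
    rw [coeff_zpow_mul] at h4
    rw [zero_sub, neg_neg] at h4
    exact h4.trans (coeff_zero_fun n).symm
  exact congrFun h1 z

variable (b B p r₀)

theorem tL_pos (v : Pts b) (w : Loop (nilOpp b)) :
    tL b p r₀ v (0, w, 0) = shift p (dlogL (jS (nilOpp b) v.2.1) (jS (nilOpp b) w)) := by
  simp only [tL, tP, tM, map_zero, zero_add, sub_zero]

theorem tL_neg (v : Pts b) (w : Loop (nil b)) :
    tL b p r₀ v (0, 0, w) = -dlogL (jS (nil b) v.2.2) (jS (nil b) w) := by
  simp only [tL, tP, tM, map_zero, zero_add, zero_sub, add_zero]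

theorem tL_cartan (v : Pts b) (x : Loop H) :
    tL b p r₀ v (x, 0, 0) = shift p (AdL (nP b v)⁻¹ (jH (rpl r₀ x))) -
      AdL (nM b v)⁻¹ (jH (rmi r₀ x)) := by
  simp only [tL, tP, tM, map_zero, add_zero]

variable {b B p r₀}

theorem AdL_nP_inv_sub_mem (v : Pts b) (x : Loop H) :
    AdL (nP b v)⁻¹ (jH x) - jH x ∈ ValuedIn (nilOpp b) := by
  rw [nP, expL_inv]
  exact AdL_nilOpp_sub_mem (Submodule.neg_mem _ (jS_mem _)) x (by
    rw [sub_self]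
    exact Submodule.zero_mem _)

theorem AdL_nM_inv_sub_mem (v : Pts b) (x : Loop H) :
    AdL (nM b v)⁻¹ (jH x) - jH x ∈ ValuedIn (nil b) := by
  rw [nM, expL_inv]
  exact AdL_nil_sub_mem (Submodule.neg_mem _ (jS_mem _)) x (by
    rw [sub_self]
    exact Submodule.zero_mem _)

theorem form_eq_zero_of_decomp {x : 𝔤} (b : (LieAlgebra.IsKilling.rootSystem H).Base)
    (h1 : ∀ u ∈ nilOpp b, B u x = 0) (h2 : ∀ u ∈ nil b, B u x = 0)
    (h3 : ∀ h : H, B (h : 𝔤) x = 0) (u : 𝔤) : B u x = 0 := by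
  rw [← proj_add_proj_add_proj b u, map_add, map_add, LinearMap.add_apply, LinearMap.add_apply,
    h1 _ (rootProj_mem _ _), h2 _ (rootProj_mem _ _), h3]
  simp

theorem IsGrad.unique (hnondeg : B.Nondegenerate)
    (hQ : Function.Surjective (qOp p r₀)) {φ : Pts b → ℂ}
    {v : Pts b} {Z Z' : Loop 𝔤} (hZ : IsGrad b B p r₀ φ v Z) (hZ' : IsGrad b B p r₀ φ v Z') :
    Z = Z' := by
  rw [← sub_eq_zero]
  set Δ := Z - Z' with hΔ
  have h0 : ∀ w, pair B (tL b p r₀ v w) Δ = 0 := fun w => by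
    rw [hΔ, pair_sub_right, (hZ w).unique (hZ' w), sub_self]
  have h1 : ∀ z, ∀ u ∈ nilOpp b, B u (ev Δ z) = 0 := by
    intro z u hu
    obtain ⟨w, hw, rfl⟩ := dlog_surjOn_nilOpp b (Y := ((ev v.2.1 (p * z) : nilOpp b) : 𝔤))
      (ev v.2.1 (p * z)).2 hu
    have := ev_eq_zero_of_pair (B := B) (Z := shift p⁻¹ Δ) (S := nilOpp b)
      (dlogL (jS (nilOpp b) v.2.1)) (fun z => dlog (ev (jS (nilOpp b) v.2.1) z)) (fun _ _ => rfl)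
      (fun X => by rw [← pair_shift_left, ← tL_pos b p r₀, h0]) (p * z) hw
    have h : ev (shift p⁻¹ Δ) (p * z) = ev Δ (p⁻¹ * (p * z)) := rfl
    rwa [h, inv_mul_cancel_left] at this
  have h2 : ∀ z, ∀ u ∈ nil b, B u (ev Δ z) = 0 := by
    intro z u hu
    obtain ⟨w, hw, rfl⟩ := dlog_surjOn_nil b (Y := ((ev v.2.2 z : nil b) : 𝔤))
      (ev v.2.2 z).2 hu
    exact ev_eq_zero_of_pair (B := B) (Z := Δ) (S := nil b)
      (dlogL (jS (nil b) v.2.2)) (fun z => dlog (ev (jS (nil b) v.2.2) z)) (fun _ _ => rfl)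
      (fun X => by rw [← neg_eq_zero, ← pair_neg_left, ← tL_neg b p r₀, h0]) z hw
  have h3 : ∀ X : Loop H, pair B (jH X) Δ = 0 := by
    intro X
    obtain ⟨x, rfl⟩ := hQ X
    have h4 := h0 (x, 0, 0)
    have h5 : tL b p r₀ v (x, 0, 0) = jH (qOp p r₀ x) +
        (shift p (AdL (nP b v)⁻¹ (jH (rpl r₀ x)) - jH (rpl r₀ x)) -
        (AdL (nM b v)⁻¹ (jH (rmi r₀ x)) - jH (rmi r₀ x))) := by
      have h6 : qOp p r₀ x = shift p (rpl r₀ x) - rmi r₀ x := rfl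
      rw [tL_cartan, h6, map_sub, map_sub, ← shift_jH]
      abel
    have h7 : pair B (shift p (AdL (nP b v)⁻¹ (jH (rpl r₀ x)) - jH (rpl r₀ x))) Δ = 0 :=
      pair_eq_zero B fun z => h1 z _ (AdL_nP_inv_sub_mem v (rpl r₀ x) (p * z))
    have h8 : pair B (AdL (nM b v)⁻¹ (jH (rmi r₀ x)) - jH (rmi r₀ x)) Δ = 0 :=
      pair_eq_zero B fun z => h2 z _ (AdL_nM_inv_sub_mem v (rmi r₀ x) z)
    rwa [h5, pair_add_left, pair_sub_left, h7, h8, sub_zero, add_zero] at h4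
  refine loop_ext fun z => hnondeg.2 _ fun u => ?_
  refine form_eq_zero_of_decomp b (h1 z) (h2 z) (fun h => ?_) u
  exact ev_eq_zero_of_pair (B := B) (Z := Δ) (S := H.toSubmodule) id (fun _ => LinearMap.id)
    (fun _ _ => rfl) h3 z h.2

/-! ### The bracket in terms of transported gradients -/

variable (b p r₀)

/-- The left gradient transported by `D⁻¹`. -/
def gS (v : Pts b) (Z : Loop 𝔤) : Loop 𝔤 := AdL (lgP b r₀ v) (shift p⁻¹ Z)

/-- The right gradient. -/
def gR (v : Pts b) (Z : Loop 𝔤) : Loop 𝔤 := AdL (lgM b r₀ v) Z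

/-- The difference of the gradients. -/
def gV (v : Pts b) (Z : Loop 𝔤) : Loop 𝔤 := gS b p r₀ v Z - gR b r₀ v Z

/-- The Hamiltonian variation. -/
def gW (v : Pts b) (Z : Loop 𝔤) : Loop 𝔤 :=
  (2 : ℂ) • (rmi (rOp b r₀) (gS b p r₀ v Z) - rpl (rOp b r₀) (gR b r₀ v Z))

variable {b p r₀}

theorem IsGrad.leftGrad_eq (hnondeg : B.Nondegenerate)
    (hinv : ∀ x y z : 𝔤, B ⁅x, y⁆ z = B x ⁅y, z⁆) (hQ : Function.Surjective (qOp p r₀))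
    {φ : Pts b → ℂ} {v : Pts b} {Z : Loop 𝔤} (hZ : IsGrad b B p r₀ φ v Z) :
    leftGrad b B p r₀ φ v = shift p (gS b p r₀ v Z) := by
  have h1 : ∃ η, IsLeftGrad b B p r₀ φ v η :=
    ⟨AdL (shiftG p (lgP b r₀ v)) Z, by rwa [isLeftGrad_iff hinv, AdL_inv_apply_self]⟩
  have h2 : IsLeftGrad b B p r₀ φ v (leftGrad b B p r₀ φ v) := Classical.epsilon_spec h1
  rw [gS, shift_AdL, shift_shift_inv, hZ.unique hnondeg hQ ((isLeftGrad_iff hinv).1 h2), AdL_self_apply_inv]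

theorem IsGrad.rightGrad_eq (hnondeg : B.Nondegenerate)
    (hinv : ∀ x y z : 𝔤, B ⁅x, y⁆ z = B x ⁅y, z⁆) (hQ : Function.Surjective (qOp p r₀))
    {φ : Pts b → ℂ} {v : Pts b} {Z : Loop 𝔤} (hZ : IsGrad b B p r₀ φ v Z) :
    rightGrad b B p r₀ φ v = gR b r₀ v Z := by
  have h1 : ∃ η, IsRightGrad b B p r₀ φ v η :=
    ⟨AdL (lgM b r₀ v) Z, by rwa [isRightGrad_iff hinv, AdL_inv_apply_self]⟩
  have h2 : IsRightGrad b B p r₀ φ v (rightGrad b B p r₀ φ v) := Classical.epsilon_spec h1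
  rw [gR, hZ.unique hnondeg hQ ((isRightGrad_iff hinv).1 h2), AdL_self_apply_inv]

theorem IsGrad.bracket_eq (hnondeg : B.Nondegenerate)
    (hinv : ∀ x y z : 𝔤, B ⁅x, y⁆ z = B x ⁅y, z⁆) (hr : Commute r₀ (shift p))
    (hQ : Function.Surjective (qOp p r₀))
    {φ ψ : Pts b → ℂ} {v : Pts b} {Z Z' : Loop 𝔤} (hZ : IsGrad b B p r₀ φ v Z)
    (hZ' : IsGrad b B p r₀ ψ v Z') :
    bracket b B p r₀ φ ψ v = pair B (gW b p r₀ v Z) (gV b p r₀ v Z') := by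
  have h1 : bracket b B p r₀ φ ψ v =
      pair B (rOp b r₀ (leftGrad b B p r₀ φ v)) (leftGrad b B p r₀ ψ v) +
      pair B (rOp b r₀ (rightGrad b B p r₀ φ v)) (rightGrad b B p r₀ ψ v) -
      2 * pair B (shift p (rpl (rOp b r₀) (rightGrad b B p r₀ φ v))) (leftGrad b B p r₀ ψ v) -
      2 * pair B (rmi (rOp b r₀) (shift p⁻¹ (leftGrad b B p r₀ φ v)))
        (rightGrad b B p r₀ ψ v) := rfl
  rw [h1, hZ.leftGrad_eq hnondeg hinv hQ, hZ'.leftGrad_eq hnondeg hinv hQ,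
    hZ.rightGrad_eq hnondeg hinv hQ, hZ'.rightGrad_eq hnondeg hinv hQ, ← shift_rOp hr, pair_shift,
    pair_shift, shift_inv_shift]
  have h2 : ∀ X, rpl (rOp b r₀) X = (1 / 2 : ℂ) • (rOp b r₀ X + X) := fun _ => rfl
  have h3 : ∀ X, rmi (rOp b r₀) X = (1 / 2 : ℂ) • (rOp b r₀ X - X) := fun _ => rfl
  have h4 : pair B (gS b p r₀ v Z) (gS b p r₀ v Z') = pair B (gR b r₀ v Z) (gR b r₀ v Z') := by
    rw [gS, gS, gR, gR, lgP_mem_isoG b r₀ hinv, lgM_mem_isoG b r₀ hinv, pair_shift]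
  simp only [gW, gV, h2, h3, pair_sub_left, pair_sub_right, pair_add_left, pair_smul_left, h4]
  ring

end Bracket

end LoopReduction

namespace LoopReduction

open scoped Matrix.Norms.Operator

/-! ### The chain rule for smooth functions -/

section ChainRule

theorem exists_slope_family {E : Type*} [AddCommGroup E] [Module ℂ E] [TopologicalSpace E]
    [IsTopologicalAddGroup E] [ContinuousSMul ℂ E] [FiniteDimensional ℂ E]
    {c : ℂ → Loop E} (hc : IsHolFamily univ c) {w : Loop E}
    (hw : ∀ (ℓ : Module.Dual ℂ E) (z : ℂˣ),
      HasDerivAt (fun t => ℓ (ev (c t) z)) (ℓ (ev w z)) 0) :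
    ∃ S : ℂ → Loop E, IsHolFamily (ball 0 (1 / 2)) S ∧ S 0 = w ∧ ∀ t, c t = c 0 + t • S t := by
  classical
  refine ⟨fun t => if t = 0 then w else t⁻¹ • (c t - c 0), fun ℓ => ?_, if_pos rfl, fun t => ?_⟩
  · obtain ⟨F, hF, h⟩ := hc ℓ
    obtain ⟨G, hG, h1, h2⟩ := SeveralVariables.exists_differentiableOn_slope (ρ := 1) (isOpen_compl_singleton (x := (0 : ℂ)))
      one_pos (hF.mono (prod_mono (subset_univ _) Subset.rfl))
    refine ⟨G, hG, fun t ht z => ?_⟩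
    by_cases h0 : t = 0
    · subst h0
      simp only [if_true]
      refine (h2 z z.ne_zero).unique ((hw ℓ z).congr_of_eventuallyEq
        (Eventually.of_forall fun t => h t (mem_univ _) z))
    · simp only [if_neg h0]
      have h3 := h1 t ht z z.ne_zero
      rw [h t (mem_univ _), h 0 (mem_univ _)] at h3
      have h4 : ℓ (ev (t⁻¹ • (c t - c 0)) z) = t⁻¹ * (ℓ (ev (c t) z) - ℓ (ev (c 0) z)) := by
        rw [ev_smul, ev_sub, map_smul, map_sub, smul_eq_mul]
      rw [h4, h3]
      field_simp
      ring
  · by_cases h0 : t = 0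
    · rw [h0, zero_smul, add_zero]
    · simp only [if_neg h0]
      rw [smul_inv_smul₀ h0, add_sub_cancel]

variable {d : ℕ} {𝔤 : LieSubalgebra ℂ (Matrix (Fin d) (Fin d) ℂ)} [LieAlgebra.IsSemisimple ℂ 𝔤]
  {H : LieSubalgebra ℂ 𝔤} [H.IsCartanSubalgebra]
  {b : (LieAlgebra.IsKilling.rootSystem H).Base} {B : LinearMap.BilinForm ℂ 𝔤} {p : ℂˣ}
  {r₀ : Module.End ℂ (Loop H)}

/-- The curve `c` in the space of points has the velocity `w` at the time `0`. -/
def HasVelocity {E : Type*} [AddCommGroup E] [Module ℂ E] [TopologicalSpace E]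
    [IsTopologicalAddGroup E] [ContinuousSMul ℂ E] (c : ℂ → Loop E) (w : Loop E) : Prop :=
  ∀ (ℓ : Module.Dual ℂ E) (z : ℂˣ), HasDerivAt (fun t => ℓ (ev (c t) z)) (ℓ (ev w z)) 0

theorem IsSmooth.hasDerivAt_comp {U : Set (Pts b)} (hU : IsOpen U) {φ : Pts b → ℂ}
    (hφ : IsSmooth b B p r₀ U φ) {c : ℂ → Pts b} (hc : IsHolFamilyPts b univ c) {w : Pts b}
    (hw : HasVelocity (fun t => (c t).1) w.1 ∧ HasVelocity (fun t => (c t).2.1) w.2.1 ∧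
      HasVelocity (fun t => (c t).2.2) w.2.2) (h0 : c 0 ∈ U) {Z : Loop 𝔤}
    (hZ : IsGrad b B p r₀ φ (c 0) Z) :
    HasDerivAt (fun t => φ (c t)) (pair B (tL b p r₀ (c 0) w) Z) 0 := by
  obtain ⟨S₁, hS₁, h01, hc1⟩ := exists_slope_family hc.1 hw.1
  obtain ⟨S₂, hS₂, h02, hc2⟩ := exists_slope_family hc.2.1 hw.2.1
  obtain ⟨S₃, hS₃, h03, hc3⟩ := exists_slope_family hc.2.2 hw.2.2
  let S : ℂ → Pts b := fun t => (S₁ t, S₂ t, S₃ t)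
  have hS0 : S 0 = w := by simp only [S, h01, h02, h03]
  have hcS : ∀ t, c t = c 0 + t • S t := fun t =>
    Prod.ext (hc1 t) (Prod.ext (hc2 t) (hc3 t))
  let C : (Fin 2 → ℂ) → Pts b := fun x => c 0 + x 1 • S (x 0)
  let Ω : Set (Fin 2 → ℂ) := (fun x => x 0) ⁻¹' ball 0 (1 / 2)
  have hΩ : IsOpen Ω := isOpen_ball.preimage (continuous_apply 0)
  have hx : ∀ {k : Fin 2}, DifferentiableOn ℂ (fun x : Fin 2 → ℂ => x k) Ω := fun {k} =>
    (differentiable_apply k).differentiableOn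
  have hC : IsHolFamilyPts b Ω C :=
    ⟨(isHolFamily_const _).add ((hS₁.comp hx fun _ h => h).smul hx),
      (isHolFamily_const _).add ((hS₂.comp hx fun _ h => h).smul hx),
      (isHolFamily_const _).add ((hS₃.comp hx fun _ h => h).smul hx)⟩
  have hCc : ContinuousOn C Ω :=
    hC.1.continuousOn.prodMk (hC.2.1.continuousOn.prodMk hC.2.2.continuousOn)
  have hΩ' : IsOpen (Ω ∩ C ⁻¹' U) := hCc.isOpen_inter_preimage hΩ hU
  have hC0 : C 0 = c 0 := by simp [C]
  have hmem : (0 : Fin 2 → ℂ) ∈ Ω ∩ C ⁻¹' U := ⟨by simp [Ω], by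
    rw [mem_preimage, hC0]
    exact h0⟩
  have hd : DifferentiableAt ℂ (φ ∘ C) 0 :=
    (hφ.1 2 _ C hΩ' ⟨fun ℓ => ?_, fun ℓ => ?_, fun ℓ => ?_⟩
      fun x hx => hx.2).differentiableAt (hΩ'.mem_nhds hmem)
  · have hline : ∀ u : Fin 2 → ℂ, HasDerivAt (fun t : ℂ => φ (C (t • u)))
        (fderiv ℂ (φ ∘ C) 0 u) 0 := by
      intro u
      have h1 : HasDerivAt (fun t : ℂ => t • u) u 0 := by
        simpa using (hasDerivAt_id (0 : ℂ)).smul_const u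
      have h2 : HasFDerivAt (φ ∘ C) (fderiv ℂ (φ ∘ C) 0) ((0 : ℂ) • u) := by
        rw [zero_smul]
        exact hd.hasFDerivAt
      exact h2.comp_hasDerivAt 0 h1
    have h11 := hline ![1, 1]
    have h10 := (hline ![1, 0]).unique ((hasDerivAt_const (0 : ℂ) (φ (c 0))).congr_of_eventuallyEq
      (Eventually.of_forall fun t => by simp [C]))
    have h01 := (hline ![0, 1]).unique ((hZ w).congr_of_eventuallyEq
      (Eventually.of_forall fun t => by simp [C, hS0]))
    have hadd : (![1, 1] : Fin 2 → ℂ) = ![1, 0] + ![0, 1] := by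
      ext i
      fin_cases i <;> simp
    rw [hadd, map_add, h10, h01, zero_add, ← hadd] at h11
    refine h11.congr_of_eventuallyEq (Eventually.of_forall fun t => ?_)
    change φ (c t) = _
    rw [hcS t]
    simp [C]
  · obtain ⟨F, hF, h⟩ := hC.1 ℓ
    exact ⟨F, hF.mono (prod_mono inter_subset_left Subset.rfl), fun x hx => h x hx.1⟩
  · obtain ⟨F, hF, h⟩ := hC.2.1 ℓ
    exact ⟨F, hF.mono (prod_mono inter_subset_left Subset.rfl), fun x hx => h x hx.1⟩
  · obtain ⟨F, hF, h⟩ := hC.2.2 ℓ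
    exact ⟨F, hF.mono (prod_mono inter_subset_left Subset.rfl), fun x hx => h x hx.1⟩

end ChainRule

/-! ### Conjugation by Cartan loops -/

section Conjugation

variable {d : ℕ} {𝔤 : LieSubalgebra ℂ (Matrix (Fin d) (Fin d) ℂ)} [LieAlgebra.IsSemisimple ℂ 𝔤]
  {H : LieSubalgebra ℂ 𝔤} [H.IsCartanSubalgebra] (S : Submodule ℂ 𝔤)

/-- A linear retraction onto a subspace. -/
def retr : 𝔤 →ₗ[ℂ] S :=
  (LinearMap.exists_leftInverse_of_injective S.subtype
    (LinearMap.ker_eq_bot.2 Subtype.val_injective)).choose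

theorem retr_coe (x : S) : retr S (x : 𝔤) = x :=
  LinearMap.congr_fun (LinearMap.exists_leftInverse_of_injective S.subtype
    (LinearMap.ker_eq_bot.2 Subtype.val_injective)).choose_spec x

variable {S}

theorem jS_retr {X : Loop 𝔤} (hX : X ∈ ValuedIn S) : jS S (Loop.map (retr S) X) = X :=
  loop_ext fun z => congrArg Subtype.val (retr_coe S ⟨ev X z, hX z⟩)

theorem jS_injective : Function.Injective (jS S) := fun _ _ h =>
  loop_ext fun z => Subtype.ext (congrArg (fun W => ev W z) h)

variable (S)

/-- The conjugation of a loop in `S` by the exponential of a Cartan loop. -/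
def conjS (κ : Loop H) (Y : Loop S) : Loop S := Loop.map (retr S) (AdL (expL (jH κ)) (jS S Y))

/-- The derivative of the conjugation of a loop in `S` by the exponential of a Cartan loop. -/
def dconjS (κ : Loop H) (Y : Loop S) (κ' : Loop H) (Y' : Loop S) : Loop S :=
  Loop.map (retr S) (AdL (expL (jH κ)) (lieL (jH κ') (jS S Y) + jS S Y'))

variable {S} (hS : ∀ (h : H), ∀ y ∈ S, ⁅(h : 𝔤), y⁆ ∈ S)

include hS in
theorem jS_conjS (κ : Loop H) (Y : Loop S) : jS S (conjS S κ Y) = AdL (expL (jH κ)) (jS S Y) :=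
  jS_retr fun z => Ad_expG_mem S (hS _) (jS_mem Y z)

include hS in
theorem jS_dconjS (κ : Loop H) (Y : Loop S) (κ' : Loop H) (Y' : Loop S) :
    jS S (dconjS S κ Y κ' Y') = AdL (expL (jH κ)) (lieL (jH κ') (jS S Y) + jS S Y') :=
  jS_retr fun z => Ad_expG_mem S (hS _) (S.add_mem (hS _ _ (jS_mem Y z)) (jS_mem Y' z))

theorem expL_jH_add (κ κ' : Loop H) : expL (jH (κ + κ')) = expL (jH κ) * expL (jH κ') := by
  rw [map_add]
  exact expL_add fun z => lie_cartan_cartan _ _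

include hS in
theorem conjS_conjS (κ κ' : Loop H) (Y : Loop S) :
    conjS S κ (conjS S κ' Y) = conjS S (κ + κ') Y := jS_injective <| by
  rw [jS_conjS hS, jS_conjS hS, jS_conjS hS, expL_jH_add, AdL_mul_apply]

include hS in
theorem conjS_zero (Y : Loop S) : conjS S (0 : Loop H) Y = Y := jS_injective <| by
  rw [jS_conjS hS, map_zero, expL_zero, map_one]
  rfl

include hS in
theorem expL_conjS (h κ : Loop H) (Y : Loop S) :
    expL (jH h) * expL (jS S (conjS S κ Y)) =
      expL (jH (h + κ)) * expL (jS S Y) * (expL (jH κ))⁻¹ := by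
  rw [jS_conjS hS, expL_AdL, expL_jH_add]
  group

include hS in
theorem logDeriv_conjS (κ : Loop H) (Y : Loop S) (κ' : Loop H) (Y' : Loop S) (x : Loop H) :
    AdL (expL (jS S (conjS S κ Y)))⁻¹ (jH x) +
      dlogL (jS S (conjS S κ Y)) (jS S (dconjS S κ Y κ' Y')) =
    AdL (expL (jH κ)) (AdL (expL (jS S Y))⁻¹ (jH x) + dlogL (jS S Y) (jS S Y') +
      (AdL (expL (jS S Y))⁻¹ (jH κ') - jH κ')) := by
  have h1 : AdL (expL (jH κ))⁻¹ (jH x) = jH x := by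
    rw [expL_inv, ← map_neg, AdL_cartan_jH]
  have h2 : AdL (expL (jS S (conjS S κ Y)))⁻¹ (jH x) =
      AdL (expL (jH κ)) (AdL (expL (jS S Y))⁻¹ (jH x)) := by
    rw [jS_conjS hS, expL_AdL, mul_inv_rev, mul_inv_rev, inv_inv, AdL_mul_apply, AdL_mul_apply, h1]
  have h3 : dlogL (jS S (conjS S κ Y)) (jS S (dconjS S κ Y κ' Y')) =
      AdL (expL (jH κ)) (AdL (expL (jS S Y))⁻¹ (jH κ') - jH κ' + dlogL (jS S Y) (jS S Y')) := by
    rw [jS_dconjS hS, jS_conjS hS, dlogL_AdL, map_add (dlogL (jS S Y)), dlogL_lieL]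
  have h4 : ∀ (T : Module.End ℂ (Loop 𝔤)) (a a' k w : Loop 𝔤),
      T a + T (a' - k + w) = T (a + w + (a' - k)) := fun T a a' k w => by
    rw [← map_add]
    congr 1
    abel
  rw [h2, h3]
  exact h4 _ _ _ _ _

theorem isHolFamily_conjS {Q : Type*} [NormedAddCommGroup Q] [NormedSpace ℂ Q] {Ω : Set Q}
    {κ : Q → Loop H} {Y : Q → Loop S} (hκ : IsHolFamily Ω κ) (hY : IsHolFamily Ω Y) :
    IsHolFamily Ω fun x => conjS S (κ x) (Y x) :=
  ((HolG.expL (hκ.map _)).isHolFamily_AdL (hY.map _)).map _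

theorem hasVelocity_conjS (κ κ' : Loop H) (Y Y' : Loop S) :
    HasVelocity (fun t : ℂ => conjS S (κ + t • κ') (Y + t • Y')) (dconjS S κ Y κ' Y') := by
  intro ℓ z
  set h : 𝔤 := ((ev κ z : H) : 𝔤)
  set h' : 𝔤 := ((ev κ' z : H) : 𝔤)
  set y : 𝔤 := ((ev Y z : S) : 𝔤)
  set y' : 𝔤 := ((ev Y' z : S) : 𝔤)
  have hd0 := hasDerivAt_Ad_expG h' y 0
  have hd1 := (hasDerivAt_id (0 : ℂ)).smul (hasDerivAt_Ad_expG h' y' 0)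
  have hd2 := ((hd0.add hd1).const_mul (gm (expG h))).mul_const (gm (expG h)⁻¹)
  refine hasDerivAt_dual (ℓ ∘ₗ retr S) (y := fun t : ℂ => Ad (expG (h + t • h')) (y + t • y'))
    (y' := Ad (expG h) (⁅h', y⁆ + y')) ((hd2.congr_deriv ?_).congr_of_eventuallyEq
      (Eventually.of_forall fun t => ?_))
  · simp only [zero_smul, expG_zero, map_one, Module.End.one_apply, coe_Ad_gm, id, one_smul,
      zero_add, AddMemClass.coe_add]
  · have hl : ⁅h, t • h'⁆ = 0 := by
      rw [lie_smul, lie_cartan_cartan, smul_zero]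
    change ((Ad (expG (h + t • h')) (y + t • y') : 𝔤) : Mat d) = _
    rw [expG_add hl, map_mul, Module.End.mul_apply, coe_Ad_gm, map_add, map_smul]
    rfl

theorem continuous_conjS : Continuous fun q : Loop H × Loop S => conjS S q.1 q.2 := by
  refine continuous_to_loop fun i => ?_
  let Φ : C(H × S, ℂ) := ⟨fun q => (Module.finBasis ℂ S).coord i (retr S (toLie 𝔤
      (NormedSpace.exp (((q.1 : H) : 𝔤) : Mat d) * ((q.2 : S) : 𝔤) *
        NormedSpace.exp (-(((q.1 : H) : 𝔤) : Mat d))))), by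
    refine (LinearMap.continuous_of_finiteDimensional
      ((Module.finBasis ℂ S).coord i ∘ₗ retr S ∘ₗ toLie 𝔤)).comp ?_
    have h1 : Continuous fun q : H × S => (((q.1 : H) : 𝔤) : Mat d) :=
      continuous_subtype_val.comp (continuous_subtype_val.comp continuous_fst)
    have h2 : Continuous fun q : H × S => (((q.2 : S) : 𝔤) : Mat d) :=
      continuous_subtype_val.comp (continuous_subtype_val.comp continuous_snd)
    exact ((AlgebraExp.continuous_exp.comp h1).mul h2).mul (AlgebraExp.continuous_exp.comp h1.neg)⟩
  have : LocallyCompactSpace ℂˣ := Units.isOpenEmbedding_val.locallyCompactSpace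
  let G : C((Loop H × Loop S) × ℂˣ, ℂ) :=
    ⟨fun q => Φ ((q.1.1.1 : C(ℂˣ, H)) q.2, (q.1.2.1 : C(ℂˣ, S)) q.2), Φ.continuous.comp
      ((((continuous_subtype_val (p := fun f => f ∈ loopSubmodule H)).comp
          (continuous_fst.comp continuous_fst)).eval continuous_snd).prodMk
        (((continuous_subtype_val (p := fun f => f ∈ loopSubmodule S)).comp
          (continuous_snd.comp continuous_fst)).eval continuous_snd))⟩
  refine G.curry.continuous.congr fun q => ContinuousMap.ext fun z => ?_
  exact congrArg ((Module.finBasis ℂ S).coord i ∘ retr S) (toLie_coe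
    (ev (AdL (expL (jH q.1)) (jS S q.2)) z))

end Conjugation

end LoopReduction

namespace LoopReduction

open scoped Matrix.Norms.Operator

/-! ### Gauge transformations by Cartan loops -/

section Twist

variable {d : ℕ} {𝔤 : LieSubalgebra ℂ (Matrix (Fin d) (Fin d) ℂ)} [LieAlgebra.IsSemisimple ℂ 𝔤]
  {H : LieSubalgebra ℂ 𝔤} [H.IsCartanSubalgebra]
  (b : (LieAlgebra.IsKilling.rootSystem H).Base) {B : LinearMap.BilinForm ℂ 𝔤} (p : ℂˣ)
  (r₀ r₀' K T : Module.End ℂ (Loop H))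

/-- An r-matrix on the Cartan loops: a skew Fourier multiplier such that the map
`X ↦ (D r₊ - r₋) X` is invertible. -/
structure IsRMatrix (B : LinearMap.BilinForm ℂ 𝔤) (p : ℂˣ) (r₀ : Module.End ℂ (Loop H)) : Prop where
  mult : ∃ τ, IsMult r₀ τ
  skew : IsAdj (cartanForm H B) r₀ (-r₀)
  comm : Commute r₀ (shift p)
  unit : IsUnit (qOp p r₀)

theorem IsRMatrix.surjective {p : ℂˣ}
    {r₀ : Module.End ℂ (Loop H)} (h : IsRMatrix B p r₀) : Function.Surjective (qOp p r₀) :=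
  ((Module.End.isUnit_iff _).1 h.unit).2

/-- The action on the Cartan component. -/
def Mop : Module.End ℂ (Loop H) := 1 - K + shift p * K

/-- The exponent of the left factor of the transformation. -/
def Aop : Module.End ℂ (Loop H) := rpl r₀' * Mop p K + K - rpl r₀

theorem rpl_eq_rmi_add_one {V : Type*} [AddCommGroup V] [Module ℂ V] (r : Module.End ℂ V) :
    rpl r = rmi r + 1 := by
  unfold rpl rmi
  module

theorem Aop_eq : Aop p r₀ r₀' K = rmi r₀' * Mop p K + shift p * K - rmi r₀ := by
  rw [Aop, rpl_eq_rmi_add_one, rpl_eq_rmi_add_one r₀, add_mul, one_mul, Mop]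
  abel

/-- The transformation `(X, n₊, n₋) ↦ (M X, e^{K X} n₊ e^{-K X}, e^{D K X} n₋ e^{-D K X})`. -/
def Psi (v : Pts b) : Pts b :=
  (Mop p K v.1, conjS (nilOpp b) (K v.1) v.2.1, conjS (nil b) (shift p (K v.1)) v.2.2)

/-- The derivative of `Psi`. -/
def dPsi (v w : Pts b) : Pts b :=
  (Mop p K w.1, dconjS (nilOpp b) (K v.1) v.2.1 (K w.1) w.2.1,
    dconjS (nil b) (shift p (K v.1)) v.2.2 (shift p (K w.1)) w.2.2)

variable {b p r₀ r₀' K T}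

theorem lie_mem_nilOpp (h : H) : ∀ y ∈ nilOpp b, ⁅(h : 𝔤), y⁆ ∈ nilOpp b :=
  fun _ hy => lie_cartan_nilOpp b h hy

theorem lie_mem_nil (h : H) : ∀ y ∈ nil b, ⁅(h : 𝔤), y⁆ ∈ nil b :=
  fun _ hy => lie_cartan_nil b h hy

theorem continuous_conjS_comp {A : Type*} [TopologicalSpace A] {S : Submodule ℂ 𝔤} {f : A → Loop H}
    {g : A → Loop S} (hf : Continuous f) (hg : Continuous g) :
    Continuous fun a => conjS S (f a) (g a) := by
  have h := (continuous_conjS (H := H) (S := S)).comp (hf.prodMk hg)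
  exact h

theorem continuous_Psi (hK : ∃ κ, IsMult K κ) : Continuous (Psi b p K) := by
  obtain ⟨κ, hκ⟩ := hK
  have h1 : Continuous fun v : Pts b => K v.1 := hκ.continuous.comp continuous_fst
  have h2 : Continuous fun v : Pts b => Mop p K v.1 :=
    ((IsMult.one.sub hκ).add ((IsMult.shift p).mul hκ)).continuous.comp continuous_fst
  have h3 : Continuous fun v : Pts b => shift p (K v.1) := (IsMult.shift p).continuous.comp h1
  have h4 : Continuous fun v : Pts b => v.2.1 := continuous_fst.comp continuous_snd
  have h5 : Continuous fun v : Pts b => v.2.2 := continuous_snd.comp continuous_snd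
  exact h2.prodMk ((continuous_conjS_comp h1 h4).prodMk (continuous_conjS_comp h3 h5))

theorem isHolFamilyPts_Psi (hK : ∃ κ, IsMult K κ) {Q : Type*} [NormedAddCommGroup Q]
    [NormedSpace ℂ Q] [FiniteDimensional ℂ Q] {Ω : Set Q} (hΩ : IsOpen Ω) {c : Q → Pts b}
    (hc : IsHolFamilyPts b Ω c) : IsHolFamilyPts b Ω fun x => Psi b p K (c x) := by
  obtain ⟨κ, hκ⟩ := hK
  have h1 := hκ.isHolFamily hΩ hc.1
  exact ⟨((IsMult.one.sub hκ).add ((IsMult.shift p).mul hκ)).isHolFamily hΩ hc.1,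
    isHolFamily_conjS h1 hc.2.1, isHolFamily_conjS (h1.shift p) hc.2.2⟩

theorem isHolFamily_line {E : Type*} [AddCommGroup E] [Module ℂ E] [TopologicalSpace E]
    [IsTopologicalAddGroup E] [ContinuousSMul ℂ E] (X Y : Loop E) :
    IsHolFamily univ fun t : ℂ => X + t • Y :=
  (isHolFamily_const X).add ((isHolFamily_const Y).smul differentiableOn_id)

theorem hasVelocity_line {E : Type*} [AddCommGroup E] [Module ℂ E] [TopologicalSpace E]
    [IsTopologicalAddGroup E] [ContinuousSMul ℂ E] (X Y : Loop E) :
    HasVelocity (fun t : ℂ => X + t • Y) Y := by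
  intro ℓ z
  have h := ((hasDerivAt_id (0 : ℂ)).mul_const (ℓ (ev Y z))).const_add (ℓ (ev X z))
  refine (h.congr_deriv (one_mul _)).congr_of_eventuallyEq (Eventually.of_forall fun t => ?_)
  change ℓ (ev X z + t • ev Y z) = _
  rw [map_add, map_smul]
  rfl

theorem IsHolFamilyPts.line (v w : Pts b) : IsHolFamilyPts b univ fun t : ℂ => v + t • w :=
  ⟨isHolFamily_line _ _, isHolFamily_line _ _, isHolFamily_line _ _⟩

theorem hasVelocity_Psi (v w : Pts b) :
    HasVelocity (fun t : ℂ => (Psi b p K (v + t • w)).1) (dPsi b p K v w).1 ∧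
    HasVelocity (fun t : ℂ => (Psi b p K (v + t • w)).2.1) (dPsi b p K v w).2.1 ∧
    HasVelocity (fun t : ℂ => (Psi b p K (v + t • w)).2.2) (dPsi b p K v w).2.2 := by
  have h1 : ∀ t : ℂ, (v + t • w).1 = v.1 + t • w.1 := fun _ => rfl
  have h2 : ∀ t : ℂ, (v + t • w).2.1 = v.2.1 + t • w.2.1 := fun _ => rfl
  have h3 : ∀ t : ℂ, (v + t • w).2.2 = v.2.2 + t • w.2.2 := fun _ => rfl
  simp only [Psi, dPsi, h1, h2, h3, map_add, map_smul]
  exact ⟨hasVelocity_line _ _, hasVelocity_conjS _ _ _ _, hasVelocity_conjS _ _ _ _⟩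

theorem lgP_Psi (v : Pts b) : lgP b r₀' (Psi b p K v) =
    expL (jH (Aop p r₀ r₀' K v.1)) * lgP b r₀ v * (expL (jH (K v.1)))⁻¹ := by
  have h : rpl r₀' (Mop p K v.1) + K v.1 = Aop p r₀ r₀' K v.1 + rpl r₀ v.1 := by
    rw [Aop]
    simp
  have h2 := expL_conjS (lie_mem_nilOpp (b := b)) (rpl r₀' (Mop p K v.1)) (K v.1) v.2.1
  rw [h, expL_jH_add] at h2
  rw [lgP, lgP, nP, nP, ← mul_assoc, ← h2]
  rfl

theorem lgM_Psi (v : Pts b) : lgM b r₀' (Psi b p K v) =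
    expL (jH (Aop p r₀ r₀' K v.1)) * lgM b r₀ v * (expL (jH (shift p (K v.1))))⁻¹ := by
  have h : rmi r₀' (Mop p K v.1) + shift p (K v.1) = Aop p r₀ r₀' K v.1 + rmi r₀ v.1 := by
    rw [Aop_eq]
    simp
  have h2 := expL_conjS (lie_mem_nil (b := b)) (rmi r₀' (Mop p K v.1)) (shift p (K v.1)) v.2.2
  rw [h, expL_jH_add] at h2
  rw [lgM, lgM, nM, nM, ← mul_assoc, ← h2]
  rfl

theorem tP_Psi (v w : Pts b) : tP b r₀' (Psi b p K v) (dPsi b p K v w) =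
    AdL (expL (jH (K v.1))) (tP b r₀ v w +
      (AdL (nP b v)⁻¹ (jH (Aop p r₀ r₀' K w.1)) - jH (K w.1))) := by
  have h : rpl r₀' (Mop p K w.1) = Aop p r₀ r₀' K w.1 + rpl r₀ w.1 - K w.1 := by
    rw [Aop]
    simp
  refine (logDeriv_conjS (lie_mem_nilOpp (b := b)) (K v.1) v.2.1 (K w.1) w.2.1
    (rpl r₀' (Mop p K w.1))).trans (congrArg _ ?_)
  have h2 : ∀ a r k k' g : Loop 𝔤, a + r - k + g + (k - k') = r + g + (a - k') := by
    intros
    abel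
  have h3 : AdL (nP b v)⁻¹ (jH (rpl r₀' (Mop p K w.1))) =
      AdL (nP b v)⁻¹ (jH (Aop p r₀ r₀' K w.1)) + AdL (nP b v)⁻¹ (jH (rpl r₀ w.1)) -
        AdL (nP b v)⁻¹ (jH (K w.1)) := by
    rw [h]
    generalize AdL (nP b v)⁻¹ = T
    simp only [map_sub, map_add]
  rw [nP] at h3
  rw [h3]
  exact h2 _ _ _ _ _

theorem tM_Psi (v w : Pts b) : tM b r₀' (Psi b p K v) (dPsi b p K v w) =
    AdL (expL (jH (shift p (K v.1)))) (tM b r₀ v w +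
      (AdL (nM b v)⁻¹ (jH (Aop p r₀ r₀' K w.1)) - jH (shift p (K w.1)))) := by
  have h : rmi r₀' (Mop p K w.1) = Aop p r₀ r₀' K w.1 + rmi r₀ w.1 - shift p (K w.1) := by
    rw [Aop_eq]
    simp
  refine (logDeriv_conjS (lie_mem_nil (b := b)) (shift p (K v.1)) v.2.2 (shift p (K w.1)) w.2.2
    (rmi r₀' (Mop p K w.1))).trans (congrArg _ ?_)
  have h2 : ∀ a r k k' g : Loop 𝔤, a + r - k + g + (k - k') = r + g + (a - k') := by
    intros
    abel
  have h3 : AdL (nM b v)⁻¹ (jH (rmi r₀' (Mop p K w.1))) =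
      AdL (nM b v)⁻¹ (jH (Aop p r₀ r₀' K w.1)) + AdL (nM b v)⁻¹ (jH (rmi r₀ w.1)) -
        AdL (nM b v)⁻¹ (jH (shift p (K w.1))) := by
    rw [h]
    generalize AdL (nM b v)⁻¹ = T
    simp only [map_sub, map_add]
  rw [nM] at h3
  rw [h3]
  exact h2 _ _ _ _ _

theorem tL_Psi (v w : Pts b) : tL b p r₀' (Psi b p K v) (dPsi b p K v w) =
    AdL (expL (jH (shift p (K v.1)))) (tL b p r₀ v w +
      (shift p (AdL (nP b v)⁻¹ (jH (Aop p r₀ r₀' K w.1))) -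
        AdL (nM b v)⁻¹ (jH (Aop p r₀ r₀' K w.1)))) := by
  have h1 : shift p (tP b r₀' (Psi b p K v) (dPsi b p K v w)) =
      AdL (expL (jH (shift p (K v.1)))) (shift p (tP b r₀ v w) +
        (shift p (AdL (nP b v)⁻¹ (jH (Aop p r₀ r₀' K w.1))) - jH (shift p (K w.1)))) := by
    rw [tP_Psi (r₀ := r₀) (r₀' := r₀') v w]
    rfl
  have h2 : ∀ (T : Module.End ℂ (Loop 𝔤)) (x y a a' k : Loop 𝔤),
      T (x + (a - k)) - T (y + (a' - k)) = T (x - y + (a - a')) := fun T x y a a' k => by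
    rw [← map_sub]
    congr 1
    abel
  rw [tL, h1, tM_Psi (r₀ := r₀) (r₀' := r₀') v w, tL]
  exact h2 _ _ _ _ _ _

/-! #### Triangularity -/

theorem AdL_cartan_eq (h : Loop H) (X : Loop 𝔤) (b : (LieAlgebra.IsKilling.rootSystem H).Base) :
    AdL (expL (jH h)) X = AdL (expL (jH h)) (Pneg b X) + jH (PH H X) +
      AdL (expL (jH h)) (Ppos b X) := by
  have h1 : ∀ (T : Module.End ℂ (Loop 𝔤)) (x y z : Loop 𝔤), T y = y →
      T (x + y + z) = T x + y + T z := fun T x y z hy => by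
    rw [map_add, map_add, hy]
  rw [← h1 _ _ _ _ (AdL_cartan_jH h (PH H X)), Pneg_add_jH_add_Ppos]

theorem PH_AdL_cartan (h : Loop H) (X : Loop 𝔤) (b : (LieAlgebra.IsKilling.rootSystem H).Base) :
    PH H (AdL (expL (jH h)) X) = PH H X := by
  rw [AdL_cartan_eq h X b, map_add (PH H), map_add (PH H), PH_jH,
    PH_of_nilOpp (AdL_cartan_nilOpp h (Pneg_mem X)), PH_of_nil (AdL_cartan_nil h (Ppos_mem X)),
    zero_add, add_zero]

theorem PH_of_sub_nilOpp {X : Loop 𝔤} {h : Loop H} (hX : X - jH h ∈ ValuedIn (nilOpp b)) :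
    PH H X = h := by
  have := PH_of_nilOpp hX
  rwa [map_sub, PH_jH, sub_eq_zero] at this

theorem PH_of_sub_nil {X : Loop 𝔤} {h : Loop H} (hX : X - jH h ∈ ValuedIn (nil b)) :
    PH H X = h := by
  have := PH_of_nil hX
  rwa [map_sub, PH_jH, sub_eq_zero] at this

theorem PH_tL (v w : Pts b) : PH H (tL b p r₀ v w) = qOp p r₀ w.1 := by
  have h1 : PH H (tP b r₀ v w) = rpl r₀ w.1 := by
    rw [tP, map_add, PH_of_sub_nilOpp (AdL_nP_inv_sub_mem v (rpl r₀ w.1)), PH_of_nilOpp (b := b),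
      add_zero]
    exact fun z => dlog_mem _ (fun u hu => lie_nilOpp_nilOpp b (jS_mem v.2.1 z) hu) (jS_mem w.2.1 z)
  have h2 : PH H (tM b r₀ v w) = rmi r₀ w.1 := by
    rw [tM, map_add, PH_of_sub_nil (AdL_nM_inv_sub_mem v (rmi r₀ w.1)), PH_of_nil (b := b),
      add_zero]
    exact fun z => dlog_mem _ (fun u hu => lie_nil_nil b (jS_mem v.2.2 z) hu) (jS_mem w.2.2 z)
  rw [tL, map_sub, ← shift_PH, h1, h2]
  rfl

theorem gS_jH_sub_mem (v : Pts b) (τ : Loop H) :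
    gS b p r₀ v (jH τ) - jH (shift p⁻¹ τ) ∈ ValuedIn (nilOpp b) := by
  have h1 : AdL (nP b v) (jH (shift p⁻¹ τ)) - jH (shift p⁻¹ τ) ∈ ValuedIn (nilOpp b) :=
    AdL_nilOpp_sub_mem (jS_mem _) _ (by
      rw [sub_self]
      exact Submodule.zero_mem _)
  have h2 := AdL_cartan_nilOpp (rpl r₀ v.1) h1
  rwa [map_sub, AdL_cartan_jH, ← AdL_mul_apply] at h2

theorem gR_jH_sub_mem (v : Pts b) (τ : Loop H) :
    gR b r₀ v (jH τ) - jH τ ∈ ValuedIn (nil b) := by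
  have h1 : AdL (nM b v) (jH τ) - jH τ ∈ ValuedIn (nil b) :=
    AdL_nil_sub_mem (jS_mem _) _ (by
      rw [sub_self]
      exact Submodule.zero_mem _)
  have h2 := AdL_cartan_nil (rmi r₀ v.1) h1
  rwa [map_sub, AdL_cartan_jH, ← AdL_mul_apply] at h2

theorem PH_gV_jH (v : Pts b) (τ : Loop H) :
    PH H (gV b p r₀ v (jH τ)) = shift p⁻¹ τ - τ := by
  rw [gV, map_sub, PH_of_sub_nilOpp (gS_jH_sub_mem v τ), PH_of_sub_nil (gR_jH_sub_mem v τ)]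

theorem gW_jH (v : Pts b) (τ : Loop H) :
    gW b p r₀ v (jH τ) = (2 : ℂ) • jH (rmi r₀ (shift p⁻¹ τ) - rpl r₀ τ) := by
  have h1 : Ppos b (gS b p r₀ v (jH τ)) = 0 := by
    have := Ppos_of_nilOpp (gS_jH_sub_mem (p := p) (r₀ := r₀) v τ)
    rwa [map_sub, Ppos_jH, sub_zero] at this
  have h2 : Pneg b (gR b r₀ v (jH τ)) = 0 := by
    have := Pneg_of_nil (gR_jH_sub_mem (r₀ := r₀) v τ)
    rwa [map_sub, Pneg_jH, sub_zero] at this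
  rw [gW, rmi_rOp, rpl_rOp, PH_of_sub_nilOpp (gS_jH_sub_mem v τ),
    PH_of_sub_nil (gR_jH_sub_mem v τ), h1, h2, zero_add, sub_zero, map_sub]

/-! #### The pairing -/

theorem pair_add_nilOpp (hinv : ∀ x y z : 𝔤, B ⁅x, y⁆ z = B x ⁅y, z⁆) (hsymm : B.IsSymm)
    {X Y : Loop 𝔤} {h k : Loop H}
    (hX : X - jH h ∈ ValuedIn (nilOpp b)) (hY : Y - jH k ∈ ValuedIn (nilOpp b)) :
    pair B X Y = pair (cartanForm H B) h k := by
  have h1 : pair B (X - jH h) Y = 0 := by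
    rw [← sub_add_cancel Y (jH k), pair_add_right, pair_jH_right hsymm hinv b, PH_of_nilOpp hX,
      pair_zero_left, add_zero]
    exact pair_eq_zero B fun z => form_nilOpp_nilOpp b hinv (hX z) (hY z)
  rw [pair_sub_left, sub_eq_zero, pair_jH_left hinv b, PH_of_sub_nilOpp hY] at h1
  exact h1

theorem pair_add_nil (hinv : ∀ x y z : 𝔤, B ⁅x, y⁆ z = B x ⁅y, z⁆) (hsymm : B.IsSymm)
    {X Y : Loop 𝔤} {h k : Loop H}
    (hX : X - jH h ∈ ValuedIn (nil b)) (hY : Y - jH k ∈ ValuedIn (nil b)) :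
    pair B X Y = pair (cartanForm H B) h k := by
  have h1 : pair B (X - jH h) Y = 0 := by
    rw [← sub_add_cancel Y (jH k), pair_add_right, pair_jH_right hsymm hinv b, PH_of_nil hX,
      pair_zero_left, add_zero]
    exact pair_eq_zero B fun z => form_nil_nil b hinv (hX z) (hY z)
  rw [pair_sub_left, sub_eq_zero, pair_jH_left hinv b, PH_of_sub_nil hY] at h1
  exact h1

theorem pair_gS_gS (hinv : ∀ x y z : 𝔤, B ⁅x, y⁆ z = B x ⁅y, z⁆) (v : Pts b) (Z Z' : Loop 𝔤) :
    pair B (gS b p r₀ v Z) (gS b p r₀ v Z') = pair B Z Z' := by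
  rw [gS, gS, lgP_mem_isoG b r₀ hinv, pair_shift]

theorem pair_gR_gR (hinv : ∀ x y z : 𝔤, B ⁅x, y⁆ z = B x ⁅y, z⁆) (v : Pts b) (Z Z' : Loop 𝔤) :
    pair B (gR b r₀ v Z) (gR b r₀ v Z') = pair B Z Z' := by
  rw [gR, gR, lgM_mem_isoG b r₀ hinv]

theorem gW_eq_rpl (v : Pts b) (Z : Loop 𝔤) : gW b p r₀ v Z =
    (2 : ℂ) • (rpl (rOp b r₀) (gV b p r₀ v Z) - gS b p r₀ v Z) := by
  rw [gW, gV, map_sub]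
  nth_rw 2 [rpl_eq_rmi_add_one]
  rw [LinearMap.add_apply, Module.End.one_apply]
  congr 1
  abel

theorem gW_eq_rmi (v : Pts b) (Z : Loop 𝔤) : gW b p r₀ v Z =
    (2 : ℂ) • (rmi (rOp b r₀) (gV b p r₀ v Z) - gR b r₀ v Z) := by
  rw [gW, gV, map_sub, rpl_eq_rmi_add_one, LinearMap.add_apply, Module.End.one_apply]
  congr 1
  abel

theorem pair_gW_gV_jH (hinv : ∀ x y z : 𝔤, B ⁅x, y⁆ z = B x ⁅y, z⁆) (hsymm : B.IsSymm) (v : Pts b)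
    (Z : Loop 𝔤) (τ : Loop H) : pair B (gW b p r₀ v Z) (gV b p r₀ v (jH τ)) =
      2 * pair (cartanForm H B) (qOp p r₀ (PH H (gV b p r₀ v Z))) τ := by
  have h1 : rpl (rOp b r₀) (gV b p r₀ v Z) - jH (rpl r₀ (PH H (gV b p r₀ v Z))) ∈
      ValuedIn (nilOpp b) := by
    rw [rpl_rOp, add_sub_cancel_right]
    exact Pneg_mem _
  have h2 : rmi (rOp b r₀) (gV b p r₀ v Z) - jH (rmi r₀ (PH H (gV b p r₀ v Z))) ∈
      ValuedIn (nil b) := by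
    rw [rmi_rOp, sub_sub_cancel_left]
    exact Submodule.neg_mem _ (Ppos_mem _)
  have h3 : qOp p r₀ (PH H (gV b p r₀ v Z)) = shift p (rpl r₀ (PH H (gV b p r₀ v Z))) -
    rmi r₀ (PH H (gV b p r₀ v Z)) := rfl
  rw [h3, pair_sub_left, pair_shift_left, ← pair_add_nilOpp hinv hsymm h1 (gS_jH_sub_mem v τ),
    ← pair_add_nil hinv hsymm h2 (gR_jH_sub_mem v τ)]
  conv_lhs => rw [gV, pair_sub_right]
  nth_rw 1 [gW_eq_rpl]
  rw [gW_eq_rmi, pair_smul_left, pair_smul_left, pair_sub_left, pair_sub_left, pair_gS_gS hinv,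
    pair_gR_gR hinv]
  ring

/-! #### Pull back of gradients -/

theorem pair_cartan_variation (hinv : ∀ x y z : 𝔤, B ⁅x, y⁆ z = B x ⁅y, z⁆) (v : Pts b)
    (h : Loop H) (Z : Loop 𝔤) :
    pair B (shift p (AdL (nP b v)⁻¹ (jH h)) - AdL (nM b v)⁻¹ (jH h)) Z =
      pair (cartanForm H B) h (PH H (gV b p r₀ v Z)) := by
  have h1 : nP b v ∈ isoG B := expL_mem_isoG hinv _
  have h2 : nM b v ∈ isoG B := expL_mem_isoG hinv _
  rw [pair_sub_left, pair_shift_left, pair_AdL_inv_left h1, pair_AdL_inv_left h2, pair_jH_left hinv b, pair_jH_left hinv b,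
    ← pair_sub_right, gV, map_sub, gS, gR, lgP, lgM, AdL_mul_apply, AdL_mul_apply,
    PH_AdL_cartan _ _ b, PH_AdL_cartan _ _ b]

variable (b p r₀ K T) in
/-- The gradient at `v` transported back from `Psi v`, before the Cartan correction. -/
def backGrad (v : Pts b) (Z' : Loop 𝔤) : Loop 𝔤 := AdL (expL (jH (shift p (K v.1))))⁻¹ Z'

variable (b p r₀ K T) in
/-- The gradient of the pull back of a function by `Psi`. -/
def pullGrad (v : Pts b) (Z' : Loop 𝔤) : Loop 𝔤 :=
  backGrad b p K v Z' + jH (T (PH H (gV b p r₀ v (backGrad b p K v Z'))))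

theorem IsGrad.pull (hinv : ∀ x y z : 𝔤, B ⁅x, y⁆ z = B x ⁅y, z⁆) (hsymm : B.IsSymm)
    (hK : ∃ κ, IsMult K κ)
    (hT : ∀ X Y, pair (cartanForm H B) (qOp p r₀ X) (T Y) =
      pair (cartanForm H B) (Aop p r₀ r₀' K X) Y)
    {U : Set (Pts b)} (hU : IsOpen U) {φ : Pts b → ℂ} (hφ : IsSmooth b B p r₀' U φ) {v : Pts b}
    (hv : Psi b p K v ∈ U) {Z' : Loop 𝔤} (hZ : IsGrad b B p r₀' φ (Psi b p K v) Z') :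
    IsGrad b B p r₀ (φ ∘ Psi b p K) v (pullGrad b p r₀ K T v Z') := by
  intro w
  have h0 : Psi b p K (v + (0 : ℂ) • w) = Psi b p K v := by rw [zero_smul, add_zero]
  have h := hφ.hasDerivAt_comp hU (isHolFamilyPts_Psi hK isOpen_univ (IsHolFamilyPts.line v w))
    (hasVelocity_Psi v w) (by rwa [h0]) (by rwa [h0])
  refine h.congr_deriv ?_
  rw [h0, tL_Psi (r₀ := r₀), pair_AdL_left (expL_mem_isoG hinv _), pair_add_left,
    pair_cartan_variation (r₀ := r₀) hinv, pullGrad, pair_add_right, pair_jH_right hsymm hinv b,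
    PH_tL, hT]
  rfl

theorem gS_Psi (v : Pts b) (Z' : Loop 𝔤) : gS b p r₀' (Psi b p K v) Z' =
    AdL (expL (jH (Aop p r₀ r₀' K v.1))) (gS b p r₀ v (backGrad b p K v Z')) := by
  have h : shift p⁻¹ (backGrad b p K v Z') = AdL (expL (jH (K v.1)))⁻¹ (shift p⁻¹ Z') := by
    rw [backGrad, shift_AdL, map_inv, shiftG_expL, shift_jH, shift_inv_shift]
  rw [gS, gS, h, lgP_Psi (r₀ := r₀), AdL_mul_apply, AdL_mul_apply]

theorem gR_Psi (v : Pts b) (Z' : Loop 𝔤) : gR b r₀' (Psi b p K v) Z' =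
    AdL (expL (jH (Aop p r₀ r₀' K v.1))) (gR b r₀ v (backGrad b p K v Z')) := by
  rw [gR, gR, lgM_Psi (r₀ := r₀), AdL_mul_apply, AdL_mul_apply]
  try rfl

theorem gV_Psi (v : Pts b) (Z' : Loop 𝔤) : gV b p r₀' (Psi b p K v) Z' =
    AdL (expL (jH (Aop p r₀ r₀' K v.1))) (gV b p r₀ v (backGrad b p K v Z')) := by
  rw [gV, gV, map_sub, gS_Psi (r₀ := r₀), gR_Psi (p := p) (r₀ := r₀)]

theorem rOp_AdL_cartan (h : Loop H) (X : Loop 𝔤) :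
    rOp b r₀ (AdL (expL (jH h)) X) = AdL (expL (jH h)) (rOp b r₀ X) := by
  have h1 : Pneg b (AdL (expL (jH h)) X) = AdL (expL (jH h)) (Pneg b X) := by
    rw [AdL_cartan_eq h X b, map_add (Pneg b), map_add (Pneg b), Pneg_jH,
      Pneg_of_nilOpp (AdL_cartan_nilOpp h (Pneg_mem X)), Pneg_of_nil (AdL_cartan_nil h (Ppos_mem X)),
      add_zero, add_zero]
  have h2 : Ppos b (AdL (expL (jH h)) X) = AdL (expL (jH h)) (Ppos b X) := by
    rw [AdL_cartan_eq h X b, map_add (Ppos b), map_add (Ppos b), Ppos_jH,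
      Ppos_of_nilOpp (AdL_cartan_nilOpp h (Pneg_mem X)), Ppos_of_nil (AdL_cartan_nil h (Ppos_mem X)),
      zero_add, zero_add]
  have h3 : ∀ (T : Module.End ℂ (Loop 𝔤)) (x y z : Loop 𝔤), T y = y →
      T x - T z + y = T (x - z + y) := fun T x y z hy => by
    rw [map_add, map_sub, hy]
  rw [rOp_apply, rOp_apply, h1, h2, PH_AdL_cartan _ _ b]
  exact h3 _ _ _ _ (AdL_cartan_jH _ _)

theorem gW_Psi (v : Pts b) (Z' : Loop 𝔤) : gW b p r₀' (Psi b p K v) Z' =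
    AdL (expL (jH (Aop p r₀ r₀' K v.1))) (gW b p r₀ v (backGrad b p K v Z') +
      jH ((r₀' - r₀) (PH H (gV b p r₀ v (backGrad b p K v Z'))))) := by
  set Z := backGrad b p K v Z'
  have h1 : ∀ X : Loop 𝔤, rOp b r₀' X = rOp b r₀ X + jH ((r₀' - r₀) (PH H X)) := fun X => by
    rw [rOp_apply, rOp_apply, LinearMap.sub_apply, map_sub]
    abel
  have h2 : ∀ (r : Module.End ℂ (Loop H)) (S R : Loop 𝔤),
      (2 : ℂ) • (rmi (rOp b r) S - rpl (rOp b r) R) = rOp b r (S - R) - (S + R) := by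
    intro r S R
    change (2 : ℂ) • ((1 / 2 : ℂ) • (rOp b r S - S) - (1 / 2 : ℂ) • (rOp b r R + R)) = _
    rw [map_sub]
    module
  have h3 : ∀ (T : Module.End ℂ (Loop 𝔤)) (S R X : Loop 𝔤), rOp b r₀' (T (S - R)) = T X →
      rOp b r₀' (T S - T R) - (T S + T R) = T (X - (S + R)) := fun T S R X h => by
    rw [map_sub T, map_add T, ← h, map_sub T, map_sub (rOp b r₀')]
  rw [gW, gS_Psi (r₀ := r₀), gR_Psi (p := p) (r₀ := r₀), h2,
    h3 _ _ _ _ (rOp_AdL_cartan (Aop p r₀ r₀' K v.1) _), gW, h2, h1]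
  congr 1
  exact (sub_add_eq_add_sub _ _ _).symm

theorem gV_add (v : Pts b) (Z Z' : Loop 𝔤) :
    gV b p r₀ v (Z + Z') = gV b p r₀ v Z + gV b p r₀ v Z' := by
  simp only [gV, gS, gR, map_add]
  abel

theorem gW_add (v : Pts b) (Z Z' : Loop 𝔤) :
    gW b p r₀ v (Z + Z') = gW b p r₀ v Z + gW b p r₀ v Z' := by
  simp only [gW, gS, gR, map_add]
  rw [← smul_add]
  congr 1
  abel

theorem pair_qOp_adjoint (hsymm : B.IsSymm) (hr : IsAdj (cartanForm H B) r₀ (-r₀)) (τ h : Loop H) :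
    pair (cartanForm H B) (rmi r₀ (shift p⁻¹ τ) - rpl r₀ τ) h =
      -pair (cartanForm H B) (qOp p r₀ h) τ := by
  have hsymm' : (cartanForm H B).IsSymm := cartanForm_isSymm hsymm
  have h1 : qOp p r₀ h = shift p (rpl r₀ h) - rmi r₀ h := rfl
  have h2 : ∀ X Y, pair (cartanForm H B) (r₀ X) Y = -pair (cartanForm H B) (r₀ Y) X :=
    fun X Y => by
      rw [hr, LinearMap.neg_apply, pair_neg_right, pair_symm hsymm']
  rw [h1, pair_sub_left, pair_sub_left, pair_shift_left]
  simp only [rmi, rpl, LinearMap.smul_apply, pair_smul_left, LinearMap.sub_apply,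
    LinearMap.add_apply, Module.End.one_apply, pair_sub_left, pair_add_left]
  rw [h2 h, h2 h, pair_symm hsymm' h, pair_symm hsymm' h]
  ring

theorem pair_gW_gV_add (hsymm : B.IsSymm)
    (hinv : ∀ x y z : 𝔤, B ⁅x, y⁆ z = B x ⁅y, z⁆) (hr : IsAdj (cartanForm H B) r₀ (-r₀))
    (hT : ∀ X Y, pair (cartanForm H B) (qOp p r₀ X) (T Y) =
      pair (cartanForm H B) (Aop p r₀ r₀' K X) Y)
    (hcmp : ∀ X Y, 2 * pair (cartanForm H B) (Aop p r₀ r₀' K X) Y -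
      2 * pair (cartanForm H B) (Aop p r₀ r₀' K (Y + (shift p⁻¹ (T Y) - T Y))) X =
      pair (cartanForm H B) ((r₀' - r₀) X) Y) (v : Pts b) (X Y : Loop 𝔤) :
    pair B (gW b p r₀ v (X + jH (T (PH H (gV b p r₀ v X)))))
      (gV b p r₀ v (Y + jH (T (PH H (gV b p r₀ v Y))))) =
    pair B (gW b p r₀ v X + jH ((r₀' - r₀) (PH H (gV b p r₀ v X)))) (gV b p r₀ v Y) := by
  have h1 := pair_gW_gV_jH (p := p) (r₀ := r₀) hinv hsymm v X (T (PH H (gV b p r₀ v Y)))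
  rw [hT] at h1
  have h6 : ∀ (h : Loop H) (V : Loop 𝔤), pair B ((2 : ℂ) • jH h) V =
      2 * pair (cartanForm H B) h (PH H V) := fun h V => by
    rw [pair_smul_left, pair_jH_left hinv b]
  have h2 : pair B (gW b p r₀ v (jH (T (PH H (gV b p r₀ v X)))))
      (gV b p r₀ v Y + gV b p r₀ v (jH (T (PH H (gV b p r₀ v Y))))) =
      -2 * pair (cartanForm H B) (Aop p r₀ r₀' K (PH H (gV b p r₀ v Y) +
        (shift p⁻¹ (T (PH H (gV b p r₀ v Y))) - T (PH H (gV b p r₀ v Y)))))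
        (PH H (gV b p r₀ v X)) := by
    rw [gW_jH, h6, pair_qOp_adjoint hsymm hr, hT, map_add (PH H), PH_gV_jH]
    ring
  have h3 := hcmp (PH H (gV b p r₀ v X)) (PH H (gV b p r₀ v Y))
  have h4 : ∀ W W' V V' : Loop 𝔤, pair B (W + W') (V + V') =
      pair B W V + pair B W V' + pair B W' (V + V') := fun W W' V V' => by
    rw [pair_add_left, pair_add_right]
  have h5 : ∀ (W V : Loop 𝔤) (h : Loop H), pair B (W + jH h) V =
      pair B W V + pair (cartanForm H B) h (PH H V) := fun W V h => by
    rw [pair_add_left, pair_jH_left hinv b]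
  rw [gW_add, gV_add, h4, h2, h1, h5, ← h3]
  ring

theorem bracket_Psi (hnondeg : B.Nondegenerate) (hsymm : B.IsSymm)
    (hinv : ∀ x y z : 𝔤, B ⁅x, y⁆ z = B x ⁅y, z⁆) (hr : IsRMatrix B p r₀) (hr' : IsRMatrix B p r₀')
    (hK : ∃ κ, IsMult K κ)
    (hT : ∀ X Y, pair (cartanForm H B) (qOp p r₀ X) (T Y) =
      pair (cartanForm H B) (Aop p r₀ r₀' K X) Y)
    (hcmp : ∀ X Y, 2 * pair (cartanForm H B) (Aop p r₀ r₀' K X) Y -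
      2 * pair (cartanForm H B) (Aop p r₀ r₀' K (Y + (shift p⁻¹ (T Y) - T Y))) X =
      pair (cartanForm H B) ((r₀' - r₀) X) Y)
    {U : Set (Pts b)} (hU : IsOpen U) {φ ψ : Pts b → ℂ} (hφ : IsSmooth b B p r₀' U φ)
    (hψ : IsSmooth b B p r₀' U ψ) {v : Pts b} (hv : Psi b p K v ∈ U) :
    bracket b B p r₀ (φ ∘ Psi b p K) (ψ ∘ Psi b p K) v =
      bracket b B p r₀' φ ψ (Psi b p K v) := by
  have hex : ∀ {φ : Pts b → ℂ}, IsSmooth b B p r₀' U φ → ∃ Z, IsGrad b B p r₀' φ (Psi b p K v) Z := by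
    rintro φ ⟨-, η, η', h, -⟩
    exact ⟨_, (isRightGrad_iff hinv).1 (h _ hv).2⟩
  obtain ⟨Zφ, hZφ⟩ := hex hφ
  obtain ⟨Zψ, hZψ⟩ := hex hψ
  rw [hZφ.bracket_eq hnondeg hinv hr'.comm (hr'.surjective) hZψ,
    (hZφ.pull hinv hsymm hK hT hU hφ hv).bracket_eq hnondeg hinv hr.comm (hr.surjective)
      (hZψ.pull hinv hsymm hK hT hU hψ hv)]
  rw [gW_Psi (r₀ := r₀), gV_Psi (r₀ := r₀), expL_mem_isoG hinv, pullGrad, pullGrad]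
  exact pair_gW_gV_add hsymm hinv hr.skew hT hcmp v _ _

theorem isHolFamily_backGrad (hK : ∃ κ, IsMult K κ) {Q : Type*} [NormedAddCommGroup Q]
    [NormedSpace ℂ Q] [FiniteDimensional ℂ Q] {Ω : Set Q} (hΩ : IsOpen Ω) {c : Q → Pts b}
    (hc : IsHolFamilyPts b Ω c) {Z : Q → Loop 𝔤} (hZ : IsHolFamily Ω Z) :
    IsHolFamily Ω fun x => backGrad b p K (c x) (Z x) := by
  obtain ⟨κ, hκ⟩ := hK
  exact (HolG.expL (((hκ.isHolFamily hΩ hc.1).shift p).map _)).inv.isHolFamily_AdL hZ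

theorem IsMult.rpl (hr : ∃ τ, IsMult r₀ τ) : ∃ τ, IsMult (rpl r₀) τ :=
  ⟨_, (hr.choose_spec.add IsMult.one).smul _⟩

theorem IsMult.rmi (hr : ∃ τ, IsMult r₀ τ) : ∃ τ, IsMult (rmi r₀) τ :=
  ⟨_, (hr.choose_spec.sub IsMult.one).smul _⟩

theorem holG_lgP (hr : ∃ τ, IsMult r₀ τ) {Q : Type*} [NormedAddCommGroup Q]
    [NormedSpace ℂ Q] [FiniteDimensional ℂ Q] {Ω : Set Q} (hΩ : IsOpen Ω) {c : Q → Pts b}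
    (hc : IsHolFamilyPts b Ω c) : HolG Ω fun x => lgP b r₀ (c x) := by
  obtain ⟨τ, hτ⟩ := IsMult.rpl hr
  exact (HolG.expL ((hτ.isHolFamily hΩ hc.1).map _)).mul (HolG.expL (hc.2.1.map _))

theorem holG_lgM (hr : ∃ τ, IsMult r₀ τ) {Q : Type*} [NormedAddCommGroup Q]
    [NormedSpace ℂ Q] [FiniteDimensional ℂ Q] {Ω : Set Q} (hΩ : IsOpen Ω) {c : Q → Pts b}
    (hc : IsHolFamilyPts b Ω c) : HolG Ω fun x => lgM b r₀ (c x) := by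
  obtain ⟨τ, hτ⟩ := IsMult.rmi hr
  exact (HolG.expL ((hτ.isHolFamily hΩ hc.1).map _)).mul (HolG.expL (hc.2.2.map _))

/-- Smoothness in terms of transported gradients. -/
theorem isSmooth_of_isGrad (hinv : ∀ x y z : 𝔤, B ⁅x, y⁆ z = B x ⁅y, z⁆) (hr : ∃ τ, IsMult r₀ τ)
    {U : Set (Pts b)} {φ : Pts b → ℂ}
    (h1 : ∀ (k : ℕ) (Ω : Set (Fin k → ℂ)) (c : (Fin k → ℂ) → Pts b), IsOpen Ω →
      IsHolFamilyPts b Ω c → MapsTo c Ω U → DifferentiableOn ℂ (φ ∘ c) Ω)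
    {Z : Pts b → Loop 𝔤} (hZ : ∀ v ∈ U, IsGrad b B p r₀ φ v (Z v))
    (h2 : ∀ (k : ℕ) (Ω : Set (Fin k → ℂ)) (c : (Fin k → ℂ) → Pts b), IsOpen Ω →
      IsHolFamilyPts b Ω c → MapsTo c Ω U → IsHolFamily Ω fun x => Z (c x)) :
    IsSmooth b B p r₀ U φ := by
  refine ⟨h1, fun v => AdL (shiftG p (lgP b r₀ v)) (Z v), fun v => AdL (lgM b r₀ v) (Z v),
    fun v hv => ⟨?_, ?_⟩, fun k Ω c hΩ hc hm => ⟨?_, ?_⟩⟩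
  · rw [isLeftGrad_iff hinv, AdL_inv_apply_self]
    exact hZ v hv
  · rw [isRightGrad_iff hinv, AdL_inv_apply_self]
    exact hZ v hv
  · exact ((holG_lgP hr hΩ hc).shiftG p).isHolFamily_AdL (h2 k Ω c hΩ hc hm)
  · exact (holG_lgM hr hΩ hc).isHolFamily_AdL (h2 k Ω c hΩ hc hm)

theorem IsSmooth.exists_isGrad (hinv : ∀ x y z : 𝔤, B ⁅x, y⁆ z = B x ⁅y, z⁆)
    (hr : ∃ τ, IsMult r₀ τ) {U : Set (Pts b)} {φ : Pts b → ℂ} (hφ : IsSmooth b B p r₀ U φ) :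
    ∃ Z : Pts b → Loop 𝔤, (∀ v ∈ U, IsGrad b B p r₀ φ v (Z v)) ∧
      ∀ (k : ℕ) (Ω : Set (Fin k → ℂ)) (c : (Fin k → ℂ) → Pts b), IsOpen Ω →
        IsHolFamilyPts b Ω c → MapsTo c Ω U → IsHolFamily Ω fun x => Z (c x) := by
  obtain ⟨-, η, η', h, h2⟩ := hφ
  exact ⟨fun v => AdL (lgM b r₀ v)⁻¹ (η' v), fun v hv => (isRightGrad_iff hinv).1 (h v hv).2,
    fun k Ω c hΩ hc hm => (holG_lgM hr hΩ hc).inv.isHolFamily_AdL (h2 k Ω c hΩ hc hm).2⟩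

theorem IsSmooth.comp_Psi (hsymm : B.IsSymm)
    (hinv : ∀ x y z : 𝔤, B ⁅x, y⁆ z = B x ⁅y, z⁆) (hr : ∃ τ, IsMult r₀ τ) (hr' : ∃ τ, IsMult r₀' τ)
    (hK : ∃ κ, IsMult K κ) (hTm : ∃ τ, IsMult T τ)
    (hT : ∀ X Y, pair (cartanForm H B) (qOp p r₀ X) (T Y) =
      pair (cartanForm H B) (Aop p r₀ r₀' K X) Y)
    {U : Set (Pts b)} (hU : IsOpen U) {φ : Pts b → ℂ} (hφ : IsSmooth b B p r₀' U φ) :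
    IsSmooth b B p r₀ (Psi b p K ⁻¹' U) (φ ∘ Psi b p K) := by
  obtain ⟨Z, hZ, hZh⟩ := hφ.exists_isGrad hinv hr'
  obtain ⟨τ, hτ⟩ := hTm
  refine isSmooth_of_isGrad hinv hr (Z := fun v => pullGrad b p r₀ K T v (Z (Psi b p K v)))
    (fun k Ω c hΩ hc hm => hφ.1 k Ω _ hΩ (isHolFamilyPts_Psi hK hΩ hc) hm)
    (fun v hv => (hZ _ hv).pull hinv hsymm hK hT hU hφ hv) fun k Ω c hΩ hc hm => ?_
  have h1 := isHolFamily_backGrad (p := p) hK hΩ hc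
    (hZh k Ω _ hΩ (isHolFamilyPts_Psi (p := p) hK hΩ hc) hm)
  have h2 := (holG_lgP hr hΩ hc).isHolFamily_AdL (h1.shift p⁻¹)
  have h3 := (holG_lgM hr hΩ hc).isHolFamily_AdL h1
  have h4 := h2.add (h3.smul (differentiableOn_const (-1 : ℂ)))
  have h5 := h1.add (IsHolFamily.map (hτ.isHolFamily hΩ (h4.map (cartanProj H)))
    (H.toSubmodule.subtype : H →ₗ[ℂ] 𝔤))
  simp only [neg_one_smul, ← sub_eq_add_neg] at h5
  exact h5

end Twist

end LoopReduction

namespace LoopReduction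

/-! ### Operator identities for the gauge transformation -/

section RingIdentities

variable {R : Type*} [Ring R] {D Di s r K L : R}

theorem mul_left_comm_of_commute {a b : R} (h : Commute a b) (x : R) : a * (b * x) = b * (a * x) := by
  rw [← mul_assoc, h.eq, mul_assoc]

/-- The product of the operator `M` with its adjoint. -/
theorem Mop_mul_adjoint (hD : D * Di = 1) (hD' : Di * D = 1) (hKDi : Commute K Di)
    (hLDi : Commute L Di) : (1 - K + D * K) * (1 - L + L * Di) =
      1 + (1 - Di) * ((1 - D) * K * L + D * K - L) := by
  have h1 : ∀ x, D * (Di * x) = x := fun x => by rw [← mul_assoc, hD, one_mul]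
  have h2 : ∀ x, Di * (D * x) = x := fun x => by rw [← mul_assoc, hD', one_mul]
  simp only [mul_add, add_mul, mul_sub, sub_mul, mul_assoc, one_mul, mul_one,
    hLDi.eq, mul_left_comm_of_commute hKDi, h1, h2]
  abel

theorem symbol_identity (hD : D * Di = 1) (hD' : Di * D = 1) (hsD : Commute s D)
    (hsDi : Commute s Di) :
    (1 - s) - (1 - Di) * (s * D * r - (r - 1)) = (1 - s * D) * (r - Di * (r - 1)) := by
  have h1 : ∀ x, D * (Di * x) = x := fun x => by rw [← mul_assoc, hD, one_mul]
  have h2 : ∀ x, Di * (D * x) = x := fun x => by rw [← mul_assoc, hD', one_mul]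
  simp only [mul_sub, sub_mul, mul_assoc, one_mul, mul_one, hsD.eq, hsDi.eq,
    mul_left_comm_of_commute hsDi, h1, h2]
  abel

theorem Aop_identity (hD : D * Di = 1) (hD' : Di * D = 1) (hsD : Commute s D)
    (hsDi : Commute s Di) (hrDi : Commute r Di)
    (hKDi : Commute K Di) (hLDi : Commute L Di) (hLr : Commute L r)
    (hK : (1 - s) * ((1 - D) * K * L + D * K - L) = -(s * D * r - (r - 1))) :
    ((1 - K + D * K) + (1 - s * D) * (K - r)) * (1 - L + L * Di) =
      (1 - s * D) * (L * (Di * (D * r - (r - 1)))) := by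
  have h1 : ∀ x, D * (Di * x) = x := fun x => by rw [← mul_assoc, hD, one_mul]
  have h2 : ∀ x, Di * (D * x) = x := fun x => by rw [← mul_assoc, hD', one_mul]
  rw [← sub_eq_zero, ← sub_eq_zero_of_eq hK, sub_neg_eq_add]
  simp only [mul_add, add_mul, mul_sub, sub_mul, mul_assoc, one_mul, mul_one, hsD.eq,
    mul_left_comm_of_commute hsD, mul_left_comm_of_commute hsDi,
    mul_left_comm_of_commute hrDi, mul_left_comm_of_commute hKDi,
    hLDi.eq, hLr.eq, mul_left_comm_of_commute hLDi, h1, h2]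
  abel

theorem bracket_identity {X A c : R} (hD : D * Di = 1)
    (hXD : Commute X D) (hLDi : Commute L Di)
    (hX : X * (1 - L + L * Di) = L * Di) (hA : A = X * (D * r - (r - 1))) :
    A - (-((1 - L + L * Di) * c) + L + (r - 1)) -
      X * ((D - 1) * (-((1 - L + L * Di) * c) + L + (r - 1))) = c - (r - 1) := by
  have h1 : ∀ x, D * (Di * x) = x := fun x => by rw [← mul_assoc, hD, one_mul]
  have e1 : (D - 1) * (L + (r - 1)) = (D * r - (r - 1)) - D * (1 - L + L * Di) := by
    simp only [mul_add, mul_sub, sub_mul, one_mul, mul_one, hLDi.eq, h1]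
    abel
  have e2 : X * ((D - 1) * ((1 - L + L * Di) * c)) = (D - 1) * (L * Di) * c := by
    rw [← mul_assoc, (hXD.sub_right (Commute.one_right X)).eq, mul_assoc,
      ← mul_assoc X, hX, ← mul_assoc]
  have e3 : X * (D * (1 - L + L * Di)) = L := by
    rw [← mul_assoc, hXD.eq, mul_assoc, hX, hLDi.eq, h1]
  have e4 : X * ((D - 1) * (-((1 - L + L * Di) * c) + L + (r - 1))) =
      -((D - 1) * (L * Di) * c) + (A - L) := by
    rw [add_assoc, mul_add (D - 1), mul_neg, mul_add X, mul_neg, e2, e1, mul_sub X, ← hA, e3]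
  rw [e4, hLDi.eq, sub_mul D 1, h1, one_mul]
  simp only [add_mul, sub_mul, one_mul]
  abel

theorem cayley_identity {a a' c : R} (h : a' * a = 1) (hc : (1 - a) * c = 1) :
    (1 - a') * -((1 + a) * c) = 1 + a' := by
  have e : (1 - a') * -(1 + a) = (1 + a') * (1 - a) := by
    simp only [mul_add, mul_sub, sub_mul, add_mul, mul_neg, h, one_mul, mul_one]
    abel
  rw [← neg_mul, ← mul_assoc, e, mul_assoc, hc, mul_one]

theorem bracket_identity_of_eq {X A As c : R} (hD : D * Di = 1)
    (hXD : Commute X D) (hLDi : Commute L Di) (hX : X * (1 - L + L * Di) = L * Di)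
    (hA : A = X * (D * r - (r - 1))) (hAs : As = (1 - L + L * Di) * -c + L - -(r - 1)) :
    A - As - X * ((D - 1) * As) = c - (r - 1) := by
  rw [← bracket_identity (c := c) hD hXD hLDi hX hA, hAs, mul_neg, sub_neg_eq_add]

theorem transformation_identity (hD : D * Di = 1) (hD' : Di * D = 1) (hsD : Commute s D)
    (hsDi : Commute s Di) (hKs : Commute K s) (hKDi : Commute K Di) (hLDi : Commute L Di)
    (hK : (1 - s) * ((1 - D) * K * L + D * K - L) = -(s * D * r - (r - 1))) :
    (1 - K + D * K) * ((1 - s) * (1 - L + L * Di)) =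
      (1 - s * D) * (Di * (D * r - (r - 1))) := by
  have hcM : Commute (1 - s) (1 - K + D * K) :=
    (Commute.one_left _).sub_left (((Commute.one_right _).sub_right hKs.symm).add_right
      (hsD.mul_right hKs.symm))
  have hc : Commute (1 - s) (1 - Di) :=
    (Commute.one_left _).sub_left ((Commute.one_right _).sub_right hsDi)
  rw [← mul_assoc, ← hcM.eq, mul_assoc, Mop_mul_adjoint hD hD' hKDi hLDi, mul_add, mul_one,
    ← mul_assoc, hc.eq, mul_assoc, hK, mul_neg, ← sub_eq_add_neg, symbol_identity hD hD' hsD hsDi,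
    mul_sub Di (D * r), ← mul_assoc Di D, hD', one_mul]

theorem quotient_identity {c q : R} (hD : D * Di = 1) (hD' : Di * D = 1) (hsD : Commute s D)
    (hsDi : Commute s Di) (hrD : Commute r D) (hrDi : Commute r Di)
    (hKDi : Commute K Di) (hLD : Commute L D) (hLDi : Commute L Di) (hLr : Commute L r)
    (hK : (1 - s) * ((1 - D) * K * L + D * K - L) = -(s * D * r - (r - 1)))
    (hc : c * (1 - s * D) = 1) (hq : (D * r - (r - 1)) * q = 1) (hq' : q * (D * r - (r - 1)) = 1) :
    (c * (1 - K + D * K) + K - r) * q * (1 - L + L * Di) = L * Di := by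
  have h1 := Aop_identity hD hD' hsD hsDi hrDi hKDi hLDi hLr hK
  have h2 : (c * (1 - K + D * K) + K - r) * (1 - L + L * Di) = L * (Di * (D * r - (r - 1))) := by
    have h3 : c * ((1 - K + D * K) + (1 - s * D) * (K - r)) = c * (1 - K + D * K) + K - r := by
      rw [mul_add c, ← mul_assoc c (1 - s * D), hc, one_mul, add_sub_assoc]
    rw [← h3, mul_assoc c, h1, ← mul_assoc c (1 - s * D), hc, one_mul]
  have hr1 : ∀ {x : R}, Commute x D → Commute x r → Commute (D * r - (r - 1)) x := fun h h' =>
    ((h.mul_right h').sub_right (h'.sub_right (Commute.one_right _))).symm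
  have hqc : ∀ {x : R}, Commute x D → Commute x r → q * x = x * q := fun {x} h h' => by
    calc q * x = q * (x * (D * r - (r - 1))) * q := by rw [mul_assoc, mul_assoc, hq, mul_one]
      _ = x * q := by rw [← (hr1 h h').eq, ← mul_assoc q, hq', one_mul]
  have hDi : Commute Di D := hD'.trans hD.symm
  have e : q * (1 - L + L * Di) = (1 - L + L * Di) * q :=
    hqc (((Commute.one_left _).sub_left hLD).add_left (hLD.mul_left hDi))
      (((Commute.one_left _).sub_left hLr).add_left (hLr.mul_left hrDi.symm))
  rw [mul_assoc, e, ← mul_assoc, h2, mul_assoc, mul_assoc, hq, mul_one]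

theorem functional_identity [Algebra ℂ R] {u Pp Pz Pn : R} (hsD : Commute s D)
    (hu : (1 - s) * u = 1) (hP : Pp + Pz + Pn = 1) (hPz : D * Pz = Pz)
    (hK : (1 - D) * K * L + D * K - L =
      -(D * s * u * Pp) - u * Pn - (1 / 2 : ℂ) • ((1 + s) * u * Pz)) :
    (1 - s) * ((1 - D) * K * L + D * K - L) =
      -(s * D * (Pp + (1 / 2 : ℂ) • Pz) - (Pp + (1 / 2 : ℂ) • Pz - 1)) := by
  have hc : Commute s (1 - s) := (Commute.one_right _).sub_right (Commute.refl _)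
  have hD : Commute D (1 - s) := (Commute.one_right _).sub_right hsD.symm
  have e1 : (1 - s) * (D * s * u * Pp) = s * D * Pp := by
    rw [← mul_assoc, ← mul_assoc, ← (hD.mul_left hc).eq, mul_assoc (D * s), hu, mul_one, hsD.eq]
  have e2 : (1 - s) * (u * Pn) = Pn := by rw [← mul_assoc, hu, one_mul]
  have e3 : (1 - s) * ((1 + s) * u * Pz) = (1 + s) * Pz := by
    rw [← mul_assoc, ← mul_assoc, ← ((Commute.one_left _).add_left hc).eq, mul_assoc (1 + _), hu,
      mul_one]
  rw [hK, mul_sub (1 - s), mul_sub (1 - s), mul_neg, mul_smul_comm, e1, e2, e3,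
    add_mul 1 s Pz, one_mul, ← hP, mul_add (s * D), mul_smul_comm, mul_assoc s D Pz, hPz]
  module

end RingIdentities

section Adjoints

variable {E : Type*} [AddCommGroup E] [Module ℂ E] [TopologicalSpace E] [IsTopologicalAddGroup E]
  [ContinuousSMul ℂ E] [FiniteDimensional ℂ E] {B : LinearMap.BilinForm ℂ E}
  {T T' : Module.End ℂ (Loop E)} {τ τ' : ℤ → Module.End ℂ E}

theorem exists_form_adjoint (hB : B.Nondegenerate) (T : Module.End ℂ E) :
    ∃ T' : Module.End ℂ E, ∀ x y, B (T x) y = B x (T' y) := by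
  have hflip : B.flip.Nondegenerate := LinearMap.BilinForm.nondegenerate_flip_iff.2 hB
  refine ⟨(B.flip.toDual hflip).symm.toLinearMap ∘ₗ T.dualMap ∘ₗ B.flip, fun x y => ?_⟩
  exact (LinearMap.BilinForm.apply_toDual_symm_apply (hB := hflip) (T.dualMap (B.flip y)) x).symm

theorem IsMult.exists_isAdj [T2Space E] (hB : B.Nondegenerate) (h : IsMult T τ) :
    ∃ T', (∃ τ', IsMult T' τ') ∧ IsAdj B T T' := by
  choose σ hσ using fun n => exists_form_adjoint hB (τ n)
  obtain ⟨T', hT'⟩ := exists_isMult (fun n => σ (-n)) fun ℓ e => by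
    obtain ⟨x, rfl⟩ := (B.toDual hB).surjective ℓ
    obtain ⟨C, ρ, hC, hρ, hb⟩ := h.expGrowth (B.flip e) x
    refine ⟨C, ρ, hC, hρ, fun n => ?_⟩
    have := hb (-n)
    rw [Int.natAbs_neg] at this
    change ‖B.toDual hB x (σ (-n) e)‖ ≤ _
    rw [LinearMap.BilinForm.toDual_def, ← hσ]
    exact this
  refine ⟨T', ⟨_, hT'⟩, h.pair_adjoint hT' fun n x y => ?_⟩
  rw [neg_neg, hσ]

theorem IsAdj.map [T2Space E] {S S' : Module.End ℂ E} (h : ∀ x y, B (S x) y = B x (S' y)) :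
    IsAdj B (Loop.map S) (Loop.map S') := fun X Y =>
  pair_congr B fun z => h (ev X z) (ev Y z)

theorem IsMult.right_inv_unique (h : IsMult T τ) {N : Module.End ℂ (Loop E)} (hN : T * N = 1) :
    N * T = 1 :=
  h.mul_left_cancel (h.isUnit hN) (by rw [← mul_assoc, hN, one_mul, mul_one])

theorem IsMult.inverse (h : IsMult T τ) (hT : IsUnit T) : ∃ τ', IsMult (Ring.inverse T) τ' :=
  ⟨_, h.inv (Ring.mul_inverse_cancel T hT)⟩

theorem shift_one_of_mode_zero (p : ℂˣ) :
    (shift p * modeProj E {0} : Module.End ℂ (Loop E)) = modeProj E {0} :=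
  ((IsMult.shift p).mul (isMult_modeProj E {0})).eq (isMult_modeProj E {0}) fun n => by
    by_cases hn : n = 0 <;> simp [hn]

theorem modeProj_add_add : (modeProj E {n : ℤ | 0 < n} + modeProj E {0} + modeProj E {n : ℤ | n < 0} :
    Module.End ℂ (Loop E)) = 1 :=
  (((isMult_modeProj E _).add (isMult_modeProj E _)).add (isMult_modeProj E _)).eq IsMult.one
    fun n => by
      rcases lt_trichotomy n 0 with hn | hn | hn
      · simp [hn, hn.ne, hn.le]
      · simp [hn]
      · simp [hn, hn.ne', hn.le]

theorem commute_modeProj (h : IsMult T τ) (S : Set ℤ) : Commute (modeProj E S) T :=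
  ((isMult_modeProj E S).comm_iff h).2 fun n => by split_ifs <;> simp

theorem isAdj_modeProj (B : LinearMap.BilinForm ℂ E) {S S' : Set ℤ} (h : ∀ n, n ∈ S ↔ -n ∈ S') :
    IsAdj B (modeProj E S) (modeProj E S') :=
  (isMult_modeProj E S).pair_adjoint (isMult_modeProj E S') fun n x y => by
    by_cases hn : n ∈ S
    · simp [hn, (h n).1 hn]
    · simp [hn, (h n).not.1 hn]

end Adjoints

section RMatrices

variable {d : ℕ} {𝔤 : LieSubalgebra ℂ (Matrix (Fin d) (Fin d) ℂ)} [LieAlgebra.IsSemisimple ℂ 𝔤]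
  {H : LieSubalgebra ℂ 𝔤} [H.IsCartanSubalgebra] {B : LinearMap.BilinForm ℂ 𝔤} {p : ℂˣ}

theorem isMult_rNew : ∃ τ, IsMult (rNew H) τ :=
  ⟨_, (isMult_modeProj H _).sub (isMult_modeProj H _)⟩

theorem rpl_rNew : rpl (rNew H) = modeProj H {n | 0 < n} + (1 / 2 : ℂ) • modeProj H {0} := by
  rw [rpl, rNew, ← modeProj_add_add]
  module

theorem rmi_rNew : rmi (rNew H) = -modeProj H {n | n < 0} - (1 / 2 : ℂ) • modeProj H {0} := by
  rw [rmi, rNew, ← modeProj_add_add]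
  module

theorem qOp_rNew : qOp p (rNew H) = shift p * modeProj H {n | 0 < n} + modeProj H {0} +
    modeProj H {n | n < 0} := by
  rw [qOp, rpl_rNew, rmi_rNew, mul_add, mul_smul_comm, shift_one_of_mode_zero]
  module

theorem commute_rpl_rNew {T : Module.End ℂ (Loop H)} {τ : ℤ → Module.End ℂ H} (h : IsMult T τ) :
    Commute (rpl (rNew H)) T := by
  rw [rpl_rNew]
  exact (commute_modeProj h _).add_left ((commute_modeProj h _).smul_left _)

theorem isRMatrix_rNew : IsRMatrix B p (rNew H) where
  mult := isMult_rNew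
  skew := by
    have := (isAdj_modeProj (cartanForm H B) (S := {n : ℤ | 0 < n}) (S' := {n | n < 0})
      (by simp)).sub (isAdj_modeProj (cartanForm H B) (S := {n : ℤ | n < 0}) (S' := {n | 0 < n})
      (by simp))
    rw [rNew, neg_sub]
    exact this
  comm := (commute_modeProj (IsMult.shift p) _).sub_left (commute_modeProj (IsMult.shift p) _)
  unit := by
    have h : qOp p (rNew H) * (shift p⁻¹ * modeProj H {n | 0 < n} + modeProj H {0} +
        modeProj H {n | n < 0}) = 1 := by
      rw [qOp_rNew]
      refine (((((IsMult.shift p).mul (isMult_modeProj H _)).add (isMult_modeProj H _)).add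
        (isMult_modeProj H _)).mul ((((IsMult.shift p⁻¹).mul (isMult_modeProj H _)).add
        (isMult_modeProj H _)).add (isMult_modeProj H _))).eq IsMult.one fun n => ?_
      rcases lt_trichotomy n 0 with hn | hn | hn
      · simp [hn, hn.ne, not_lt.2 hn.le]
      · simp [hn]
      · simp [hn, hn.ne', not_lt.2 hn.le, ← mul_smul,
          inv_mul_cancel₀ (zpow_ne_zero n p.ne_zero)]
    have hm : ∃ τ, IsMult (qOp p (rNew H)) τ := by
      rw [qOp_rNew]
      exact ⟨_, (((IsMult.shift p).mul (isMult_modeProj H _)).add (isMult_modeProj H _)).add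
        (isMult_modeProj H _)⟩
    exact ⟨⟨_, _, h, hm.choose_spec.right_inv_unique h⟩, rfl⟩

/-- The hypotheses on the pointwise action of the Coxeter element. -/
structure IsEllipticIsometry (β : LinearMap.BilinForm ℂ H) (S : Module.End ℂ H) : Prop where
  finite_order : ∃ m : ℕ, 0 < m ∧ S ^ m = 1
  unit : IsUnit (1 - S)
  isometry : ∀ x y, β (S x) (S y) = β x y

/-- The elliptic r-matrix `(1 + s D) / (1 - s D)`. -/
def ellR (p : ℂˣ) (S : Module.End ℂ H) : Module.End ℂ (Loop H) :=
  (1 + Loop.map S * shift p) * Ring.inverse (1 - Loop.map S * shift p)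

variable {S : Module.End ℂ H}

theorem commute_map_shift (S : Module.End ℂ H) (p : ℂˣ) :
    Commute (Loop.map S) (shift p : Module.End ℂ (Loop H)) := rfl

theorem map_mul_map (S S' : Module.End ℂ H) :
    (Loop.map S * Loop.map S' : Module.End ℂ (Loop H)) = Loop.map (S * S') := rfl

theorem isUnit_one_sub_map (hS : IsUnit (1 - S)) :
    IsUnit (1 - Loop.map S : Module.End ℂ (Loop H)) := by
  refine ⟨⟨1 - Loop.map S, Loop.map (Ring.inverse (1 - S)), ?_, ?_⟩, rfl⟩
  · exact LinearMap.ext fun X => loop_ext fun z =>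
      LinearMap.congr_fun (Ring.mul_inverse_cancel _ hS) (ev X z)
  · refine LinearMap.ext fun X => loop_ext fun z => ?_
    exact LinearMap.congr_fun (Ring.inverse_mul_cancel _ hS) (ev X z)

variable {β : LinearMap.BilinForm ℂ H}

theorem IsEllipticIsometry.exists_inv (hS : IsEllipticIsometry β S) :
    ∃ S' : Module.End ℂ H, S * S' = 1 ∧ S' * S = 1 ∧ ∀ x y, β (S x) y = β x (S' y) := by
  obtain ⟨m, hm, h⟩ := hS.finite_order
  obtain ⟨k, rfl⟩ : ∃ k, m = k + 1 := ⟨m - 1, by omega⟩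
  refine ⟨S ^ k, by rw [← pow_succ', h], by rw [← pow_succ, h], fun x y => ?_⟩
  rw [← hS.isometry x, ← Module.End.mul_apply, ← pow_succ', h, Module.End.one_apply]

theorem IsEllipticIsometry.isUnit (hS : IsEllipticIsometry β S) (hp : ‖(p : ℂ)‖ < 1) :
    IsUnit (1 - Loop.map S * shift p : Module.End ℂ (Loop H)) :=
  let ⟨_, hm, h⟩ := hS.finite_order
  isUnit_one_sub_map_mul_shift hp hm h hS.unit

theorem rpl_ellR (hS : IsEllipticIsometry β S) (hp : ‖(p : ℂ)‖ < 1) :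
    rpl (ellR p S) = Ring.inverse (1 - Loop.map S * shift p) := by
  have h := Ring.mul_inverse_cancel _ (hS.isUnit hp)
  rw [rpl, ellR]
  nth_rw 3 [← h]
  rw [← add_mul, add_add_sub_cancel, add_mul, one_mul, ← two_smul ℂ, smul_smul]
  norm_num

theorem rmi_ellR (hS : IsEllipticIsometry β S) (hp : ‖(p : ℂ)‖ < 1) :
    rmi (ellR p S) = Loop.map S * shift p * Ring.inverse (1 - Loop.map S * shift p) := by
  have h := Ring.mul_inverse_cancel _ (hS.isUnit hp)
  rw [rmi, ellR]
  nth_rw 3 [← h]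
  rw [← sub_mul, add_sub_sub_cancel, add_mul, ← two_smul ℂ, smul_smul]
  norm_num

theorem isMult_ellR (hS : IsEllipticIsometry β S) (hp : ‖(p : ℂ)‖ < 1) :
    ∃ τ, IsMult (ellR p S) τ :=
  have h := (IsMult.map S).mul (IsMult.shift (E := H) p)
  have h' := IsMult.one.sub h
  ⟨_, (IsMult.one.add h).mul (h'.inverse (hS.isUnit hp)).choose_spec⟩

theorem commute_ellR_shift (hS : IsEllipticIsometry β S) (hp : ‖(p : ℂ)‖ < 1) :
    Commute (ellR p S) (shift p) := by
  have h : Commute (Loop.map S * shift p : Module.End ℂ (Loop H)) (shift p) :=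
    (commute_map_shift S p).mul_left (Commute.refl _)
  have h' : Commute (1 - Loop.map S * shift p : Module.End ℂ (Loop H)) (shift p) :=
    (Commute.one_left _).sub_left h
  refine ((Commute.one_left _).add_left h).mul_left ?_
  obtain ⟨u, hu⟩ := hS.isUnit hp
  rw [← hu, Ring.inverse_unit]
  rw [← hu] at h'
  exact h'.units_inv_left

theorem skew_ellR (hβ : β.Nondegenerate) (hS : IsEllipticIsometry β S) (hp : ‖(p : ℂ)‖ < 1) :
    IsAdj β (ellR p S) (-ellR p S) := by
  obtain ⟨S', h1, h2, hadj⟩ := hS.exists_inv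
  have hU := hS.isUnit hp
  have hsD : IsAdj β (Loop.map S * shift p) (shift p⁻¹ * Loop.map S') :=
    (IsAdj.map hadj).mul (IsAdj.shift p)
  have hV := IsAdj.one.sub hsD
  obtain ⟨τ, hτ⟩ := (IsMult.one.sub ((IsMult.map S).mul (IsMult.shift (E := H) p))).inverse hU
  obtain ⟨C, -, hC⟩ := hτ.exists_isAdj hβ
  have hCV : C * (1 - shift p⁻¹ * Loop.map S') = 1 :=
    hV.inv hβ hC (Ring.mul_inverse_cancel _ hU)
  have e1 : (shift p⁻¹ * Loop.map S') * (Loop.map S * shift p) =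
      (1 : Module.End ℂ (Loop H)) := by
    rw [mul_assoc, ← mul_assoc (Loop.map S'), map_mul_map, h2]
    exact shift_inv_mul_shift p
  have e2 : (1 - shift p⁻¹ * Loop.map S') * -ellR p S =
      (1 + shift p⁻¹ * Loop.map S' : Module.End ℂ (Loop H)) :=
    cayley_identity e1 (Ring.mul_inverse_cancel _ hU)
  have key := (IsAdj.one.add hsD).mul hC
  rwa [← e2, ← mul_assoc, hCV, one_mul] at key

theorem qOp_ellR (hS : IsEllipticIsometry β S) (hp : ‖(p : ℂ)‖ < 1) :
    qOp p (ellR p S) =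
      shift p * (1 - Loop.map S) * Ring.inverse (1 - Loop.map S * shift p) := by
  rw [qOp, rpl_ellR hS hp, rmi_ellR hS hp, ← sub_mul, mul_sub, mul_one,
    (commute_map_shift S p).eq]

theorem isUnit_shift (p : ℂˣ) : IsUnit (shift p : Module.End ℂ (Loop H)) :=
  ⟨⟨_, _, shift_mul_shift_inv p, shift_inv_mul_shift p⟩, rfl⟩

theorem isRMatrix_ellR {S : Module.End ℂ H} (hβ : (cartanForm H B).Nondegenerate)
    (hS : IsEllipticIsometry (cartanForm H B) S) (hp : ‖(p : ℂ)‖ < 1) :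
    IsRMatrix B p (ellR p S) where
  mult := isMult_ellR hS hp
  skew := skew_ellR hβ hS hp
  comm := commute_ellR_shift hS hp
  unit := by
    rw [qOp_ellR hS hp]
    exact ((isUnit_shift p).mul (isUnit_one_sub_map hS.unit)).mul
      ⟨⟨_, _, Ring.inverse_mul_cancel _ (hS.isUnit hp), Ring.mul_inverse_cancel _ (hS.isUnit hp)⟩, rfl⟩

end RMatrices

end LoopReduction

namespace LoopReduction

/-! ### The transformation between the two r-matrices -/

section Transformation

variable {d : ℕ} {𝔤 : LieSubalgebra ℂ (Matrix (Fin d) (Fin d) ℂ)} [LieAlgebra.IsSemisimple ℂ 𝔤]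
  {H : LieSubalgebra ℂ 𝔤} [H.IsCartanSubalgebra] {B : LinearMap.BilinForm ℂ 𝔤} {p : ℂˣ}

theorem IsMult.Mop {K : Module.End ℂ (Loop H)} (hK : ∃ κ, IsMult K κ) :
    ∃ κ, IsMult (Mop p K) κ :=
  ⟨_, (IsMult.one.sub hK.choose_spec).add ((IsMult.shift p).mul hK.choose_spec)⟩

theorem IsMult.Aop {r₀ r₀' K : Module.End ℂ (Loop H)} (hr : ∃ τ, IsMult r₀ τ)
    (hr' : ∃ τ, IsMult r₀' τ) (hK : ∃ κ, IsMult K κ) : ∃ κ, IsMult (Aop p r₀ r₀' K) κ :=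
  ⟨_, (((IsMult.rpl hr').choose_spec.mul (IsMult.Mop hK).choose_spec).add hK.choose_spec).sub
    (IsMult.rpl hr).choose_spec⟩

theorem IsMult.qOp {r₀ : Module.End ℂ (Loop H)} (hr : ∃ τ, IsMult r₀ τ) :
    ∃ κ, IsMult (qOp p r₀) κ :=
  ⟨_, ((IsMult.shift p).mul (IsMult.rpl hr).choose_spec).sub (IsMult.rmi hr).choose_spec⟩

/-- The Cartan correction of the gradient of a function transformed by `Psi`. -/
theorem exists_correction (hβ : (cartanForm H B).Nondegenerate) {r₀ r₀' K : Module.End ℂ (Loop H)}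
    (hr : IsRMatrix B p r₀) (hr' : ∃ τ, IsMult r₀' τ) (hK : ∃ κ, IsMult K κ) :
    ∃ T, (∃ τ, IsMult T τ) ∧
      IsAdj (cartanForm H B) (Aop p r₀ r₀' K * Ring.inverse (qOp p r₀)) T := by
  obtain ⟨τ, hτ⟩ := IsMult.Aop (p := p) hr.mult hr' hK
  obtain ⟨σ, hσ⟩ := (IsMult.qOp (p := p) hr.mult).choose_spec.inverse hr.unit
  exact (hτ.mul hσ).exists_isAdj hβ

theorem correction_spec {r₀ r₀' K T : Module.End ℂ (Loop H)} (hr : IsRMatrix B p r₀)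
    (hT : IsAdj (cartanForm H B) (Aop p r₀ r₀' K * Ring.inverse (qOp p r₀)) T) (X Y : Loop H) :
    pair (cartanForm H B) (qOp p r₀ X) (T Y) = pair (cartanForm H B) (Aop p r₀ r₀' K X) Y := by
  rw [← hT, ← Module.End.mul_apply, mul_assoc, Ring.inverse_mul_cancel _ hr.unit, mul_one]

/-- The functional equation for `K` in the form in which it is used. -/
theorem functional_equation {S : Module.End ℂ H} (hS : IsUnit (1 - S))
    {K L : Module.End ℂ (Loop H)}
    (hK : (1 - shift p) * K * L + shift p * K - L =
      - (shift p * Loop.map S * Ring.inverse (1 - Loop.map S) * modeProj H {n | 0 < n})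
      - Ring.inverse (1 - Loop.map S) * modeProj H {n | n < 0}
      - (1 / 2 : ℂ) • ((1 + Loop.map S) * Ring.inverse (1 - Loop.map S) * modeProj H {0})) :
    (1 - Loop.map S) * ((1 - shift p) * K * L + shift p * K - L) =
      -(Loop.map S * shift p * rpl (rNew H) - (rpl (rNew H) - 1)) := by
  rw [rpl_rNew]
  exact functional_identity (commute_map_shift S p)
    (Ring.mul_inverse_cancel _ (isUnit_one_sub_map hS)) modeProj_add_add
    (shift_one_of_mode_zero p) hK

variable {S : Module.End ℂ H} {K L : Module.End ℂ (Loop H)}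

/-- The data of the theorem: `K` with its adjoint `L`. -/
structure IsTransformation (B : LinearMap.BilinForm ℂ 𝔤) (p : ℂˣ) (S : Module.End ℂ H)
    (K L : Module.End ℂ (Loop H)) : Prop where
  adj : IsAdj (cartanForm H B) K L
  commS : Commute K (Loop.map S)
  commD : Commute K (shift p)
  eqn : (1 - Loop.map S) * ((1 - shift p) * K * L + shift p * K - L) =
    -(Loop.map S * shift p * rpl (rNew H) - (rpl (rNew H) - 1))

theorem commute_shift_inv {T : Module.End ℂ (Loop H)} (h : Commute T (shift p)) :
    Commute T (shift p⁻¹) := by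
  have := shift_mul_shift_inv (E := H) p
  have h' := shift_inv_mul_shift (E := H) p
  calc T * shift p⁻¹ = shift p⁻¹ * (shift p * T) * shift p⁻¹ := by
        rw [← mul_assoc, h', one_mul]
    _ = shift p⁻¹ * T := by rw [← h.eq, mul_assoc, mul_assoc, this, mul_one]

theorem IsAdj.rpl {β : LinearMap.BilinForm ℂ H} {r₀ : Module.End ℂ (Loop H)}
    (h : IsAdj β r₀ (-r₀)) : IsAdj β (rpl r₀) (-rmi r₀) := by
  have e : -LoopReduction.rmi r₀ = (1 / 2 : ℂ) • (-r₀ + 1) := by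
    unfold LoopReduction.rmi
    module
  rw [e]
  exact (h.add IsAdj.one).smul _

/-- The comparison of the antisymmetrized pairings, for abstract operators. -/
theorem pair_correction {β : LinearMap.BilinForm ℂ H} (hβ : β.IsSymm)
    {A As X T W : Module.End ℂ (Loop H)} (hA : IsAdj β A As) (hT : IsAdj β X T)
    (hW : A - As - X * ((shift p - 1) * As) = W) (x y : Loop H) :
    pair β (A x) y - pair β (A (y + (shift p⁻¹ (T y) - T y))) x = pair β (W x) y := by
  have e1 : pair β (A (y + (shift p⁻¹ (T y) - T y))) x =
      pair β (As x) y + pair β ((shift p - 1) (As x)) (T y) := by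
    rw [hA, pair_symm hβ, pair_add_right, pair_sub_right, ← pair_shift_left,
      LinearMap.sub_apply, pair_sub_left, Module.End.one_apply]
  rw [e1, ← hT, ← hW]
  simp only [LinearMap.sub_apply, pair_sub_left, Module.End.mul_apply]
  ring

variable (hβ : (cartanForm H B).Nondegenerate) (hp : ‖(p : ℂ)‖ < 1)
  (hS : IsEllipticIsometry (cartanForm H B) S) (hsymm : (cartanForm H B).IsSymm)
  (h : IsTransformation B p S K L)
include hβ h

theorem IsTransformation.comm_adj : Commute L (shift p) := by
  have := h.adj.commute hβ (IsAdj.shift p) h.commD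
  simpa using commute_shift_inv this

include hp

theorem IsTransformation.isMult : ∃ κ, IsMult K κ := exists_isMult_of_isAdj hβ hp h.adj h.commD

include hsymm in
theorem IsTransformation.isMult_adj : ∃ κ, IsMult L κ :=
  exists_isMult_of_isAdj hβ hp (h.adj.symm hsymm) (h.comm_adj hβ)

include hsymm hS

theorem IsTransformation.exists_inverse : ∃ N, Mop p K * N = 1 ∧ N * Mop p K = 1 := by
  have e := transformation_identity (shift_mul_shift_inv p) (shift_inv_mul_shift p)
    (commute_map_shift S p) (commute_map_shift S p⁻¹) h.commS (commute_shift_inv h.commD)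
    (commute_shift_inv (h.comm_adj hβ)) h.eqn
  have hW : IsUnit ((1 - Loop.map S * shift p) *
      (shift p⁻¹ * (shift p * rpl (rNew H) - (rpl (rNew H) - 1)))) := by
    have := (isRMatrix_rNew (B := B) (p := p) (H := H)).unit
    rw [qOp, ← sub_eq_of_eq_add (rpl_eq_rmi_add_one (rNew H))] at this
    exact (hS.isUnit hp).mul ((isUnit_shift p⁻¹).mul this)
  obtain ⟨κ, hκ⟩ := IsMult.Mop (p := p) (h.isMult hβ hp)
  have hN := Ring.mul_inverse_cancel _ hW
  rw [← e, mul_assoc] at hN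
  exact ⟨_, hN, hκ.right_inv_unique hN⟩

theorem IsTransformation.correction_comp {T : Module.End ℂ (Loop H)}
    (hT : IsAdj (cartanForm H B) (Aop p (rNew H) (ellR p S) K * Ring.inverse (qOp p (rNew H))) T)
    (X Y : Loop H) :
    2 * pair (cartanForm H B) (Aop p (rNew H) (ellR p S) K X) Y -
      2 * pair (cartanForm H B) (Aop p (rNew H) (ellR p S) K (Y + (shift p⁻¹ (T Y) - T Y))) X =
      pair (cartanForm H B) ((ellR p S - rNew H) X) Y := by
  have hq : qOp p (rNew H) = shift p * rpl (rNew H) - (rpl (rNew H) - 1) := by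
    rw [qOp, ← sub_eq_of_eq_add (rpl_eq_rmi_add_one (rNew H))]
  have hu := (isRMatrix_rNew (B := B) (p := p) (H := H)).unit
  obtain ⟨τ, hL⟩ := h.isMult_adj hβ hp hsymm
  have hr := commute_rpl_rNew (IsMult.shift (E := H) p)
  have hq1 : (shift p * rpl (rNew H) - (rpl (rNew H) - 1)) * Ring.inverse (qOp p (rNew H)) = 1 := by
    rw [← hq, Ring.mul_inverse_cancel _ hu]
  have hq2 : Ring.inverse (qOp p (rNew H)) * (shift p * rpl (rNew H) - (rpl (rNew H) - 1)) = 1 := by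
    rw [← hq, Ring.inverse_mul_cancel _ hu]
  have e1 := quotient_identity (shift_mul_shift_inv p) (shift_inv_mul_shift p)
    (commute_map_shift S p) (commute_map_shift S p⁻¹) hr (commute_shift_inv hr)
    (commute_shift_inv h.commD) (h.comm_adj hβ) (commute_shift_inv (h.comm_adj hβ))
    (commute_rpl_rNew hL).symm h.eqn (Ring.inverse_mul_cancel _ (hS.isUnit hp))
    hq1 hq2
  have hsk := (isRMatrix_rNew (B := B) (p := p) (H := H)).skew
  have hsk' := skew_ellR hβ hS hp
  have hM : IsAdj (cartanForm H B) (Mop p K) (1 - L + L * shift p⁻¹) :=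
    (IsAdj.one.sub h.adj).add ((IsAdj.shift p).mul h.adj)
  obtain ⟨As, hAs, hA⟩ : ∃ As, As = (1 - L + L * shift p⁻¹) * -rmi (ellR p S) + L -
      -(rpl (rNew H) - 1) ∧ IsAdj (cartanForm H B) (Aop p (rNew H) (ellR p S) K) As := by
    refine ⟨_, rfl, ?_⟩
    rw [sub_eq_of_eq_add (rpl_eq_rmi_add_one (rNew H))]
    exact ((hsk'.rpl.mul hM).add h.adj).sub hsk.rpl
  have hX : Commute (Aop p (rNew H) (ellR p S) K * Ring.inverse (qOp p (rNew H))) (shift p) := by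
    obtain ⟨κ, hκ⟩ := IsMult.Aop (p := p) isMult_rNew (isMult_ellR hS hp) (h.isMult hβ hp)
    obtain ⟨σ, hσ⟩ := (IsMult.qOp (p := p) (isMult_rNew (H := H))).choose_spec.inverse hu
    exact ((hκ.mul hσ).comm_iff (IsMult.shift p)).2 fun n => (Commute.one_right _).smul_right _
  have hAX : Aop p (rNew H) (ellR p S) K = Aop p (rNew H) (ellR p S) K *
      Ring.inverse (qOp p (rNew H)) * (shift p * rpl (rNew H) - (rpl (rNew H) - 1)) := by
    rw [← hq, mul_assoc, Ring.inverse_mul_cancel _ hu, mul_one]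
  rw [← rpl_ellR hS hp] at e1
  have e2 := bracket_identity_of_eq (c := rmi (ellR p S)) (shift_mul_shift_inv p) hX
    (commute_shift_inv (h.comm_adj hβ)) e1 hAX hAs
  have e3 := pair_correction hsymm hA hT e2 X Y
  have e4 : ellR p S - rNew H = (2 : ℂ) • (rmi (ellR p S) - (rpl (rNew H) - 1)) := by
    unfold rmi rpl
    module
  rw [e4, LinearMap.smul_apply, pair_smul_left, ← e3]
  exact (mul_sub _ _ _).symm

end Transformation

end LoopReduction

namespace LoopReduction

/-! ### Reduction and isomorphisms of Poisson spaces -/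

namespace PoissonSpace

/-- The sheaf property and the algebra of brackets which make reduced brackets well defined. -/
structure IsRegular (P : PoissonSpace) : Prop where
  mono : ∀ {U V : Set P.pt}, U ⊆ V → P.smooth V ⊆ P.smooth U
  sub : ∀ {U : Set P.pt} {φ ψ : P.pt → ℂ}, φ ∈ P.smooth U → ψ ∈ P.smooth U → φ - ψ ∈ P.smooth U
  skew : ∀ {U : Set P.pt} {φ ψ : P.pt → ℂ}, IsOpen U → φ ∈ P.smooth U → ψ ∈ P.smooth U →
    ∀ v ∈ U, P.bracket φ ψ v = -P.bracket ψ φ v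
  bracket_sub : ∀ {U : Set P.pt} {φ ψ ψ' : P.pt → ℂ}, IsOpen U → φ ∈ P.smooth U →
    ψ ∈ P.smooth U → ψ' ∈ P.smooth U →
    ∀ v ∈ U, P.bracket φ (ψ - ψ') v = P.bracket φ ψ v - P.bracket φ ψ' v

/-- An isomorphism of Poisson spaces. -/
structure Iso (P P' : PoissonSpace) where
  toHomeomorph : P.pt ≃ₜ P'.pt
  curve_map : ∀ {Ω : Set ℂ} {c : ℂ → P.pt}, IsOpen Ω → c ∈ P.curve Ω →
    toHomeomorph ∘ c ∈ P'.curve Ω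
  curve_symm : ∀ {Ω : Set ℂ} {c : ℂ → P'.pt}, IsOpen Ω → c ∈ P'.curve Ω →
    toHomeomorph.symm ∘ c ∈ P.curve Ω
  smooth_pull : ∀ {U : Set P'.pt} {φ : P'.pt → ℂ}, IsOpen U → φ ∈ P'.smooth U →
    φ ∘ toHomeomorph ∈ P.smooth (toHomeomorph ⁻¹' U)
  smooth_push : ∀ {U : Set P.pt} {φ : P.pt → ℂ}, IsOpen U → φ ∈ P.smooth U →
    φ ∘ toHomeomorph.symm ∈ P'.smooth (toHomeomorph.symm ⁻¹' U)
  bracket_pull : ∀ {U : Set P'.pt} {φ ψ : P'.pt → ℂ}, IsOpen U → φ ∈ P'.smooth U →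
    ψ ∈ P'.smooth U → ∀ v, toHomeomorph v ∈ U →
    P.bracket (φ ∘ toHomeomorph) (ψ ∘ toHomeomorph) v = P'.bracket φ ψ (toHomeomorph v)

namespace Iso

variable {P P' : PoissonSpace}

/-- The inverse isomorphism. -/
def symm (e : Iso P P') : Iso P' P where
  toHomeomorph := e.toHomeomorph.symm
  curve_map := e.curve_symm
  curve_symm := e.curve_map
  smooth_pull := e.smooth_push
  smooth_push := e.smooth_pull
  bracket_pull := by
    intro U φ ψ hU hφ hψ v hv
    have h := e.bracket_pull (hU.preimage e.toHomeomorph.symm.continuous) (e.smooth_push hU hφ)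
      (e.smooth_push hU hψ) (e.toHomeomorph.symm v) (by simpa using hv)
    rw [e.toHomeomorph.apply_symm_apply] at h
    rw [← h]
    congr 1 <;> ext w <;> simp

variable (e : Iso P P')

theorem comp_symm_comp {α : Type*} (φ : P.pt → α) :
    (φ ∘ e.toHomeomorph.symm) ∘ e.toHomeomorph = φ := by
  ext; simp

variable {C : Set P.pt} {C' : Set P'.pt} (hC : ∀ v, v ∈ C ↔ e.toHomeomorph v ∈ C')
include hC

theorem mem_symm (v : P'.pt) : v ∈ C' ↔ e.toHomeomorph.symm v ∈ C := by
  rw [hC, e.toHomeomorph.apply_symm_apply]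

theorem vanishing_pull {U : Set P'.pt} (hU : IsOpen U) {ι : P'.pt → ℂ}
    (h : ι ∈ P'.vanishing C' U) :
    ι ∘ e.toHomeomorph ∈ P.vanishing C (e.toHomeomorph ⁻¹' U) :=
  ⟨e.smooth_pull hU h.1, fun v hv => h.2 _ ⟨(hC v).1 hv.1, hv.2⟩⟩

theorem firstClass_pull (hP' : P'.IsRegular) {U : Set P'.pt} (hU : IsOpen U) {φ : P'.pt → ℂ}
    (h : φ ∈ P'.firstClass C' U) :
    φ ∘ e.toHomeomorph ∈ P.firstClass C (e.toHomeomorph ⁻¹' U) := by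
  refine ⟨e.smooth_pull hU h.1, fun V hV hVo ι hι v hv => ?_⟩
  have hV' : e.toHomeomorph.symm ⁻¹' V ⊆ U := fun w hw => by simpa using hV hw
  have hVo' := hVo.preimage e.toHomeomorph.symm.continuous
  have hι' := e.symm.vanishing_pull (e.mem_symm hC) hVo hι
  have hv' : e.toHomeomorph v ∈ e.toHomeomorph.symm ⁻¹' V := by simpa using hv.2
  have h0 := h.2 _ hV' hVo' _ hι' (e.toHomeomorph v) ⟨(hC v).1 hv.1, hv'⟩
  rw [← e.bracket_pull hVo' (hP'.mono hV' h.1) hι'.1 v hv'] at h0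
  rw [← h0]
  exact congrArg (fun ψ => P.bracket _ ψ v) (e.comp_symm_comp ι).symm

theorem isGaugeCurve_map (hP : P.IsRegular) {Ω : Set ℂ} (hΩ : IsOpen Ω) {c : ℂ → P.pt}
    (h : P.IsGaugeCurve C Ω c) : P'.IsGaugeCurve C' Ω (e.toHomeomorph ∘ c) := by
  refine ⟨e.curve_map hΩ h.1, fun t ht => ⟨(hC _).1 (h.2 t ht).1, ?_⟩⟩
  obtain ⟨U, hU, htU, ι, hι, H⟩ := (h.2 t ht).2
  refine ⟨e.toHomeomorph.symm ⁻¹' U, hU.preimage e.toHomeomorph.symm.continuous, by simpa using htU,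
    _, e.symm.vanishing_pull (e.mem_symm hC) hU hι, fun V hV hVo htV ψ hψ => ?_⟩
  have hVU : e.toHomeomorph ⁻¹' V ⊆ U := fun w hw => by simpa using hV hw
  have hVo' := hVo.preimage e.toHomeomorph.continuous
  have h1 := H _ hVU hVo' htV _ (e.smooth_pull hVo hψ)
  have h2 := e.symm.bracket_pull hVo' (e.smooth_pull hVo hψ) (hP.mono hVU hι.1)
    (e.toHomeomorph (c t)) (by simpa [symm] using htV)
  have h3 : e.symm.toHomeomorph (e.toHomeomorph (c t)) = c t := e.toHomeomorph.symm_apply_apply _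
  rw [h3] at h2
  rw [← h2] at h1
  have h4 : (ψ ∘ e.toHomeomorph) ∘ e.symm.toHomeomorph = ψ := by
    ext w
    exact congrArg ψ (e.toHomeomorph.apply_symm_apply w)
  rw [h4] at h1
  exact h1

/-- The restriction of an isomorphism to the constraint surfaces. -/
def surfaceEquiv : C ≃ C' := e.toHomeomorph.toEquiv.subtypeEquiv hC

theorem gauge_map (hP : P.IsRegular) {v w : C} (h : (P.gauge C) v w) :
    (P'.gauge C') (e.surfaceEquiv hC v) (e.surfaceEquiv hC w) := by
  induction h with
  | rel x y hxy =>
    obtain ⟨Ω, c, hΩ, hpre, hc, ⟨t, ht, htx⟩, u, hu, huy⟩ := hxy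
    exact .rel _ _ ⟨Ω, _, hΩ, hpre, e.isGaugeCurve_map hC hP hΩ hc,
      ⟨t, ht, congrArg e.toHomeomorph htx⟩, u, hu, congrArg e.toHomeomorph huy⟩
  | refl x => exact .refl _
  | symm x y _ ih => exact .symm _ _ ih
  | trans x y z _ _ ih1 ih2 => exact .trans _ _ _ ih1 ih2

/-- The map of spaces of leaves. -/
def redMap (hP : P.IsRegular) : P.Reduced C → P'.Reduced C' :=
  Quotient.map (e.surfaceEquiv hC) fun _ _ h => e.gauge_map hC hP h

theorem continuous_redMap (hP : P.IsRegular) : Continuous (e.redMap hC hP) :=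
  Continuous.quotient_map' ((e.toHomeomorph.continuous.comp continuous_subtype_val).subtype_mk _) _

/-- The homeomorphism of spaces of leaves. -/
def redHomeomorph (hP : P.IsRegular) (hP' : P'.IsRegular) : P.Reduced C ≃ₜ P'.Reduced C' where
  toFun := e.redMap hC hP
  invFun := e.symm.redMap (e.mem_symm hC) hP'
  left_inv := by
    rintro ⟨v⟩
    exact congrArg (P.cls C) (Subtype.ext (e.toHomeomorph.symm_apply_apply _))
  right_inv := by
    rintro ⟨v⟩
    exact congrArg (P'.cls C') (Subtype.ext (e.toHomeomorph.apply_symm_apply _))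
  continuous_toFun := e.continuous_redMap hC hP
  continuous_invFun := e.symm.continuous_redMap (e.mem_symm hC) hP'

theorem isLift_pull (hP : P.IsRegular) (hP' : P'.IsRegular) {g : P'.Reduced C' → ℂ} {U : Set P'.pt}
    {φ : P'.pt → ℂ} (h : P'.IsLift C' g U φ) :
    P.IsLift C (g ∘ e.redMap hC hP) (e.toHomeomorph ⁻¹' U) (φ ∘ e.toHomeomorph) :=
  ⟨h.1.preimage e.toHomeomorph.continuous, e.firstClass_pull hC hP' h.1 h.2.1,
    fun v hv => h.2.2 (e.surfaceEquiv hC v) hv⟩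

theorem redSmooth_pull (hP : P.IsRegular) (hP' : P'.IsRegular) {g : P'.Reduced C' → ℂ}
    {O : Set (P'.Reduced C')} (h : g ∈ P'.redSmooth C' O) :
    g ∘ e.redMap hC hP ∈ P.redSmooth C (e.redMap hC hP ⁻¹' O) := fun v hv => by
  obtain ⟨U, φ, hU, hφ⟩ := h (e.surfaceEquiv hC v) hv
  exact ⟨_, _, hU, e.isLift_pull hC hP hP' hφ⟩

end Iso

/-- The bracket of lifts does not depend on the lifts. -/
theorem IsRegular.bracket_lift_eq {P : PoissonSpace} (hP : P.IsRegular) {C : Set P.pt}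
    {g₁ g₂ : P.Reduced C → ℂ} {U U' : Set P.pt} {φ₁ φ₂ φ₁' φ₂' : P.pt → ℂ}
    (h₁ : P.IsLift C g₁ U φ₁) (h₂ : P.IsLift C g₂ U φ₂) (h₁' : P.IsLift C g₁ U' φ₁')
    (h₂' : P.IsLift C g₂ U' φ₂') (v : C) (hv : (v : P.pt) ∈ U) (hv' : (v : P.pt) ∈ U') :
    P.bracket φ₁ φ₂ v = P.bracket φ₁' φ₂' v := by
  have hW := h₁.1.inter h₁'.1
  have m : ∀ {φ}, φ ∈ P.smooth U → φ ∈ P.smooth (U ∩ U') := fun h => hP.mono inter_subset_left h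
  have m' : ∀ {φ}, φ ∈ P.smooth U' → φ ∈ P.smooth (U ∩ U') := fun h => hP.mono inter_subset_right h
  have hd : ∀ {g : P.Reduced C → ℂ} {φ φ' : P.pt → ℂ}, P.IsLift C g U φ → P.IsLift C g U' φ' →
      φ - φ' ∈ P.vanishing C (U ∩ U') := fun h h' =>
    ⟨hP.sub (m h.2.1.1) (m' h'.2.1.1), fun w hw => by
      rw [Pi.sub_apply, h.2.2 ⟨w, hw.1⟩ hw.2.1, h'.2.2 ⟨w, hw.1⟩ hw.2.2, sub_self]⟩
  have e1 := h₁.2.1.2 _ inter_subset_left hW _ (hd h₂ h₂') v ⟨v.2, hv, hv'⟩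
  have e2 := h₂'.2.1.2 _ inter_subset_right hW _ (hd h₁ h₁') v ⟨v.2, hv, hv'⟩
  rw [hP.bracket_sub hW (m h₁.2.1.1) (m h₂.2.1.1) (m' h₂'.2.1.1) v ⟨hv, hv'⟩] at e1
  rw [hP.bracket_sub hW (m' h₂'.2.1.1) (m h₁.2.1.1) (m' h₁'.2.1.1) v ⟨hv, hv'⟩,
    hP.skew hW (m' h₂'.2.1.1) (m h₁.2.1.1) v ⟨hv, hv'⟩,
    hP.skew hW (m' h₂'.2.1.1) (m' h₁'.2.1.1) v ⟨hv, hv'⟩] at e2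
  linear_combination e1 - e2

/-- An isomorphism which matches the constraint surfaces induces an isomorphism of the reduced
spaces. -/
theorem Iso.reducedIso {P P' : PoissonSpace} (e : Iso P P') (hP : P.IsRegular) (hP' : P'.IsRegular)
    {C : Set P.pt} {C' : Set P'.pt} (hC : ∀ v, v ∈ C ↔ e.toHomeomorph v ∈ C') :
    ReducedIso P P' C C' := by
  refine ⟨e.redHomeomorph hC hP hP', fun O hO g => ⟨fun h => e.redSmooth_pull hC hP hP' h,
    fun h => ?_⟩, fun v => ⟨e.surfaceEquiv hC v, rfl, fun g₁ g₂ U U' φ₁ φ₂ φ₁' φ₂' hv hv' h₁ h₂ h₁' h₂' => ?_⟩⟩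
  · have h1 := e.symm.redSmooth_pull (e.mem_symm hC) hP' hP h
    have h2 : ∀ w, e.redMap hC hP (e.symm.redMap (e.mem_symm hC) hP' w) = w :=
      (e.redHomeomorph hC hP hP').apply_symm_apply
    have h3 : (g ∘ e.redHomeomorph hC hP hP') ∘ e.symm.redMap (e.mem_symm hC) hP' = g :=
      funext fun w => congrArg g (h2 w)
    have h4 : e.symm.redMap (e.mem_symm hC) hP' ⁻¹' ((e.redHomeomorph hC hP hP') ⁻¹' O) = O :=
      Set.ext fun w => by
        change e.redMap hC hP (e.symm.redMap (e.mem_symm hC) hP' w) ∈ O ↔ w ∈ O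
        rw [h2]
    rwa [h3, h4] at h1
  · have e1 := hP.bracket_lift_eq h₁ h₂ (e.isLift_pull hC hP hP' h₁') (e.isLift_pull hC hP hP' h₂')
      v hv hv'
    rw [e1]
    exact e.bracket_pull h₁'.1 h₁'.2.1.1 h₂'.2.1.1 v hv'

end PoissonSpace

end LoopReduction

namespace LoopReduction

open scoped Matrix.Norms.Operator

/-! ### The Poisson isomorphism -/

section PoissonIso

variable {d : ℕ} {𝔤 : LieSubalgebra ℂ (Matrix (Fin d) (Fin d) ℂ)} [LieAlgebra.IsSemisimple ℂ 𝔤]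
  {H : LieSubalgebra ℂ 𝔤} [H.IsCartanSubalgebra]
  {b : (LieAlgebra.IsKilling.rootSystem H).Base} {B : LinearMap.BilinForm ℂ 𝔤} {p : ℂˣ}
  {r₀ : Module.End ℂ (Loop H)}

theorem form_rootProj_neg (hinv : ∀ x y z : 𝔤, B ⁅x, y⁆ z = B x ⁅y, z⁆) (hsymm : B.IsSymm)
    (x y : 𝔤) : B (rootProj H (negRoots b) x) y = B x (rootProj H (posRoots b) y) := by
  have h1 : B (rootProj H (negRoots b) x) y =
      B (rootProj H (negRoots b) x) (rootProj H (posRoots b) y) := by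
    conv_lhs => rw [← proj_add_proj_add_proj b y]
    rw [map_add, map_add, form_nilOpp_nilOpp b hinv (rootProj_mem _ _) (rootProj_mem _ _),
      ← hsymm.eq (cartanProj H y : 𝔤),
      form_cartan_nilOpp b hinv _ (rootProj_mem _ _), zero_add, zero_add]
  have h2 : B x (rootProj H (posRoots b) y) =
      B (rootProj H (negRoots b) x) (rootProj H (posRoots b) y) := by
    conv_lhs => rw [← proj_add_proj_add_proj b x]
    rw [LinearMap.BilinForm.add_left, LinearMap.BilinForm.add_left,
      form_nil_nil b hinv (rootProj_mem _ _) (rootProj_mem _ _),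
      form_cartan_nil b hinv _ (rootProj_mem _ _), add_zero, add_zero]
  rw [h1, h2]

theorem isAdj_rOp (hinv : ∀ x y z : 𝔤, B ⁅x, y⁆ z = B x ⁅y, z⁆) (hsymm : B.IsSymm)
    (hr : IsAdj (cartanForm H B) r₀ (-r₀)) : IsAdj B (rOp b r₀) (-rOp b r₀) := fun X Y => by
  have h1 : pair B (Pneg b X) Y = pair B X (Ppos b Y) :=
    pair_congr B fun z => form_rootProj_neg hinv hsymm _ _
  have h2 : pair B (Ppos b X) Y = pair B X (Pneg b Y) := by
    rw [pair_symm hsymm, pair_symm hsymm X]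
    exact (pair_congr B fun z => form_rootProj_neg hinv hsymm _ _).symm
  have h3 : pair B (jH (r₀ (PH H X))) Y = -pair B X (jH (r₀ (PH H Y))) := by
    rw [pair_jH_left hinv b, pair_jH_right hsymm hinv b, hr, LinearMap.neg_apply, pair_neg_right]
  rw [rOp_apply, LinearMap.neg_apply, rOp_apply, pair_neg_right, pair_add_left, pair_sub_left,
    pair_add_right, pair_sub_right, h1, h2, h3]
  ring

theorem gW_eq (v : Pts b) (Z : Loop 𝔤) : gW b p r₀ v Z =
    rOp b r₀ (gV b p r₀ v Z) - (gS b p r₀ v Z + gR b r₀ v Z) := by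
  have h : ∀ (r : Module.End ℂ (Loop 𝔤)) (s t : Loop 𝔤),
      (2 : ℂ) • (rmi r s - rpl r t) = r (s - t) - (s + t) := fun r s t => by
    rw [map_sub r, rmi, rpl, LinearMap.smul_apply, LinearMap.smul_apply, LinearMap.sub_apply,
      LinearMap.add_apply, Module.End.one_apply, Module.End.one_apply]
    module
  exact h _ _ _

theorem pair_gW_gV_skew (hinv : ∀ x y z : 𝔤, B ⁅x, y⁆ z = B x ⁅y, z⁆) (hsymm : B.IsSymm)
    (hr : IsAdj (cartanForm H B) r₀ (-r₀)) (v : Pts b) (Z Z' : Loop 𝔤) :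
    pair B (gW b p r₀ v Z) (gV b p r₀ v Z') = -pair B (gW b p r₀ v Z') (gV b p r₀ v Z) := by
  have e1 := isAdj_rOp (b := b) hinv hsymm hr (gV b p r₀ v Z) (gV b p r₀ v Z')
  rw [LinearMap.neg_apply, pair_neg_right, pair_symm hsymm] at e1
  have e2 : ∀ Z Z', pair B (gS b p r₀ v Z + gR b r₀ v Z) (gV b p r₀ v Z') =
      pair B (gR b r₀ v Z) (gS b p r₀ v Z') - pair B (gS b p r₀ v Z) (gR b r₀ v Z') :=
    fun Z Z' => by
      rw [gV, pair_add_left, pair_sub_right, pair_sub_right, pair_gS_gS hinv, pair_gR_gR hinv]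
      ring
  rw [gW_eq, gW_eq, pair_sub_left, pair_sub_left, e2, e2, pair_symm hsymm (gR b r₀ v Z),
    pair_symm hsymm (gS b p r₀ v Z), pair_symm hsymm (rOp b r₀ (gV b p r₀ v Z)), e1,
    pair_symm hsymm (gV b p r₀ v Z)]
  ring

theorem IsGrad.sub {φ ψ : Pts b → ℂ} {v : Pts b} {Z Z' : Loop 𝔤} (h : IsGrad b B p r₀ φ v Z)
    (h' : IsGrad b B p r₀ ψ v Z') : IsGrad b B p r₀ (φ - ψ) v (Z - Z') := fun w => by
  rw [pair_sub_right]
  exact (h w).sub (h' w)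

theorem IsSmooth.mono {U V : Set (Pts b)} (hUV : U ⊆ V) {φ : Pts b → ℂ}
    (h : IsSmooth b B p r₀ V φ) : IsSmooth b B p r₀ U φ :=
  ⟨fun k Ω c hΩ hc hm => h.1 k Ω c hΩ hc (hm.mono_right hUV), h.2.choose, h.2.choose_spec.choose,
    fun v hv => h.2.choose_spec.choose_spec.1 v (hUV hv),
    fun k Ω c hΩ hc hm => h.2.choose_spec.choose_spec.2 k Ω c hΩ hc (hm.mono_right hUV)⟩

theorem IsHolFamily.sub {Q : Type*} [NormedAddCommGroup Q] [NormedSpace ℂ Q] {Ω : Set Q}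
    {E : Type*} [AddCommGroup E] [Module ℂ E] [TopologicalSpace E] [IsTopologicalAddGroup E]
    [ContinuousSMul ℂ E] {c c' : Q → Loop E} (hc : IsHolFamily Ω c) (hc' : IsHolFamily Ω c') :
    IsHolFamily Ω fun x => c x - c' x := by
  have := hc.add (hc'.smul (differentiableOn_const (-1 : ℂ)))
  simpa [neg_one_smul, sub_eq_add_neg] using this

theorem IsSmooth.sub (hinv : ∀ x y z : 𝔤, B ⁅x, y⁆ z = B x ⁅y, z⁆) (hr : ∃ τ, IsMult r₀ τ)
    {U : Set (Pts b)} {φ ψ : Pts b → ℂ}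
    (h : IsSmooth b B p r₀ U φ) (h' : IsSmooth b B p r₀ U ψ) : IsSmooth b B p r₀ U (φ - ψ) := by
  obtain ⟨Z, hZ, hZ'⟩ := h.exists_isGrad hinv hr
  obtain ⟨W, hW, hW'⟩ := h'.exists_isGrad hinv hr
  exact isSmooth_of_isGrad hinv hr
    (fun k Ω c hΩ hc hm => (h.1 k Ω c hΩ hc hm).sub (h'.1 k Ω c hΩ hc hm))
    (fun v hv => (hZ v hv).sub (hW v hv))
    fun k Ω c hΩ hc hm => (hZ' k Ω c hΩ hc hm).sub (hW' k Ω c hΩ hc hm)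

theorem gV_sub (v : Pts b) (Z Z' : Loop 𝔤) :
    gV b p r₀ v (Z - Z') = gV b p r₀ v Z - gV b p r₀ v Z' := by
  have h := gV_add (p := p) (r₀ := r₀) v (Z - Z') Z'
  rw [sub_add_cancel] at h
  exact eq_sub_of_add_eq h.symm

theorem isRegular_space (hnondeg : B.Nondegenerate) (hsymm : B.IsSymm)
    (hinv : ∀ x y z : 𝔤, B ⁅x, y⁆ z = B x ⁅y, z⁆) (hr : IsRMatrix B p r₀) :
    (space b B p r₀).IsRegular where
  mono hUV _ h := IsSmooth.mono hUV h
  sub h h' := IsSmooth.sub hinv hr.mult h h'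
  skew _ h h' v hv := by
    obtain ⟨Z, hZ, -⟩ := IsSmooth.exists_isGrad hinv hr.mult h
    obtain ⟨W, hW, -⟩ := IsSmooth.exists_isGrad hinv hr.mult h'
    exact ((hZ v hv).bracket_eq hnondeg hinv hr.comm hr.surjective (hW v hv)).trans
      ((pair_gW_gV_skew hinv hsymm hr.skew v _ _).trans (congrArg Neg.neg
        ((hW v hv).bracket_eq hnondeg hinv hr.comm hr.surjective (hZ v hv)).symm))
  bracket_sub _ h h' h'' v hv := by
    obtain ⟨Z, hZ, -⟩ := IsSmooth.exists_isGrad hinv hr.mult h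
    obtain ⟨W, hW, -⟩ := IsSmooth.exists_isGrad hinv hr.mult h'
    obtain ⟨W', hW', -⟩ := IsSmooth.exists_isGrad hinv hr.mult h''
    have e1 := (hZ v hv).bracket_eq hnondeg hinv hr.comm hr.surjective (hW v hv)
    have e2 := (hZ v hv).bracket_eq hnondeg hinv hr.comm hr.surjective (hW' v hv)
    have e3 := (hZ v hv).bracket_eq hnondeg hinv hr.comm hr.surjective ((hW v hv).sub (hW' v hv))
    rw [gV_sub (p := p) (r₀ := r₀) v, pair_sub_right, ← e1, ← e2] at e3
    exact e3

theorem Psi_Psi {K N : Module.End ℂ (Loop H)} (h : N * Mop p K = 1) (v : Pts b) :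
    Psi b p (-(K * N)) (Psi b p K v) = v := by
  have e : ∀ X, N (Mop p K X) = X := fun X => LinearMap.congr_fun h X
  have e1 : (-(K * N)) (Mop p K v.1) = -K v.1 := by
    rw [LinearMap.neg_apply, Module.End.mul_apply, e]
  refine Prod.ext ?_ (Prod.ext ?_ ?_)
  · change Mop p (-(K * N)) (Mop p K v.1) = v.1
    rw [Mop, LinearMap.add_apply, LinearMap.sub_apply, Module.End.mul_apply, e1,
      Module.End.one_apply, map_neg, Mop, LinearMap.add_apply, LinearMap.sub_apply,
      Module.End.mul_apply, Module.End.one_apply]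
    abel
  · change conjS (nilOpp b) ((-(K * N)) (Mop p K v.1)) (conjS (nilOpp b) (K v.1) v.2.1) = v.2.1
    rw [e1, conjS_conjS lie_mem_nilOpp, neg_add_cancel, conjS_zero lie_mem_nilOpp]
  · change conjS (nil b) (shift p ((-(K * N)) (Mop p K v.1)))
      (conjS (nil b) (shift p (K v.1)) v.2.2) = v.2.2
    rw [e1, conjS_conjS lie_mem_nil, map_neg, neg_add_cancel, conjS_zero lie_mem_nil]

theorem Mop_neg_mul {K N : Module.End ℂ (Loop H)} (h : Mop p K * N = 1) :
    Mop p (-(K * N)) = N := by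
  have e : N = Mop p K * N + K * N - shift p * K * N := by
    rw [Mop, add_mul, sub_mul, one_mul]
    abel
  rw [h] at e
  rw [Mop, sub_neg_eq_add, mul_neg, ← mul_assoc, ← sub_eq_add_neg, ← e]

theorem Psi_Psi' {K N : Module.End ℂ (Loop H)} (h : Mop p K * N = 1) (h' : N * Mop p K = 1)
    (v : Pts b) : Psi b p K (Psi b p (-(K * N)) v) = v := by
  have h2 := Psi_Psi (b := b) (p := p) (K := -(K * N)) (N := Mop p K)
    (by rw [Mop_neg_mul h, h]) v
  rwa [neg_mul, neg_neg, mul_assoc, h', mul_one] at h2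

/-- The isomorphism of Poisson spaces given by `Psi`. -/
def poissonIso (hnondeg : B.Nondegenerate) (hsymm : B.IsSymm)
    (hinv : ∀ x y z : 𝔤, B ⁅x, y⁆ z = B x ⁅y, z⁆) {r₀' K N T T' : Module.End ℂ (Loop H)}
    (hr : IsRMatrix B p r₀) (hr' : IsRMatrix B p r₀') (hK : ∃ κ, IsMult K κ)
    (hN : ∃ κ, IsMult N κ) (h : Mop p K * N = 1) (h' : N * Mop p K = 1)
    (hTm : ∃ τ, IsMult T τ)
    (hT : ∀ X Y, pair (cartanForm H B) (qOp p r₀ X) (T Y) =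
      pair (cartanForm H B) (Aop p r₀ r₀' K X) Y)
    (hTm' : ∃ τ, IsMult T' τ)
    (hT' : ∀ X Y, pair (cartanForm H B) (qOp p r₀' X) (T' Y) =
      pair (cartanForm H B) (Aop p r₀' r₀ (-(K * N)) X) Y)
    (hcmp : ∀ X Y, 2 * pair (cartanForm H B) (Aop p r₀ r₀' K X) Y -
      2 * pair (cartanForm H B) (Aop p r₀ r₀' K (Y + (shift p⁻¹ (T Y) - T Y))) X =
      pair (cartanForm H B) ((r₀' - r₀) X) Y) :
    PoissonSpace.Iso (space b B p r₀) (space b B p r₀') where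
  toHomeomorph := {
    toFun := Psi b p K
    invFun := Psi b p (-(K * N))
    left_inv := Psi_Psi h'
    right_inv := Psi_Psi' h h'
    continuous_toFun := continuous_Psi hK
    continuous_invFun := continuous_Psi ⟨_, (hK.choose_spec.mul hN.choose_spec).neg⟩ }
  curve_map hΩ hc := isHolFamilyPts_Psi hK hΩ hc
  curve_symm hΩ hc := isHolFamilyPts_Psi ⟨_, (hK.choose_spec.mul hN.choose_spec).neg⟩ hΩ hc
  smooth_pull hU hφ := IsSmooth.comp_Psi hsymm hinv hr.mult hr'.mult hK hTm hT hU hφ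
  smooth_push hU hφ := IsSmooth.comp_Psi hsymm hinv hr'.mult hr.mult
    ⟨_, (hK.choose_spec.mul hN.choose_spec).neg⟩ hTm' hT' hU hφ
  bracket_pull hU hφ hψ _ hv := bracket_Psi hnondeg hsymm hinv hr hr' hK hT hcmp hU hφ hψ hv

theorem IsTransformation.exists_iso (hnondeg : B.Nondegenerate) (hsymm : B.IsSymm)
    (hinv : ∀ x y z : 𝔤, B ⁅x, y⁆ z = B x ⁅y, z⁆) {S : Module.End ℂ H}
    (hS : IsEllipticIsometry (cartanForm H B) S) (hp : ‖(p : ℂ)‖ < 1)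
    {K L : Module.End ℂ (Loop H)} (h : IsTransformation B p S K L)
    (b : (LieAlgebra.IsKilling.rootSystem H).Base) :
    ∃ e : PoissonSpace.Iso (space b B p (rNew H)) (space b B p (ellR p S)),
      ∀ v, e.toHomeomorph v = Psi b p K v := by
  have hβ := cartanForm_nondegenerate b hsymm hnondeg hinv
  have hβs := cartanForm_isSymm (H := H) hsymm
  have hr := isRMatrix_rNew (H := H) (B := B) (p := p)
  have hr' := isRMatrix_ellR hβ hS hp
  have hK := h.isMult hβ hp
  obtain ⟨N, hN, hN'⟩ := h.exists_inverse hβ hp hS hβs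
  have hNm : ∃ κ, IsMult N κ := ⟨_, (IsMult.Mop (p := p) hK).choose_spec.inv hN⟩
  obtain ⟨T, hTm, hT⟩ := exists_correction hβ hr hr'.mult hK
  obtain ⟨T', hTm', hT'⟩ := exists_correction hβ hr' hr.mult
    (K := -(K * N)) ⟨_, (hK.choose_spec.mul hNm.choose_spec).neg⟩
  exact ⟨poissonIso hnondeg hsymm hinv hr hr' hK hNm hN hN' hTm (correction_spec hr hT) hTm'
    (correction_spec hr' hT') (h.correction_comp hβ hp hS hβs hT), fun _ => rfl⟩

end PoissonIso

end LoopReduction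

namespace LoopReduction

open scoped Matrix.Norms.Operator
open LieAlgebra LieAlgebra.IsKilling

/-! ### Coxeter elements -/

section Reflections

variable {ι V : Type*} [AddCommGroup V] [Module ℂ V] {v : ι → V} {a : ι → Module.Dual ℂ V}
  {T : ι → Module.End ℂ V}

theorem prod_reflections_sub_mem (hT : ∀ i x, T i x = x - a i x • v i) (l : List ι) (x : V) :
    (l.map T).prod x - x ∈ Submodule.span ℂ (v '' {i | i ∈ l}) := by
  induction l with
  | nil => simp
  | cons i l ih =>
    rw [List.map_cons, List.prod_cons, Module.End.mul_apply, hT, sub_right_comm]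
    exact Submodule.sub_mem _
      (Submodule.span_mono (image_mono fun j hj => List.mem_cons_of_mem i hj) ih)
      (Submodule.smul_mem _ _ (Submodule.subset_span ⟨i, List.mem_cons_self, rfl⟩))

theorem eq_zero_of_prod_reflections_fixed (hT : ∀ i x, T i x = x - a i x • v i)
    (h2 : ∀ i, a i (v i) = 2) {s : Set ι} (hs : LinearIndepOn ℂ v s) {l : List ι} (hl : l.Nodup)
    (hb : ∀ i ∈ l, i ∈ s) {x : V} (hx : (l.map T).prod x = x) : ∀ i ∈ l, a i x = 0 := by
  induction l with
  | nil => simp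
  | cons i l ih =>
    rw [List.nodup_cons] at hl
    rw [List.map_cons, List.prod_cons, Module.End.mul_apply] at hx
    have hTT : ∀ z, T i (T i z) = z := fun z => by
      rw [hT, hT, map_sub, map_smul, h2]
      module
    have h1 : (l.map T).prod x = T i x := by rw [← hTT ((l.map T).prod x), hx]
    have h3 := prod_reflections_sub_mem hT l x
    rw [h1, hT, sub_sub_cancel_left] at h3
    have h4 : a i x = 0 := by
      by_contra h0
      have h5 : v i ∈ Submodule.span ℂ (v '' {j | j ∈ l}) := by
        have := Submodule.smul_mem _ (-(a i x)⁻¹) h3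
        rwa [smul_neg, neg_smul, neg_neg, inv_smul_smul₀ h0] at this
      refine ((linearIndepOn_insert (s := {j | j ∈ l}) (a := i) hl.1).1 (hs.mono ?_)).2 h5
      rintro j (rfl | hj)
      · exact hb _ List.mem_cons_self
      · exact hb _ (List.mem_cons_of_mem i hj)
    intro j hj
    rcases List.mem_cons.1 hj with rfl | hj
    · exact h4
    · refine ih hl.2 (fun k hk => hb k (List.mem_cons_of_mem i hk)) ?_ j hj
      rw [h1, hT, h4, zero_smul, sub_zero]

end Reflections

section Coxeter

variable {d : ℕ} {𝔤 : LieSubalgebra ℂ (Matrix (Fin d) (Fin d) ℂ)} [LieAlgebra.IsSemisimple ℂ 𝔤]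
  {H : LieSubalgebra ℂ 𝔤} [H.IsCartanSubalgebra]
  {b : (LieAlgebra.IsKilling.rootSystem H).Base} {B : LinearMap.BilinForm ℂ 𝔤}

variable (H) in
/-- The index type of the root system. -/
abbrev RootIdx : Type := {α // α ∈ (LieSubalgebra.root : Finset (LieModule.Weight ℂ H 𝔤))}

/-- The reflection in a root, as an endomorphism of the Cartan subalgebra. -/
abbrev refl (i : RootIdx H) : Module.End ℂ H :=
  ((rootSystem H).coreflection i : Module.End ℂ H)

theorem refl_apply (i : RootIdx H) (x : H) :
    refl i x = x - (rootSystem H).root i x • (rootSystem H).coroot i := rfl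

theorem root_coroot_self (i : RootIdx H) :
    (rootSystem H).root i ((rootSystem H).coroot i) = 2 := (rootSystem H).root_coroot_two i

theorem refl_coroot (i j : RootIdx H) :
    refl i ((rootSystem H).coroot j) =
      (rootSystem H).coroot ((rootSystem H).reflectionPerm i j) :=
  ((rootSystem H).coroot_reflectionPerm i j).symm

theorem exists_coroot_triple (i : RootIdx H) {y : 𝔤}
    (hy0 : y ≠ 0) (hy : y ∈ rootSpace H (-((rootSystem H).root i) : H → ℂ)) :
    ∃ x ∈ rootSpace H ((rootSystem H).root i : H → ℂ),
      ⁅x, y⁆ = ((rootSystem H).coroot i : 𝔤) := by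
  have hα : (i : LieModule.Weight ℂ H 𝔤).IsNonZero := (Finset.mem_filter.1 i.2).2
  obtain ⟨h, e, f, ht, he, hf⟩ := exists_isSl2Triple_of_weight_isNonZero hα
  have hy' : y ∈ rootSpace H (-(i : LieModule.Weight ℂ H 𝔤) : H → ℂ) := hy
  obtain ⟨c, hc⟩ := (finrank_eq_one_iff_of_nonzero' (⟨y, hy'⟩ : rootSpace H (-(i : LieModule.Weight ℂ H 𝔤) : H → ℂ))
    (by simpa using hy0)).1 (finrank_rootSpace_eq_one (-(i : LieModule.Weight ℂ H 𝔤)) (by simpa)) ⟨f, hf⟩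
  refine ⟨c • e, Submodule.smul_mem _ c he, ?_⟩
  have hc' : c • y = f := congrArg Subtype.val hc
  rw [smul_lie, ← lie_smul, hc', ht.lie_e_f]
  exact ht.h_eq_coroot hα he hf

theorem form_coroot (hinv : ∀ x y z : 𝔤, B ⁅x, y⁆ z = B x ⁅y, z⁆)
    (i : RootIdx H) :
    ∃ c : ℂ, ∀ x : H, cartanForm H B ((rootSystem H).coroot i) x = c * (rootSystem H).root i x := by
  have hα : (i : LieModule.Weight ℂ H 𝔤).IsNonZero := (Finset.mem_filter.1 i.2).2
  obtain ⟨h, e, f, ht, he, hf⟩ := exists_isSl2Triple_of_weight_isNonZero hα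
  refine ⟨B e f, fun x => ?_⟩
  have hf' : f ∈ rootSpace H (-((rootSystem H).root i) : H → ℂ) := hf
  have h1 := lie_cartan_rootSpace hf' x
  have h2 : ((rootSystem H).coroot i : 𝔤) = ⁅e, f⁆ := by
    rw [ht.lie_e_f]
    exact (ht.h_eq_coroot hα he hf).symm
  rw [cartanForm_apply, h2, hinv, ← lie_skew, h1, Pi.neg_apply, neg_smul, neg_neg, map_smul,
    smul_eq_mul, mul_comm]

theorem cartanForm_refl (hsymm : B.IsSymm) (hinv : ∀ x y z : 𝔤, B ⁅x, y⁆ z = B x ⁅y, z⁆)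
    (i : RootIdx H) (x y : H) :
    cartanForm H B (refl i x) (refl i y) = cartanForm H B x y := by
  obtain ⟨c, hc⟩ := form_coroot (B := B) hinv i
  have h1 := (cartanForm_isSymm (H := H) hsymm).eq x ((rootSystem H).coroot i)
  rw [hc] at h1
  simp only [refl_apply, map_sub, LinearMap.sub_apply, map_smul, LinearMap.smul_apply, smul_eq_mul,
    hc, root_coroot_self, h1]
  ring

/-- A product of reflections. -/
abbrev reflProd (l : List (RootIdx H)) : Module.End ℂ H :=
  (l.map refl).prod

theorem cartanForm_reflProd (hsymm : B.IsSymm) (hinv : ∀ x y z : 𝔤, B ⁅x, y⁆ z = B x ⁅y, z⁆)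
    (l : List (RootIdx H)) (x y : H) :
    cartanForm H B (reflProd l x) (reflProd l y) = cartanForm H B x y := by
  induction l with
  | nil => rfl
  | cons i l ih =>
    rw [reflProd, List.map_cons, List.prod_cons, Module.End.mul_apply, Module.End.mul_apply,
      cartanForm_refl hsymm hinv, ih]

theorem exists_perm_reflProd (l : List (RootIdx H)) :
    ∃ π : Equiv.Perm (RootIdx H), ∀ j,
      reflProd l ((rootSystem H).coroot j) = (rootSystem H).coroot (π j) := by
  induction l with
  | nil => exact ⟨1, fun j => rfl⟩
  | cons i l ih =>
    obtain ⟨π, hπ⟩ := ih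
    refine ⟨(rootSystem H).reflectionPerm i * π, fun j => ?_⟩
    rw [reflProd, List.map_cons, List.prod_cons, Module.End.mul_apply, hπ, refl_coroot]
    rfl

theorem exists_reflProd_pow_eq_one (l : List (RootIdx H)) :
    ∃ m : ℕ, 0 < m ∧ reflProd l ^ m = 1 := by
  obtain ⟨π, hπ⟩ := exists_perm_reflProd l
  refine ⟨orderOf π, orderOf_pos π, ?_⟩
  have h : ∀ (n : ℕ) j, (reflProd l ^ n) ((rootSystem H).coroot j) =
      (rootSystem H).coroot ((π ^ n) j) := fun n j => by
    induction n with
    | zero => rfl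
    | succ n ih => rw [pow_succ', Module.End.mul_apply, ih, hπ, pow_succ', Equiv.Perm.mul_apply]
  have hs : Submodule.span ℂ (range (rootSystem H).coroot) = ⊤ :=
    RootPairing.IsRootSystem.span_coroot_eq_top
  refine LinearMap.ext_on hs ?_
  rintro _ ⟨j, rfl⟩
  rw [h, pow_orderOf_eq_one]
  rfl

theorem eq_zero_of_simple_roots {x : H} (h : ∀ i ∈ b.support, (rootSystem H).root i x = 0) :
    x = 0 := by
  rw [← Module.forall_dual_apply_eq_zero_iff ℂ x]
  intro φ
  have : φ ∈ Submodule.span ℂ ((rootSystem H).root '' b.support) := by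
    rw [b.span_root_support]
    change φ ∈ Submodule.span ℂ (range (rootSystem H).root)
    rw [RootPairing.IsRootSystem.span_root_eq_top]
    exact Submodule.mem_top
  induction this using Submodule.span_induction with
  | mem φ hφ => obtain ⟨i, hi, rfl⟩ := hφ; exact h i hi
  | zero => rfl
  | add φ ψ _ _ h1 h2 => rw [LinearMap.add_apply, h1, h2, add_zero]
  | smul a φ _ h1 => rw [LinearMap.smul_apply, h1, smul_zero]

theorem finrank_cartan {l : ℕ} (e : Fin l ≃ b.support) : Module.finrank ℂ H = l := by
  rw [Module.finrank_eq_nat_card_basis b.toCoweightBasis, ← Nat.card_congr e, Nat.card_fin]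

theorem isEllipticIsometry_reflProd (hsymm : B.IsSymm)
    (hinv : ∀ x y z : 𝔤, B ⁅x, y⁆ z = B x ⁅y, z⁆) {l : ℕ} (e : Fin l ≃ b.support) :
    IsEllipticIsometry (cartanForm H B) (reflProd (List.ofFn fun i => (e i : RootIdx H))) where
  finite_order := exists_reflProd_pow_eq_one _
  isometry := cartanForm_reflProd hsymm hinv _
  unit := by
    have h : LinearMap.ker (1 - reflProd (List.ofFn fun i => (e i : RootIdx H))) = ⊥ := by
      rw [LinearMap.ker_eq_bot']
      intro x hx
      have hx' : reflProd (List.ofFn fun i => (e i : RootIdx H)) x = x :=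
        (sub_eq_zero.1 hx).symm
      refine eq_zero_of_simple_roots (b := b) fun i hi => ?_
      refine eq_zero_of_prod_reflections_fixed refl_apply root_coroot_self
        b.linearIndepOn_coroot ?_ ?_ hx' i ?_
      · exact List.nodup_ofFn.2 (Subtype.val_injective.comp e.injective)
      · intro j hj
        obtain ⟨k, rfl⟩ := (List.mem_ofFn' _ _).1 hj
        exact (e k).2
      · exact (List.mem_ofFn' _ _).2 ⟨e.symm ⟨i, hi⟩, by simp⟩
    exact LinearMap.isUnit_iff_ker_eq_bot _ |>.2 h

end Coxeter

end LoopReduction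

namespace LoopReduction

open scoped Matrix.Norms.Operator
open LieAlgebra LieAlgebra.IsKilling

/-! ### The slice of a Coxeter element -/

section AdjointSeries

variable {d : ℕ} {𝔤 : LieSubalgebra ℂ (Mat d)}

theorem eq_of_hasDerivAt_affine {g : ℂ → Mat d} {g₀ g₁ : Mat d}
    (h : ∀ t, HasDerivAt g (g₀ + t • g₁) t) (t : ℂ) :
    g t = g 0 + t • g₀ + (t ^ 2 / 2) • g₁ := by
  have h1 : ∀ t, HasDerivAt (fun t => g t - (t • g₀ + (t ^ 2 / 2) • g₁)) 0 t := fun t => by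
    have h2 : HasDerivAt (fun t : ℂ => t • g₀) ((1 : ℂ) • g₀) t := (hasDerivAt_id t).smul_const g₀
    have h3 : HasDerivAt (fun t : ℂ => (t ^ 2 / 2) • g₁) (t • g₁) t := by
      have := ((hasDerivAt_pow 2 t).div_const 2).smul_const g₁
      refine this.congr_deriv ?_
      norm_num
    refine ((h t).sub (h2.add h3)).congr_deriv ?_
    rw [one_smul, sub_self]
  have h4 := is_const_of_deriv_eq_zero (fun t => (h1 t).differentiableAt) (fun t => (h1 t).deriv) t 0
  simp only [zero_smul, add_zero, sub_zero, ne_eq, OfNat.ofNat_ne_zero, not_false_eq_true, zero_pow,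
    zero_div] at h4
  rw [← h4]
  abel

theorem Ad_expG_eq_of_lie_lie {x y : 𝔤} (h : ⁅y, ⁅y, x⁆⁆ = 0) (t : ℂ) :
    Ad (expG (t • y)) x = x + t • ⁅y, x⁆ := by
  have h1 : ∀ t : ℂ, Ad (expG (t • y)) ⁅y, x⁆ = ⁅y, x⁆ := fun t =>
    Ad_expG_of_lie_eq_zero (by rw [smul_lie, h, smul_zero])
  have h2 : ∀ t : ℂ, HasDerivAt (fun t : ℂ => ((Ad (expG (t • y)) x : 𝔤) : Mat d))
      (((⁅y, x⁆ : 𝔤) : Mat d) + t • 0) t := fun t => by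
    have := hasDerivAt_Ad_expG y x t
    rw [lie_Ad_expG, h1] at this
    rwa [smul_zero, add_zero]
  have h3 := eq_of_hasDerivAt_affine h2 t
  apply Subtype.ext
  rw [h3, zero_smul, expG_zero, map_one, Module.End.one_apply, smul_zero, add_zero]
  rfl

theorem Ad_expG_eq_of_lie_lie_lie {x y : 𝔤} (h : ⁅y, ⁅y, ⁅y, x⁆⁆⁆ = 0) (t : ℂ) :
    Ad (expG (t • y)) x = x + t • ⁅y, x⁆ + (t ^ 2 / 2) • ⁅y, ⁅y, x⁆⁆ := by
  have h2 : ∀ t : ℂ, HasDerivAt (fun t : ℂ => ((Ad (expG (t • y)) x : 𝔤) : Mat d))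
      (((⁅y, x⁆ : 𝔤) : Mat d) + t • ((⁅y, ⁅y, x⁆⁆ : 𝔤) : Mat d)) t := fun t => by
    have := hasDerivAt_Ad_expG y x t
    rw [lie_Ad_expG, Ad_expG_eq_of_lie_lie h] at this
    exact this
  have h3 := eq_of_hasDerivAt_affine h2 t
  apply Subtype.ext
  rw [h3, zero_smul, expG_zero, map_one, Module.End.one_apply]
  rfl

end AdjointSeries

section Slice

variable {d : ℕ} {𝔤 : LieSubalgebra ℂ (Matrix (Fin d) (Fin d) ℂ)} [LieAlgebra.IsSemisimple ℂ 𝔤]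
  {H : LieSubalgebra ℂ 𝔤} [H.IsCartanSubalgebra]
  (b : (LieAlgebra.IsKilling.rootSystem H).Base) {B : LinearMap.BilinForm ℂ 𝔤}

/-- The positive Borel subalgebra. -/
def borel : Submodule ℂ 𝔤 := LinearMap.ker (rootProj H (negRoots b))

variable {b}

theorem mem_borel {x : 𝔤} : x ∈ borel b ↔ rootProj H (negRoots b) x = 0 := LinearMap.mem_ker

theorem cartan_mem_borel (h : H) : (h : 𝔤) ∈ borel b := mem_borel.2 (rootProj_neg_cartan b h)

theorem nil_le_borel : nil b ≤ borel b := fun _ hx => mem_borel.2 (rootProj_neg_nil b hx)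

theorem eq_of_mem_borel {x : 𝔤} (hx : x ∈ borel b) :
    (cartanProj H x : 𝔤) + rootProj H (posRoots b) x = x := by
  have := proj_add_proj_add_proj b x
  rwa [mem_borel.1 hx, zero_add] at this

theorem eq_zero_of_mem_borel_of_nilOpp {x : 𝔤} (hx : x ∈ borel b) (hx' : x ∈ nilOpp b) : x = 0 := by
  rw [← rootProj_of_mem hx', mem_borel.1 hx]

theorem borel_eq : borel b = rootSum H {χ | 0 ≤ (χ (grading b)).re} := by
  apply le_antisymm
  · intro x hx
    rw [← eq_of_mem_borel hx]
    refine Submodule.add_mem _ ?_ ?_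
    · exact rootSum_le_rootSum (S := {0}) (fun χ hχ h => by rw [hχ]; simp)
        (rootProj_mem {0} x)
    · refine rootSum_le_rootSum (fun χ hχ h => ?_) (rootProj_mem (posRoots b) x)
      exact ((mem_posRoots_iff b h).1 hχ).le
  · intro x hx
    refine mem_borel.2 ?_
    have h : rootSum H {χ | 0 ≤ (χ (grading b)).re} = rootSum H (negRoots b)ᶜ :=
      rootSum_congr fun χ hχ => by
        rw [mem_compl_iff, mem_negRoots_iff b hχ, not_lt]
        rfl
    rw [h] at hx
    exact rootProj_of_mem_disjoint disjoint_compl_right hx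

theorem form_nil_borel (hinv : ∀ x y z : 𝔤, B ⁅x, y⁆ z = B x ⁅y, z⁆) (hsymm : B.IsSymm) {x v : 𝔤}
    (hx : x ∈ nil b) (hv : v ∈ borel b) : B x v = 0 := by
  rw [← eq_of_mem_borel hv, map_add, form_nil_nil b hinv hx (rootProj_mem _ _), add_zero,
    ← hsymm.eq, form_cartan_nil b hinv _ hx]

/-- The adjoint action on the Borel subalgebra of a negative simple root vector. -/
theorem cartanProj_Ad_simple (hinv : ∀ x y z : 𝔤, B ⁅x, y⁆ z = B x ⁅y, z⁆) (hsymm : B.IsSymm)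
    (hβ : (cartanForm H B).Nondegenerate) {i : RootIdx H} (hi : i ∈ b.support) {y : 𝔤}
    (hy0 : y ≠ 0) (hy : y ∈ rootSpace H (-((rootSystem H).root i) : H → ℂ)) {v : 𝔤}
    (hv : v ∈ borel b) (hv' : Ad (expG (-y)) v ∈ borel b) :
    cartanProj H (Ad (expG (-y)) v) = refl i (cartanProj H v) := by
  obtain ⟨x, hx, hxy⟩ := exists_coroot_triple i hy0 hy
  set c : H := (rootSystem H).coroot i with hc
  have hky : ∀ k : H, ⁅y, (k : 𝔤)⁆ = (rootSystem H).root i k • y := fun k => by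
    rw [← lie_skew, lie_cartan_rootSpace hy k, Pi.neg_apply, neg_smul, neg_neg]
  have hcy : ⁅y, (c : 𝔤)⁆ = (2 : ℂ) • y := by rw [hky, root_coroot_self]
  have hyx : ⁅y, x⁆ = -(c : 𝔤) := by rw [← lie_skew, hxy]
  have hyyx : ⁅y, ⁅y, x⁆⁆ = (-2 : ℂ) • y := by rw [hyx, lie_neg, hcy, neg_smul]
  have hpos : x ∈ nil b := rootSpace_le_rootSum
    (S := posRoots b) ⟨i, b.isPos_of_mem_support hi, rfl⟩ hx
  have move : ∀ w : 𝔤, B w (Ad (expG (-y)) v) = B (Ad (expG y) w) v := fun w => by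
    rw [← form_Ad_expG hinv y w, ← Module.End.mul_apply, ← map_mul, ← expG_inv, mul_inv_cancel,
      map_one, Module.End.one_apply]
  have e1 : B y v = -B (c : 𝔤) v := by
    have h1 := Ad_expG_eq_of_lie_lie_lie (x := x) (y := y)
      (by rw [hyyx, lie_smul, lie_self, smul_zero]) 1
    rw [one_smul, one_smul, hyyx, hyx] at h1
    have h2 := move x
    rw [form_nil_borel hinv hsymm hpos hv', h1, map_add, map_add, LinearMap.add_apply,
      LinearMap.add_apply, form_nil_borel hinv hsymm hpos hv, map_neg, map_smul, map_smul,
      LinearMap.neg_apply, LinearMap.smul_apply, LinearMap.smul_apply, smul_eq_mul, smul_eq_mul] at h2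
    linear_combination h2
  have e2 : ∀ k : H, B (k : 𝔤) (Ad (expG (-y)) v) = B (k : 𝔤) v + (rootSystem H).root i k * B y v :=
    fun k => by
      have h1 := Ad_expG_eq_of_lie_lie (x := (k : 𝔤)) (y := y)
        (by rw [hky, lie_smul, lie_self, smul_zero]) 1
      rw [one_smul, one_smul, hky] at h1
      rw [move, h1, map_add, LinearMap.add_apply, map_smul, LinearMap.smul_apply, smul_eq_mul]
  have e3 : ∀ k : H, cartanForm H B k (cartanProj H (Ad (expG (-y)) v)) =
      cartanForm H B k (refl i (cartanProj H v)) := fun k => by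
    have h1 : refl i (refl i k) = k := (rootSystem H).coreflection_same i k
    rw [← form_cartan_right b hinv, e2, e1, ← h1, cartanForm_refl hsymm hinv, h1, refl_apply,
      map_sub, LinearMap.sub_apply, map_smul, LinearMap.smul_apply, ← hc,
      form_cartan_right b hinv, form_cartan_right b hinv, smul_eq_mul]
    ring
  have hs := cartanForm_isSymm (H := H) hsymm
  rw [← sub_eq_zero]
  exact hβ.2 _ fun k => by rw [map_sub, e3, sub_self]

/-- Elements of the Borel subalgebra which stay there under successive actions. -/
def slice (b : (LieAlgebra.IsKilling.rootSystem H).Base) : List 𝔤 → Submodule ℂ 𝔤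
  | [] => borel b
  | y :: l => borel b ⊓ (slice b l).comap (Ad (expG (-y)))

/-- Successive action of `exp (-y)`. -/
def actList : List 𝔤 → Module.End ℂ 𝔤
  | [] => 1
  | y :: l => actList l * Ad (expG (-y))

theorem slice_le (l : List 𝔤) : slice b l ≤ borel b := by
  cases l with
  | nil => exact le_rfl
  | cons y l => exact inf_le_left

theorem actList_mem_borel (l : List 𝔤) {v : 𝔤} (hv : v ∈ slice b l) : actList l v ∈ borel b := by
  induction l generalizing v with
  | nil => exact hv
  | cons y l ih => exact ih hv.2

/-- A nonzero root vector for the negative of a simple root. -/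
def IsNegSimple (b : (LieAlgebra.IsKilling.rootSystem H).Base) (q : RootIdx H × 𝔤) : Prop :=
  q.1 ∈ b.support ∧ q.2 ≠ 0 ∧ q.2 ∈ rootSpace H (-((rootSystem H).root q.1) : H → ℂ)

theorem cartanProj_actList (hinv : ∀ x y z : 𝔤, B ⁅x, y⁆ z = B x ⁅y, z⁆) (hsymm : B.IsSymm)
    (hβ : (cartanForm H B).Nondegenerate) {l : List (RootIdx H × 𝔤)}
    (hl : ∀ q ∈ l, IsNegSimple b q) {v : 𝔤} (hv : v ∈ slice b (l.map Prod.snd)) :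
    cartanProj H (actList (l.map Prod.snd) v) =
      reflProd (l.map Prod.fst).reverse (cartanProj H v) := by
  induction l generalizing v with
  | nil => rfl
  | cons q l ih =>
    have hq := hl q List.mem_cons_self
    have h1 := ih (fun q' hq' => hl q' (List.mem_cons_of_mem q hq')) hv.2
    have h2 := cartanProj_Ad_simple hinv hsymm hβ hq.1 hq.2.1 hq.2.2 hv.1 (slice_le _ hv.2)
    rw [h2] at h1
    rw [List.map_cons, List.map_cons, List.reverse_cons, reflProd, List.map_append, List.prod_append,
      List.map_cons, List.map_nil, List.prod_singleton, Module.End.mul_apply]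
    exact h1

theorem root_eq_zero_of_mem_slice {l : List (RootIdx H × 𝔤)} (hl : ∀ q ∈ l, IsNegSimple b q)
    {h : H} (hh : (h : 𝔤) ∈ slice b (l.map Prod.snd)) :
    ∀ q ∈ l, (rootSystem H).root q.1 h = 0 := by
  induction l with
  | nil => simp
  | cons q l ih =>
    have hq := hl q List.mem_cons_self
    have hky : ⁅-q.2, (h : 𝔤)⁆ = -((rootSystem H).root q.1 h • q.2) := by
      rw [neg_lie, ← lie_skew, lie_cartan_rootSpace hq.2.2 h, Pi.neg_apply, neg_smul, neg_neg]
    have h1 := Ad_expG_eq_of_lie_lie (x := (h : 𝔤)) (y := -q.2)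
      (by rw [hky, lie_neg, lie_smul, neg_lie, lie_self, neg_zero, smul_zero, neg_zero]) 1
    rw [one_smul, one_smul, hky] at h1
    have h2 : Ad (expG (-q.2)) (h : 𝔤) ∈ slice b (l.map Prod.snd) := hh.2
    have hneg : q.2 ∈ nilOpp b := rootSpace_le_rootSum
      (S := negRoots b) ⟨q.1, b.isPos_of_mem_support hq.1, neg_neg _⟩ hq.2.2
    have h3 : (rootSystem H).root q.1 h • q.2 = 0 := by
      refine eq_zero_of_mem_borel_of_nilOpp (b := b) ?_ (Submodule.smul_mem _ _ hneg)
      have h4 := slice_le _ h2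
      rw [h1, ← sub_eq_add_neg] at h4
      have := Submodule.sub_mem _ (cartan_mem_borel (b := b) h) h4
      rwa [sub_sub_cancel] at this
    have h5 : (rootSystem H).root q.1 h = 0 := (smul_eq_zero.1 h3).resolve_right hq.2.1
    rw [h1, h3, neg_zero, add_zero] at h2
    intro q' hq'
    rcases List.mem_cons.1 hq' with rfl | hq'
    · exact h5
    · exact ih (fun q'' hq'' => hl q'' (List.mem_cons_of_mem q hq'')) h2 q' hq'

theorem lie_neg_simple_mem {i : RootIdx H} (hi : i ∈ b.support) {y : 𝔤}
    (hy : y ∈ rootSpace H (-((rootSystem H).root i) : H → ℂ)) {x : 𝔤} (hx : x ∈ borel b) :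
    ⁅y, x⁆ ∈ borel b ⊔ Submodule.span ℂ {y} := by
  rw [borel_eq] at hx
  refine rootSum_le (N := (borel b ⊔ Submodule.span ℂ {y}).comap (LieAlgebra.ad ℂ 𝔤 y))
    (fun χ hχ x hx => ?_) hx
  change ⁅y, x⁆ ∈ borel b ⊔ Submodule.span ℂ {y}
  by_cases hx0 : x = 0
  · rw [hx0, lie_zero]
    exact Submodule.zero_mem _
  have hne : rootSpace H χ ≠ ⊥ := fun h => hx0 (by rwa [h, LieSubmodule.mem_bot] at hx)
  rcases eq_zero_or_root hne with rfl | ⟨j, rfl⟩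
  · have hx' : x ∈ H := by rwa [rootSpace_zero_eq] at hx
    have h1 := lie_cartan_rootSpace hy ⟨x, hx'⟩
    rw [← lie_skew, h1]
    exact Submodule.neg_mem _ (Submodule.smul_mem _ _
      (Submodule.mem_sup_right (Submodule.mem_span_singleton_self y)))
  · refine Submodule.mem_sup_left ?_
    rw [borel_eq]
    refine rootSpace_le_rootSum ?_ (lie_mem_genWeightSpace_of_mem_genWeightSpace hy hx)
    have h0 := b.height_ne_zero j
    change 0 ≤ ((-(rootSystem H).root i + (rootSystem H).root j) (grading b)).re
    have h1 : 0 ≤ ((rootSystem H).root j (grading b)).re := hχ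
    rw [LinearMap.add_apply, LinearMap.neg_apply, root_grading, root_grading,
      b.height_one_of_mem_support hi]
    rw [root_grading] at h1
    have h2 : 0 ≤ b.height j := by simpa using h1
    have h3 : 1 ≤ b.height j := by omega
    have h4 : (1 : ℝ) ≤ (b.height j : ℝ) := by exact_mod_cast h3
    simpa using h4

theorem finrank_map_injective {V : Type*} [AddCommGroup V] [Module ℂ V] {T : Module.End ℂ V}
    (hT : Function.Injective T) (S : Submodule ℂ V) :
    Module.finrank ℂ (S.map T) = Module.finrank ℂ S :=
  (Submodule.equivMapOfInjective T hT S).finrank_eq.symm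

theorem finrank_slice {l : List (RootIdx H × 𝔤)} (hl : ∀ q ∈ l, IsNegSimple b q) :
    Module.finrank ℂ (borel b) ≤ Module.finrank ℂ (slice b (l.map Prod.snd)) + l.length := by
  induction l with
  | nil => exact le_rfl
  | cons q l ih =>
    have hq := hl q List.mem_cons_self
    have ih := ih fun q' hq' => hl q' (List.mem_cons_of_mem q hq')
    obtain ⟨Q, hQ⟩ : ∃ Q, Q = borel b ⊔ Submodule.span ℂ {q.2} := ⟨_, rfl⟩
    have hQdim : Module.finrank ℂ Q ≤ Module.finrank ℂ (borel b) + 1 := hQ ▸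
      (Submodule.finrank_add_le_finrank_add_finrank _ _).trans
        (Nat.add_le_add_left (finrank_span_singleton hq.2.1).le _)
    have hstab : ∀ x ∈ Q, ⁅-q.2, x⁆ ∈ Q := fun x hx => by
      rw [hQ] at hx ⊢
      obtain ⟨x₁, h₁, x₂, h₂, rfl⟩ := Submodule.mem_sup.1 hx
      obtain ⟨a, rfl⟩ := Submodule.mem_span_singleton.1 h₂
      rw [neg_lie, lie_add, lie_smul, lie_self, smul_zero, add_zero]
      exact Submodule.neg_mem _ (lie_neg_simple_mem hq.1 hq.2.2 h₁)
    have hinj : Function.Injective (Ad (expG (-q.2))) := fun x y h => by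
      have := congrArg (Ad (expG (-q.2))⁻¹) h
      rwa [← Module.End.mul_apply, ← Module.End.mul_apply, ← map_mul, inv_mul_cancel, map_one,
        Module.End.one_apply, Module.End.one_apply] at this
    obtain ⟨A, hA⟩ : ∃ A, A = (borel b).map (Ad (expG (-q.2))) := ⟨_, rfl⟩
    obtain ⟨C, hC⟩ : ∃ C, C = slice b (l.map Prod.snd) := ⟨_, rfl⟩
    rw [← hC] at ih
    have hAdim : Module.finrank ℂ A = Module.finrank ℂ (borel b) := by
      rw [hA]
      exact finrank_map_injective hinj _
    have hAC : A ⊔ C ≤ Q := by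
      refine sup_le ?_ (hC ▸ hQ ▸ (slice_le _).trans le_sup_left)
      rw [hA]
      rintro _ ⟨x, hx, rfl⟩
      exact Ad_expG_mem Q hstab (hQ ▸ Submodule.mem_sup_left hx)
    have h1 : Module.finrank ℂ ↥(A ⊔ C) + Module.finrank ℂ ↥(A ⊓ C) =
        Module.finrank ℂ A + Module.finrank ℂ C := Submodule.finrank_sup_add_finrank_inf_eq A C
    have h2 : Module.finrank ℂ ↥(A ⊔ C) ≤ Module.finrank ℂ Q := Submodule.finrank_mono hAC
    have h3 : (slice b ((q :: l).map Prod.snd)).map (Ad (expG (-q.2))) = A ⊓ C := by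
      rw [hA, hC]
      ext x
      constructor
      · rintro ⟨x, hx, rfl⟩
        exact ⟨⟨x, hx.1, rfl⟩, hx.2⟩
      · rintro ⟨⟨x, hx, rfl⟩, hx'⟩
        exact ⟨x, ⟨hx, hx'⟩, rfl⟩
    have h4 : Module.finrank ℂ ↥(A ⊓ C) =
        Module.finrank ℂ (slice b ((q :: l).map Prod.snd)) := by
      rw [← h3]
      exact finrank_map_injective hinj _
    rw [List.length_cons]
    omega

theorem exists_mem_slice {l : List (RootIdx H × 𝔤)} (hl : ∀ q ∈ l, IsNegSimple b q)
    (hlen : l.length = Module.finrank ℂ H) (hall : ∀ i ∈ b.support, ∃ q ∈ l, q.1 = i)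
    {u : 𝔤} (hu : u ∈ borel b) : ∃ h : H, u - (h : 𝔤) ∈ slice b (l.map Prod.snd) := by
  have h2 := finrank_slice hl
  obtain ⟨C, hC⟩ : ∃ C, C = slice b (l.map Prod.snd) := ⟨_, rfl⟩
  rw [← hC] at h2 ⊢
  have hdisj : C ⊓ H.toSubmodule = ⊥ := by
    rw [eq_bot_iff]
    rintro x ⟨hx, hxH⟩
    have h0 : (⟨x, hxH⟩ : H) = 0 := eq_zero_of_simple_roots (b := b) fun i hi => by
      obtain ⟨q, hq, rfl⟩ := hall i hi
      exact root_eq_zero_of_mem_slice hl (h := ⟨x, hxH⟩) (hC ▸ hx) q hq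
    exact congrArg Subtype.val h0
  have hle : C ⊔ H.toSubmodule ≤ borel b :=
    sup_le (hC ▸ slice_le _) fun x hx => cartan_mem_borel ⟨x, hx⟩
  have h1 := Submodule.finrank_sup_add_finrank_inf_eq C H.toSubmodule
  rw [hdisj, finrank_bot] at h1
  have h3 : Module.finrank ℂ H.toSubmodule = l.length := hlen.symm
  have h4 : C ⊔ H.toSubmodule = borel b :=
    Submodule.eq_of_le_of_finrank_le hle (by omega)
  rw [← h4] at hu
  obtain ⟨x, hx, k, hk, rfl⟩ := Submodule.mem_sup.1 hu
  exact ⟨⟨k, hk⟩, by rwa [add_sub_cancel_right]⟩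

end Slice

end LoopReduction

namespace LoopReduction

open scoped Matrix.Norms.Operator
open LieAlgebra LieAlgebra.IsKilling AlgebraExp

/-! ### Products of exponentials in the opposite unipotent group -/

section Unipotent

variable {d : ℕ} {𝔤 : LieSubalgebra ℂ (Matrix (Fin d) (Fin d) ℂ)} [LieAlgebra.IsSemisimple ℂ 𝔤]
  {H : LieSubalgebra ℂ 𝔤} [H.IsCartanSubalgebra]
  (b : (LieAlgebra.IsKilling.rootSystem H).Base) {B : LinearMap.BilinForm ℂ 𝔤}

/-- The grading element of the opposite nilradical. -/
def negGrading : 𝔤 := -((grading b : H) : 𝔤)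

/-- The filtration of matrices defined by the negative grading. -/
abbrev negFilt (m : ℕ) : Submodule ℂ (Mat d) := filt ((negGrading b : 𝔤) : Mat d) m

/-- Elements of the normalizer acting unipotently from below. -/
def lowerUnipotent : Submonoid (adGroup 𝔤) where
  carrier := {g | (∀ x ∈ nilOpp b, Ad g⁻¹ x ∈ nilOpp b) ∧
    Ad g⁻¹ (negGrading b) - negGrading b ∈ nilOpp b ∧ gm g - 1 ∈ negFilt b 1}
  one_mem' := by
    refine ⟨fun x hx => by rwa [inv_one, map_one], ?_, ?_⟩
    · rw [inv_one, map_one, Module.End.one_apply, sub_self]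
      exact Submodule.zero_mem _
    · rw [gm_one, sub_self]
      exact Submodule.zero_mem _
  mul_mem' := by
    rintro g h ⟨h1, h2, h3⟩ ⟨k1, k2, k3⟩
    refine ⟨fun x hx => ?_, ?_, ?_⟩
    · rw [mul_inv_rev, map_mul, Module.End.mul_apply]
      exact k1 _ (h1 _ hx)
    · have := Submodule.add_mem _ (k1 _ h2) k2
      rwa [map_sub (Ad h⁻¹), sub_add_sub_cancel, ← Module.End.mul_apply, ← map_mul,
        ← mul_inv_rev] at this
    · have e : gm (g * h) - 1 = (gm g - 1) * (gm h - 1) + ((gm g - 1) + (gm h - 1)) := by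
        rw [gm_mul]
        noncomm_ring
      rw [e]
      refine Submodule.add_mem _ ?_ (Submodule.add_mem _ h3 k3)
      exact filt_antitone (by norm_num : 1 ≤ 1 + 1) (mul_mem_filt 1 1 _ h3 _ k3)

variable {b}

theorem coe_mem_negFilt {x : 𝔤} (hx : x ∈ nilOpp b) : (x : Mat d) ∈ negFilt b 1 :=
  coe_mem_filt_of_mem_nilOpp b hx

theorem expG_mem_lowerUnipotent {y : 𝔤} (hy : y ∈ nilOpp b) : expG y ∈ lowerUnipotent b := by
  have hy' : -y ∈ nilOpp b := Submodule.neg_mem _ hy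
  refine ⟨fun x hx => ?_, ?_, ?_⟩
  · rw [expG_inv]
    exact Ad_expG_mem _ (fun z hz => lie_nilOpp_nilOpp b hy' hz) hx
  · rw [expG_inv]
    refine Ad_nilOpp_sub_mem b hy' (-grading b) (x := negGrading b) ?_
    rw [negGrading]
    push_cast
    rw [sub_self]
    exact Submodule.zero_mem _
  · exact exp_sub_one_mem filt_antitone mul_mem_filt one_mem_filt (coe_mem_negFilt hy)

theorem exists_lie_negGrading {x : 𝔤} (hx : x ∈ nilOpp b) :
    ∃ R ∈ nilOpp b, ⁅(negGrading b : 𝔤), R⁆ = x := by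
  have h : nilOpp b ≤ (nilOpp b).map (LieAlgebra.ad ℂ 𝔤 (negGrading b)) :=
    rootSum_le fun χ hχ x hx => by
      by_cases hx0 : x = 0
      · rw [hx0]
        exact Submodule.zero_mem _
      have hne : rootSpace H χ ≠ ⊥ := fun h => hx0 (by rwa [h, LieSubmodule.mem_bot] at hx)
      have h1 := (mem_negRoots_iff b hne).1 hχ
      have h2 : -χ (grading b) ≠ 0 := fun h0 => by
        rw [neg_eq_zero] at h0
        rw [h0] at h1
        exact lt_irrefl _ h1
      refine ⟨(-χ (grading b))⁻¹ • x, Submodule.smul_mem _ _ (rootSpace_le_rootSum hχ hx), ?_⟩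
      rw [LieAlgebra.ad_apply, negGrading, lie_smul, neg_lie, lie_cartan_rootSpace hx, ← neg_smul,
        inv_smul_smul₀ h2]
  obtain ⟨R, hR, h⟩ := h hx
  exact ⟨R, hR, h⟩

theorem coe_der (x : 𝔤) : der ((negGrading b : 𝔤) : Mat d) (x : Mat d) =
    ((⁅(negGrading b : 𝔤), x⁆ : 𝔤) : Mat d) := by rw [der_apply, coe_lie]

/-- One step of the approximation of a unipotent element by exponentials. -/
theorem exists_approx_step {g : adGroup 𝔤} (hg : g ∈ lowerUnipotent b) {m : ℕ} (hm : 1 ≤ m)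
    (h : gm g - 1 ∈ negFilt b m) :
    ∃ R ∈ nilOpp b, (R : Mat d) ∈ negFilt b m ∧ gm g - 1 - (R : Mat d) ∈ negFilt b (m + 1) := by
  obtain ⟨-, h2, h3⟩ := hg
  set x := Ad g⁻¹ (negGrading b) - negGrading b with hx
  have e1 : gm g * (x : Mat d) = der ((negGrading b : 𝔤) : Mat d) (gm g - 1) := by
    have e0 : (x : Mat d) = gm g⁻¹ * ((negGrading b : 𝔤) : Mat d) * gm g - ((negGrading b : 𝔤) : Mat d) := by
      rw [hx]
      change ((Ad g⁻¹ (negGrading b) : 𝔤) : Mat d) - _ = _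
      rw [coe_Ad_gm, inv_inv]
    rw [e0, der_apply, mul_sub, ← mul_assoc, ← mul_assoc, gm_mul_inv, one_mul, mul_sub, sub_mul,
      mul_one, one_mul, sub_sub_sub_cancel_right]
  obtain ⟨R, hR, hRx⟩ := exists_lie_negGrading h2
  have hder : der ((negGrading b : 𝔤) : Mat d) (gm g - 1) ∈ negFilt b m := der_mem_filt h
  have e3 : (x : Mat d) ∈ negFilt b 1 := coe_mem_negFilt h2
  have e2 : (gm g - 1) * (x : Mat d) ∈ negFilt b (m + 1) := mul_mem_filt m 1 _ h _ e3
  have e4 : (x : Mat d) ∈ negFilt b m := by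
    have : (x : Mat d) = gm g * (x : Mat d) - (gm g - 1) * (x : Mat d) := by
      rw [sub_mul, one_mul, sub_sub_cancel]
    rw [this, e1]
    exact Submodule.sub_mem _ hder (filt_antitone (Nat.le_succ m) e2)
  have e5 : (R : Mat d) ∈ negFilt b m := mem_filt_of_der_mem hm (coe_mem_negFilt hR) (by
    rw [coe_der, hRx]
    exact e4)
  refine ⟨R, hR, e5, mem_filt_of_der_mem (Nat.le_add_left 1 m) (Submodule.sub_mem _ h3
    (coe_mem_negFilt hR)) ?_⟩
  rw [map_sub (der ((negGrading b : 𝔤) : Mat d)), ← e1, coe_der, hRx]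
  have : gm g * (x : Mat d) - (x : Mat d) = (gm g - 1) * (x : Mat d) := by rw [sub_mul, one_mul]
  rw [this]
  exact e2

theorem exists_approx {g : adGroup 𝔤} (hg : g ∈ lowerUnipotent b) (m : ℕ) :
    ∃ Z ∈ nilOpp b, gm g - expm Z ∈ negFilt b (m + 1) := by
  induction m with
  | zero =>
    refine ⟨0, Submodule.zero_mem _, ?_⟩
    rw [← gm_expG, expG_zero, gm_one]
    exact hg.2.2
  | succ m ih =>
    obtain ⟨Z, hZ, h⟩ := ih
    have hv := mul_mem (expG_mem_lowerUnipotent (Submodule.neg_mem _ hZ)) hg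
    rw [← expG_inv] at hv
    have hE : ∀ W ∈ nilOpp b, expm W - 1 ∈ negFilt b 1 := fun W hW =>
      (expG_mem_lowerUnipotent hW).2.2
    have h1 : gm ((expG Z)⁻¹ * g) - 1 = gm (expG Z)⁻¹ * (gm g - expm Z) := by
      rw [gm_mul, mul_sub, ← gm_expG Z, gm_inv_mul]
    have h0 : gm (expG Z)⁻¹ ∈ negFilt b 0 := by
      have h2 := hE _ (Submodule.neg_mem _ hZ)
      rw [← gm_expG, ← expG_inv] at h2
      have := Submodule.add_mem _ (filt_antitone (Nat.zero_le 1) h2) one_mem_filt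
      rwa [sub_add_cancel] at this
    have h3 : gm ((expG Z)⁻¹ * g) - 1 ∈ negFilt b (m + 1) := by
      rw [h1]
      have := mul_mem_filt 0 (m + 1) _ h0 _ h
      rwa [zero_add] at this
    obtain ⟨R, hR, hRm, hR'⟩ := exists_approx_step hv (Nat.le_add_left 1 m) h3
    refine ⟨Z + R, Submodule.add_mem _ hZ hR, ?_⟩
    have h4 : expm (Z + R) - expm Z - (R : Mat d) ∈ negFilt b (m + 1 + 1) :=
      exp_add_sub_sub_mem filt_antitone mul_mem_filt one_mem_filt (Nat.le_add_left 1 m)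
        (coe_mem_negFilt hZ) hRm
    have h5 : (expm Z - 1) * (gm ((expG Z)⁻¹ * g) - 1) ∈ negFilt b (m + 1 + 1) := by
      have := mul_mem_filt 1 (m + 1) _ (hE Z hZ) _ h3
      rwa [add_comm 1 (m + 1)] at this
    have h6 : gm g - expm (Z + R) = (gm ((expG Z)⁻¹ * g) - 1 - (R : Mat d)) +
        (expm Z - 1) * (gm ((expG Z)⁻¹ * g) - 1) - (expm (Z + R) - expm Z - (R : Mat d)) := by
      have h7 : expm Z * gm ((expG Z)⁻¹ * g) = gm g := by
        rw [← gm_expG, ← gm_mul, mul_inv_cancel_left]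
      rw [sub_mul, mul_sub, h7, one_mul, mul_one]
      abel
    rw [h6]
    exact Submodule.sub_mem _ (Submodule.add_mem _ hR' h5) h4

/-- The opposite unipotent group is the image of the exponential map. -/
theorem exists_expG_eq {g : adGroup 𝔤} (hg : g ∈ lowerUnipotent b) :
    ∃ Z ∈ nilOpp b, expG Z = g := by
  obtain ⟨m, hm⟩ := exists_filt_eq_bot ((negGrading b : 𝔤) : Mat d)
  obtain ⟨Z, hZ, h⟩ := exists_approx hg m
  refine ⟨Z, hZ, Subtype.ext (Units.ext ?_)⟩
  have h1 := filt_antitone (Nat.le_succ m) h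
  rw [hm, Submodule.mem_bot, sub_eq_zero] at h1
  exact h1.symm

end Unipotent

/-! ### The character condition -/

section Character

variable {d : ℕ} {𝔤 : LieSubalgebra ℂ (Matrix (Fin d) (Fin d) ℂ)} [LieAlgebra.IsSemisimple ℂ 𝔤]
  {H : LieSubalgebra ℂ 𝔤} [H.IsCartanSubalgebra]
  {b : (LieAlgebra.IsKilling.rootSystem H).Base} {B : LinearMap.BilinForm ℂ 𝔤}

theorem actList_eq (l : List 𝔤) : actList l = Ad ((l.map fun y => expG y).prod)⁻¹ := by
  induction l with
  | nil => rw [List.map_nil, List.prod_nil, inv_one, map_one]; rfl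
  | cons y l ih =>
    rw [actList, ih, List.map_cons, List.prod_cons, mul_inv_rev, map_mul, expG_inv]

theorem slice_pairing (hinv : ∀ x y z : 𝔤, B ⁅x, y⁆ z = B x ⁅y, z⁆) (hsymm : B.IsSymm)
    (hβ : (cartanForm H B).Nondegenerate) {l : List (RootIdx H × 𝔤)}
    (hl : ∀ q ∈ l, IsNegSimple b q) (hlen : l.length = Module.finrank ℂ H)
    (hall : ∀ i ∈ b.support, ∃ q ∈ l, q.1 = i) {Y : 𝔤} (hY : Y ∈ nilOpp b)
    (hYl : expG Y = ((l.map Prod.snd).map fun y => expG y).prod) {u β : 𝔤} (hu : u ∈ nil b)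
    (hβn : β ∈ nil b) {ζ : H}
    (hζ : ζ - reflProd (l.map Prod.fst).reverse ζ =
      reflProd (l.map Prod.fst).reverse (cartanProj H (Ad (expG Y) β))) :
    B u (Ad (expG Y) (β + (ζ : 𝔤))) = 0 := by
  obtain ⟨h₀, hv⟩ := exists_mem_slice hl hlen hall (nil_le_borel hu)
  set v := u - (h₀ : 𝔤) with hv0
  have hact : Ad (expG Y)⁻¹ = actList (l.map Prod.snd) := by rw [actList_eq, hYl]
  have hPv : cartanProj H v = -h₀ := by
    rw [hv0, map_sub, cartanProj_nil b hu, cartanProj_coe, zero_sub]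
  have h1 : B v (Ad (expG Y) (β + (ζ : 𝔤))) =
      -cartanForm H B (reflProd (l.map Prod.fst).reverse h₀) ζ := by
    have e1 := form_Ad_expG hinv Y (Ad (expG Y)⁻¹ v) (β + (ζ : 𝔤))
    rw [← Module.End.mul_apply, ← map_mul, mul_inv_cancel, map_one, Module.End.one_apply] at e1
    have e2 : Ad (expG Y)⁻¹ v ∈ borel b := by
      rw [hact]
      exact actList_mem_borel _ hv
    have e3 : cartanProj H (Ad (expG Y)⁻¹ v) = -reflProd (l.map Prod.fst).reverse h₀ := by
      rw [hact, cartanProj_actList hinv hsymm hβ hl hv, hPv, map_neg]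
    rw [e1, map_add, ← hsymm.eq β, form_nil_borel hinv hsymm hβn e2, zero_add,
      form_cartan_left b hsymm hinv, e3, map_neg, LinearMap.neg_apply]
  have h2 : cartanProj H (Ad (expG Y) (ζ : 𝔤)) = ζ := by
    have := Ad_nilOpp_sub_mem b hY ζ (x := (ζ : 𝔤)) (by rw [sub_self]; exact Submodule.zero_mem _)
    have h3 := cartanProj_nilOpp b this
    rwa [map_sub, cartanProj_coe, sub_eq_zero] at h3
  have h3 : B (h₀ : 𝔤) (Ad (expG Y) (β + (ζ : 𝔤))) =
      cartanForm H B h₀ (cartanProj H (Ad (expG Y) β)) + cartanForm H B h₀ ζ := by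
    rw [form_cartan_right b hinv, map_add, map_add, h2, map_add]
  have h4 : cartanForm H B (reflProd (l.map Prod.fst).reverse h₀) ζ =
      cartanForm H B h₀ ζ + cartanForm H B h₀ (cartanProj H (Ad (expG Y) β)) := by
    rw [← cartanForm_reflProd hsymm hinv (l.map Prod.fst).reverse h₀ ζ,
      ← cartanForm_reflProd hsymm hinv (l.map Prod.fst).reverse h₀ (cartanProj H _), ← hζ,
      map_sub]
    ring
  have h5 : u = v + (h₀ : 𝔤) := (sub_add_cancel _ _).symm
  rw [h5, map_add, LinearMap.add_apply, h1, h3, h4]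
  ring

end Character

end LoopReduction

namespace LoopReduction

open scoped Matrix.Norms.Operator
open LieAlgebra LieAlgebra.IsKilling AlgebraExp

/-! ### Polynomial functions of matrix entries -/

section Polynomials

variable {d : ℕ}

/-- The value of a polynomial in the matrix entries. -/
def evalM (q : MvPolynomial (Fin d × Fin d) ℂ) (m : Mat d) : ℂ :=
  MvPolynomial.eval (fun ij => m ij.1 ij.2) q

theorem hasDerivAt_evalM {m : ℂ → Mat d} {m' : Mat d} {t : ℂ} (h : HasDerivAt m m' t)
    (q : MvPolynomial (Fin d × Fin d) ℂ) : HasDerivAt (fun t => evalM q (m t))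
      (∑ ij, evalM (MvPolynomial.pderiv ij q) (m t) * m' ij.1 ij.2) t := by
  have hij : ∀ i j, HasDerivAt (fun t => m t i j) (m' i j) t := hasDerivAt_matrix_iff.2 h
  induction q using MvPolynomial.induction_on with
  | C a => simpa [evalM] using hasDerivAt_const t a
  | add p q hp hq =>
    refine ((hp.add hq).congr_deriv ?_).congr_of_eventuallyEq (Eventually.of_forall fun t => ?_)
    · simp only [evalM, map_add, add_mul, Finset.sum_add_distrib]
    · simp only [evalM, map_add, Pi.add_apply]
  | mul_X p ij hp =>
    refine ((hp.mul (hij ij.1 ij.2)).congr_deriv ?_).congr_of_eventuallyEq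
      (Eventually.of_forall fun t => ?_)
    · simp only [evalM, MvPolynomial.pderiv_mul, map_add, map_mul, MvPolynomial.eval_X, add_mul,
        Finset.sum_add_distrib, Finset.sum_mul, MvPolynomial.pderiv_X]
      congr 1
      · exact Finset.sum_congr rfl fun _ _ => by ring
      · rw [Finset.sum_eq_single ij]
        · simp
        · intro kl _ hkl
          simp [hkl.symm]
        · simp
    · simp only [evalM, map_mul, MvPolynomial.eval_X, Pi.mul_apply]

/-- The matrix of partial derivatives of a polynomial. -/
def derivMat (q : MvPolynomial (Fin d × Fin d) ℂ) (m : Mat d) : Mat d :=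
  Matrix.of fun i j => evalM (MvPolynomial.pderiv (j, i) q) m

/-- The left invariant differential of a polynomial with respect to the trace form. -/
def polyGrad (q : MvPolynomial (Fin d × Fin d) ℂ) (m : Mat d) : Mat d := derivMat q m * m

theorem hasDerivAt_evalM_mul {m : ℂ → Mat d} {x : Mat d} {t : ℂ} (h : HasDerivAt m (m t * x) t)
    (q : MvPolynomial (Fin d × Fin d) ℂ) :
    HasDerivAt (fun t => evalM q (m t)) (Matrix.trace (polyGrad q (m t) * x)) t := by
  refine (hasDerivAt_evalM h q).congr_deriv ?_
  rw [polyGrad, Matrix.mul_assoc, Matrix.trace, Fintype.sum_prod_type, Finset.sum_comm]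
  exact Finset.sum_congr rfl fun i _ => by simp [derivMat, Matrix.mul_apply]

theorem differentiable_evalM (q : MvPolynomial (Fin d × Fin d) ℂ) :
    Differentiable ℂ fun m : Fin d × Fin d → ℂ => MvPolynomial.eval m q :=
  fun m => (AnalyticOnNhd.eval_mvPolynomial q m (mem_univ m)).differentiableAt

theorem HolM.holF_evalM {Q : Type*} [NormedAddCommGroup Q] [NormedSpace ℂ Q] {Ω : Set Q}
    {g : Q → ℂˣ → Mat d} (hg : HolM Ω g) (q : MvPolynomial (Fin d × Fin d) ℂ) :
    HolF Ω fun x z => evalM q (g x z) :=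
  Hol.comp (κ := Fin d × Fin d) (fun ij => hg.holF_apply ij.1 ij.2) (differentiable_evalM q)

theorem dual_matrix_eq_sum (ℓ : Mat d →ₗ[ℂ] ℂ) (m : Mat d) :
    ℓ m = ∑ i, ∑ j, ℓ (Matrix.single i j 1) * m i j := by
  conv_lhs => rw [Matrix.matrix_eq_sum_single m]
  simp only [map_sum]
  refine Finset.sum_congr rfl fun i _ => Finset.sum_congr rfl fun j _ => ?_
  rw [← mul_one (m i j), ← smul_eq_mul, ← Matrix.smul_single, map_smul, smul_eq_mul, smul_eq_mul,
    mul_one, mul_comm]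

variable {I : Type*} {E F G : Type*} [AddCommGroup E] [Module ℂ E] [AddCommGroup F] [Module ℂ F]
  [AddCommGroup G] [Module ℂ G]

/-- `g` depends polynomially on the matrix `m`. -/
def IsPoly (m : I → Mat d) (g : I → E) : Prop :=
  ∀ ℓ : Module.Dual ℂ E, ∃ q : MvPolynomial (Fin d × Fin d) ℂ, ∀ i, ℓ (g i) = evalM q (m i)

namespace IsPoly

variable {m : I → Mat d} {g h : I → E}

theorem congr (hg : IsPoly m g) (hh : ∀ i, g i = h i) : IsPoly m h := fun ℓ => by
  obtain ⟨q, hq⟩ := hg ℓ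
  exact ⟨q, fun i => by rw [← hh, hq]⟩

theorem const (x : E) : IsPoly m fun _ => x := fun ℓ => ⟨MvPolynomial.C (ℓ x), fun i => by simp [evalM]⟩

theorem add (hg : IsPoly m g) (hh : IsPoly m h) : IsPoly m fun i => g i + h i := fun ℓ => by
  obtain ⟨q, hq⟩ := hg ℓ
  obtain ⟨r, hr⟩ := hh ℓ
  exact ⟨q + r, fun i => by rw [map_add, hq, hr]; simp [evalM]⟩

theorem map (hg : IsPoly m g) (T : E →ₗ[ℂ] F) : IsPoly m fun i => T (g i) := fun ℓ => hg (ℓ ∘ₗ T)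

theorem sum {κ : Type*} (s : Finset κ) {g : κ → I → E} (hg : ∀ k ∈ s, IsPoly m (g k)) :
    IsPoly m fun i => ∑ k ∈ s, g k i := by
  classical
  induction s using Finset.induction_on with
  | empty => simpa using const (0 : E)
  | insert k s hk ih =>
    refine ((hg k (s.mem_insert_self k)).add (ih fun k' hk' => hg k'
      (Finset.mem_insert_of_mem hk'))).congr fun i => ?_
    rw [Finset.sum_insert hk]

theorem bilin [FiniteDimensional ℂ E] (hg : IsPoly m g) {h : I → F} (hh : IsPoly m h)
    (β : E →ₗ[ℂ] F →ₗ[ℂ] G) : IsPoly m fun i => β (g i) (h i) := fun ℓ => by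
  choose q hq using fun k => hg ((Module.finBasis ℂ E).coord k)
  choose r hr using fun k => hh (ℓ ∘ₗ β (Module.finBasis ℂ E k))
  refine ⟨∑ k, q k * r k, fun i => ?_⟩
  change ℓ (β (g i) (h i)) = _
  conv_lhs => rw [← (Module.finBasis ℂ E).sum_repr (g i)]
  simp only [map_sum, map_smul, LinearMap.sum_apply, LinearMap.smul_apply, smul_eq_mul, evalM,
    map_mul]
  exact Finset.sum_congr rfl fun k _ => congrArg₂ (· * ·) (hq k i) (hr k i)

theorem of_entries {g : I → Mat d} (hg : ∀ i j, ∃ q, ∀ k, g k i j = evalM q (m k)) :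
    IsPoly m g := fun ℓ => by
  choose q hq using hg
  refine ⟨∑ i, ∑ j, MvPolynomial.C (ℓ (Matrix.single i j 1)) * q i j, fun k => ?_⟩
  rw [dual_matrix_eq_sum ℓ]
  simp only [hq, evalM, map_sum, map_mul, MvPolynomial.eval_C]

theorem self : IsPoly m m :=
  of_entries fun i j => ⟨MvPolynomial.X (i, j), fun k => by simp [evalM]⟩

theorem mul {g h : I → Mat d} (hg : IsPoly m g) (hh : IsPoly m h) : IsPoly m fun i => g i * h i :=
  hg.bilin hh (LinearMap.mul ℂ (Mat d))

theorem pow {g : I → Mat d} (hg : IsPoly m g) (k : ℕ) : IsPoly m fun i => g i ^ k := by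
  induction k with
  | zero => simpa using const (1 : Mat d)
  | succ k ih => simpa [pow_succ] using ih.mul hg

theorem polyGrad (q : MvPolynomial (Fin d × Fin d) ℂ) : IsPoly m fun i => polyGrad q (m i) :=
  IsPoly.mul (of_entries fun i j => ⟨MvPolynomial.pderiv (j, i) q, fun _ => rfl⟩) self

theorem holF (hg : IsPoly m g) {Q : Type*} [NormedAddCommGroup Q] [NormedSpace ℂ Q] {Ω : Set Q}
    {c : Q → ℂˣ → I} (hc : HolM Ω fun x z => m (c x z)) (ℓ : Module.Dual ℂ E) :
    HolF Ω fun x z => ℓ (g (c x z)) := by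
  obtain ⟨q, hq⟩ := hg ℓ
  simp only [hq]
  exact hc.holF_evalM q

end IsPoly

end Polynomials

section Unipotent

variable {d : ℕ} {𝔤 : LieSubalgebra ℂ (Matrix (Fin d) (Fin d) ℂ)} [LieAlgebra.IsSemisimple ℂ 𝔤]
  {H : LieSubalgebra ℂ 𝔤} [H.IsCartanSubalgebra]
  (b : (LieAlgebra.IsKilling.rootSystem H).Base)

/-- The exponential map of the opposite nilradical. -/
def expN (Y : nilOpp b) : Mat d := expm (Y : 𝔤)

theorem isPoly_expN_neg : IsPoly (expN b) fun Y : nilOpp b => expm (-(Y : 𝔤)) := by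
  obtain ⟨M, hM⟩ := exists_filt_eq_bot ((negGrading b : 𝔤) : Mat d)
  have h1 : IsPoly (expN b) fun Y : nilOpp b => 1 - expN b Y :=
    ((IsPoly.const 1).add (IsPoly.self.map (-LinearMap.id))).congr fun Y => by
      rw [LinearMap.neg_apply, LinearMap.id_apply, ← sub_eq_add_neg]
  refine (IsPoly.sum (Finset.range M) fun k _ => h1.pow k).congr fun Y => ?_
  have h2 : (1 - expN b Y) ^ M = 0 := by
    refine pow_eq_zero_of_mem_filt hM ?_
    rw [← neg_sub]
    exact Submodule.neg_mem _ (expG_mem_lowerUnipotent Y.2).2.2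
  have h3 := geom_sum_mul_neg (1 - expN b Y) M
  rw [h2, sub_sub_cancel, sub_zero] at h3
  have h4 : expN b Y * expm (-(Y : 𝔤)) = 1 := exp_mul_exp_neg (((Y : 𝔤) : Mat d))
  exact left_inv_eq_right_inv h3 h4

variable {b}

theorem IsPoly.Ad {g : nilOpp b → 𝔤} (hg : IsPoly (expN b) g) :
    IsPoly (expN b) fun Y => Ad (expG (Y : 𝔤)) (g Y) :=
  (((IsPoly.self.mul (hg.map 𝔤.toSubmodule.subtype)).mul (isPoly_expN_neg b)).map
    (toLie 𝔤)).congr fun Y => by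
      rw [← toLie_coe (LoopReduction.Ad (expG (Y : 𝔤)) (g Y)), coe_Ad_gm, expG_inv]
      rfl

theorem holM_expN {Q : Type*} [NormedAddCommGroup Q] [NormedSpace ℂ Q] {Ω : Set Q}
    {c : Q → Loop (nilOpp b)} (hc : IsHolFamily Ω c) : HolM Ω fun x z => expN b (ev (c x) z) :=
  HolM.exp (HolM.of_family hc (𝔤.toSubmodule.subtype ∘ₗ (nilOpp b).subtype))

variable {E : Type*} [AddCommGroup E] [Module ℂ E] [TopologicalSpace E] [IsTopologicalAddGroup E]
  [ContinuousSMul ℂ E] [FiniteDimensional ℂ E]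

/-- The loop `z ↦ zⁿ g(X(z))` for a polynomial function `g` on the opposite unipotent group. -/
def polyLoop {g : nilOpp b → E} (hg : IsPoly (expN b) g) (n : ℤ) (X : Loop (nilOpp b)) : Loop E :=
  Loop.ofHol (fun z => (z : ℂ) ^ n • g (ev X z)) fun ℓ => by
    refine ((holU_zpow n).mul (HolF.holU (hg.holF (Ω := univ) (c := fun (_ : ℂ) z => ev X z)
      (holM_expN (isHolFamily_const X)) ℓ) (mem_univ 0))).congr fun z => ?_
    rw [map_smul, smul_eq_mul]

theorem ev_polyLoop {g : nilOpp b → E} (hg : IsPoly (expN b) g) (n : ℤ) (X : Loop (nilOpp b))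
    (z : ℂˣ) : ev (polyLoop hg n X) z = (z : ℂ) ^ n • g (ev X z) := rfl

theorem isHolFamily_polyLoop {g : nilOpp b → E} (hg : IsPoly (expN b) g) (n : ℤ) {Q : Type*}
    [NormedAddCommGroup Q] [NormedSpace ℂ Q] {Ω : Set Q} {c : Q → Loop (nilOpp b)}
    (hc : IsHolFamily Ω c) : IsHolFamily Ω fun x => polyLoop hg n (c x) :=
  isHolFamily_iff.2 fun ℓ => by
    have h1 : HolF Ω fun _ z => (z : ℂ) ^ n := HolF.of_holU (holU_zpow n)
    refine (Hol.mul h1 (hg.holF (holM_expN hc) ℓ)).congr fun i => ?_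
    change _ = ℓ (((i.2 : ℂˣ) : ℂ) ^ n • g (ev (c i.1) i.2))
    rw [map_smul, smul_eq_mul]

end Unipotent

end LoopReduction

namespace LoopReduction

open scoped Matrix.Norms.Operator
open LieAlgebra LieAlgebra.IsKilling AlgebraExp

/-! ### Matrix coefficients of the unipotent factor -/

section Constraints

variable {d : ℕ} {𝔤 : LieSubalgebra ℂ (Matrix (Fin d) (Fin d) ℂ)} [LieAlgebra.IsSemisimple ℂ 𝔤]
  {H : LieSubalgebra ℂ 𝔤} [H.IsCartanSubalgebra]
  {b : (LieAlgebra.IsKilling.rootSystem H).Base} {B : LinearMap.BilinForm ℂ 𝔤} {p : ℂˣ}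
  {S : Module.End ℂ H}

variable (b B) in
/-- `δ` represents the trace form, restricted to the opposite nilradical, by elements of the
nilradical. -/
def IsDualNil (δ : Mat d →ₗ[ℂ] 𝔤) : Prop :=
  ∀ P, δ P ∈ nil b ∧ ∀ x ∈ nilOpp b, B x (δ P) = Matrix.trace (P * (x : Mat d))

theorem exists_isDualNil (hsymm : B.IsSymm) (hnondeg : B.Nondegenerate)
    (hinv : ∀ x y z : 𝔤, B ⁅x, y⁆ z = B x ⁅y, z⁆) : ∃ δ, IsDualNil b B δ := by
  let τ : Mat d →ₗ[ℂ] Module.Dual ℂ 𝔤 := (LinearMap.lcomp ℂ ℂ (𝔤.toSubmodule.subtype)) ∘ₗ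
    (LinearMap.mul ℂ (Mat d)).compr₂ (Matrix.traceLinearMap (Fin d) ℂ ℂ)
  refine ⟨rootProj H (posRoots b) ∘ₗ (B.toDual hnondeg).symm.toLinearMap ∘ₗ τ, fun P =>
    ⟨rootProj_mem _ _, fun x hx => ?_⟩⟩
  have h1 := form_rootProj_neg (b := b) hinv hsymm x ((B.toDual hnondeg).symm (τ P))
  rw [rootProj_of_mem hx, ← hsymm.eq,
    LinearMap.BilinForm.apply_toDual_symm_apply] at h1
  exact h1.symm

variable (δ : Mat d →ₗ[ℂ] 𝔤) (R : Module.End ℂ H) (q : MvPolynomial (Fin d × Fin d) ℂ)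

/-- The nilpotent part of the gradient of a regular function. -/
def gradNil (Y : nilOpp b) : 𝔤 := δ (polyGrad q (expN b Y))

/-- The Cartan part of the gradient of a regular function. -/
def gradCartan (Y : nilOpp b) : H := R (cartanProj H (Ad (expG (Y : 𝔤)) (gradNil δ q Y)))

theorem isPoly_gradNil : IsPoly (expN b) (gradNil (b := b) δ q) := (IsPoly.polyGrad q).map δ

theorem isPoly_gradCartan : IsPoly (expN b) (gradCartan (b := b) δ R q) :=
  (isPoly_gradNil δ q).Ad.map (R ∘ₗ cartanProj H)

/-- The gradient of the `n`-th Laurent coefficient of a regular function of `n₊`, before the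
shift. -/
def coeffGrad (n : ℤ) (X : Loop (nilOpp b)) : Loop 𝔤 :=
  polyLoop (isPoly_gradNil δ q) (-n) X + jH (polyLoop (isPoly_gradCartan δ R q) (-n) X)

theorem nPlus_eq (v : Pts b) (z : ℂˣ) : nPlus b v z = expN b (ev v.2.1 z) := rfl

theorem isHolFamily_coeffGrad (n : ℤ) {Q : Type*} [NormedAddCommGroup Q] [NormedSpace ℂ Q]
    {Ω : Set Q} {c : Q → Loop (nilOpp b)} (hc : IsHolFamily Ω c) :
    IsHolFamily Ω fun x => coeffGrad δ R q n (c x) :=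
  (isHolFamily_polyLoop (isPoly_gradNil δ q) (-n) hc).add
    ((isHolFamily_polyLoop (isPoly_gradCartan δ R q) (-n) hc).map _)

theorem hasDerivAt_coeff {c : ℂ → ℂˣ → ℂ} {w : ℂˣ → ℂ} (hc : HolF univ c)
    (hw : ∀ z, HasDerivAt (fun t => c t z) (w z) 0) (hwU : HolU w) (n : ℤ) :
    HasDerivAt (fun t => coeff n (c t)) (coeff n w) 0 := by
  have hcU : ∀ t, HolU (c t) := fun t => hc.holU (mem_univ t)
  have lin : ∀ (ℓ : Module.Dual ℂ ℂ) (x : ℂ), ℓ x = ℓ 1 * x := fun ℓ x => by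
    rw [mul_comm, ← smul_eq_mul, ← map_smul, smul_eq_mul, mul_one]
  let C : ℂ → Loop ℂ := fun t => Loop.ofHol (c t) fun ℓ =>
    ((hcU t).const_mul (ℓ 1)).congr fun z => (lin ℓ _).symm
  let W : Loop ℂ := Loop.ofHol w fun ℓ => (hwU.const_mul (ℓ 1)).congr fun z => (lin ℓ _).symm
  have hC : IsHolFamily univ C := isHolFamily_iff.2 fun ℓ =>
    (Hol.const_mul (ℓ 1) hc).congr fun i => (lin ℓ _).symm
  obtain ⟨T, hT, hT0, hCT⟩ := exists_slope_family (w := W) hC fun ℓ z =>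
    (((hw z).const_mul (ℓ 1)).congr_deriv (lin ℓ _).symm).congr_of_eventuallyEq
      (Eventually.of_forall fun t => lin ℓ _)
  have hTF : HolF (ball (0 : ℂ) (1 / 2)) fun t z => ev (T t) z :=
    isHolFamily_iff.1 hT LinearMap.id
  have hd : DifferentiableAt ℂ (fun t => coeff n fun z => ev (T t) z) 0 :=
    (hTF.differentiableOn_coeff isOpen_ball n).differentiableAt
      (isOpen_ball.mem_nhds (mem_ball_self (by norm_num)))
  have h1 : HasDerivAt (fun t : ℂ => coeff n (c 0) + t * coeff n fun z => ev (T t) z)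
      (coeff n w) 0 := by
    refine (((hasDerivAt_id (0 : ℂ)).mul hd.hasDerivAt).const_add _).congr_deriv ?_
    simp only [id, one_mul, zero_mul, add_zero, hT0]
    rfl
  refine h1.congr_of_eventuallyEq ?_
  filter_upwards [isOpen_ball.mem_nhds (mem_ball_self (by norm_num : (0 : ℝ) < 1 / 2))] with t ht
  have e : c t = fun z => c 0 z + t * ev (T t) z := funext fun z => congrArg (fun L => ev L z) (hCT t)
  rw [e, coeff_add (hcU 0) ((hTF.holU ht).const_mul t), coeff_const_mul]

theorem hasDerivAt_matCoeff {δ : Mat d →ₗ[ℂ] 𝔤} (hδ : IsDualNil b B δ) (n : ℤ) (v w : Pts b) :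
    HasDerivAt (fun t : ℂ => matCoeff q n (nPlus b (v + t • w)))
      (pair B (dlogL (jS (nilOpp b) v.2.1) (jS (nilOpp b) w.2.1))
        (polyLoop (isPoly_gradNil δ q) (-n) v.2.1)) 0 := by
  set ν := dlogL (jS (nilOpp b) v.2.1) (jS (nilOpp b) w.2.1) with hν
  have hνm : ∀ z, ev ν z ∈ nilOpp b := fun z =>
    dlog_mem _ (fun u hu => lie_nilOpp_nilOpp b (jS_mem v.2.1 z) hu) (jS_mem w.2.1 z)
  have e1 : pair B ν (polyLoop (isPoly_gradNil δ q) (-n) v.2.1) =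
      coeff n fun z => B (ev ν z) (gradNil δ q (ev v.2.1 z)) := by
    rw [pair]
    simp only [ev_polyLoop, map_smul, smul_eq_mul]
    rw [coeff_zpow_mul, zero_sub, neg_neg]
  have hfam : HolF univ fun (t : ℂ) z => evalM q (nPlus b (v + t • w) z) :=
    (holM_expN (IsHolFamilyPts.line v w).2.1).holF_evalM q
  rw [e1]
  refine hasDerivAt_coeff hfam (fun z => ?_) ?_ n
  · have h1 := hasDerivAt_expm (ev (jS (nilOpp b) v.2.1) z) (ev (jS (nilOpp b) w.2.1) z)
    have h2 : HasDerivAt (fun t : ℂ => nPlus b (v + t • w) z)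
        (nPlus b (v + (0 : ℂ) • w) z * ((ev ν z : 𝔤) : Mat d)) 0 := by
      rw [zero_smul, add_zero]
      exact h1
    have h3 := hasDerivAt_evalM_mul h2 q
    rw [zero_smul, add_zero, nPlus_eq, ← (hδ _).2 _ (hνm z)] at h3
    exact h3
  · have := holU_bilin B ν (polyLoop (isPoly_gradNil δ q) 0 v.2.1)
    simpa only [ev_polyLoop, zpow_zero, one_smul] using this

variable {δ} {q} {R}

theorem coeffGrad_sub_mem (hδ : IsDualNil b B δ) (n : ℤ) (X : Loop (nilOpp b)) :
    coeffGrad δ R q n X - jH (polyLoop (isPoly_gradCartan δ R q) (-n) X) ∈ ValuedIn (nil b) := by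
  rw [coeffGrad, add_sub_cancel_right]
  exact fun z => Submodule.smul_mem _ _ (hδ _).1

theorem polyLoop_gradCartan (n : ℤ) (v : Pts b) :
    polyLoop (isPoly_gradCartan δ R q) n v.2.1 =
      Loop.map R (PH H (AdL (nP b v) (polyLoop (isPoly_gradNil δ q) n v.2.1))) :=
  loop_ext fun z => by
    change (z : ℂ) ^ n • R (cartanProj H (Ad (expG _) (gradNil δ q (ev v.2.1 z)))) =
      R (cartanProj H (Ad (expG _) ((z : ℂ) ^ n • gradNil δ q (ev v.2.1 z))))
    simp only [map_smul]
    rfl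

theorem PH_AdL_coeffGrad (n : ℤ) (v : Pts b) :
    PH H (AdL (nP b v) (coeffGrad δ R q n v.2.1)) =
      PH H (AdL (nP b v) (polyLoop (isPoly_gradNil δ q) (-n) v.2.1)) +
        polyLoop (isPoly_gradCartan δ R q) (-n) v.2.1 := by
  have h1 : AdL (nP b v) (jH (polyLoop (isPoly_gradCartan δ R q) (-n) v.2.1)) -
      jH (polyLoop (isPoly_gradCartan δ R q) (-n) v.2.1) ∈ ValuedIn (nilOpp b) :=
    AdL_nilOpp_sub_mem (jS_mem v.2.1) _ (by rw [sub_self]; exact Submodule.zero_mem _)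
  rw [coeffGrad, map_add (AdL (nP b v)), map_add (PH H), PH_of_sub_nilOpp h1]

/-- The Cartan part of the gradient solves `ζ = S (η + ζ)`. -/
theorem map_cartan_coeffGrad (hR : R - S * R = S) (n : ℤ) (v : Pts b) :
    Loop.map S (PH H (AdL (nP b v) (coeffGrad δ R q n v.2.1))) =
      polyLoop (isPoly_gradCartan δ R q) (-n) v.2.1 := by
  rw [PH_AdL_coeffGrad, polyLoop_gradCartan]
  set η := PH H (AdL (nP b v) (polyLoop (isPoly_gradNil δ q) (-n) v.2.1))
  refine loop_ext fun z => ?_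
  have h := LinearMap.congr_fun hR (ev η z)
  change R (ev η z) - S (R (ev η z)) = S (ev η z) at h
  change S (ev η z + R (ev η z)) = R (ev η z)
  rw [map_add, ← h, sub_add_cancel]

theorem isGrad_matCoeff (hsymm : B.IsSymm) (hinv : ∀ x y z : 𝔤, B ⁅x, y⁆ z = B x ⁅y, z⁆)
    (hS : IsEllipticIsometry (cartanForm H B) S) (hp : ‖(p : ℂ)‖ < 1) (hδ : IsDualNil b B δ)
    (hR : R - S * R = S) (n : ℤ) (v : Pts b) :
    IsGrad b B p (ellR p S) (fun v => matCoeff q n (nPlus b v)) v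
      (shift p (coeffGrad δ R q n v.2.1)) := by
  intro w
  refine (hasDerivAt_matCoeff q hδ n v w).congr_deriv ?_
  set β := polyLoop (isPoly_gradNil δ q) (-n) v.2.1 with hβ
  obtain ⟨ζ, hζ⟩ : ∃ ζ, ζ = polyLoop (isPoly_gradCartan δ R q) (-n) v.2.1 := ⟨_, rfl⟩
  obtain ⟨Z, hZ⟩ : ∃ Z, Z = coeffGrad δ R q n v.2.1 := ⟨_, rfl⟩
  obtain ⟨ν, hν⟩ : ∃ ν, ν = dlogL (jS (nilOpp b) v.2.1) (jS (nilOpp b) w.2.1) := ⟨_, rfl⟩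
  obtain ⟨c, hc⟩ : ∃ c, c = rpl (ellR p S) w.1 := ⟨_, rfl⟩
  obtain ⟨a, ha⟩ : ∃ a, a = AdL (nP b v)⁻¹ (jH c) := ⟨_, rfl⟩
  have hνm : ν ∈ ValuedIn (nilOpp b) := hν ▸ fun z =>
    dlog_mem _ (fun u hu => lie_nilOpp_nilOpp b (jS_mem v.2.1 z) hu) (jS_mem w.2.1 z)
  have hZe : Z = β + jH ζ := by rw [hZ, hζ]; rfl
  have hSZ := map_cartan_coeffGrad (q := q) (δ := δ) hR n v
  rw [← hZ, ← hζ] at hSZ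
  have hZn : Z - jH ζ ∈ ValuedIn (nil b) := by
    rw [hZ, hζ]
    exact coeffGrad_sub_mem hδ n _
  have hmi : rmi (ellR p S) w.1 = Loop.map S (shift p c) := by
    rw [hc, rpl_ellR hS hp, rmi_ellR hS hp]
    rfl
  have htM : tM b (ellR p S) v w - jH (rmi (ellR p S) w.1) ∈ ValuedIn (nil b) := by
    rw [tM, add_sub_right_comm]
    exact Submodule.add_mem _ (AdL_nM_inv_sub_mem v _) fun z =>
      dlog_mem _ (fun u hu => lie_nil_nil b (jS_mem v.2.2 z) hu) (jS_mem w.2.2 z)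
  have h1 : pair B (tM b (ellR p S) v w) (shift p Z) =
      pair (cartanForm H B) (Loop.map S c) ζ := by
    have h2 : shift p Z - jH (shift p ζ) ∈ ValuedIn (nil b) := fun z => hZn (p * z)
    rw [pair_add_nil hinv hsymm htM h2, hmi]
    exact pair_shift (cartanForm H B) p (Loop.map S c) ζ
  have h3 : pair B a Z = pair (cartanForm H B) c (PH H (AdL (nP b v) Z)) := by
    rw [ha, pair_AdL_inv_left (g := nP b v) (expL_mem_isoG hinv _), pair_jH_left hinv b]
  have h4 : pair B ν Z = pair B ν β := by
    rw [hZe, pair_add_right, pair_jH_right hsymm hinv b, PH_of_nilOpp hνm, pair_zero_left, add_zero]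
  have h5 : pair (cartanForm H B) c (PH H (AdL (nP b v) Z)) =
      pair (cartanForm H B) (Loop.map S c) ζ := by
    rw [← hSZ]
    exact pair_congr _ fun z => (hS.isometry _ _).symm
  rw [← hZ, ← hν, tL, pair_sub_left, pair_shift, h1, tP, ← hc, ← ha, ← hν, pair_add_left, h3, h4, h5]
  ring

end Constraints

end LoopReduction

namespace LoopReduction

open scoped Matrix.Norms.Operator
open LieAlgebra LieAlgebra.IsKilling AlgebraExp

/-! ### Brackets of matrix coefficients for the elliptic r-matrix -/

theorem apply_inverse_one_sub {V : Type*} [AddCommGroup V] [Module ℂ V] {A D C : Module.End ℂ V}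
    (h : C * (1 - A * D) = 1) (h' : (1 - A * D) * C = 1) (hAD : Commute A D) {τ ζ : V}
    (hτ : A τ = ζ) : (A * D * C) (τ - D ζ) = D ζ := by
  have h1 : A * D * C = C * (D * A) := by
    rw [← hAD.eq]
    rw [mul_sub, mul_one, sub_eq_iff_eq_add] at h
    rw [sub_mul, one_mul, sub_eq_iff_eq_add] at h'
    exact add_left_cancel (h'.symm.trans h)
  have h2 : (D * A) (τ - D ζ) = (1 - A * D) (D ζ) := by
    have h3 := LinearMap.congr_fun hAD.eq (D ζ)
    change D (A (τ - D ζ)) = D ζ - (A * D) (D ζ)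
    rw [map_sub, map_sub, hτ, h3]
    rfl
  rw [h1, Module.End.mul_apply, h2, ← Module.End.mul_apply, h, Module.End.one_apply]

section EllipticBracket

variable {d : ℕ} {𝔤 : LieSubalgebra ℂ (Matrix (Fin d) (Fin d) ℂ)} [LieAlgebra.IsSemisimple ℂ 𝔤]
  {H : LieSubalgebra ℂ 𝔤} [H.IsCartanSubalgebra]
  {b : (LieAlgebra.IsKilling.rootSystem H).Base} {B : LinearMap.BilinForm ℂ 𝔤} {p : ℂˣ}
  {S : Module.End ℂ H}

theorem Ppos_AdL_cartan (h : Loop H) (X : Loop 𝔤) :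
    Ppos b (AdL (expL (jH h)) X) = AdL (expL (jH h)) (Ppos b X) := by
  rw [AdL_cartan_eq h X b, map_add (Ppos b), map_add (Ppos b), Ppos_jH,
    Ppos_of_nilOpp (AdL_cartan_nilOpp h (Pneg_mem X)), Ppos_of_nil (AdL_cartan_nil h (Ppos_mem X)),
    add_zero, zero_add]

theorem gS_shift (r₀ : Module.End ℂ (Loop H)) (v : Pts b) (Z : Loop 𝔤) : gS b p r₀ v (shift p Z) =
    AdL (expL (jH (rpl r₀ v.1))) (AdL (nP b v) Z) := by
  rw [gS, shift_inv_shift, lgP, AdL_mul_apply]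

theorem gR_shift_sub_mem (r₀ : Module.End ℂ (Loop H)) (v : Pts b) {Z : Loop 𝔤} {ζ : Loop H}
    (hZ : Z - jH ζ ∈ ValuedIn (nil b)) :
    gR b r₀ v (shift p Z) - jH (shift p ζ) ∈ ValuedIn (nil b) := by
  have h2 : shift p Z - jH (shift p ζ) ∈ ValuedIn (nil b) := fun z => hZ (p * z)
  have h3 : AdL (expL (jH (rmi r₀ v.1))) (AdL (nM b v) (shift p Z) - jH (shift p ζ)) ∈
      ValuedIn (nil b) := by
    refine AdL_cartan_nil _ ?_
    have := Submodule.add_mem _ (AdL_nil_sub_mem (jS_mem v.2.2) _ h2) h2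
    rwa [sub_add_sub_cancel] at this
  rwa [map_sub (AdL (expL (jH (rmi r₀ v.1)))), AdL_cartan_jH, ← AdL_mul_apply] at h3

theorem gW_shift_of_cartan (hS : IsEllipticIsometry (cartanForm H B) S) (hp : ‖(p : ℂ)‖ < 1)
    (v : Pts b) {Z : Loop 𝔤} {ζ : Loop H} (hZ : Z - jH ζ ∈ ValuedIn (nil b))
    (hζ : Loop.map S (PH H (AdL (nP b v) Z)) = ζ) :
    gW b p (ellR p S) v (shift p Z) =
      (-2 : ℂ) • AdL (expL (jH (rpl (ellR p S) v.1))) (Ppos b (AdL (nP b v) Z)) := by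
  have hR := gR_shift_sub_mem (p := p) (ellR p S) v hZ
  have hPR : PH H (gR b (ellR p S) v (shift p Z)) = shift p ζ := PH_of_sub_nil hR
  have hc : rmi (ellR p S) (PH H (AdL (nP b v) Z) - shift p ζ) = shift p ζ := by
    have hu := hS.isUnit (p := p) hp
    rw [rmi_ellR hS hp]
    exact apply_inverse_one_sub (Ring.inverse_mul_cancel _ hu) (Ring.mul_inverse_cancel _ hu)
      (commute_map_shift S p) hζ
  have hV : PH H (gV b p (ellR p S) v (shift p Z)) = PH H (AdL (nP b v) Z) - shift p ζ := by
    rw [gV, map_sub (PH H), hPR, gS_shift, PH_AdL_cartan _ _ b]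
  have hG : Ppos b (gR b (ellR p S) v (shift p Z)) =
      gR b (ellR p S) v (shift p Z) - jH (shift p ζ) := by
    have := Ppos_of_nil hR
    rwa [map_sub (Ppos b), Ppos_jH, sub_zero] at this
  have hP : Ppos b (gV b p (ellR p S) v (shift p Z)) =
      AdL (expL (jH (rpl (ellR p S) v.1))) (Ppos b (AdL (nP b v) Z)) -
        (gR b (ellR p S) v (shift p Z) - jH (shift p ζ)) := by
    rw [gV, map_sub (Ppos b), hG, gS_shift, Ppos_AdL_cartan]
  rw [gW_eq_rmi, rmi_rOp, hV, hc, hP]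
  module

theorem pair_gW_gV_of_cartan (hsymm : B.IsSymm) (hinv : ∀ x y z : 𝔤, B ⁅x, y⁆ z = B x ⁅y, z⁆)
    (hS : IsEllipticIsometry (cartanForm H B) S) (hp : ‖(p : ℂ)‖ < 1)
    (v : Pts b) {Z Z' : Loop 𝔤} {ζ ζ' : Loop H} (hZ : Z - jH ζ ∈ ValuedIn (nil b))
    (hζ : Loop.map S (PH H (AdL (nP b v) Z)) = ζ) (hZ' : Z' - jH ζ' ∈ ValuedIn (nil b)) :
    pair B (gW b p (ellR p S) v (shift p Z)) (gV b p (ellR p S) v (shift p Z')) =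
      -2 * pair B (Ppos b (AdL (nP b v) Z)) (AdL (nP b v) Z') := by
  have h1 : pair B (AdL (expL (jH (rpl (ellR p S) v.1))) (Ppos b (AdL (nP b v) Z)))
      (gR b (ellR p S) v (shift p Z')) = 0 := by
    have h2 := AdL_cartan_nil (rpl (ellR p S) v.1) (Ppos_mem (b := b) (AdL (nP b v) Z))
    rw [← sub_zero (AdL (expL _) _), ← map_zero (jH (H := H))] at h2
    rw [pair_add_nil hinv hsymm h2 (gR_shift_sub_mem (p := p) (ellR p S) v hZ'), pair_zero_left]
  rw [gW_shift_of_cartan hS hp v hZ hζ, pair_smul_left, gV, pair_sub_right, h1, sub_zero, gS_shift,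
    pair_AdL_expL hinv]

variable {δ : Mat d →ₗ[ℂ] 𝔤} {R : Module.End ℂ H}

variable (δ R) in
/-- The total gradient of a regular function, conjugated by the point. -/
def conjGrad (q : MvPolynomial (Fin d × Fin d) ℂ) (Y : nilOpp b) : 𝔤 :=
  Ad (expG (Y : 𝔤)) (gradNil δ q Y + (gradCartan δ R q Y : 𝔤))

theorem isPoly_conjGrad (q : MvPolynomial (Fin d × Fin d) ℂ) :
    IsPoly (expN b) (conjGrad (b := b) δ R q) :=
  ((isPoly_gradNil δ q).add ((isPoly_gradCartan δ R q).map
    (H.toSubmodule.subtype : H →ₗ[ℂ] 𝔤))).Ad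

theorem ev_AdL_coeffGrad (q : MvPolynomial (Fin d × Fin d) ℂ) (n : ℤ) (v : Pts b) (z : ℂˣ) :
    ev (AdL (nP b v) (coeffGrad δ R q n v.2.1)) z =
      (z : ℂ) ^ (-n) • conjGrad δ R q (ev v.2.1 z) := by
  change Ad (expG _) ((z : ℂ) ^ (-n) • gradNil δ q (ev v.2.1 z) +
    (((z : ℂ) ^ (-n) • gradCartan δ R q (ev v.2.1 z) : H) : 𝔤)) = _
  rw [conjGrad, ← map_smul, smul_add]
  rfl

/-- The Poisson bracket of two regular functions as a function on the unipotent group. -/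
theorem exists_bracket_poly (B : LinearMap.BilinForm ℂ 𝔤) (δ : Mat d →ₗ[ℂ] 𝔤)
    (R : Module.End ℂ H) (q q' : MvPolynomial (Fin d × Fin d) ℂ) :
    ∃ Q : MvPolynomial (Fin d × Fin d) ℂ, ∀ Y : nilOpp b,
      -2 * B (rootProj H (posRoots b) (conjGrad δ R q Y)) (conjGrad δ R q' Y) =
        evalM Q (expN b Y) := by
  obtain ⟨Q, hQ⟩ := (((isPoly_conjGrad (b := b) (δ := δ) (R := R) q).map
    (rootProj H (posRoots b))).bilin (isPoly_conjGrad (R := R) q') B) ((-2 : ℂ) • LinearMap.id)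
  exact ⟨Q, hQ⟩

theorem bracket_matCoeff (hsymm : B.IsSymm) (hnondeg : B.Nondegenerate)
    (hinv : ∀ x y z : 𝔤, B ⁅x, y⁆ z = B x ⁅y, z⁆)
    (hS : IsEllipticIsometry (cartanForm H B) S) (hp : ‖(p : ℂ)‖ < 1) (hδ : IsDualNil b B δ)
    (hR : R - S * R = S) (q q' : MvPolynomial (Fin d × Fin d) ℂ) (n n' : ℤ) (v : Pts b) :
    bracket b B p (ellR p S) (fun v => matCoeff q n (nPlus b v))
      (fun v => matCoeff q' n' (nPlus b v)) v = coeff (n + n') fun z =>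
        -2 * B (rootProj H (posRoots b) (conjGrad δ R q (ev v.2.1 z)))
          (conjGrad δ R q' (ev v.2.1 z)) := by
  have hr : IsRMatrix B p (ellR p S) :=
    isRMatrix_ellR (cartanForm_nondegenerate b hsymm hnondeg hinv) hS hp
  rw [IsGrad.bracket_eq hnondeg hinv hr.comm hr.surjective
      (isGrad_matCoeff hsymm hinv hS hp hδ hR n v) (isGrad_matCoeff hsymm hinv hS hp hδ hR n' v),
    pair_gW_gV_of_cartan hsymm hinv hS hp v (coeffGrad_sub_mem hδ n v.2.1)
      (map_cartan_coeffGrad hR n v) (coeffGrad_sub_mem hδ n' v.2.1), pair, ← coeff_const_mul]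
  have e : ∀ z, -2 * B (ev (Ppos b (AdL (nP b v) (coeffGrad δ R q n v.2.1))) z)
      (ev (AdL (nP b v) (coeffGrad δ R q' n' v.2.1)) z) = (z : ℂ) ^ (-(n + n')) *
        (-2 * B (rootProj H (posRoots b) (conjGrad δ R q (ev v.2.1 z)))
          (conjGrad δ R q' (ev v.2.1 z))) := fun z => by
    change -2 * B (rootProj H (posRoots b) (ev (AdL (nP b v) (coeffGrad δ R q n v.2.1)) z)) _ = _
    rw [ev_AdL_coeffGrad, ev_AdL_coeffGrad, map_smul, map_smul, map_smul, LinearMap.smul_apply,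
      neg_add, zpow_add₀ z.ne_zero, smul_eq_mul, smul_eq_mul]
    ring
  simp only [e]
  rw [coeff_zpow_mul, zero_sub, neg_neg]

theorem isSmooth_matCoeff (hsymm : B.IsSymm)
    (hinv : ∀ x y z : 𝔤, B ⁅x, y⁆ z = B x ⁅y, z⁆)
    (hS : IsEllipticIsometry (cartanForm H B) S) (hp : ‖(p : ℂ)‖ < 1) (hδ : IsDualNil b B δ)
    (hR : R - S * R = S) (q : MvPolynomial (Fin d × Fin d) ℂ) (n : ℤ) :
    IsSmooth b B p (ellR p S) univ fun v => matCoeff q n (nPlus b v) :=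
  isSmooth_of_isGrad hinv (isMult_ellR hS hp)
    (fun _ _ c hΩ hc _ => HolF.differentiableOn_coeff hΩ
      (g := fun x z => evalM q (nPlus b (c x) z)) ((holM_expN hc.2.1).holF_evalM q) n)
    (fun v _ => isGrad_matCoeff hsymm hinv hS hp hδ hR n v)
    fun _ _ _ _ hc _ => (isHolFamily_coeffGrad δ R q n hc.2.1).shift p

end EllipticBracket

end LoopReduction

namespace LoopReduction

open scoped Matrix.Norms.Operator
open LieAlgebra LieAlgebra.IsKilling AlgebraExp

/-! ### The Leibniz rule -/

section Leibniz

variable {d : ℕ} {𝔤 : LieSubalgebra ℂ (Matrix (Fin d) (Fin d) ℂ)} [LieAlgebra.IsSemisimple ℂ 𝔤]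
  {H : LieSubalgebra ℂ 𝔤} [H.IsCartanSubalgebra]
  {b : (LieAlgebra.IsKilling.rootSystem H).Base} {B : LinearMap.BilinForm ℂ 𝔤} {p : ℂˣ}
  {r₀ : Module.End ℂ (Loop H)}

theorem IsGrad.const (a : ℂ) (v : Pts b) : IsGrad b B p r₀ (fun _ => a) v 0 := fun w => by
  rw [pair_zero_right]
  exact hasDerivAt_const 0 a

theorem IsGrad.add {φ ψ : Pts b → ℂ} {v : Pts b} {Z Z' : Loop 𝔤} (h : IsGrad b B p r₀ φ v Z)
    (h' : IsGrad b B p r₀ ψ v Z') : IsGrad b B p r₀ (φ + ψ) v (Z + Z') := fun w => by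
  rw [pair_add_right]
  exact (h w).add (h' w)

theorem IsGrad.mul {φ ψ : Pts b → ℂ} {v : Pts b} {Z Z' : Loop 𝔤} (h : IsGrad b B p r₀ φ v Z)
    (h' : IsGrad b B p r₀ ψ v Z') : IsGrad b B p r₀ (φ * ψ) v (ψ v • Z + φ v • Z') := fun w => by
  rw [pair_add_right, pair_smul_right, pair_smul_right]
  refine ((h w).mul (h' w)).congr_deriv ?_
  rw [zero_smul, add_zero, mul_comm (ψ v)]

theorem IsSmooth.const (hinv : ∀ x y z : 𝔤, B ⁅x, y⁆ z = B x ⁅y, z⁆) (hr : ∃ τ, IsMult r₀ τ)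
    (U : Set (Pts b)) (a : ℂ) : IsSmooth b B p r₀ U fun _ => a :=
  isSmooth_of_isGrad hinv hr (fun _ _ _ _ _ _ => differentiableOn_const a)
    (fun v _ => IsGrad.const a v) fun _ _ _ _ _ _ => isHolFamily_const 0

theorem IsSmooth.add (hinv : ∀ x y z : 𝔤, B ⁅x, y⁆ z = B x ⁅y, z⁆) (hr : ∃ τ, IsMult r₀ τ)
    {U : Set (Pts b)} {φ ψ : Pts b → ℂ}
    (h : IsSmooth b B p r₀ U φ) (h' : IsSmooth b B p r₀ U ψ) : IsSmooth b B p r₀ U (φ + ψ) := by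
  obtain ⟨Z, hZ, hZ2⟩ := h.exists_isGrad hinv hr
  obtain ⟨Z', hZ', hZ2'⟩ := h'.exists_isGrad hinv hr
  exact isSmooth_of_isGrad hinv hr
    (fun k Ω c hΩ hc hm => (h.1 k Ω c hΩ hc hm).add (h'.1 k Ω c hΩ hc hm))
    (fun v hv => (hZ v hv).add (hZ' v hv))
    fun k Ω c hΩ hc hm => (hZ2 k Ω c hΩ hc hm).add (hZ2' k Ω c hΩ hc hm)

theorem IsSmooth.mul (hinv : ∀ x y z : 𝔤, B ⁅x, y⁆ z = B x ⁅y, z⁆) (hr : ∃ τ, IsMult r₀ τ)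
    {U : Set (Pts b)} {φ ψ : Pts b → ℂ}
    (h : IsSmooth b B p r₀ U φ) (h' : IsSmooth b B p r₀ U ψ) : IsSmooth b B p r₀ U (φ * ψ) := by
  obtain ⟨Z, hZ, hZ2⟩ := h.exists_isGrad hinv hr
  obtain ⟨Z', hZ', hZ2'⟩ := h'.exists_isGrad hinv hr
  exact isSmooth_of_isGrad hinv hr
    (fun k Ω c hΩ hc hm => (h.1 k Ω c hΩ hc hm).mul (h'.1 k Ω c hΩ hc hm))
    (fun v hv => (hZ v hv).mul (hZ' v hv))
    fun k Ω c hΩ hc hm => ((hZ2 k Ω c hΩ hc hm).smul (h'.1 k Ω c hΩ hc hm)).add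
      ((hZ2' k Ω c hΩ hc hm).smul (h.1 k Ω c hΩ hc hm))

theorem gV_smul (v : Pts b) (a : ℂ) (Z : Loop 𝔤) :
    gV b p r₀ v (a • Z) = a • gV b p r₀ v Z := by
  simp only [gV, gS, gR]
  rw [map_smul (shift p⁻¹), map_smul (AdL (lgP b r₀ v)), map_smul (AdL (lgM b r₀ v)), smul_sub]

variable (hnondeg : B.Nondegenerate) (hsymm : B.IsSymm)
  (hinv : ∀ x y z : 𝔤, B ⁅x, y⁆ z = B x ⁅y, z⁆) (hr : IsRMatrix B p r₀)

include hnondeg hsymm hinv hr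

theorem IsGrad.bracket_eq_neg {φ ψ : Pts b → ℂ} {v : Pts b} {Z Z' : Loop 𝔤}
    (hZ : IsGrad b B p r₀ φ v Z) (hZ' : IsGrad b B p r₀ ψ v Z') :
    bracket b B p r₀ φ ψ v = -pair B (gW b p r₀ v Z') (gV b p r₀ v Z) := by
  rw [hZ.bracket_eq hnondeg hinv hr.comm hr.surjective hZ', pair_gW_gV_skew hinv hsymm hr.skew]

theorem bracket_const_left (a : ℂ) {ψ : Pts b → ℂ} (hψ : IsSmooth b B p r₀ univ ψ) :
    bracket b B p r₀ (fun _ => a) ψ = 0 := funext fun v => by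
  obtain ⟨W, hW, -⟩ := hψ.exists_isGrad hinv hr.mult
  rw [(IsGrad.const a v).bracket_eq_neg hnondeg hsymm hinv hr (hW v (mem_univ v)),
    ← zero_smul ℂ (0 : Loop 𝔤), gV_smul, zero_smul, pair_zero_right, neg_zero]
  rfl

theorem bracket_add_left {φ φ' ψ : Pts b → ℂ} (hφ : IsSmooth b B p r₀ univ φ)
    (hφ' : IsSmooth b B p r₀ univ φ') (hψ : IsSmooth b B p r₀ univ ψ) :
    bracket b B p r₀ (φ + φ') ψ = bracket b B p r₀ φ ψ + bracket b B p r₀ φ' ψ :=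
  funext fun v => by
    obtain ⟨Z, hZ, -⟩ := hφ.exists_isGrad hinv hr.mult
    obtain ⟨Z', hZ', -⟩ := hφ'.exists_isGrad hinv hr.mult
    obtain ⟨W, hW, -⟩ := hψ.exists_isGrad hinv hr.mult
    have h1 := hZ v (mem_univ v)
    have h2 := hZ' v (mem_univ v)
    have h3 := hW v (mem_univ v)
    rw [Pi.add_apply, (h1.add h2).bracket_eq_neg hnondeg hsymm hinv hr h3,
      h1.bracket_eq_neg hnondeg hsymm hinv hr h3, h2.bracket_eq_neg hnondeg hsymm hinv hr h3, gV_add,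
      pair_add_right, neg_add]

theorem bracket_mul_left {φ φ' ψ : Pts b → ℂ} (hφ : IsSmooth b B p r₀ univ φ)
    (hφ' : IsSmooth b B p r₀ univ φ') (hψ : IsSmooth b B p r₀ univ ψ) :
    bracket b B p r₀ (φ * φ') ψ = φ' * bracket b B p r₀ φ ψ + φ * bracket b B p r₀ φ' ψ :=
  funext fun v => by
    obtain ⟨Z, hZ, -⟩ := hφ.exists_isGrad hinv hr.mult
    obtain ⟨Z', hZ', -⟩ := hφ'.exists_isGrad hinv hr.mult
    obtain ⟨W, hW, -⟩ := hψ.exists_isGrad hinv hr.mult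
    have h1 := hZ v (mem_univ v)
    have h2 := hZ' v (mem_univ v)
    have h3 := hW v (mem_univ v)
    rw [Pi.add_apply, Pi.mul_apply, Pi.mul_apply,
      (h1.mul h2).bracket_eq_neg hnondeg hsymm hinv hr h3,
      h1.bracket_eq_neg hnondeg hsymm hinv hr h3, h2.bracket_eq_neg hnondeg hsymm hinv hr h3, gV_add,
      gV_smul, gV_smul, pair_add_right, pair_smul_right, pair_smul_right]
    ring

theorem bracket_skew {φ ψ : Pts b → ℂ} (hφ : IsSmooth b B p r₀ univ φ)
    (hψ : IsSmooth b B p r₀ univ ψ) : bracket b B p r₀ φ ψ = -bracket b B p r₀ ψ φ :=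
  funext fun v => (isRegular_space hnondeg hsymm hinv hr).skew (isOpen_univ (X := Pts b)) hφ hψ v
    (mem_univ v)

/-- A set of smooth functions whose mutual brackets lie in the algebra it generates and vanish at a
point generates a Poisson algebra with the evaluation at this point as a character. -/
theorem bracket_mem_adjoin {s : Set (Pts b → ℂ)} (v₀ : Pts b)
    (hs : ∀ φ ∈ s, IsSmooth b B p r₀ univ φ)
    (h : ∀ φ ∈ s, ∀ ψ ∈ s, bracket b B p r₀ φ ψ ∈ Algebra.adjoin ℂ s ∧
      bracket b B p r₀ φ ψ v₀ = 0) :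
    (∀ φ ∈ Algebra.adjoin ℂ s, IsSmooth b B p r₀ univ φ) ∧
    ∀ φ ∈ Algebra.adjoin ℂ s, ∀ ψ ∈ Algebra.adjoin ℂ s,
      bracket b B p r₀ φ ψ ∈ Algebra.adjoin ℂ s ∧ bracket b B p r₀ φ ψ v₀ = 0 := by
  have hsm : ∀ φ ∈ Algebra.adjoin ℂ s, IsSmooth b B p r₀ univ φ := fun φ hφ => by
    induction hφ using Algebra.adjoin_induction with
    | mem x hx => exact hs x hx
    | algebraMap a => exact IsSmooth.const hinv hr.mult univ a
    | add x y _ _ hx hy => exact hx.add hinv hr.mult hy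
    | mul x y _ _ hx hy => exact hx.mul hinv hr.mult hy
  have hstep : ∀ ψ ∈ Algebra.adjoin ℂ s, (∀ φ ∈ s, bracket b B p r₀ φ ψ ∈ Algebra.adjoin ℂ s ∧
      bracket b B p r₀ φ ψ v₀ = 0) → ∀ φ ∈ Algebra.adjoin ℂ s,
      bracket b B p r₀ φ ψ ∈ Algebra.adjoin ℂ s ∧ bracket b B p r₀ φ ψ v₀ = 0 := by
    intro ψ hψ hψs φ hφ
    induction hφ using Algebra.adjoin_induction with
    | mem x hx => exact hψs x hx
    | algebraMap a =>
      have e : bracket b B p r₀ (algebraMap ℂ (Pts b → ℂ) a) ψ = 0 :=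
        bracket_const_left hnondeg hsymm hinv hr a (hsm ψ hψ)
      rw [e]
      exact ⟨Subalgebra.zero_mem _, rfl⟩
    | add x y hx hy ihx ihy =>
      rw [bracket_add_left hnondeg hsymm hinv hr (hsm x hx) (hsm y hy) (hsm ψ hψ)]
      exact ⟨Subalgebra.add_mem _ ihx.1 ihy.1, by rw [Pi.add_apply, ihx.2, ihy.2, add_zero]⟩
    | mul x y hx hy ihx ihy =>
      rw [bracket_mul_left hnondeg hsymm hinv hr (hsm x hx) (hsm y hy) (hsm ψ hψ)]
      exact ⟨Subalgebra.add_mem _ (Subalgebra.mul_mem _ hy ihx.1) (Subalgebra.mul_mem _ hx ihy.1),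
        by rw [Pi.add_apply, Pi.mul_apply, Pi.mul_apply, ihx.2, ihy.2, mul_zero, mul_zero, add_zero]⟩
  refine ⟨hsm, fun φ hφ ψ hψ => hstep ψ hψ (fun g hg => ?_) φ hφ⟩
  have hg' := Algebra.subset_adjoin (R := ℂ) hg
  have h1 := hstep g hg' (fun g' hg'' => h g' hg'' g hg) ψ hψ
  rw [bracket_skew hnondeg hsymm hinv hr (hsm g hg') (hsm ψ hψ)]
  exact ⟨Subalgebra.neg_mem _ h1.1, by rw [Pi.neg_apply, h1.2, neg_zero]⟩

end Leibniz

end LoopReduction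

namespace LoopReduction

open scoped Matrix.Norms.Operator
open LieAlgebra LieAlgebra.IsKilling AlgebraExp

/-! ### The reduction theorem -/

section Reduction

variable {d : ℕ} {𝔤 : LieSubalgebra ℂ (Matrix (Fin d) (Fin d) ℂ)} [LieAlgebra.IsSemisimple ℂ 𝔤]
  {H : LieSubalgebra ℂ 𝔤} [H.IsCartanSubalgebra]
  {b : (LieAlgebra.IsKilling.rootSystem H).Base} {B : LinearMap.BilinForm ℂ 𝔤} {p : ℂˣ}
  {S K : Module.End ℂ (Loop H)}

theorem mu_zero (v : Pts b) : mu b 0 v = nPlus b v := funext fun z => by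
  have h : expm ((ev ((0 : Module.End ℂ (Loop H)) v.1) z : H) : 𝔤) = 1 :=
    congrArg gm (expG_zero (𝔤 := 𝔤))
  have h' : expm (-((ev ((0 : Module.End ℂ (Loop H)) v.1) z : H) : 𝔤)) = 1 := by
    have e : -((ev ((0 : Module.End ℂ (Loop H)) v.1) z : H) : 𝔤) = 0 := neg_zero
    rw [e]
    exact congrArg gm (expG_zero (𝔤 := 𝔤))
  rw [mu, h, h', one_mul, mul_one]

theorem mu_eq_nPlus_Psi (v : Pts b) : mu b K v = nPlus b (Psi b p K v) := funext fun z => by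
  have h : nPlus b (Psi b p K v) z = gm (atG (expL (jS (nilOpp b) (Psi b p K v).2.1)) z) := rfl
  rw [h, Psi, jS_conjS lie_mem_nilOpp, expL_AdL]
  rfl

/-- Composition with a map as a homomorphism of algebras of functions. -/
def compHom {X Y : Type*} (T : X → Y) : (Y → ℂ) →ₐ[ℂ] (X → ℂ) where
  toFun φ := φ ∘ T
  map_one' := rfl
  map_mul' _ _ := rfl
  map_zero' := rfl
  map_add' _ _ := rfl
  commutes' _ := rfl

theorem constraints_zero : constraints b 0 =
    Algebra.adjoin ℂ {φ | ∃ q n, φ = fun v : Pts b => matCoeff q n (nPlus b v)} := by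
  simp only [constraints, mu_zero]

variable (p) in
theorem constraints_eq_map :
    constraints b K = (constraints b 0).map (compHom (Psi b p K)) := by
  rw [constraints_zero, AlgHom.map_adjoin, constraints]
  congr 1
  ext φ
  simp only [mu_eq_nPlus_Psi (p := p), mem_ofPred_eq, mem_image]
  constructor
  · rintro ⟨q, n, rfl⟩
    exact ⟨_, ⟨q, n, rfl⟩, rfl⟩
  · rintro ⟨_, ⟨q, n, rfl⟩, rfl⟩
    exact ⟨q, n, rfl⟩

/-- The point with `n₊ = exp Y` and trivial other components. -/
def constPt (Y : nilOpp b) : Pts b := (0, mono 0 Y, 0)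

theorem ev_constPt (Y : nilOpp b) (z : ℂˣ) : ev (constPt Y).2.1 z = Y := by
  rw [constPt, ev_mono, zpow_zero, one_smul]

variable (hnondeg : B.Nondegenerate) (hsymm : B.IsSymm)
  (hinv : ∀ x y z : 𝔤, B ⁅x, y⁆ z = B x ⁅y, z⁆) (hp : ‖(p : ℂ)‖ < 1)
  {l : ℕ} (e : Fin l ≃ b.support) {y : Fin l → 𝔤} (hy0 : ∀ i, y i ≠ 0)
  (hy : ∀ i, y i ∈ rootSpace H (-((rootSystem H).root (e i)) : H → ℂ))

/-- The product of the simple reflections. -/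
abbrev coxeterEnd (e : Fin l ≃ b.support) : Module.End ℂ H :=
  reflProd (List.ofFn fun i => (e i : RootIdx H))

theorem coxeter_eq : coxeter b e = Loop.map (coxeterEnd e) := by
  rw [coxeterEnd, reflProd, List.map_ofFn]
  rfl

include hy0 hy in
theorem exists_nilOpp_exp : ∃ Y : nilOpp b,
    expG (Y : 𝔤) = (List.ofFn fun i => expG (y i)).reverse.prod := by
  have h : (List.ofFn fun i => expG (y i)).reverse.prod ∈ lowerUnipotent b := by
    refine Submonoid.list_prod_mem _ fun g hg => ?_
    rw [List.mem_reverse, List.mem_ofFn] at hg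
    obtain ⟨i, rfl⟩ := hg
    exact expG_mem_lowerUnipotent (rootSpace_le_rootSum
      (S := negRoots b) ⟨e i, b.isPos_of_mem_support (e i).2, neg_neg _⟩ (hy i))
  obtain ⟨Y, hY, h⟩ := exists_expG_eq h
  exact ⟨⟨Y, hY⟩, h⟩

include hnondeg hsymm hinv hy0 hy in
theorem form_conjGrad_eq_zero {Y : nilOpp b}
    (hY : expG (Y : 𝔤) = (List.ofFn fun i => expG (y i)).reverse.prod) {δ : Mat d →ₗ[ℂ] 𝔤}
    (hδ : IsDualNil b B δ) {R : Module.End ℂ H} (hR : R - coxeterEnd e * R = coxeterEnd e)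
    (q q' : MvPolynomial (Fin d × Fin d) ℂ) :
    B (rootProj H (posRoots b) (conjGrad δ R q Y)) (conjGrad δ R q' Y) = 0 := by
  have hfst : (((List.ofFn fun i => ((e i : RootIdx H), y i)).reverse).map Prod.fst).reverse =
      List.ofFn fun i => (e i : RootIdx H) := by
    rw [List.map_reverse, List.reverse_reverse, List.map_ofFn]
    rfl
  refine slice_pairing (l := (List.ofFn fun i => ((e i : RootIdx H), y i)).reverse) hinv hsymm
    (cartanForm_nondegenerate b hsymm hnondeg hinv) (fun s hs => ?_) ?_ (fun i hi => ?_) Y.2 ?_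
    (rootProj_mem _ _) (hδ _).1 ?_
  · rw [List.mem_reverse, List.mem_ofFn] at hs
    obtain ⟨i, rfl⟩ := hs
    exact ⟨(e i).2, hy0 i, hy i⟩
  · rw [List.length_reverse, List.length_ofFn, finrank_cartan e]
  · refine ⟨((e (e.symm ⟨i, hi⟩) : RootIdx H), y (e.symm ⟨i, hi⟩)), ?_, by simp⟩
    rw [List.mem_reverse, List.mem_ofFn]
    exact ⟨_, rfl⟩
  · rw [hY, List.map_reverse, List.map_reverse, List.map_ofFn, List.map_ofFn]
    rfl
  · rw [hfst]
    exact LinearMap.congr_fun hR _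

include hnondeg hsymm hinv hp hy0 hy in
/-- The constraints of the elliptic reduction form a Poisson algebra, and evaluation at the given
unipotent element is a character. -/
theorem elliptic_constraints {Y : nilOpp b}
    (hY : expG (Y : 𝔤) = (List.ofFn fun i => expG (y i)).reverse.prod) :
    (∀ φ ∈ constraints b 0, IsSmooth b B p (ellR p (coxeterEnd e)) univ φ) ∧
    ∀ φ ∈ constraints b 0, ∀ ψ ∈ constraints b 0,
      bracket b B p (ellR p (coxeterEnd e)) φ ψ ∈ constraints b 0 ∧
        bracket b B p (ellR p (coxeterEnd e)) φ ψ (constPt Y) = 0 := by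
  have hS := isEllipticIsometry_reflProd hsymm hinv e
  obtain ⟨δ, hδ⟩ := exists_isDualNil (b := b) hsymm hnondeg hinv
  obtain ⟨R, hR⟩ : ∃ R : Module.End ℂ H, R - coxeterEnd e * R = coxeterEnd e := by
    refine ⟨Ring.inverse (1 - coxeterEnd e) * coxeterEnd e, ?_⟩
    rw [← mul_assoc, ← sub_mul]
    have h := Ring.mul_inverse_cancel _ hS.unit
    rw [sub_mul, one_mul] at h
    rw [h, one_mul]
  rw [constraints_zero]
  refine bracket_mem_adjoin hnondeg hsymm hinv
    (isRMatrix_ellR (cartanForm_nondegenerate b hsymm hnondeg hinv) hS hp) (constPt Y) ?_ ?_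
  · rintro _ ⟨q, n, rfl⟩
    exact isSmooth_matCoeff hsymm hinv hS hp hδ hR q n
  · rintro _ ⟨q, n, rfl⟩ _ ⟨q', n', rfl⟩
    obtain ⟨Q, hQ⟩ := exists_bracket_poly (b := b) B δ R q q'
    have hb := bracket_matCoeff (p := p) hsymm hnondeg hinv hS hp hδ hR q q' n n'
    constructor
    · refine Algebra.subset_adjoin ⟨Q, n + n', funext fun v => ?_⟩
      rw [hb v]
      simp only [hQ]
      rfl
    · rw [hb]
      simp only [ev_constPt, form_conjGrad_eq_zero hnondeg hsymm hinv e hy0 hy hY hδ hR, mul_zero]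
      exact coeff_zero_fun _

include hnondeg hsymm hinv hp hy0 hy in
theorem reduction_theorem {K L : Module.End ℂ (Loop H)}
    (hK : IsTransformation B p (coxeterEnd e) K L) (f : Mat d)
    (hf : f = (List.ofFn fun i => expm (y i)).reverse.prod) :
    (space b B p (rNew H)).IsPoissonSubalgebra (constraints b K) ∧
    ∃ χ : constraints b K →ₐ[ℂ] ℂ, TakesValue b K f χ ∧
      (space b B p (rNew H)).IsPoissonCharacter χ ∧
      ∃ χ' : constraints b 0 →ₐ[ℂ] ℂ, TakesValue b 0 f χ' ∧
        PoissonSpace.ReducedIso (space b B p (rNew H)) (space b B p (ellR p (coxeterEnd e)))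
          ((space b B p (rNew H)).surface χ)
          ((space b B p (ellR p (coxeterEnd e))).surface χ') := by
  have hβ := cartanForm_nondegenerate b hsymm hnondeg hinv
  have hS := isEllipticIsometry_reflProd hsymm hinv e
  obtain ⟨Y, hY⟩ := exists_nilOpp_exp e hy0 hy
  have hfY : expN b Y = f := by
    rw [hf]
    have h := congrArg (((Units.coeHom (Mat d)).comp (adGroup 𝔤).subtype)) hY
    rw [map_list_prod, List.map_reverse, List.map_ofFn] at h
    exact h
  obtain ⟨hsm, hbr⟩ := elliptic_constraints hnondeg hsymm hinv hp e hy0 hy hY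
  obtain ⟨E, hE⟩ := hK.exists_iso hnondeg hsymm hinv hS hp b
  obtain ⟨u₀, hu₀⟩ : ∃ u₀ : Pts b, Psi b p K u₀ = constPt Y :=
    ⟨E.toHomeomorph.symm (constPt Y), by
      rw [← hE]
      exact E.toHomeomorph.apply_symm_apply _⟩
  have hE' : ⇑E.toHomeomorph = Psi b p K := funext hE
  have hval : ∀ z, nPlus b (constPt Y) z = f := fun z => by rw [nPlus_eq, ev_constPt, hfY]
  have hmem : ∀ φ ∈ constraints b K, ∃ ψ ∈ constraints b 0, φ = ψ ∘ Psi b p K := fun φ hφ => by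
    rw [constraints_eq_map p] at hφ
    obtain ⟨ψ, hψ, rfl⟩ := hφ
    exact ⟨ψ, hψ, rfl⟩
  have hmem' : ∀ ψ ∈ constraints b 0, ψ ∘ Psi b p K ∈ constraints b K := fun ψ hψ => by
    rw [constraints_eq_map p]
    exact ⟨ψ, hψ, rfl⟩
  have hsm' : ∀ ψ ∈ constraints b 0, IsSmooth b B p (rNew H) univ (ψ ∘ Psi b p K) := fun ψ hψ =>
    hE' ▸ E.smooth_pull isOpen_univ (hsm ψ hψ)
  have hbr' : ∀ φ ∈ constraints b 0, ∀ ψ ∈ constraints b 0,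
      bracket b B p (rNew H) (φ ∘ Psi b p K) (ψ ∘ Psi b p K) =
        bracket b B p (ellR p (coxeterEnd e)) φ ψ ∘ Psi b p K := fun φ hφ ψ hψ => funext fun v => by
    have := E.bracket_pull isOpen_univ (hsm φ hφ) (hsm ψ hψ) v (mem_univ _)
    rw [hE'] at this
    exact this
  refine ⟨⟨fun φ hφ => ?_, fun φ hφ ψ hψ => ?_⟩,
    (Pi.evalAlgHom ℂ (fun _ : Pts b => ℂ) u₀).comp (constraints b K).val, fun q n φ hφ => ?_,
    fun φ ψ θ hθ => ?_,
    (Pi.evalAlgHom ℂ (fun _ : Pts b => ℂ) (constPt Y)).comp (constraints b 0).val,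
    fun q n φ hφ => ?_, ?_⟩
  · obtain ⟨φ', hφ', rfl⟩ := hmem φ hφ
    exact hsm' φ' hφ'
  · obtain ⟨φ', hφ', rfl⟩ := hmem φ hφ
    obtain ⟨ψ', hψ', rfl⟩ := hmem ψ hψ
    have := hmem' _ (hbr φ' hφ' ψ' hψ').1
    rw [← hbr' φ' hφ' ψ' hψ'] at this
    exact this
  · change (φ : Pts b → ℂ) u₀ = _
    rw [hφ]
    change matCoeff q n (mu b K u₀) = _
    rw [mu_eq_nPlus_Psi (p := p), hu₀, funext hval]
  · obtain ⟨φ', hφ', hφe⟩ := hmem φ.1 φ.2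
    obtain ⟨ψ', hψ', hψe⟩ := hmem ψ.1 ψ.2
    have hθ' : θ.1 = bracket b B p (rNew H) φ.1 ψ.1 := hθ
    change θ.1 u₀ = 0
    rw [hθ', hφe, hψe, hbr' φ' hφ' ψ' hψ', Function.comp_apply, hu₀]
    exact (hbr φ' hφ' ψ' hψ').2
  · change (φ : Pts b → ℂ) (constPt Y) = _
    rw [hφ]
    change matCoeff q n (mu b 0 (constPt Y)) = _
    rw [mu_zero, funext hval]
  · refine E.reducedIso (isRegular_space hnondeg hsymm hinv isRMatrix_rNew)
      (isRegular_space hnondeg hsymm hinv (isRMatrix_ellR hβ hS hp)) fun v => ?_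
    rw [hE]
    constructor
    · intro hv φ
      have h : φ.1 (Psi b p K v) = φ.1 (Psi b p K u₀) :=
        hv ⟨_, hmem' φ.1 φ.2⟩
      rw [hu₀] at h
      exact h
    · intro hv φ
      obtain ⟨ψ, hψ, hφ⟩ := hmem φ.1 φ.2
      have h : ψ (Psi b p K v) = ψ (constPt Y) := hv ⟨ψ, hψ⟩
      change φ.1 v = φ.1 u₀
      rw [hφ]
      change ψ (Psi b p K v) = ψ (Psi b p K u₀)
      rw [h, hu₀]

end Reduction

end LoopReduction

end

theorem theorem19 {d : ℕ} (𝔤 : LieSubalgebra ℂ (Matrix (Fin d) (Fin d) ℂ))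
    [LieAlgebra.IsSemisimple ℂ 𝔤] (H : LieSubalgebra ℂ 𝔤) [H.IsCartanSubalgebra]
    (b : (LieAlgebra.IsKilling.rootSystem H).Base)
    (B : LinearMap.BilinForm ℂ 𝔤) (hsymm : B.IsSymm) (hnondeg : B.Nondegenerate)
    (hinv : ∀ x y z : 𝔤, B ⁅x, y⁆ z = B x ⁅y, z⁆)
    (p : ℂˣ) (hp : ‖(p : ℂ)‖ < 1)
    {l : ℕ} (e : Fin l ≃ b.support)
    (y : Fin l → 𝔤) (hy0 : ∀ i, y i ≠ 0)
    (hy : ∀ i, y i ∈ LieAlgebra.rootSpace H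
      (-((LieAlgebra.IsKilling.rootSystem H).root (e i)) : H → ℂ))
    (f : Matrix (Fin d) (Fin d) ℂ)
    (hf : f = (List.ofFn fun i => LoopReduction.expm (y i)).reverse.prod)
    (K Kadj : Module.End ℂ (LoopReduction.Loop H))
    (hadj : ∀ X Y, LoopReduction.pair (LoopReduction.cartanForm H B) (K X) Y =
      LoopReduction.pair (LoopReduction.cartanForm H B) X (Kadj Y))
    (hKs : Commute K (LoopReduction.coxeter b e))
    (hKp : Commute K (LoopReduction.shift p))
    (hK : (1 - LoopReduction.shift p) * K * Kadj + LoopReduction.shift p * K - Kadj =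
      - (LoopReduction.shift p * LoopReduction.coxeter b e *
          Ring.inverse (1 - LoopReduction.coxeter b e) * LoopReduction.modeProj H {n | 0 < n})
      - Ring.inverse (1 - LoopReduction.coxeter b e) * LoopReduction.modeProj H {n | n < 0}
      - (1 / 2 : ℂ) • ((1 + LoopReduction.coxeter b e) *
          Ring.inverse (1 - LoopReduction.coxeter b e) * LoopReduction.modeProj H {0})) :
    -- (i) the matrix coefficients form a Poisson subalgebra
    (LoopReduction.space b B p (LoopReduction.rNew H)).IsPoissonSubalgebra
      (LoopReduction.constraints b K) ∧
    ∃ χ : LoopReduction.constraints b K →ₐ[ℂ] ℂ, LoopReduction.TakesValue b K f χ ∧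
      -- (ii) the map defined by `μ ↦ f` is a character of this Poisson algebra
      (LoopReduction.space b B p (LoopReduction.rNew H)).IsPoissonCharacter χ ∧
      -- (iii) the reduced Poisson manifolds are isomorphic
      ∃ χ' : LoopReduction.constraints b 0 →ₐ[ℂ] ℂ, LoopReduction.TakesValue b 0 f χ' ∧
        LoopReduction.PoissonSpace.ReducedIso (LoopReduction.space b B p (LoopReduction.rNew H))
          (LoopReduction.space b B p (LoopReduction.rEll b p e))
          ((LoopReduction.space b B p (LoopReduction.rNew H)).surface χ)
          ((LoopReduction.space b B p (LoopReduction.rEll b p e)).surface χ') := by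
  rw [LoopReduction.coxeter_eq] at hKs hK
  exact LoopReduction.reduction_theorem hnondeg hsymm hinv hp e hy0 hy
    ⟨hadj, hKs, hKp, LoopReduction.functional_equation
      (LoopReduction.isEllipticIsometry_reflProd hsymm hinv e).unit hK⟩ f hf |>.imp_right
    fun h => by rwa [LoopReduction.rEll, LoopReduction.coxeter_eq]
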